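/- \textbf{Setting.} Let $d,\ell\ge 1$ be integers, $\mathcal X\subseteq\mathbb R^d$, let $D^*$ be a probability distribution on $\mathcal X$ and $\mathcal C$ a nonempty class of functions $\mathcal X\to\{\pm1\}$. $D^*$ is \emph{$A$-hypercontractive} ($A\ge1$) if all coordinates $x_i$ are $D^*$-integrable and, for every real polynomial $p$ in $d$ variables and every real $t\ge2$, $\mathbb E_{D^*}|p(x)|^t\le (At)^{t\deg p}\,(\mathbb E_{D^*}|p(x)|)^t$. $\mathcal C$ has \emph{$\eta$-sandwiching degree $\ell$} with respect to $D^*$ if for every $f\in\mathcal C$ there are polynomials $p_{\rm up},p_{\rm down}$ of degree at most $\ell$ with $p_{\rm down}(x)\le f(x)\le p_{\rm up}(x)$ for all $x\in\mathcal X$ and $\mathbb E_{D^*}[p_{\rm up}-p_{\rm down}]\le\eta$. \emph{$Q$-heavy additive contamination.} Let $\bar D$ be a distribution on $\mathcal X\times\{\pm1\}$ with $\mathcal X$-marginal $D^*$. A clean sample $\bar S_{\rm cln}$ of $m$ i.i.d. examples from $\bar D$ is drawn; an adversary sees it and adds $M-m$ arbitrary labeled examples of $\mathcal X\times\{\pm1\}$,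 where $m\le M\le Qm$, and presents the resulting dataset $\bar S_{\rm inp}$ of size $M$ in any order. Let $$\mathrm{opt}_{\rm total}=\min_{f\in\mathcal C}\frac1M\sum_{(x,y)\in\bar S_{\rm inp}}\mathbf 1\{y\ne f(x)\}.$$ \emph{Algorithms} are programs of a real random access machine (exact real arithmetic and comparisons at unit cost, no rounding; natural-number registers with $+$, truncated $-$, $\times$ and indirect addressing) that can draw independent unlabeled points from $D^*$, at cost $d+1$ each plus the cost of computing the storage address. The input is $(d,\ell,A,\varepsilon,\delta,Q,M,\bar S_{\rm inp})$; neither $m$ nor the identity of the clean examples is given. The output hypothesis $h:\mathcal X\to\{\pm1\}$ is the sign of a polynomial of degree at most $\ell$ (with $\mathrm{sign}(0)=1$), given by $(d+1)^\ell$ coefficients. \textbf{Theorem (Sandwiching implies HC-Learning).} There are universal constants $C\ge1$, $K,k\in\mathbb N$ and an algorithm such that the following holds for all $d,\ell\ge1$, $A,Q\ge1$, $\varepsilon,\delta\in(0,1)$ and $\mathcal X\subseteq\mathbb R^d$. Put $$n_0=\frac{Q^2}{\varepsilon^5}\,(KAd)^{2\ell}\,\log\frac2\delta,\qquad B=A^\ell+\Big(\log\frac2\delta\Big)^{\ell}+(d+1)^\ell+\frac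 Q\varepsilon .$$ (1) \emph{(Error and clean sample complexity.)} If $D^*$ is $A$-hypercontractive on $\mathcal X$ and the nonempty class $\mathcal C$ has $\frac{\varepsilon^2}{CQ}$-sandwiching degree $\ell$ with respect to $D^*$, then for every $m\ge n_0$, every $\bar D$ with marginal $D^*$, every $M$ with $m\le M\le Qm$ and every adversary, with probability at least $1-\delta$ over the clean sample and the algorithm's draws from $D^*$, the output $h$ satisfies $$\Pr_{(x,y)\sim\bar D}[y\ne h(x)]\le Q\cdot\mathrm{opt}_{\rm total}+\varepsilon .$$ (2) \emph{(Running time.)} On every input dataset of size $M\le Q\lceil n_0\rceil$, in particular on all datasets with $m=\lceil n_0\rceil$ clean examples, and for all outcomes of its draws, the algorithm halts after at most $k\,B^k$ steps, i.e. in time $\mathrm{poly}(A^\ell,(\log\frac2\delta)^\ell,(d+1)^\ell,Q/\varepsilon)$. On a dataset of arbitrary size $M$ it halts after at most $k\,(B+M)^k$ steps. -/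

import Mathlib

open MeasureTheory

/-! A real random access machine, in structured form. The memory has an unbounded array of
natural-number cells and an unbounded array of real cells, both with indirect addressing. Real
arithmetic and comparisons are exact; there is no rounding, no conversion of reals to naturals,
and no division of naturals. The machine can also draw points from a sample oracle. -/

/-- Natural-number expressions; `get a` reads the natural cell at address `a`. -/
inductive NExp : Type
  | const (n : ℕ)
  | get (a : NExp)
  | add (a b : NExp)
  | sub (a b : NExp)
  | mul (a b : NExp)

/-- Real expressions; `get a` reads the real cell at address `a`. -/
inductive RExp : Type
  | ofNat (a : NExp)
  | get (a : NExp)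
  | add (a b : RExp)
  | sub (a b : RExp)
  | mul (a b : RExp)
  | div (a b : RExp)

/-- Tests. -/
inductive BExp : Type
  | natLt (a b : NExp)
  | realLt (a b : RExp)
  | not (b : BExp)
  | and (b c : BExp)

/-- Programs. `draw a` draws the next point of the sample oracle and stores its coordinates in
the consecutive real cells that start at address `a`. -/
inductive Program : Type
  | skip
  | setNat (a : NExp) (e : NExp)
  | setReal (a : NExp) (e : RExp)
  | draw (a : NExp)
  | seq (p q : Program)
  | branch (b : BExp) (p q : Program)
  | loop (b : BExp) (p : Program)

/-- A memory state, with the number of oracle points drawn so far. -/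
structure Memory where
  nat : ℕ → ℕ
  real : ℕ → ℝ
  drawn : ℕ

def NExp.eval (s : Memory) : NExp → ℕ
  | .const n => n
  | .get a => s.nat (a.eval s)
  | .add a b => a.eval s + b.eval s
  | .sub a b => a.eval s - b.eval s
  | .mul a b => a.eval s * b.eval s

/-- The number of elementary operations in an expression. -/
def NExp.cost : NExp → ℕ
  | .const _ => 1
  | .get a => a.cost + 1
  | .add a b => a.cost + b.cost + 1
  | .sub a b => a.cost + b.cost + 1
  | .mul a b => a.cost + b.cost + 1

/-- Values of real expressions (division by zero gives zero). -/
noncomputable def RExp.eval (s : Memory) : RExp → ℝ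
  | .ofNat a => (a.eval s : ℝ)
  | .get a => s.real (a.eval s)
  | .add a b => a.eval s + b.eval s
  | .sub a b => a.eval s - b.eval s
  | .mul a b => a.eval s * b.eval s
  | .div a b => a.eval s / b.eval s

def RExp.cost : RExp → ℕ
  | .ofNat a => a.cost + 1
  | .get a => a.cost + 1
  | .add a b => a.cost + b.cost + 1
  | .sub a b => a.cost + b.cost + 1
  | .mul a b => a.cost + b.cost + 1
  | .div a b => a.cost + b.cost + 1

def BExp.holds (s : Memory) : BExp → Prop
  | .natLt a b => a.eval s < b.eval s
  | .realLt a b => a.eval s < b.eval s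
  | .not b => ¬ b.holds s
  | .and b c => b.holds s ∧ c.holds s

def BExp.cost : BExp → ℕ
  | .natLt a b => a.cost + b.cost + 1
  | .realLt a b => a.cost + b.cost + 1
  | .not b => b.cost + 1
  | .and b c => b.cost + c.cost + 1

/-- Store the coordinates of `x` in the real cells `a, …, a + d - 1` and count the draw. -/
def Memory.storePoint {d : ℕ} (s : Memory) (a : ℕ) (x : Fin d → ℝ) : Memory where
  nat := s.nat
  real := fun i => if h : a ≤ i ∧ i < a + d then x ⟨i - a, by omega⟩ else s.real i
  drawn := s.drawn + 1

/-- `Exec ω p s t s'`: when the oracle supplies the points `ω 0, ω 1, …`, the program `p` started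
in the state `s` halts after exactly `t` elementary steps in the state `s'`. -/
inductive Exec {d : ℕ} (ω : ℕ → Fin d → ℝ) : Program → Memory → ℕ → Memory → Prop
  | skip (s : Memory) : Exec ω .skip s 1 s
  | setNat (a e : NExp) (s : Memory) :
      Exec ω (.setNat a e) s (a.cost + e.cost + 1)
        { s with nat := Function.update s.nat (a.eval s) (e.eval s) }
  | setReal (a : NExp) (e : RExp) (s : Memory) :
      Exec ω (.setReal a e) s (a.cost + e.cost + 1)
        { s with real := Function.update s.real (a.eval s) (e.eval s) }
  | draw (a : NExp) (s : Memory) :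
      Exec ω (.draw a) s (a.cost + d + 1) (s.storePoint (a.eval s) (ω s.drawn))
  | seq {p q : Program} {s s₁ s₂ : Memory} {t₁ t₂ : ℕ} :
      Exec ω p s t₁ s₁ → Exec ω q s₁ t₂ s₂ → Exec ω (.seq p q) s (t₁ + t₂) s₂
  | branchTrue {b : BExp} {p q : Program} {s s₁ : Memory} {t : ℕ} :
      b.holds s → Exec ω p s t s₁ → Exec ω (.branch b p q) s (b.cost + t) s₁
  | branchFalse {b : BExp} {p q : Program} {s s₁ : Memory} {t : ℕ} :
      ¬ b.holds s → Exec ω q s t s₁ → Exec ω (.branch b p q) s (b.cost + t) s₁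
  | loopTrue {b : BExp} {p : Program} {s s₁ s₂ : Memory} {t₁ t₂ : ℕ} :
      b.holds s → Exec ω p s t₁ s₁ → Exec ω (.loop b p) s₁ t₂ s₂ →
      Exec ω (.loop b p) s (b.cost + t₁ + t₂) s₂
  | loopFalse {b : BExp} {p : Program} {s : Memory} :
      ¬ b.holds s → Exec ω (.loop b p) s b.cost s

/-! Labeled examples are pairs in `X × ℤˣ`, where `X ⊆ ℝᵈ` and `ℤˣ = {1, -1}`. -/

/-- The initial memory: the naturals `d`, `ℓ`, `M`, the reals `A`, `ε`, `δ`, `Q`, then the `M`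
input examples one after the other, each as its `d` coordinates followed by its label. -/
noncomputable def initialMemory {d : ℕ} {X : Set (Fin d → ℝ)} (ℓ : ℕ) (A ε δ Q : ℝ) {M : ℕ}
    (S : Fin M → X × ℤˣ) : Memory where
  nat
    | 0 => d
    | 1 => ℓ
    | 2 => M
    | _ => 0
  real
    | 0 => A
    | 1 => ε
    | 2 => δ
    | 3 => Q
    | n + 4 =>
      if h : n / (d + 1) < M then
        if h' : n % (d + 1) < d then (S ⟨n / (d + 1), h⟩).1.1 ⟨n % (d + 1), h'⟩
        else (((S ⟨n / (d + 1), h⟩).2 : ℤ) : ℝ)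
      else 0
  drawn := 0

/-- The hypothesis that is written in a final memory: the threshold function `sign p` (with
`sign 0 = 1`) of the polynomial `p(x) = ∑ₛ cₛ ∏ⱼ x̃ (s j)` of degree at most `ℓ`, where
`x̃ = (1, x)`, the sum is over `s ∈ {0, …, d}^ℓ`, and the coefficients `cₛ` are read off the first
`(d + 1) ^ ℓ` real cells. -/
noncomputable def outputHypothesis {d : ℕ} (X : Set (Fin d → ℝ)) (ℓ : ℕ) (s : Memory) (x : X) :
    ℤˣ :=
  if 0 ≤ ∑ σ : Fin ℓ → Fin (d + 1),
      s.real (finFunctionFinEquiv σ) * ∏ j, (Fin.cons 1 x.1 : Fin (d + 1) → ℝ) (σ j)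
  then 1 else -1

/-- `A`-hypercontractivity with respect to polynomials. Moments are taken in `[0, ∞]`. -/
def IsHypercontractive {d : ℕ} {X : Set (Fin d → ℝ)} (D : Measure X) (A : ℝ) : Prop :=
  1 ≤ A ∧
  (∀ (p : MvPolynomial (Fin d) ℝ) (t : ℝ), 2 ≤ t →
    ∫⁻ x, ENNReal.ofReal (|MvPolynomial.eval x.1 p| ^ t) ∂D ≤
      ENNReal.ofReal ((A * t) ^ ((p.totalDegree : ℝ) * t)) *
        (∫⁻ x, ENNReal.ofReal |MvPolynomial.eval x.1 p| ∂D) ^ t) ∧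
  ∀ i, Integrable (fun x : X => x.1 i) D

/-- The class `𝒞` has `η`-sandwiching degree `ℓ` with respect to `D`. -/
def HasSandwichingDegree {d : ℕ} {X : Set (Fin d → ℝ)} (𝒞 : Set (X → ℤˣ)) (D : Measure X)
    (η : ℝ) (ℓ : ℕ) : Prop :=
  ∀ f ∈ 𝒞, ∃ pup pdown : MvPolynomial (Fin d) ℝ,
    pup.totalDegree ≤ ℓ ∧ pdown.totalDegree ≤ ℓ ∧
    (∀ x : X, MvPolynomial.eval x.1 pdown ≤ ((f x : ℤ) : ℝ) ∧
      ((f x : ℤ) : ℝ) ≤ MvPolynomial.eval x.1 pup) ∧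
    Integrable (fun x : X => MvPolynomial.eval x.1 pup - MvPolynomial.eval x.1 pdown) D ∧
    ∫ x : X, (MvPolynomial.eval x.1 pup - MvPolynomial.eval x.1 pdown) ∂D ≤ η

/-- `opt_total`: the least empirical error of a concept of `𝒞` on the whole dataset `S`. -/
noncomputable def optTotal {α : Type*} (𝒞 : Set (α → ℤˣ)) {M : ℕ} (S : Fin M → α × ℤˣ) : ℝ :=
  ⨅ f : 𝒞, (1 / (M : ℝ)) * ∑ i, if (S i).2 ≠ f.1 (S i).1 then (1 : ℝ) else 0

/-- `Sinp` arises from the clean sample `Scln` by adding labeled examples, in any order. -/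
def IsAdditiveContamination {α : Type*} {m M : ℕ} (Scln : Fin m → α) (Sinp : Fin M → α) : Prop :=
  ∃ e : Fin m ↪ Fin M, ∀ i, Sinp (e i) = Scln i

/-- With `m` clean examples, the program `P` is an `(ε, δ, Q)`-HC-learner for `𝒞` with respect to
the marginal `D`: for every clean distribution `Dbar` with marginal `D`, every size `M ≤ Q m` of
the input dataset, and every adversary, which sees the clean sample and adds `M - m` examples, the
probability over the clean sample and the oracle's independent draws from `D` that `P` fails to
output a hypothesis of clean error at most `Q * opt_total + ε` is at most `δ`.
(For a non-measurable event this is a bound on its outer measure.) -/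
def IsHCLearner {d : ℕ} {X : Set (Fin d → ℝ)} (P : Program) (𝒞 : Set (X → ℤˣ)) (D : Measure X)
    [IsProbabilityMeasure D] (ℓ : ℕ) (A ε δ Q : ℝ) (m : ℕ) : Prop :=
  ∀ (Dbar : Measure (X × ℤˣ)) [IsProbabilityMeasure Dbar], Dbar.map Prod.fst = D →
  ∀ M : ℕ, m ≤ M → (M : ℝ) ≤ Q * m →
  ∀ adv : (Fin m → X × ℤˣ) → (Fin M → X × ℤˣ), (∀ S, IsAdditiveContamination S (adv S)) →
    ((Measure.pi fun _ : Fin m => Dbar).prod (Measure.infinitePi fun _ : ℕ => D))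
      {z | ¬ ∃ (t : ℕ) (s : Memory),
        Exec (fun k => (z.2 k).1) P (initialMemory ℓ A ε δ Q (adv z.1)) t s ∧
        Dbar.real {w | w.2 ≠ outputHypothesis X ℓ s w.1} ≤ Q * optTotal 𝒞 (adv z.1) + ε}
    ≤ ENNReal.ofReal δ

/-- On every input dataset of `M` labeled examples and for all oracle draws, the program `P` halts
after at most `T` elementary steps. -/
def RunsInTime {d : ℕ} (X : Set (Fin d → ℝ)) (P : Program) (ℓ : ℕ) (A ε δ Q : ℝ) (M : ℕ)
    (T : ℝ) : Prop :=
  ∀ (S : Fin M → X × ℤˣ) (ω : ℕ → X), ∃ (t : ℕ) (s : Memory),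
    Exec (fun k => (ω k).1) P (initialMemory ℓ A ε δ Q S) t s ∧ (t : ℝ) ≤ T

/-- The number `(Q² / ε⁵) (K A d)^{2ℓ} log (2 / δ)` of clean examples. -/
noncomputable def cleanSampleBound (K d ℓ : ℕ) (A ε δ Q : ℝ) : ℝ :=
  Q ^ 2 / ε ^ 5 * (K * A * d) ^ (2 * ℓ) * Real.log (2 / δ)

/-- `A^ℓ + (log (2 / δ))^ℓ + (d + 1)^ℓ + Q / ε`; a quantity is polynomial in these four terms iff
it is at most `k * timeBase ^ k` for a constant `k`. -/
noncomputable def timeBase (d ℓ : ℕ) (A ε δ Q : ℝ) : ℝ :=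
  A ^ ℓ + Real.log (2 / δ) ^ ℓ + ((d : ℝ) + 1) ^ ℓ + Q / ε

/-! The learner fits two polynomials of degree at most `ℓ`, an upper one `u` and a lower one `l`,
and outputs the sign of `l - θ` for a threshold `θ`. A positive example pays `(1 - u)⁺`, a negative
one `(1 + l)⁺`, each with weight `1 / M`, and the pair pays the mean of `(u - l)⁺` over fresh
unlabeled draws from `D`. If `u` and `l` sandwich a concept `f`, an example with `y = f x` pays
nothing and any other pays at most `2` (`labelHinge_le`), so the best objective value is about `2 *
optTotal` plus a multiple of the sandwiching error (`exists_comparator`).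

Conversely, average over `θ` in `[-1, 1]`, an interval of length `2`. The fraction of thresholds
that violate a row, meaning `u < θ` at a positive example, `θ < l` at a negative one, or `l < θ < u`
at a draw, is at most half of its hinge loss. Hence some grid threshold has violated weight at most
half the objective, up to grid error (`sum_count_row_le`, `count_le_of_isBestThreshold`), and the
factor `2` cancels. The output errs at a positive point only if `u < θ` or `l < θ ≤ u`, and at a
negative point only if `θ ≤ l`. The events that involve labels are estimated on the clean sample,
whose frequencies are at most `Q` times those of the input because `M ≤ Q * m`. The mass between `l`
and `u` depends on the marginal only and is estimated on the draws, out of the adversary's reach.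
This gives `Q * optTotal + ε` (`error_le`).

Polynomials are unbounded, so uniform convergence is proved on a region where an orthonormal system
of `L²(D)` is bounded by a power of the scale parameter `Z`. There values are Lipschitz in the
coefficients, threshold events lie between soft margins of width `1 / Z ^ 3`, and a net with
Hoeffding's inequality suffices (`IsIID.measure_exists_le`, `measure_exists_margin_le`).
Hypercontractivity controls what the region leaves out: fourth moments bound the truncation error,
moments of order about `log (2 / δ)` bound empirical second moments, and the comparison of `L¹` with
`L²` makes sandwiching polynomials small in `L²`. The outcome is `GoodDraws`: empirical and true
norms of all polynomials are comparable.

The objective is convex. The columns of monomials are orthogonalized for the empirical inner product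
of the draws, and subgradient descent is run in coordinates scaled by the column norms, so that its
rate does not depend on the conditioning of the monomials (`obj_avg_le_obj`). Adversarial examples
could make subgradients huge; examples at which some column is far above its scale are therefore
dropped. Dropping only lowers the objective, and a clean example in the region is never dropped, so
only the small mass outside the region is lost. Identity rows appended to the matrix carry the
change of basis, so the monomial coefficients of the result can be read off there.

The machine program is written in a small language of capped counted loops, for which effect (`run`)
and step count (`time`) are separate recursive functions. All sizes are powers of `Z`, which is
polynomial in the four terms of `timeBase`; `exec_learner_guarantee` is the interface between
program and analysis. -/

/-! ### A structured command language and its translation to programs -/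

/-- Structured commands. Cell `3` holds the base address of the arrays, cell `4` a cap on all loop
counts. -/
inductive Cmd : Type
  | nset (v : ℕ) (e : NExp)
  | aset (k : ℕ) (i : NExp) (e : RExp)
  | rset (a : NExp) (e : RExp)
  | draw (a : NExp)
  | seq (p q : Cmd)
  | ite (b : BExp) (p q : Cmd)
  | forTo (v : ℕ) (e : NExp) (p : Cmd)

namespace NExp

/-- The content of the natural cell `v`. -/
def cell (v : ℕ) : NExp := .get (.const v)

/-- The address of entry `i` of the array number `k`. -/
def adr (k : ℕ) (i : NExp) : NExp := .add (cell 3) (.add (.mul (.const 16) i) (.const k))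

def pow (a : NExp) : ℕ → NExp
  | 0 => .const 1
  | n + 1 => .mul (pow a n) a

/-- With truncated subtraction, `e - (e - c)` is `min e c`; the machine has no other minimum. -/
def capped (e : NExp) : NExp := .sub e (.sub e (cell 4))

end NExp

/-- Entry `i` of the array number `k`. -/
def RExp.arr (k : ℕ) (i : NExp) : RExp := .get (NExp.adr k i)

namespace Memory

def setN (s : Memory) (v x : ℕ) : Memory := { s with nat := Function.update s.nat v x }

def setR (s : Memory) (a : ℕ) (x : ℝ) : Memory := { s with real := Function.update s.real a x }

/-- Sixteen unbounded arrays are interleaved by residue modulo `16` above the base address in cell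
`3`, so they are disjoint without any size bound. -/
def arr (s : Memory) (k i : ℕ) : ℝ := s.real (s.nat 3 + (16 * i + k))

def setA (s : Memory) (k i : ℕ) (x : ℝ) : Memory := s.setR (s.nat 3 + (16 * i + k)) x

@[simp] theorem setN_nat (s : Memory) (v x w : ℕ) :
    (s.setN v x).nat w = if w = v then x else s.nat w := by
  simp [setN, Function.update_apply]

@[simp] theorem setN_real (s : Memory) (v x : ℕ) : (s.setN v x).real = s.real := rfl

@[simp] theorem setN_drawn (s : Memory) (v x : ℕ) : (s.setN v x).drawn = s.drawn := rfl

@[simp] theorem setR_nat (s : Memory) (a : ℕ) (x : ℝ) : (s.setR a x).nat = s.nat := rfl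

@[simp] theorem setR_real (s : Memory) (a : ℕ) (x : ℝ) (b : ℕ) :
    (s.setR a x).real b = if b = a then x else s.real b := by
  simp [setR, Function.update_apply]

@[simp] theorem setA_nat (s : Memory) (k i : ℕ) (x : ℝ) : (s.setA k i x).nat = s.nat := rfl

@[simp] theorem setA_drawn (s : Memory) (k i : ℕ) (x : ℝ) : (s.setA k i x).drawn = s.drawn := rfl

theorem setN_arr (s : Memory) {v : ℕ} (x : ℕ) (hv : v ≠ 3) (k i : ℕ) :
    (s.setN v x).arr k i = s.arr k i := by
  simp [arr, hv.symm]

/-- For `k, k' < 16` the offset `16 * i + k` determines both the array and the index. -/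
theorem setA_arr (s : Memory) {k k' : ℕ} (i i' : ℕ) (x : ℝ) (hk : k < 16) (hk' : k' < 16) :
    (s.setA k i x).arr k' i' = if k' = k ∧ i' = i then x else s.arr k' i' := by
  simp only [arr, setA, setR_nat, setR_real]
  congr 1
  apply propext
  constructor
  · intro h; omega
  · rintro ⟨rfl, rfl⟩; rfl

theorem setA_low (s : Memory) {k i a : ℕ} (x : ℝ) (ha : a < s.nat 3) :
    (s.setA k i x).real a = s.real a := by
  simp only [setA, setR_real]
  rw [if_neg (by omega)]

end Memory

@[simp] theorem NExp.eval_const (s : Memory) (n : ℕ) : (NExp.const n).eval s = n := rfl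

@[simp] theorem NExp.eval_cell (s : Memory) (v : ℕ) : (NExp.cell v).eval s = s.nat v := rfl

@[simp] theorem NExp.eval_add (s : Memory) (a b : NExp) :
    (NExp.add a b).eval s = a.eval s + b.eval s := rfl

@[simp] theorem NExp.eval_sub (s : Memory) (a b : NExp) :
    (NExp.sub a b).eval s = a.eval s - b.eval s := rfl

@[simp] theorem NExp.eval_mul (s : Memory) (a b : NExp) :
    (NExp.mul a b).eval s = a.eval s * b.eval s := rfl

@[simp] theorem NExp.eval_pow (s : Memory) (a : NExp) (n : ℕ) :
    (NExp.pow a n).eval s = a.eval s ^ n := by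
  induction n with
  | zero => rfl
  | succ n ih => simp [NExp.pow, ih, pow_succ]

@[simp] theorem NExp.eval_capped (s : Memory) (e : NExp) :
    (NExp.capped e).eval s = min (e.eval s) (s.nat 4) := by
  simp only [NExp.capped, NExp.eval_sub, NExp.eval_cell]; omega

@[simp] theorem RExp.eval_arr (s : Memory) (k : ℕ) (i : NExp) :
    (RExp.arr k i).eval s = s.arr k (i.eval s) := rfl

@[simp] theorem RExp.eval_ofNat (s : Memory) (a : NExp) :
    (RExp.ofNat a).eval s = (a.eval s : ℝ) := rfl

@[simp] theorem RExp.eval_get (s : Memory) (a : NExp) :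
    (RExp.get a).eval s = s.real (a.eval s) := rfl

@[simp] theorem RExp.eval_add (s : Memory) (a b : RExp) :
    (RExp.add a b).eval s = a.eval s + b.eval s := rfl

@[simp] theorem RExp.eval_sub (s : Memory) (a b : RExp) :
    (RExp.sub a b).eval s = a.eval s - b.eval s := rfl

@[simp] theorem RExp.eval_mul (s : Memory) (a b : RExp) :
    (RExp.mul a b).eval s = a.eval s * b.eval s := rfl

@[simp] theorem RExp.eval_div (s : Memory) (a b : RExp) :
    (RExp.div a b).eval s = a.eval s / b.eval s := rfl

@[simp] theorem BExp.holds_natLt (s : Memory) (a b : NExp) :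
    (BExp.natLt a b).holds s ↔ a.eval s < b.eval s := Iff.rfl

@[simp] theorem BExp.holds_realLt (s : Memory) (a b : RExp) :
    (BExp.realLt a b).holds s ↔ a.eval s < b.eval s := Iff.rfl

@[simp] theorem BExp.holds_and (s : Memory) (a b : BExp) :
    (BExp.and a b).holds s ↔ a.holds s ∧ b.holds s := Iff.rfl

/-! ### Effect, written cells and step bounds of commands -/

namespace Cmd

/-- Translation to programs. -/
def toProgram : Cmd → Program
  | nset v e => .setNat (.const v) e
  | aset k i e => .setReal (NExp.adr k i) e
  | rset a e => .setReal a e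
  | draw a => .draw a
  | seq p q => .seq p.toProgram q.toProgram
  | ite b p q => .branch b p.toProgram q.toProgram
  | forTo v e p =>
    -- The bound is evaluated once and kept in cell `v + 1`, so the body may change the cells that
    -- `e` reads.
    .seq (.setNat (.const (v + 1)) (NExp.capped e)) <|
    .seq (.setNat (.const v) (.const 0)) <|
    .loop (.natLt (NExp.cell v) (NExp.cell (v + 1))) <|
      .seq p.toProgram (.setNat (.const v) (.add (NExp.cell v) (.const 1)))

/-- The effect of a command on the memory. -/
noncomputable def run {d : ℕ} (ω : ℕ → Fin d → ℝ) : Cmd → Memory → Memory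
  | nset v e, s => s.setN v (e.eval s)
  | aset k i e, s => s.setA k (i.eval s) (e.eval s)
  | rset a e, s => s.setR (a.eval s) (e.eval s)
  | draw a, s => s.storePoint (a.eval s) (ω s.drawn)
  | seq p q, s => run ω q (run ω p s)
  | ite b p q, s => open Classical in if b.holds s then run ω p s else run ω q s
  | forTo v e p, s =>
    (fun s => (run ω p s).setN v ((run ω p s).nat v + 1))^[min (e.eval s) (s.nat 4)]
      ((s.setN (v + 1) (min (e.eval s) (s.nat 4))).setN v 0)

/-- The natural cells that a command may write. -/
def natW : Cmd → List ℕ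
  | nset v _ => [v]
  | aset _ _ _ => []
  | rset _ _ => []
  | draw _ => []
  | seq p q => p.natW ++ q.natW
  | ite _ p q => p.natW ++ q.natW
  | forTo v _ p => v :: (v + 1) :: p.natW

/-- The arrays that a command may write. -/
def arrW : Cmd → List ℕ
  | nset _ _ => []
  | aset k _ _ => [k]
  | rset _ _ => []
  | draw _ => []
  | seq p q => p.arrW ++ q.arrW
  | ite _ p q => p.arrW ++ q.arrW
  | forTo _ _ p => p.arrW

/-- Loop counters are only changed by their loops, and cells `3` and `4` are never changed. -/
def WF : Cmd → Prop
  | nset v _ => v ≠ 3 ∧ v ≠ 4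
  | aset _ _ _ => True
  | rset _ _ => True
  | draw _ => True
  | seq p q => p.WF ∧ q.WF
  | ite _ p q => p.WF ∧ q.WF
  | forTo v _ p => v ≠ 3 ∧ v ≠ 4 ∧ v + 1 ≠ 3 ∧ v + 1 ≠ 4 ∧ v ∉ p.natW ∧ v + 1 ∉ p.natW ∧ p.WF

/-- The command uses neither the oracle nor raw addresses, and only arrays with number `< 16`. -/
def Local : Cmd → Prop
  | nset _ _ => True
  | aset k _ _ => k < 16
  | rset _ _ => False
  | draw _ => False
  | seq p q => p.Local ∧ q.Local
  | ite _ p q => p.Local ∧ q.Local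
  | forTo _ _ p => p.Local

instance decidableWF : (p : Cmd) → Decidable p.WF
  | nset v _ => inferInstanceAs (Decidable (v ≠ 3 ∧ v ≠ 4))
  | aset _ _ _ => inferInstanceAs (Decidable True)
  | rset _ _ => inferInstanceAs (Decidable True)
  | draw _ => inferInstanceAs (Decidable True)
  | seq p q =>
    have := decidableWF p
    have := decidableWF q
    inferInstanceAs (Decidable (p.WF ∧ q.WF))
  | ite _ p q =>
    have := decidableWF p
    have := decidableWF q
    inferInstanceAs (Decidable (p.WF ∧ q.WF))
  | forTo v _ p =>
    have := decidableWF p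
    inferInstanceAs (Decidable (v ≠ 3 ∧ v ≠ 4 ∧ v + 1 ≠ 3 ∧ v + 1 ≠ 4 ∧ v ∉ p.natW ∧
      v + 1 ∉ p.natW ∧ p.WF))

instance decidableLocal : (p : Cmd) → Decidable p.Local
  | nset _ _ => inferInstanceAs (Decidable True)
  | aset k _ _ => inferInstanceAs (Decidable (k < 16))
  | rset _ _ => inferInstanceAs (Decidable False)
  | draw _ => inferInstanceAs (Decidable False)
  | seq p q =>
    have := decidableLocal p
    have := decidableLocal q
    inferInstanceAs (Decidable (p.Local ∧ q.Local))
  | ite _ p q =>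
    have := decidableLocal p
    have := decidableLocal q
    inferInstanceAs (Decidable (p.Local ∧ q.Local))
  | forTo _ _ p => decidableLocal p

/-- An upper bound for the number of steps, if all loop counts are capped at `β` and points have
dimension `D`. -/
def time (D β : ℕ) : Cmd → ℕ
  | nset _ e => 1 + e.cost + 1
  | aset k i e => (NExp.adr k i).cost + e.cost + 1
  | rset a e => a.cost + e.cost + 1
  | draw a => a.cost + D + 1
  | seq p q => p.time D β + q.time D β
  | ite b p q => b.cost + (p.time D β + q.time D β)
  | forTo _ e p => e.cost + e.cost + 17 + β * (p.time D β + 11)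

variable {d : ℕ} {ω : ℕ → Fin d → ℝ}

theorem run_forTo (v : ℕ) (e : NExp) (p : Cmd) (s : Memory) :
    run ω (forTo v e p) s =
      (fun s => (run ω p s).setN v ((run ω p s).nat v + 1))^[min (e.eval s) (s.nat 4)]
        ((s.setN (v + 1) (min (e.eval s) (s.nat 4))).setN v 0) := rfl

@[simp] theorem run_seq (p q : Cmd) (s : Memory) :
    run ω (seq p q) s = run ω q (run ω p s) := rfl

@[simp] theorem run_nset (v : ℕ) (e : NExp) (s : Memory) :
    run ω (nset v e) s = s.setN v (e.eval s) := rfl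

@[simp] theorem run_aset (k : ℕ) (i : NExp) (e : RExp) (s : Memory) :
    run ω (aset k i e) s = s.setA k (i.eval s) (e.eval s) := rfl

open Classical in
theorem run_ite (b : BExp) (p q : Cmd) (s : Memory) :
    run ω (ite b p q) s = if b.holds s then run ω p s else run ω q s := rfl

theorem run_nat {p : Cmd} {v : ℕ} (hv : v ∉ p.natW) (s : Memory) :
    (run ω p s).nat v = s.nat v := by
  induction p generalizing s with
  | nset w e => simp only [natW, List.mem_singleton] at hv; simp [hv]
  | aset k i e => rfl
  | rset a e => rfl
  | draw a => rfl
  | seq p q ihp ihq =>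
    simp only [natW, List.mem_append, not_or] at hv
    rw [run_seq, ihq hv.2, ihp hv.1]
  | ite b p q ihp ihq =>
    simp only [natW, List.mem_append, not_or] at hv
    rw [run_ite]; split_ifs
    · exact ihp hv.1 s
    · exact ihq hv.2 s
  | forTo w e p ih =>
    simp only [natW, List.mem_cons, not_or] at hv
    rw [run_forTo]
    generalize min (e.eval s) (s.nat 4) = n
    have key : ∀ n s', ((fun s => (run ω p s).setN w ((run ω p s).nat w + 1))^[n] s').nat v
        = s'.nat v := by
      intro n
      induction n with
      | zero => intro s'; rfl
      | succ n ihn =>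
        intro s'
        rw [Function.iterate_succ_apply', Memory.setN_nat, if_neg hv.1, ih hv.2.2, ihn]
    rw [key]
    simp [hv.1, hv.2.1]

/-- The base address and the loop cap therefore keep their values throughout a well-formed command.
-/
theorem three_notMem_natW {p : Cmd} (h : p.WF) : 3 ∉ p.natW ∧ 4 ∉ p.natW := by
  induction p with
  | nset w e => simp only [WF] at h; simp [natW]; omega
  | aset k i e => simp [natW]
  | rset a e => simp [natW]
  | draw a => simp [natW]
  | seq p q ihp ihq =>
    simp only [natW, List.mem_append, not_or]
    exact ⟨⟨(ihp h.1).1, (ihq h.2).1⟩, ⟨(ihp h.1).2, (ihq h.2).2⟩⟩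
  | ite b p q ihp ihq =>
    simp only [natW, List.mem_append, not_or]
    exact ⟨⟨(ihp h.1).1, (ihq h.2).1⟩, ⟨(ihp h.1).2, (ihq h.2).2⟩⟩
  | forTo w e p ih =>
    simp only [WF] at h
    obtain ⟨h1, h2, h3, h4, -, -, h7⟩ := h
    simp only [natW, List.mem_cons, not_or]
    exact ⟨⟨h1.symm, h3.symm, (ih h7).1⟩, ⟨h2.symm, h4.symm, (ih h7).2⟩⟩

end Cmd

/-- If the body acts as the function `f` and the test first fails after `n` rounds, the loop
computes the `n`-th iterate; the last summand of the cost pays for the failing test. -/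
theorem exec_loop_iterate {d : ℕ} {ω : ℕ → Fin d → ℝ} {b : BExp} {p : Program}
    (f : Memory → Memory) (τ n : ℕ) (s : Memory)
    (h : ∀ k < n, b.holds (f^[k] s) ∧ ∃ t ≤ τ, Exec ω p (f^[k] s) t (f (f^[k] s)))
    (hn : ¬ b.holds (f^[n] s)) :
    ∃ t ≤ n * (b.cost + τ) + b.cost, Exec ω (.loop b p) s t (f^[n] s) := by
  induction n generalizing s with
  | zero => exact ⟨b.cost, by omega, .loopFalse hn⟩
  | succ n ih =>
    obtain ⟨h0, t0, ht0, e0⟩ := h 0 (Nat.succ_pos n)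
    obtain ⟨t1, ht1, e1⟩ := ih (f s) (fun k hk => by
      have := h (k + 1) (by omega)
      simpa only [Function.iterate_succ_apply] using this)
      (by simpa only [Function.iterate_succ_apply] using hn)
    refine ⟨b.cost + t0 + t1, ?_, .loopTrue h0 e0 e1⟩
    have : (n + 1) * (b.cost + τ) = n * (b.cost + τ) + (b.cost + τ) := by ring
    omega

namespace Cmd

variable {d : ℕ} {ω : ℕ → Fin d → ℝ}

theorem iterate_nat {p : Cmd} {v : ℕ} (hv : v ∉ p.natW) (s : Memory) (k : ℕ) :
    ((fun s => (run ω p s).setN v ((run ω p s).nat v + 1))^[k] s).nat v = s.nat v + k := by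
  induction k with
  | zero => rfl
  | succ k ih =>
    rw [Function.iterate_succ_apply', Memory.setN_nat, if_pos rfl, run_nat hv, ih]; omega

theorem iterate_nat_of_ne {p : Cmd} {v w : ℕ} (hw : w ∉ p.natW) (hne : w ≠ v) (s : Memory)
    (k : ℕ) :
    ((fun s => (run ω p s).setN v ((run ω p s).nat v + 1))^[k] s).nat w = s.nat w := by
  induction k with
  | zero => rfl
  | succ k ih =>
    rw [Function.iterate_succ_apply', Memory.setN_nat, if_neg hne, run_nat hw, ih]

/-- A command runs within its time bound and has the effect `run`. -/
theorem exec_toProgram {p : Cmd} (hp : p.WF) {β : ℕ} (s : Memory) (hβ : s.nat 4 ≤ β) :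
    ∃ t ≤ p.time d β, Exec ω p.toProgram s t (run ω p s) := by
  induction p generalizing s with
  | nset v e => exact ⟨_, le_rfl, .setNat _ _ _⟩
  | aset k i e => exact ⟨_, le_rfl, .setReal _ _ _⟩
  | rset a e => exact ⟨_, le_rfl, .setReal _ _ _⟩
  | draw a => exact ⟨_, le_rfl, .draw _ _⟩
  | seq p q ihp ihq =>
    obtain ⟨t1, h1, e1⟩ := ihp hp.1 s hβ
    obtain ⟨t2, h2, e2⟩ := ihq hp.2 (run ω p s)
      (by rw [run_nat (three_notMem_natW hp.1).2]; exact hβ)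
    exact ⟨t1 + t2, Nat.add_le_add h1 h2, .seq e1 e2⟩
  | ite b p q ihp ihq =>
    rw [run_ite]
    split_ifs with hb
    · obtain ⟨t1, h1, e1⟩ := ihp hp.1 s hβ
      exact ⟨_, by simp only [time]; omega, .branchTrue hb e1⟩
    · obtain ⟨t1, h1, e1⟩ := ihq hp.2 s hβ
      exact ⟨_, by simp only [time]; omega, .branchFalse hb e1⟩
  | forTo v e p ih =>
    simp only [WF] at hp
    obtain ⟨h1, h2, h3, h4, h5, h6, h7⟩ := hp
    rw [run_forTo]
    set n := min (e.eval s) (s.nat 4) with hn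
    set s0 := (s.setN (v + 1) n).setN v 0 with hs0
    set f : Memory → Memory := fun s => (run ω p s).setN v ((run ω p s).nat v + 1) with hf
    have hv : ∀ k, (f^[k] s0).nat v = k := fun k => by
      rw [hf, iterate_nat h5]; simp [hs0]
    have hv1 : ∀ k, (f^[k] s0).nat (v + 1) = n := fun k => by
      rw [hf, iterate_nat_of_ne h6 (by omega)]; simp [hs0]
    have h44 : ∀ k, (f^[k] s0).nat 4 = s.nat 4 := fun k => by
      rw [hf, iterate_nat_of_ne (three_notMem_natW h7).2 (Ne.symm h2)]
      simp [hs0, Ne.symm h2, Ne.symm h4]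
    -- The increment of the counter costs 6 steps and the test 5, which explains the 11 per round in
    -- `time`.
    obtain ⟨t, ht, ex⟩ := exec_loop_iterate (ω := ω)
      (b := .natLt (NExp.cell v) (NExp.cell (v + 1)))
      (p := .seq p.toProgram (.setNat (.const v) (.add (NExp.cell v) (.const 1))))
      f (p.time d β + 6) n s0 (fun k hk => by
        refine ⟨by simpa [hv, hv1] using hk, ?_⟩
        obtain ⟨t1, ht1, e1⟩ := ih h7 (f^[k] s0) (by rw [h44]; exact hβ)
        refine ⟨t1 + 6, by omega, .seq e1 ?_⟩
        exact .setNat _ _ _) (by simp [hv, hv1])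
    have e1 : Exec ω (.setNat (.const (v + 1)) (NExp.capped e)) s
        (1 + (NExp.capped e).cost + 1) (s.setN (v + 1) n) := by
      have := Exec.setNat (ω := ω) (.const (v + 1)) (NExp.capped e) s
      rwa [NExp.eval_capped] at this
    have e2 : Exec ω (.setNat (.const v) (.const 0)) (s.setN (v + 1) n) 3 s0 :=
      Exec.setNat (ω := ω) (.const v) (.const 0) (s.setN (v + 1) n)
    refine ⟨_, ?_, .seq e1 (.seq e2 ex)⟩
    · have hnβ : n ≤ β := by omega
      have : n * (1 + 1 + (1 + 1) + 1 + (p.time d β + 6)) ≤ β * (p.time d β + 11) := by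
        calc _ = n * (p.time d β + 11) := by ring
          _ ≤ _ := Nat.mul_le_mul_right _ hnβ
      simp only [time, NExp.cost, BExp.cost, NExp.cell, NExp.capped] at ht ⊢
      omega

end Cmd

/-! ### Frame conditions and invariant rules -/

/-- `s'` agrees with `s` outside the cells `W` and the arrays `A`. -/
structure Frame (W A : List ℕ) (s s' : Memory) : Prop where
  nat : ∀ v ∉ W, s'.nat v = s.nat v
  arr : ∀ k < 16, k ∉ A → ∀ i, s'.arr k i = s.arr k i
  low : ∀ a < s.nat 3, s'.real a = s.real a
  drawn : s'.drawn = s.drawn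

theorem Frame.refl (W A : List ℕ) (s : Memory) : Frame W A s s :=
  ⟨fun _ _ => rfl, fun _ _ _ _ => rfl, fun _ _ => rfl, rfl⟩

theorem Frame.trans {W A : List ℕ} {s s' s'' : Memory} (hW : 3 ∉ W) (h : Frame W A s s')
    (h' : Frame W A s' s'') : Frame W A s s'' :=
  ⟨fun v hv => (h'.nat v hv).trans (h.nat v hv),
    fun k hk hA i => (h'.arr k hk hA i).trans (h.arr k hk hA i),
    fun a ha => (h'.low a (by rw [h.nat 3 hW]; exact ha)).trans (h.low a ha),
    h'.drawn.trans h.drawn⟩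

theorem Frame.mono {W A W' A' : List ℕ} {s s' : Memory} (h : Frame W A s s')
    (hW : W ⊆ W') (hA : A ⊆ A') : Frame W' A' s s' :=
  ⟨fun v hv => h.nat v fun h' => hv (hW h'),
    fun k hk hk' => h.arr k hk fun h' => hk' (hA h'), h.low, h.drawn⟩

theorem Frame.setN {W A : List ℕ} {s : Memory} {v x : ℕ} (hv : v ∈ W) (h3 : v ≠ 3) :
    Frame W A s (s.setN v x) :=
  ⟨fun w hw => by rw [Memory.setN_nat, if_neg]; rintro rfl; exact hw hv,
    fun k _ _ i => Memory.setN_arr _ _ h3 _ _, fun _ _ => rfl, rfl⟩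

namespace Cmd

variable {d : ℕ} {ω : ℕ → Fin d → ℝ}

/-- Locality is what makes this true: draws and raw writes could hit the arrays or the cells below
the base address. -/
theorem run_frame {p : Cmd} (hp : p.WF) (hl : p.Local) (s : Memory) :
    Frame p.natW p.arrW s (run ω p s) := by
  induction p generalizing s with
  | nset v e => exact Frame.setN (by simp [natW]) hp.1
  | aset k i e =>
    refine ⟨fun v _ => rfl, fun k' hk' hA i' => ?_, fun a ha => Memory.setA_low _ _ ha, rfl⟩
    rw [run_aset, Memory.setA_arr _ _ _ _ hl hk', if_neg]
    rintro ⟨rfl, -⟩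
    simp [arrW] at hA
  | rset a e => exact hl.elim
  | draw a => exact hl.elim
  | seq p q ihp ihq =>
    exact ((ihp hp.1 hl.1 s).mono (by simp [natW]) (by simp [arrW])).trans
      (three_notMem_natW (p := seq p q) hp).1
      ((ihq hp.2 hl.2 _).mono (by simp [natW]) (by simp [arrW]))
  | ite b p q ihp ihq =>
    rw [run_ite]; split_ifs
    · exact (ihp hp.1 hl.1 s).mono (by simp [natW]) (by simp [arrW])
    · exact (ihq hp.2 hl.2 s).mono (by simp [natW]) (by simp [arrW])
  | forTo w e p ih =>
    have hp' := hp
    simp only [WF] at hp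
    obtain ⟨h1, h2, h3, h4, h5, h6, h7⟩ := hp
    have h30 := (three_notMem_natW hp').1
    rw [run_forTo]
    generalize min (e.eval s) (s.nat 4) = n
    have key : ∀ n s', Frame (natW (forTo w e p)) (arrW (forTo w e p)) s'
        ((fun s => (run ω p s).setN w ((run ω p s).nat w + 1))^[n] s') := by
      intro n
      induction n with
      | zero => intro s'; exact Frame.refl _ _ _
      | succ n ihn =>
        intro s'
        rw [Function.iterate_succ_apply']
        refine (ihn s').trans h30 (Frame.trans h30 ((ih h7 hl _).mono ?_ ?_) (Frame.setN ?_ h1))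
        · intro x hx; simp [natW, hx]
        · intro x hx; exact hx
        · simp [natW]
    exact ((Frame.setN (by simp [natW]) h3).trans h30 (Frame.setN (by simp [natW]) h1)).trans h30
      (key _ _)

/-- The invariant rule for counted loops. -/
theorem run_forTo_inv {v : ℕ} {e : NExp} {p : Cmd} {s : Memory} (I : ℕ → Memory → Prop) {n : ℕ}
    (hw : (forTo v e p).WF) (hn : e.eval s = n) (hcap : n ≤ s.nat 4)
    (h0 : I 0 ((s.setN (v + 1) n).setN v 0))
    (hs : ∀ k < n, ∀ s', s'.nat v = k → I k s' → I (k + 1) ((run ω p s').setN v (k + 1))) :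
    I n (run ω (forTo v e p) s) := by
  have hw' := hw
  simp only [WF] at hw'
  obtain ⟨h1, h2, h3, h4, h5, h6, h7⟩ := hw'
  rw [run_forTo, hn, min_eq_left hcap]
  set s0 := (s.setN (v + 1) n).setN v 0 with hs0
  have hv : ∀ k, ((fun s => (run ω p s).setN v ((run ω p s).nat v + 1))^[k] s0).nat v = k :=
    fun k => by rw [iterate_nat h5]; simp [hs0]
  suffices H : ∀ k ≤ n, I k ((fun s => (run ω p s).setN v ((run ω p s).nat v + 1))^[k] s0) from
    H n le_rfl
  intro k
  induction k with
  | zero => intro _; exact h0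
  | succ k ih =>
    intro hk
    have := hs k (by omega) _ (hv k) (ih (by omega))
    rw [Function.iterate_succ_apply']
    rw [run_nat h5, hv]
    exact this

/-- The invariant rule for counted loops over local commands, with the frame condition. -/
theorem run_forTo_inv_frame {v : ℕ} {e : NExp} {p : Cmd} {s : Memory} (I : ℕ → Memory → Prop)
    {n : ℕ} (hw : (forTo v e p).WF) (hl : p.Local) (hn : e.eval s = n) (hcap : n ≤ s.nat 4)
    (h0 : I 0 ((s.setN (v + 1) n).setN v 0))
    (hs : ∀ k < n, ∀ s', s'.nat v = k → Frame (forTo v e p).natW p.arrW s s' → I k s' →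
      I (k + 1) ((run ω p s').setN v (k + 1))) :
    I n (run ω (forTo v e p) s) := by
  have h30 := (three_notMem_natW hw).1
  have hw' := hw
  simp only [WF] at hw'
  obtain ⟨h1, h2, h3, h4, h5, h6, h7⟩ := hw'
  refine (run_forTo_inv (ω := ω)
    (fun k s' => Frame (forTo v e p).natW p.arrW s s' ∧ I k s') hw hn hcap ⟨?_, h0⟩ ?_).2
  · exact (Frame.setN (by simp [natW]) h3).trans h30 (Frame.setN (by simp [natW]) h1)
  · rintro k hk s' hv ⟨hf, hI⟩
    refine ⟨hf.trans h30 (((run_frame h7 hl s').mono ?_ ?_).trans h30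
      (Frame.setN (by simp [natW]) h1)), hs k hk s' hv hf hI⟩
    · intro x hx; simp [natW, hx]
    · intro x hx; exact hx

end Cmd

/-! ### Elementary loops -/

namespace Cmd

variable {d : ℕ} {ω : ℕ → Fin d → ℝ}

/-- Entry `q` of the array `13` becomes the sum over `v < e` of the values of `E`. -/
def sumTo (q v : ℕ) (e : NExp) (E : RExp) : Cmd :=
  seq (aset 13 (.const q) (.ofNat (.const 0)))
    (forTo v e (aset 13 (.const q) (.add (.arr 13 (.const q)) E)))

/-- The summand may read everything except what the loop itself changes: the counter cells and entry
`q` of the scratch array `13`. The other entries of that array survive, so several sums can be kept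
side by side. -/
theorem run_sumTo {q v : ℕ} {e : NExp} {E : RExp} {s : Memory} {n : ℕ} (f : ℕ → ℝ)
    (hv : 4 < v) (hn : ∀ s', Frame [] [13] s s' → e.eval s' = n) (hcap : n ≤ s.nat 4)
    (hE : ∀ k < n, ∀ s', s'.nat v = k → Frame [v, v + 1] [13] s s' →
      (∀ i ≠ q, s'.arr 13 i = s.arr 13 i) → E.eval s' = f k) :
    (run ω (sumTo q v e E) s).arr 13 q = ∑ k ∈ Finset.range n, f k ∧
    (∀ i ≠ q, (run ω (sumTo q v e E) s).arr 13 i = s.arr 13 i) ∧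
    Frame [v, v + 1] [13] s (run ω (sumTo q v e E) s) := by
  have hwf : (sumTo q v e E).WF := by simp [sumTo, WF, natW]; omega
  have hl : (sumTo q v e E).Local := by simp [sumTo, Local]
  have hfr : Frame [v, v + 1] [13] s (run ω (sumTo q v e E) s) :=
    (run_frame hwf hl s).mono (by simp [sumTo, natW]) (by simp [sumTo, arrW])
  refine (and_assoc.1 ⟨?_, hfr⟩)
  have h1 : Frame [] [13] s (run ω (aset 13 (.const q) (.ofNat (.const 0))) s) :=
    (run_frame (by trivial) (by simp [Local]) s).mono (by simp [natW]) (by simp [arrW])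
  rw [sumTo, run_seq]
  set s1 := run ω (aset 13 (.const q) (.ofNat (.const 0))) s with hs1
  have ha1 : ∀ i, s1.arr 13 i = if i = q then 0 else s.arr 13 i := fun i => by
    simp [hs1, Memory.setA_arr]
  refine run_forTo_inv_frame (ω := ω) (fun k s' => s'.arr 13 q = ∑ k ∈ Finset.range k, f k ∧
    ∀ i ≠ q, s'.arr 13 i = s.arr 13 i) hwf.2 (by simp [Local]) (hn s1 h1)
    (by rw [h1.nat 4 (by simp)]; exact hcap) ?_ ?_
  · simp only [Memory.setN_arr _ _ (show v ≠ 3 by omega),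
      Memory.setN_arr _ _ (show v + 1 ≠ 3 by omega), ha1, if_true, Finset.range_zero,
      Finset.sum_empty, true_and]
    intro i hi; simp [hi]
  · rintro k hk s' hvk hf ⟨hI, hI'⟩
    have hf' : Frame [v, v + 1] [13] s s' :=
      (h1.mono (by simp) (by simp)).trans (by simp; omega)
        (hf.mono (by simp [natW]) (by simp [arrW]))
    simp only [Memory.setN_arr _ _ (show v ≠ 3 by omega), run_aset, RExp.eval_add, RExp.eval_arr,
      NExp.eval_const, Memory.setA_arr _ _ _ _ (show 13 < 16 by omega) (show 13 < 16 by omega),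
      true_and, if_true]
    constructor
    · rw [hI, hE k hk s' hvk hf' hI', Finset.sum_range_succ]
    · intro i hi
      rw [if_neg hi, hI' i hi]

/-- Injectivity of the target `g` ensures that no written entry is overwritten later. The expression
may even read the array that is being written, as long as it reads entries not yet reached. -/
theorem run_map {v k : ℕ} {e i : NExp} {E : RExp} {s : Memory} {n : ℕ} (g : ℕ → ℕ) (f : ℕ → ℝ)
    (hv : 4 < v) (hk : k < 16) (hn : e.eval s = n) (hcap : n ≤ s.nat 4)
    (hg : ∀ r < n, ∀ r' < n, g r = g r' → r = r')
    (hi : ∀ r < n, ∀ s', s'.nat v = r → Frame [v, v + 1] [k] s s' → i.eval s' = g r)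
    (hE : ∀ r < n, ∀ s', s'.nat v = r → Frame [v, v + 1] [k] s s' →
      (∀ x, (∀ r' < r, x ≠ g r') → s'.arr k x = s.arr k x) → E.eval s' = f r) :
    (∀ r < n, (run ω (forTo v e (aset k i E)) s).arr k (g r) = f r) ∧
    (∀ x, (∀ r < n, x ≠ g r) → (run ω (forTo v e (aset k i E)) s).arr k x = s.arr k x) ∧
    Frame [v, v + 1] [k] s (run ω (forTo v e (aset k i E)) s) := by
  have hwf : (forTo v e (aset k i E)).WF := by simp [WF, natW]; omega
  have hl : (forTo v e (aset k i E)).Local := by simp [Local, hk]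
  have hfr : Frame [v, v + 1] [k] s (run ω (forTo v e (aset k i E)) s) :=
    (run_frame hwf hl s).mono (by simp [natW]) (by simp [arrW])
  refine (and_assoc.1 ⟨?_, hfr⟩)
  refine run_forTo_inv_frame (ω := ω) (fun m s' => (∀ r < m, s'.arr k (g r) = f r) ∧
    (∀ x, (∀ r < m, x ≠ g r) → s'.arr k x = s.arr k x)) hwf hl hn hcap ?_ ?_
  · refine ⟨fun r hr => by omega, fun x _ => ?_⟩
    simp only [Memory.setN_arr _ _ (show v ≠ 3 by omega),
      Memory.setN_arr _ _ (show v + 1 ≠ 3 by omega)]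
  · rintro m hm s' hvm hf ⟨hI, hI'⟩
    have hf' : Frame [v, v + 1] [k] s s' := hf.mono (by simp [natW]) (by simp [arrW])
    simp only [Memory.setN_arr _ _ (show v ≠ 3 by omega), run_aset, hi m hm s' hvm hf',
      Memory.setA_arr _ _ _ _ hk hk, true_and, hE m hm s' hvm hf' hI']
    constructor
    · intro r hr
      rcases Nat.lt_succ_iff_lt_or_eq.1 hr with h | h
      · rw [if_neg (fun h' => by have := hg r (by omega) m hm h'; omega), hI r h]
      · rw [h, if_pos rfl]
    · intro x hx
      rw [if_neg (hx m (by omega)), hI' x fun r hr => hx r (by omega)]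

end Cmd

/-- Uniqueness of quotient and remainder: distinct positions of a matrix with `N` columns have
distinct addresses. -/
theorem row_index_inj {N r r' j j' : ℕ} (hj : j < N) (hj' : j' < N)
    (h : r * N + j = r' * N + j') : r = r' ∧ j = j' := by
  have hN : 0 < N := by omega
  have h1 : (r * N + j) / N = r := by
    rw [Nat.add_comm, Nat.add_mul_div_right _ _ hN, Nat.div_eq_of_lt hj, Nat.zero_add]
  have h2 : (r' * N + j') / N = r' := by
    rw [Nat.add_comm, Nat.add_mul_div_right _ _ hN, Nat.div_eq_of_lt hj', Nat.zero_add]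
  have : r = r' := by rw [← h1, ← h2, h]
  subst this
  exact ⟨rfl, by omega⟩

/-! ### Gram–Schmidt on the columns of a matrix -/

/-- The mean product of the columns `i` and `j` over the first `T` rows. -/
noncomputable def colDot (T : ℕ) (V : ℕ → ℕ → ℝ) (i j : ℕ) : ℝ :=
  (∑ r ∈ Finset.range T, V r i * V r j) / T

/-- Make column `j` orthogonal to column `i`. -/
noncomputable def colElim (T : ℕ) (V : ℕ → ℕ → ℝ) (j i : ℕ) : ℕ → ℕ → ℝ := fun r q =>
  if q = j then V r j - colDot T V i j / colDot T V i i * V r i else V r q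

/-- Make column `j` orthogonal to the columns before `i`. -/
noncomputable def colReduce (T : ℕ) (V : ℕ → ℕ → ℝ) (j : ℕ) : ℕ → ℕ → ℕ → ℝ
  | 0 => V
  | i + 1 => colElim T (colReduce T V j i) j i

/-- Orthogonalize the columns before `j`. -/
noncomputable def gramSchmidtCols (T : ℕ) (V : ℕ → ℕ → ℝ) : ℕ → ℕ → ℕ → ℝ
  | 0 => V
  | j + 1 => colReduce T (gramSchmidtCols T V j) j j

theorem colReduce_of_ne (T : ℕ) (V : ℕ → ℕ → ℝ) (j i r q : ℕ) (hq : q ≠ j) :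
    colReduce T V j i r q = V r q := by
  induction i with
  | zero => rfl
  | succ i ih => rw [colReduce, colElim, if_neg hq, ih]

theorem gramSchmidtCols_of_le (T : ℕ) (V : ℕ → ℕ → ℝ) {j k : ℕ} (hk : j ≤ k) (r q : ℕ)
    (hq : q < j) : gramSchmidtCols T V k r q = gramSchmidtCols T V j r q := by
  induction k, hk using Nat.le_induction with
  | base => rfl
  | succ k hk ih => rw [gramSchmidtCols, colReduce_of_ne _ _ _ _ _ _ (by omega), ih]

theorem colDot_congr {T : ℕ} {V V' : ℕ → ℕ → ℝ} {i j : ℕ} (hi : ∀ r < T, V r i = V' r i)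
    (hj : ∀ r < T, V r j = V' r j) : colDot T V i j = colDot T V' i j := by
  unfold colDot
  congr 1
  refine Finset.sum_congr rfl fun r hr => ?_
  rw [hi r (Finset.mem_range.1 hr), hj r (Finset.mem_range.1 hr)]

namespace Cmd

variable {d : ℕ} {ω : ℕ → Fin d → ℝ}

/-- Entry `(r, j)` of the data matrix. -/
def vE (r j : NExp) : RExp := .arr 0 (.add (.mul r (.cell 5)) j)

/-- The total number of rows: oracle points, input examples, and one row for each monomial. -/
def rowsE : NExp := .add (.add (.cell 11) (.cell 2)) (.cell 5)

/-- The command behind `colElim`, for the columns `j` and `i` in the cells `20` and `22`. -/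
def elimCmd : Cmd :=
  seq (sumTo 0 24 (.cell 11) (.mul (vE (.cell 24) (.cell 22)) (vE (.cell 24) (.cell 20)))) <|
  seq (aset 13 (.const 0) (.div (.div (.arr 13 (.const 0)) (.ofNat (.cell 11)))
    (.arr 1 (.cell 22)))) <|
  forTo 24 rowsE (aset 0 (.add (.mul (.cell 24) (.cell 5)) (.cell 20))
    (.sub (vE (.cell 24) (.cell 20)) (.mul (.arr 13 (.const 0)) (vE (.cell 24) (.cell 22)))))

/-- Orthogonalization of the columns of the data matrix; the mean squares are stored in the
array `1`. -/
def gramSchmidtCmd : Cmd :=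
  forTo 20 (.cell 5) <|
    seq (forTo 22 (.cell 20) elimCmd) <|
    seq (sumTo 0 24 (.cell 11) (.mul (vE (.cell 24) (.cell 20)) (vE (.cell 24) (.cell 20)))) <|
    aset 1 (.cell 20) (.div (.arr 13 (.const 0)) (.ofNat (.cell 11)))

/-- The projection coefficient is computed from the `T` oracle rows only, but the column operation
is applied to all `T + M + N` rows; examples and identity rows thus follow the same change of basis.
The mean square of column `i` is read from array `1`. -/
theorem run_elimCmd {s : Memory} {T M N j i : ℕ} {V : ℕ → ℕ → ℝ}
    (hT : s.nat 11 = T) (hM : s.nat 2 = M) (hN : s.nat 5 = N) (hj : s.nat 20 = j)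
    (hi : s.nat 22 = i) (hcap : T + M + N ≤ s.nat 4) (hij : i < j) (hjN : j < N)
    (hV : ∀ r < T + M + N, ∀ q < N, s.arr 0 (r * N + q) = V r q)
    (hn : s.arr 1 i = colDot T V i i) :
    ∀ r < T + M + N, ∀ q < N, (run ω elimCmd s).arr 0 (r * N + q) = colElim T V j i r q := by
  obtain ⟨h1, -, hf1⟩ := run_sumTo (ω := ω) (q := 0) (v := 24) (e := .cell 11)
    (E := .mul (vE (.cell 24) (.cell 22)) (vE (.cell 24) (.cell 20))) (s := s) (n := T)
    (fun r => V r i * V r j) (by norm_num) (fun s' h => by rw [NExp.eval_cell, h.nat _ (by simp), hT])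
    (by omega) (fun k hk s' hvk hf _ => by
      simp only [vE, RExp.eval_mul, RExp.eval_arr, NExp.eval_add, NExp.eval_mul, NExp.eval_cell,
        hvk, hf.nat 5 (by simp), hf.nat 22 (by simp), hf.nat 20 (by simp), hN, hi, hj,
        hf.arr 0 (by norm_num) (by simp)]
      rw [hV k (by omega) i (by omega), hV k (by omega) j hjN])
  rw [elimCmd, run_seq, run_seq]
  set s1 := run ω (sumTo 0 24 (.cell 11)
    (.mul (vE (.cell 24) (.cell 22)) (vE (.cell 24) (.cell 20)))) s
  set A := (aset 13 (.const 0) (.div (.div (.arr 13 (.const 0)) (.ofNat (.cell 11)))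
    (.arr 1 (.cell 22)))) with hA
  have hf2 : Frame [] [13] s1 (run ω A s1) := run_frame (p := A) trivial (by simp [hA, Local]) s1
  have h2 : (run ω A s1).arr 13 0 = colDot T V i j / colDot T V i i := by
    simp only [hA, run_aset, NExp.eval_const, RExp.eval_div, RExp.eval_arr, RExp.eval_ofNat,
      NExp.eval_cell, Memory.setA_arr _ _ _ _ (show 13 < 16 by omega) (show 13 < 16 by omega),
      and_self, if_true, h1, hf1.nat 11 (by simp), hf1.nat 22 (by simp), hi, hT,
      hf1.arr 1 (by norm_num) (by simp), hn]
    rfl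
  set s2 := run ω A s1
  have hf : Frame [24, 25] [13] s s2 := hf1.trans (by simp) (hf2.mono (by simp) (by simp))
  have h5 : s2.nat 5 = N := by rw [hf.nat 5 (by simp), hN]
  obtain ⟨h3, h3', -⟩ := run_map (ω := ω) (v := 24) (k := 0) (e := rowsE)
    (i := .add (.mul (.cell 24) (.cell 5)) (.cell 20))
    (E := .sub (vE (.cell 24) (.cell 20)) (.mul (.arr 13 (.const 0)) (vE (.cell 24) (.cell 22))))
    (s := s2) (n := T + M + N) (fun r => r * N + j) (fun r => colElim T V j i r j)
    (by norm_num) (by norm_num) (by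
      simp [rowsE, hf.nat 11 (by simp), hf.nat 2 (by simp), h5, hT, hM])
    (by rw [hf.nat 4 (by simp)]; exact hcap)
    (fun r _ r' _ h => (row_index_inj hjN hjN h).1)
    (fun r hr s' hvr hf' => by
      simp [hvr, hf'.nat 5 (by simp), hf'.nat 20 (by simp), hf.nat 20 (by simp), h5, hj])
    (fun r hr s' hvr hf' hx => by
      simp only [vE, RExp.eval_mul, RExp.eval_sub, RExp.eval_arr, NExp.eval_add, NExp.eval_mul,
        NExp.eval_cell, NExp.eval_const, hvr, hf'.nat 5 (by simp), hf'.nat 22 (by simp),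
        hf'.nat 20 (by simp), hf.nat 22 (by simp), hf.nat 20 (by simp), h5, hi, hj,
        hf'.arr 13 (by norm_num) (by simp), h2]
      rw [hx, hx, hf.arr 0 (by norm_num) (by simp), hf.arr 0 (by norm_num) (by simp),
        hV r hr j hjN, hV r hr i (by omega), colElim, if_pos rfl]
      · intro r' hr' h; have := (row_index_inj (by omega) hjN h).2; omega
      · intro r' hr' h; have := (row_index_inj hjN hjN h).1; omega)
  intro r hr q hq
  by_cases hqj : q = j
  · subst hqj; exact h3 r hr
  · rw [h3', hf.arr 0 (by norm_num) (by simp), hV r hr q hq, colElim, if_neg hqj]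
    intro r' hr' h
    exact hqj (row_index_inj hq hjN h).2

end Cmd

namespace Cmd

variable {d : ℕ} {ω : ℕ → Fin d → ℝ}

/-- Columns left of `j` no longer change in the pass for column `j` or later, so the mean squares
stored in array `1` stay valid until the end. -/
theorem run_gramSchmidtCmd {s : Memory} {T M N : ℕ} {V : ℕ → ℕ → ℝ}
    (hT : s.nat 11 = T) (hM : s.nat 2 = M) (hN : s.nat 5 = N) (hcap : T + M + N ≤ s.nat 4)
    (hV : ∀ r < T + M + N, ∀ q < N, s.arr 0 (r * N + q) = V r q) :
    (∀ r < T + M + N, ∀ q < N,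
      (run ω gramSchmidtCmd s).arr 0 (r * N + q) = gramSchmidtCols T V N r q) ∧
    ∀ i < N, (run ω gramSchmidtCmd s).arr 1 i = colDot T (gramSchmidtCols T V N) i i := by
  refine run_forTo_inv_frame (ω := ω) (fun j s' => (∀ r < T + M + N, ∀ q < N,
      s'.arr 0 (r * N + q) = gramSchmidtCols T V j r q) ∧
    ∀ i < j, s'.arr 1 i = colDot T (gramSchmidtCols T V j) i i) (by decide) (by decide)
    hN (by omega) ⟨fun r hr q hq => hV r hr q hq, fun i hi => by omega⟩ ?_
  rintro j hj s' hj' hf ⟨hI, hI'⟩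
  have e5 : s'.nat 5 = N := by rw [hf.nat 5 (by decide), hN]
  have e11 : s'.nat 11 = T := by rw [hf.nat 11 (by decide), hT]
  have e2 : s'.nat 2 = M := by rw [hf.nat 2 (by decide), hM]
  have e4 : s'.nat 4 = s.nat 4 := hf.nat 4 (by decide)
  rw [run_seq, run_seq]
  have hf1 := run_frame (ω := ω) (p := forTo 22 (.cell 20) elimCmd) (by decide) (by decide) s'
  have hV1 : ∀ r < T + M + N, ∀ q < N, (run ω (forTo 22 (.cell 20) elimCmd) s').arr 0 (r * N + q)
      = gramSchmidtCols T V (j + 1) r q := by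
    refine run_forTo_inv_frame (ω := ω) (fun i s'' => ∀ r < T + M + N, ∀ q < N,
      s''.arr 0 (r * N + q) = colReduce T (gramSchmidtCols T V j) j i r q) (by decide) (by decide)
      hj' (by omega) hI ?_
    intro i hi s'' hi' hf' hJ
    have := run_elimCmd (ω := ω) (s := s'') (j := j) (i := i) (T := T) (M := M) (N := N)
      (by rw [hf'.nat 11 (by decide), e11]) (by rw [hf'.nat 2 (by decide), e2])
      (by rw [hf'.nat 5 (by decide), e5]) (by rw [hf'.nat 20 (by decide), hj']) hi'
      (by rw [hf'.nat 4 (by decide), e4]; exact hcap) hi hj hJ (by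
        rw [hf'.arr 1 (by norm_num) (by decide), hI' i hi]
        refine colDot_congr ?_ ?_ <;>
          exact fun r _ => (colReduce_of_ne _ _ _ _ _ _ (by omega)).symm)
    exact this
  set s1 := run ω (forTo 22 (.cell 20) elimCmd) s'
  obtain ⟨h2, -, hf2⟩ := run_sumTo (ω := ω) (q := 0) (v := 24) (e := .cell 11)
    (E := .mul (vE (.cell 24) (.cell 20)) (vE (.cell 24) (.cell 20))) (s := s1) (n := T)
    (fun r => gramSchmidtCols T V (j + 1) r j * gramSchmidtCols T V (j + 1) r j) (by norm_num)
    (fun s' h => by rw [NExp.eval_cell, h.nat _ (by simp), hf1.nat _ (by decide), e11])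
    (by rw [hf1.nat 4 (by decide)]; omega) (fun k hk s'' hvk hf _ => by
      simp only [vE, RExp.eval_mul, RExp.eval_arr, NExp.eval_add, NExp.eval_mul, NExp.eval_cell,
        hvk, hf.nat 5 (by simp), hf.nat 20 (by simp), hf1.nat 5 (by decide),
        hf1.nat 20 (by decide), e5, hj', hf.arr 0 (by norm_num) (by simp)]
      rw [hV1 k (by omega) j hj])
  set s2 := run ω (sumTo 0 24 (.cell 11) (.mul (vE (.cell 24) (.cell 20))
    (vE (.cell 24) (.cell 20)))) s1
  have hj2 : s2.nat 20 = j := by rw [hf2.nat 20 (by simp), hf1.nat 20 (by decide), hj']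
  have hT2 : s2.nat 11 = T := by rw [hf2.nat 11 (by simp), hf1.nat 11 (by decide), e11]
  refine ⟨fun r hr q hq => ?_, fun i hi => ?_⟩
  · rw [Memory.setN_arr _ _ (by norm_num), run_aset, Memory.setA_arr _ _ _ _ (by norm_num)
      (by norm_num), if_neg (by simp), hf2.arr 0 (by norm_num) (by simp), hV1 r hr q hq]
  · rw [Memory.setN_arr _ _ (by norm_num), run_aset, Memory.setA_arr _ _ _ _ (by norm_num)
      (by norm_num)]
    simp only [NExp.eval_cell, hj2, RExp.eval_div, RExp.eval_arr, NExp.eval_const,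
      RExp.eval_ofNat, hT2, h2, true_and]
    split_ifs with h
    · rw [h]; rfl
    · rw [hf2.arr 1 (by norm_num) (by simp), hf1.arr 1 (by norm_num) (by decide), hI' i (by omega)]
      refine colDot_congr ?_ ?_ <;>
        exact fun r _ => (gramSchmidtCols_of_le T V (Nat.le_succ j) r i (by omega)).symm

/-- Input examples with a too large value in some column get weight `0`. -/
def filterCmd : Cmd :=
  forTo 20 (.cell 2) <| forTo 22 (.cell 5) <|
    ite (.realLt (.mul (.ofNat (.pow (.cell 6) 10)) (.arr 1 (.cell 22)))
      (.mul (vE (.add (.cell 11) (.cell 20)) (.cell 22))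
        (vE (.add (.cell 11) (.cell 20)) (.cell 22))))
      (aset 5 (.add (.cell 11) (.cell 20)) (.ofNat (.const 0))) (nset 18 (.const 0))

open Classical in
-- The nested loops only ever write `0`, so the weight of an example survives exactly if no column
-- triggers the test. The assignment to cell `18` plays the role of an empty command.
theorem run_filterCmd {s : Memory} {T M N Z : ℕ} {V : ℕ → ℕ → ℝ} {n : ℕ → ℝ}
    (hT : s.nat 11 = T) (hM : s.nat 2 = M) (hN : s.nat 5 = N) (hZ : s.nat 6 = Z)
    (hcap : T + M + N ≤ s.nat 4)
    (hV : ∀ r < T + M + N, ∀ q < N, s.arr 0 (r * N + q) = V r q)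
    (hn : ∀ q < N, s.arr 1 q = n q) :
    (∀ r < T, (run ω filterCmd s).arr 5 r = s.arr 5 r) ∧
    ∀ r < M, (run ω filterCmd s).arr 5 (T + r) =
      if ∀ q < N, V (T + r) q ^ 2 ≤ (Z : ℝ) ^ 10 * n q then s.arr 5 (T + r) else 0 := by
  suffices H : ∀ x, (run ω filterCmd s).arr 5 x = if ∀ r < M, x = T + r →
      ∀ q < N, V (T + r) q ^ 2 ≤ (Z : ℝ) ^ 10 * n q then s.arr 5 x else 0 by
    refine ⟨fun r hr => ?_, fun r hr => ?_⟩
    · rw [H, if_pos]; intro r' _ h; omega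
    · rw [H]
      refine if_congr ⟨fun h => h r hr rfl, fun h r' hr' hrr' => ?_⟩ rfl rfl
      obtain rfl : r = r' := by omega
      exact h
  refine run_forTo_inv_frame (ω := ω) (fun m s' => ∀ x, s'.arr 5 x = if ∀ r < m, x = T + r →
      ∀ q < N, V (T + r) q ^ 2 ≤ (Z : ℝ) ^ 10 * n q then s.arr 5 x else 0) (by decide) (by decide)
    hM (by omega) (fun x => by
      rw [if_pos (by intro r hr; omega)]
      rfl) ?_
  intro m hm s' hm' hf hI
  have e5 : s'.nat 5 = N := by rw [hf.nat 5 (by decide), hN]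
  have step := run_forTo_inv_frame (ω := ω) (v := 22) (e := .cell 5) (s := s') (n := N)
    (p := ite (.realLt (.mul (.ofNat (.pow (.cell 6) 10)) (.arr 1 (.cell 22)))
      (.mul (vE (.add (.cell 11) (.cell 20)) (.cell 22))
        (vE (.add (.cell 11) (.cell 20)) (.cell 22))))
      (aset 5 (.add (.cell 11) (.cell 20)) (.ofNat (.const 0))) (nset 18 (.const 0)))
    (fun k s'' => ∀ x, s''.arr 5 x = if x = T + m →
      ∀ q < k, V (T + m) q ^ 2 ≤ (Z : ℝ) ^ 10 * n q then s'.arr 5 x else 0) (by decide) (by decide)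
    e5 (by rw [hf.nat 4 (by decide)]; omega) (fun x => by
      rw [if_pos (by intro _ q hq; omega)]; rfl) (by
      intro k hk s'' hk' hf' hJ x
      have hf2 := hf.trans (by decide) (hf'.mono (W' := [20, 21, 22, 23, 18]) (A' := [5])
        (by decide) (by decide))
      rw [Memory.setN_arr _ _ (by norm_num), run_ite]
      have hb : (BExp.realLt (.mul (.ofNat (.pow (.cell 6) 10)) (.arr 1 (.cell 22)))
          (.mul (vE (.add (.cell 11) (.cell 20)) (.cell 22))
          (vE (.add (.cell 11) (.cell 20)) (.cell 22)))).holds s'' ↔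
          (Z : ℝ) ^ 10 * n k < V (T + m) k ^ 2 := by
        simp only [vE, BExp.holds_realLt, RExp.eval_mul, RExp.eval_arr, RExp.eval_ofNat,
          NExp.eval_pow, NExp.eval_cell, NExp.eval_add, NExp.eval_mul, hf2.nat 6 (by decide),
          hf2.nat 11 (by decide), hf2.nat 5 (by decide), hf'.nat 20 (by decide), hm', hk', hT, hN,
          hZ, hf2.arr 1 (by norm_num) (by decide), hf2.arr 0 (by norm_num) (by decide)]
        rw [hV _ (by omega) _ hk, hn k hk, sq, Nat.cast_pow]
      split_ifs with h1 h2 h2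
      · rw [run_aset, Memory.setA_arr _ _ _ _ (by norm_num) (by norm_num), if_neg, hJ x, if_pos]
        · intro hx q hq; exact h2 hx q (by omega)
        · simp only [NExp.eval_add, NExp.eval_cell, hf2.nat 11 (by decide), hf'.nat 20 (by decide),
            hm', hT, true_and]
          intro hx
          exact absurd (h2 hx k (by omega)) (not_le.2 (hb.1 h1))
      · rw [run_aset, Memory.setA_arr _ _ _ _ (by norm_num) (by norm_num)]
        split_ifs with h3
        · simp
        · rw [hJ x, if_neg]
          simp only [NExp.eval_add, NExp.eval_cell, hf2.nat 11 (by decide), hf'.nat 20 (by decide),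
            hm', hT, true_and] at h3
          exact fun _ => h2 fun hx => absurd hx h3
      · rw [run_nset, Memory.setN_arr _ _ (by norm_num), hJ x, if_pos]
        intro hx q hq; exact h2 hx q (by omega)
      · rw [run_nset, Memory.setN_arr _ _ (by norm_num), hJ x, if_neg]
        intro h3
        refine h2 fun hx q hq => ?_
        rcases Nat.lt_succ_iff_lt_or_eq.1 hq with h | h
        · exact h3 hx q h
        · rw [h]; exact not_lt.1 fun h' => h1 (hb.2 h'))
  intro x
  rw [Memory.setN_arr _ _ (by norm_num), step x, hI x]
  by_cases hx : x = T + m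
  · subst hx
    have h0 : ∀ r < m, T + m = T + r → ∀ q < N, V (T + r) q ^ 2 ≤ (Z : ℝ) ^ 10 * n q := by
      intro r hr h; omega
    rw [if_pos h0]
    refine if_congr ⟨fun h r _ hr => ?_, fun h => h m (by omega)⟩ rfl rfl
    obtain rfl : m = r := by omega
    exact h rfl
  · rw [if_pos (fun h => absurd h hx)]
    refine if_congr ⟨fun h r hr hxr => h r ?_ hxr, fun h r hr hxr => h r (by omega) hxr⟩ rfl rfl
    rcases Nat.lt_succ_iff_lt_or_eq.1 hr with h' | h'
    · exact h'
    · exact absurd (h' ▸ hxr) hx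

end Cmd

/-! ### The optimization problem and the program for its descent -/

/-- A weighted sum of hinge functions `w r * (a r - pu r * u r - pl r * l r)⁺` of the two linear
functions `u` and `l` with coefficient vectors with respect to the columns of `B`. The column `j`
has the scale `n j`, and `α` is a step size. -/
structure HingeProblem where
  R : ℕ
  N : ℕ
  B : ℕ → ℕ → ℝ
  n : ℕ → ℝ
  pu : ℕ → ℝ
  pl : ℕ → ℝ
  a : ℕ → ℝ
  w : ℕ → ℝ
  α : ℝ

namespace HingeProblem

variable (P : HingeProblem)

/-- The value of the linear function with coefficients `c` at row `r`. -/
noncomputable def lin (c : ℕ → ℝ) (r : ℕ) : ℝ := ∑ j ∈ Finset.range P.N, c j * P.B r j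

open Classical in
/-- The weight of row `r` if its hinge function is active. -/
noncomputable def active (c : (ℕ → ℝ) × (ℕ → ℝ)) (r : ℕ) : ℝ :=
  if 0 < P.a r - P.pu r * P.lin c.1 r - P.pl r * P.lin c.2 r then P.w r else 0

/-- A step of scaled subgradient descent. -/
noncomputable def next (c : (ℕ → ℝ) × (ℕ → ℝ)) : (ℕ → ℝ) × (ℕ → ℝ) :=
  (fun j => c.1 j + P.α * ((∑ r ∈ Finset.range P.R, P.active c r * (P.pu r * P.B r j)) / P.n j),
   fun j => c.2 j + P.α * ((∑ r ∈ Finset.range P.R, P.active c r * (P.pl r * P.B r j)) / P.n j))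

/-- Scaled subgradient descent from `0`. -/
noncomputable def descent : ℕ → (ℕ → ℝ) × (ℕ → ℝ)
  | 0 => (fun _ => 0, fun _ => 0)
  | k + 1 => P.next (descent k)

open Classical in
/-- The weight of the rows whose hinge function is violated at the threshold `θ` up to `γ`, for
given values `u` and `l`. -/
noncomputable def count (u l : ℕ → ℝ) (γ θ : ℝ) : ℝ :=
  ∑ r ∈ Finset.range P.R,
    if P.pu r * (u r - θ) < γ ∧ P.pl r * (l r - θ) < γ then P.w r else 0

end HingeProblem

/-- The memory holds the rows and columns of the hinge problem `P`. -/
structure Holds (P : HingeProblem) (T M N Z : ℕ) (s : Memory) : Prop where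
  hT : s.nat 11 = T
  hM : s.nat 2 = M
  hN : s.nat 5 = N
  hZ : s.nat 6 = Z
  hR : P.R = T + M
  hN' : P.N = N
  cap : T + M + N ≤ s.nat 4
  B : ∀ r < T + M + N, ∀ q < N, s.arr 0 (r * N + q) = P.B r q
  n : ∀ q < N, s.arr 1 q = P.n q
  pu : ∀ r < T + M, s.arr 2 r = P.pu r
  pl : ∀ r < T + M, s.arr 3 r = P.pl r
  a : ∀ r < T + M, s.arr 4 r = P.a r
  w : ∀ r < T + M, s.arr 5 r = P.w r

theorem Holds.frame {P : HingeProblem} {T M N Z : ℕ} {s s' : Memory} {W A : List ℕ}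
    (h : Holds P T M N Z s) (hf : Frame W A s s') (hW : ∀ v ∈ [2, 4, 5, 6, 11], v ∉ W)
    (hA : ∀ k ∈ [0, 1, 2, 3, 4, 5], k ∉ A) : Holds P T M N Z s' where
  hT := by rw [hf.nat 11 (hW _ (by simp)), h.hT]
  hM := by rw [hf.nat 2 (hW _ (by simp)), h.hM]
  hN := by rw [hf.nat 5 (hW _ (by simp)), h.hN]
  hZ := by rw [hf.nat 6 (hW _ (by simp)), h.hZ]
  hR := h.hR
  hN' := h.hN'
  cap := by rw [hf.nat 4 (hW _ (by simp))]; exact h.cap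
  B r hr q hq := by rw [hf.arr 0 (by norm_num) (hA _ (by simp)), h.B r hr q hq]
  n q hq := by rw [hf.arr 1 (by norm_num) (hA _ (by simp)), h.n q hq]
  pu q hq := by rw [hf.arr 2 (by norm_num) (hA _ (by simp)), h.pu q hq]
  pl q hq := by rw [hf.arr 3 (by norm_num) (hA _ (by simp)), h.pl q hq]
  a q hq := by rw [hf.arr 4 (by norm_num) (hA _ (by simp)), h.a q hq]
  w q hq := by rw [hf.arr 5 (by norm_num) (hA _ (by simp)), h.w q hq]

namespace Cmd

variable {d : ℕ} {ω : ℕ → Fin d → ℝ}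

/-- Evaluate both linear functions at the row in cell `22`, and update the sums of the values and
the active weight of that row. -/
def rowCmd : Cmd :=
  seq (sumTo 0 24 (.cell 5) (.mul (.arr 6 (.cell 24)) (vE (.cell 22) (.cell 24)))) <|
  seq (sumTo 1 24 (.cell 5) (.mul (.arr 7 (.cell 24)) (vE (.cell 22) (.cell 24)))) <|
  seq (aset 10 (.cell 22) (.add (.arr 10 (.cell 22)) (.arr 13 (.const 0)))) <|
  seq (aset 11 (.cell 22) (.add (.arr 11 (.cell 22)) (.arr 13 (.const 1)))) <|
  ite (.realLt (.ofNat (.const 0)) (.sub (.sub (.arr 4 (.cell 22))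
      (.mul (.arr 2 (.cell 22)) (.arr 13 (.const 0))))
      (.mul (.arr 3 (.cell 22)) (.arr 13 (.const 1)))))
    (aset 12 (.cell 22) (.arr 5 (.cell 22))) (aset 12 (.cell 22) (.ofNat (.const 0)))

/-- The descent step for the column in cell `22`. -/
def columnCmd : Cmd :=
  seq (sumTo 0 24 (.add (.cell 11) (.cell 2)) (.mul (.arr 12 (.cell 24))
    (.mul (.arr 2 (.cell 24)) (vE (.cell 24) (.cell 22))))) <|
  seq (sumTo 1 24 (.add (.cell 11) (.cell 2)) (.mul (.arr 12 (.cell 24))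
    (.mul (.arr 3 (.cell 24)) (vE (.cell 24) (.cell 22))))) <|
  seq (aset 6 (.cell 22) (.add (.arr 6 (.cell 22))
    (.mul (.div (.ofNat (.const 1)) (.ofNat (.pow (.cell 6) 15)))
      (.div (.arr 13 (.const 0)) (.arr 1 (.cell 22)))))) <|
  aset 7 (.cell 22) (.add (.arr 7 (.cell 22))
    (.mul (.div (.ofNat (.const 1)) (.ofNat (.pow (.cell 6) 15)))
      (.div (.arr 13 (.const 1)) (.arr 1 (.cell 22)))))

/-- The inner loop visits the identity rows as well. They have no hinge function, but the sums of
values gathered there become the monomial coefficients of the averaged iterate. -/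
def descentCmd : Cmd :=
  forTo 20 (.pow (.cell 6) 26) <| seq (forTo 22 rowsE rowCmd) (forTo 22 (.cell 5) columnCmd)

theorem run_rowCmd {P : HingeProblem} {T M N Z r : ℕ} {s : Memory} {c : (ℕ → ℝ) × (ℕ → ℝ)}
    (h : Holds P T M N Z s) (hr : s.nat 22 = r) (hrR : r < T + M + N)
    (h6 : ∀ j < N, s.arr 6 j = c.1 j) (h7 : ∀ j < N, s.arr 7 j = c.2 j) :
    (∀ i, (run ω rowCmd s).arr 10 i = if i = r then s.arr 10 i + P.lin c.1 r else s.arr 10 i) ∧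
    (∀ i, (run ω rowCmd s).arr 11 i = if i = r then s.arr 11 i + P.lin c.2 r else s.arr 11 i) ∧
    (r < T + M → (run ω rowCmd s).arr 12 r = P.active c r) ∧
    ∀ i ≠ r, (run ω rowCmd s).arr 12 i = s.arr 12 i := by
  have hcap := h.cap
  obtain ⟨ha, -, hf1⟩ := run_sumTo (ω := ω) (q := 0) (v := 24) (e := .cell 5)
    (E := .mul (.arr 6 (.cell 24)) (vE (.cell 22) (.cell 24))) (s := s) (n := N)
    (fun j => c.1 j * P.B r j) (by norm_num)
    (fun s' h' => by rw [NExp.eval_cell, h'.nat _ (by simp), h.hN])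
    (by omega) (fun k hk s' hvk hf _ => by
      simp only [vE, RExp.eval_mul, RExp.eval_arr, NExp.eval_add, NExp.eval_mul, NExp.eval_cell,
        hvk, hf.nat 5 (by simp), hf.nat 22 (by simp), h.hN, hr,
        hf.arr 0 (by norm_num) (by simp), hf.arr 6 (by norm_num) (by simp)]
      rw [h.B r hrR k hk, h6 k hk])
  rw [rowCmd]
  simp only [run_seq]
  set s1 := run ω (sumTo 0 24 (.cell 5) (.mul (.arr 6 (.cell 24)) (vE (.cell 22) (.cell 24)))) s
  obtain ⟨hb, hb', hf2⟩ := run_sumTo (ω := ω) (q := 1) (v := 24) (e := .cell 5)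
    (E := .mul (.arr 7 (.cell 24)) (vE (.cell 22) (.cell 24))) (s := s1) (n := N)
    (fun j => c.2 j * P.B r j) (by norm_num)
    (fun s' h' => by rw [NExp.eval_cell, h'.nat _ (by simp), hf1.nat _ (by simp), h.hN])
    (by rw [hf1.nat 4 (by simp)]; omega) (fun k hk s' hvk hf' _ => by
      have hf := hf1.trans (by simp) hf'
      simp only [vE, RExp.eval_mul, RExp.eval_arr, NExp.eval_add, NExp.eval_mul, NExp.eval_cell,
        hvk, hf.nat 5 (by simp), hf.nat 22 (by simp), h.hN, hr,
        hf.arr 0 (by norm_num) (by simp), hf.arr 7 (by norm_num) (by simp)]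
      rw [h.B r hrR k hk, h7 k hk])
  set s2 := run ω (sumTo 1 24 (.cell 5) (.mul (.arr 7 (.cell 24)) (vE (.cell 22) (.cell 24)))) s1
  have hf := hf1.trans (by simp) hf2
  have e0 : s2.arr 13 0 = P.lin c.1 r := by
    rw [hb' 0 (by norm_num), ha, HingeProblem.lin, h.hN']
  have e1 : s2.arr 13 1 = P.lin c.2 r := by rw [hb, HingeProblem.lin, h.hN']
  have e22 : s2.nat 22 = r := by rw [hf.nat 22 (by simp), hr]
  rw [run_ite]
  simp only [run_aset, BExp.holds_realLt, RExp.eval_sub, RExp.eval_mul, RExp.eval_add,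
    RExp.eval_arr, RExp.eval_ofNat, NExp.eval_cell, NExp.eval_const, Memory.setA_nat, e22,
    Memory.setA_arr _ _ _ _ (show 10 < 16 by norm_num) (show 11 < 16 by norm_num),
    Memory.setA_arr _ _ _ _ (show 11 < 16 by norm_num) (show 2 < 16 by norm_num),
    Memory.setA_arr _ _ _ _ (show 10 < 16 by norm_num) (show 2 < 16 by norm_num),
    Memory.setA_arr _ _ _ _ (show 11 < 16 by norm_num) (show 3 < 16 by norm_num),
    Memory.setA_arr _ _ _ _ (show 10 < 16 by norm_num) (show 3 < 16 by norm_num),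
    Memory.setA_arr _ _ _ _ (show 11 < 16 by norm_num) (show 4 < 16 by norm_num),
    Memory.setA_arr _ _ _ _ (show 10 < 16 by norm_num) (show 4 < 16 by norm_num),
    Memory.setA_arr _ _ _ _ (show 11 < 16 by norm_num) (show 5 < 16 by norm_num),
    Memory.setA_arr _ _ _ _ (show 10 < 16 by norm_num) (show 5 < 16 by norm_num),
    Memory.setA_arr _ _ _ _ (show 11 < 16 by norm_num) (show 13 < 16 by norm_num),
    Memory.setA_arr _ _ _ _ (show 10 < 16 by norm_num) (show 13 < 16 by norm_num)]
  norm_num only [false_and, if_false, Nat.cast_zero]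
  simp only [e0, e1, hf.arr 2 (by norm_num) (by simp), hf.arr 3 (by norm_num) (by simp),
    hf.arr 4 (by norm_num) (by simp), hf.arr 5 (by norm_num) (by simp)]
  refine ⟨fun i => ?_, fun i => ?_, fun hrTM => ?_, fun i hi => ?_⟩
  · have : ∀ x, (Memory.setA ((s2.setA 10 r (s2.arr 10 r + P.lin c.1 r)).setA 11 r
        (s2.arr 11 r + P.lin c.2 r)) 12 r x).arr 10 i =
        if i = r then s.arr 10 i + P.lin c.1 r else s.arr 10 i := fun x => by
      rw [Memory.setA_arr _ _ _ _ (by norm_num) (by norm_num), if_neg (by norm_num),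
        Memory.setA_arr _ _ _ _ (by norm_num) (by norm_num), if_neg (by norm_num),
        Memory.setA_arr _ _ _ _ (by norm_num) (by norm_num), hf.arr 10 (by norm_num) (by simp),
        hf.arr 10 (by norm_num) (by simp)]
      simp only [true_and]
      split_ifs with h
      · rw [h]
      · rfl
    generalize (if i = r then _ else _ : ℝ) = y at this ⊢
    split_ifs <;> exact this _
  · have : ∀ x, (Memory.setA ((s2.setA 10 r (s2.arr 10 r + P.lin c.1 r)).setA 11 r
        (s2.arr 11 r + P.lin c.2 r)) 12 r x).arr 11 i =
        if i = r then s.arr 11 i + P.lin c.2 r else s.arr 11 i := fun x => by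
      rw [Memory.setA_arr _ _ _ _ (by norm_num) (by norm_num), if_neg (by norm_num),
        Memory.setA_arr _ _ _ _ (by norm_num) (by norm_num),
        Memory.setA_arr _ _ _ _ (by norm_num) (by norm_num), hf.arr 11 (by norm_num) (by simp),
        hf.arr 11 (by norm_num) (by simp)]
      norm_num only [true_and, false_and, if_false]
      split_ifs with h
      · rw [h]
      · rfl
    generalize (if i = r then _ else _ : ℝ) = y at this ⊢
    split_ifs <;> exact this _
  · rw [HingeProblem.active, h.a r hrTM, h.pu r hrTM, h.pl r hrTM, h.w r hrTM]
    split_ifs <;> rw [Memory.setA_arr _ _ _ _ (by norm_num) (by norm_num), if_pos ⟨rfl, rfl⟩]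
  · split_ifs <;> rw [Memory.setA_arr _ _ _ _ (by norm_num) (by norm_num), if_neg (by simp [hi]),
      Memory.setA_arr _ _ _ _ (by norm_num) (by norm_num), if_neg (by norm_num),
      Memory.setA_arr _ _ _ _ (by norm_num) (by norm_num), if_neg (by norm_num),
      hf.arr 12 (by norm_num) (by simp)]

end Cmd

namespace Cmd

variable {d : ℕ} {ω : ℕ → Fin d → ℝ}

/-- The active weights in array `12` come from the preceding sweep over the rows, so updating the
columns one after the other still gives a simultaneous subgradient step. -/
theorem run_columnCmd {P : HingeProblem} {T M N Z j : ℕ} {s : Memory} {c : (ℕ → ℝ) × (ℕ → ℝ)}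
    (h : Holds P T M N Z s) (hα : P.α = 1 / (Z : ℝ) ^ 15) (hj : s.nat 22 = j) (hjN : j < N)
    (h6 : s.arr 6 j = c.1 j) (h7 : s.arr 7 j = c.2 j)
    (h12 : ∀ r < T + M, s.arr 12 r = P.active c r) :
    (∀ i, (run ω columnCmd s).arr 6 i = if i = j then (P.next c).1 j else s.arr 6 i) ∧
    (∀ i, (run ω columnCmd s).arr 7 i = if i = j then (P.next c).2 j else s.arr 7 i) := by
  have hcap := h.cap
  obtain ⟨ha, -, hf1⟩ := run_sumTo (ω := ω) (q := 0) (v := 24) (e := .add (.cell 11) (.cell 2))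
    (E := .mul (.arr 12 (.cell 24)) (.mul (.arr 2 (.cell 24)) (vE (.cell 24) (.cell 22))))
    (s := s) (n := T + M) (fun r => P.active c r * (P.pu r * P.B r j)) (by norm_num)
    (fun s' h' => by simp [h'.nat 11 (by simp), h'.nat 2 (by simp), h.hT, h.hM])
    (by omega) (fun k hk s' hvk hf _ => by
      simp only [vE, RExp.eval_mul, RExp.eval_arr, NExp.eval_add, NExp.eval_mul, NExp.eval_cell,
        hvk, hf.nat 5 (by simp), hf.nat 22 (by simp), h.hN, hj, hf.arr 12 (by norm_num) (by simp),
        hf.arr 0 (by norm_num) (by simp), hf.arr 2 (by norm_num) (by simp)]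
      rw [h.B k (by omega) j hjN, h12 k hk, h.pu k hk])
  rw [columnCmd]
  simp only [run_seq]
  set s1 := run ω (sumTo 0 24 (.add (.cell 11) (.cell 2)) (.mul (.arr 12 (.cell 24))
    (.mul (.arr 2 (.cell 24)) (vE (.cell 24) (.cell 22))))) s
  obtain ⟨hb, hb', hf2⟩ := run_sumTo (ω := ω) (q := 1) (v := 24) (e := .add (.cell 11) (.cell 2))
    (E := .mul (.arr 12 (.cell 24)) (.mul (.arr 3 (.cell 24)) (vE (.cell 24) (.cell 22))))
    (s := s1) (n := T + M) (fun r => P.active c r * (P.pl r * P.B r j)) (by norm_num)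
    (fun s' h' => by
      simp [h'.nat 11 (by simp), h'.nat 2 (by simp), hf1.nat 11 (by simp), hf1.nat 2 (by simp),
        h.hT, h.hM])
    (by rw [hf1.nat 4 (by simp)]; omega) (fun k hk s' hvk hf' _ => by
      have hf := hf1.trans (by simp) hf'
      simp only [vE, RExp.eval_mul, RExp.eval_arr, NExp.eval_add, NExp.eval_mul, NExp.eval_cell,
        hvk, hf.nat 5 (by simp), hf.nat 22 (by simp), h.hN, hj, hf.arr 12 (by norm_num) (by simp),
        hf.arr 0 (by norm_num) (by simp), hf.arr 3 (by norm_num) (by simp)]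
      rw [h.B k (by omega) j hjN, h12 k hk, h.pl k hk])
  set s2 := run ω (sumTo 1 24 (.add (.cell 11) (.cell 2)) (.mul (.arr 12 (.cell 24))
    (.mul (.arr 3 (.cell 24)) (vE (.cell 24) (.cell 22))))) s1
  have hf := hf1.trans (by simp) hf2
  have e0 : s2.arr 13 0 = ∑ r ∈ Finset.range P.R, P.active c r * (P.pu r * P.B r j) := by
    rw [hb' 0 (by norm_num), ha, h.hR]
  have e1 : s2.arr 13 1 = ∑ r ∈ Finset.range P.R, P.active c r * (P.pl r * P.B r j) := by
    rw [hb, h.hR]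
  have e22 : s2.nat 22 = j := by rw [hf.nat 22 (by simp), hj]
  have e6 : s2.nat 6 = Z := by rw [hf.nat 6 (by simp), h.hZ]
  simp only [run_aset, RExp.eval_mul, RExp.eval_add, RExp.eval_div,
    RExp.eval_arr, RExp.eval_ofNat, NExp.eval_cell, NExp.eval_const, NExp.eval_pow,
    Memory.setA_nat, e22, e6,
    Memory.setA_arr _ _ _ _ (show 6 < 16 by norm_num) (show 6 < 16 by norm_num),
    Memory.setA_arr _ _ _ _ (show 7 < 16 by norm_num) (show 7 < 16 by norm_num),
    Memory.setA_arr _ _ _ _ (show 6 < 16 by norm_num) (show 7 < 16 by norm_num),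
    Memory.setA_arr _ _ _ _ (show 7 < 16 by norm_num) (show 6 < 16 by norm_num),
    Memory.setA_arr _ _ _ _ (show 6 < 16 by norm_num) (show 1 < 16 by norm_num),
    Memory.setA_arr _ _ _ _ (show 6 < 16 by norm_num) (show 13 < 16 by norm_num)]
  norm_num only [false_and, if_false, Nat.cast_one, Nat.cast_pow, true_and]
  simp only [e0, e1, hf.arr 6 (by norm_num) (by simp), hf.arr 7 (by norm_num) (by simp),
    hf.arr 1 (by norm_num) (by simp), h6, h7, h.n j hjN, HingeProblem.next, hα]
  exact ⟨fun _ => by norm_num, fun _ => by norm_num⟩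

/-- Arrays `10` and `11` gather the values before each update, hence the sums run over the iterates
`0, …, Z ^ 26 - 1`, starting with the zero vector. -/
theorem run_descentCmd {P : HingeProblem} {T M N Z : ℕ} {s : Memory}
    (h : Holds P T M N Z s) (hα : P.α = 1 / (Z : ℝ) ^ 15) (hcap : Z ^ 26 ≤ s.nat 4)
    (h6 : ∀ j < N, s.arr 6 j = 0) (h7 : ∀ j < N, s.arr 7 j = 0)
    (h10 : ∀ r < T + M + N, s.arr 10 r = 0) (h11 : ∀ r < T + M + N, s.arr 11 r = 0) :
    (∀ r < T + M + N, (run ω descentCmd s).arr 10 r =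
      ∑ k ∈ Finset.range (Z ^ 26), P.lin (P.descent k).1 r) ∧
    (∀ r < T + M + N, (run ω descentCmd s).arr 11 r =
      ∑ k ∈ Finset.range (Z ^ 26), P.lin (P.descent k).2 r) := by
  have key := run_forTo_inv_frame (ω := ω) (v := 20) (e := .pow (.cell 6) 26) (s := s)
    (p := seq (forTo 22 rowsE rowCmd) (forTo 22 (.cell 5) columnCmd)) (n := Z ^ 26)
    (fun m s' => ((∀ j < N, s'.arr 6 j = (P.descent m).1 j) ∧
      (∀ j < N, s'.arr 7 j = (P.descent m).2 j)) ∧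
      (∀ r < T + M + N, s'.arr 10 r = ∑ k ∈ Finset.range m, P.lin (P.descent k).1 r) ∧
      (∀ r < T + M + N, s'.arr 11 r = ∑ k ∈ Finset.range m, P.lin (P.descent k).2 r))
    (by decide) (by decide) (by simp [h.hZ]) hcap
    ⟨⟨h6, h7⟩, fun r hr => by rw [Finset.range_zero, Finset.sum_empty]; exact h10 r hr,
      fun r hr => by rw [Finset.range_zero, Finset.sum_empty]; exact h11 r hr⟩ ?_
  · exact key.2
  rintro m hm s1 hm1 hf1 ⟨⟨h6, h7⟩, h10, h11⟩
  have hP1 := h.frame hf1 (by decide) (by decide)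
  rw [run_seq]
  set c := P.descent m with hc
  have hrows := run_forTo_inv_frame (ω := ω) (v := 22) (e := rowsE) (s := s1) (p := rowCmd)
    (n := T + M + N) (fun m s' =>
      (∀ i, s'.arr 10 i = if i < m then s1.arr 10 i + P.lin c.1 i else s1.arr 10 i) ∧
      (∀ i, s'.arr 11 i = if i < m then s1.arr 11 i + P.lin c.2 i else s1.arr 11 i) ∧
      ∀ r < m, r < T + M → s'.arr 12 r = P.active c r)
    (by decide) (by decide) (by simp [rowsE, hP1.hT, hP1.hM, hP1.hN]) hP1.cap
    ⟨fun i => rfl, fun i => rfl, fun r hr => by omega⟩ (by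
      rintro r hr s2 hr2 hf2 ⟨i10, i11, i12⟩
      have hP2 := hP1.frame hf2 (by decide) (by decide)
      obtain ⟨a10, a11, a12, a12'⟩ := run_rowCmd (ω := ω) hP2 hr2 hr (c := c)
        (fun j hj => by rw [hf2.arr 6 (by norm_num) (by decide), h6 j hj])
        (fun j hj => by rw [hf2.arr 7 (by norm_num) (by decide), h7 j hj])
      simp only [Memory.setN_arr _ _ (show 22 ≠ 3 by norm_num)]
      refine ⟨fun i => ?_, fun i => ?_, fun r' hr' hr'' => ?_⟩
      · rw [a10, i10]; split_ifs <;> first | rfl | omega | (subst_vars; rfl)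
      · rw [a11, i11]; split_ifs <;> first | rfl | omega | (subst_vars; rfl)
      · rcases Nat.lt_succ_iff_lt_or_eq.1 hr' with h' | h'
        · rw [a12' r' (by omega), i12 r' h' hr'']
        · rw [h', a12 (by omega)])
  have hf2 := run_frame (ω := ω) (p := forTo 22 rowsE rowCmd) (by decide) (by decide) s1
  set s2 := run ω (forTo 22 rowsE rowCmd) s1
  obtain ⟨b10, b11, b12⟩ := hrows
  have hP2 := hP1.frame hf2 (by decide) (by decide)
  have hf3 := run_frame (ω := ω) (p := forTo 22 (.cell 5) columnCmd) (by decide) (by decide) s2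
  have hcols := run_forTo_inv_frame (ω := ω) (v := 22) (e := .cell 5) (s := s2) (p := columnCmd)
    (n := N) (fun m s' =>
      (∀ i, s'.arr 6 i = if i < m then (P.next c).1 i else s2.arr 6 i) ∧
      (∀ i, s'.arr 7 i = if i < m then (P.next c).2 i else s2.arr 7 i))
    (by decide) (by decide) hP2.hN (by have := hP2.cap; omega)
    ⟨fun i => rfl, fun i => rfl⟩ (by
      rintro j hj s3 hj3 hf4 ⟨i6, i7⟩
      have hP3 := hP2.frame hf4 (by decide) (by decide)
      obtain ⟨a6, a7⟩ := run_columnCmd (ω := ω) hP3 hα hj3 hj (c := c)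
        (by rw [i6, if_neg (lt_irrefl j), hf2.arr 6 (by norm_num) (by decide), h6 j hj])
        (by rw [i7, if_neg (lt_irrefl j), hf2.arr 7 (by norm_num) (by decide), h7 j hj])
        (fun r hr => by
          rw [hf4.arr 12 (by norm_num) (by decide), b12 r (by omega) hr])
      simp only [Memory.setN_arr _ _ (show 22 ≠ 3 by norm_num)]
      refine ⟨fun i => ?_, fun i => ?_⟩
      · rw [a6, i6]; split_ifs <;> first | rfl | omega | (subst_vars; rfl)
      · rw [a7, i7]; split_ifs <;> first | rfl | omega | (subst_vars; rfl))
  obtain ⟨c6, c7⟩ := hcols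
  simp only [Memory.setN_arr _ _ (show 20 ≠ 3 by norm_num)]
  refine ⟨⟨fun j hj => by rw [c6, if_pos hj]; rfl, fun j hj => by rw [c7, if_pos hj]; rfl⟩,
    fun r hr => ?_, fun r hr => ?_⟩
  · rw [hf3.arr 10 (by norm_num) (by decide), b10, if_pos hr, h10 r hr, Finset.sum_range_succ]
  · rw [hf3.arr 11 (by norm_num) (by decide), b11, if_pos hr, h11 r hr, Finset.sum_range_succ]

/-! ### The choice of the threshold -/

/-- The condition of `HingeProblem.count` at the row in cell `22` and the threshold in entry `2` of
the array `14`. -/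
def countB : BExp :=
  .and (.realLt (.mul (.arr 2 (.cell 22)) (.sub (.div (.arr 10 (.cell 22))
      (.ofNat (.pow (.cell 6) 26))) (.arr 14 (.const 2))))
      (.div (.ofNat (.const 1)) (.ofNat (.pow (.cell 6) 3))))
    (.realLt (.mul (.arr 3 (.cell 22)) (.sub (.div (.arr 11 (.cell 22))
      (.ofNat (.pow (.cell 6) 26))) (.arr 14 (.const 2))))
      (.div (.ofNat (.const 1)) (.ofNat (.pow (.cell 6) 3))))

def countCmd : Cmd :=
  seq (aset 13 (.const 0) (.ofNat (.const 0))) <|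
  forTo 22 (.add (.cell 11) (.cell 2)) <|
    ite countB (aset 13 (.const 0) (.add (.arr 13 (.const 0)) (.arr 5 (.cell 22))))
      (nset 18 (.const 0))

/-- Try all thresholds of a grid; the best weight is entry `0` of the array `14`, and the best
threshold is entry `1`. -/
def thresholdCmd : Cmd :=
  seq (aset 14 (.const 0) (.ofNat (.const 3))) <|
  seq (aset 14 (.const 1) (.ofNat (.const 0))) <|
  forTo 20 (.pow (.cell 6) 3) <|
    seq (aset 14 (.const 2) (.sub (.div (.ofNat (.mul (.const 2) (.cell 20)))
      (.ofNat (.pow (.cell 6) 3))) (.ofNat (.const 1)))) <|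
    seq countCmd <|
    ite (.realLt (.arr 13 (.const 0)) (.arr 14 (.const 0)))
      (seq (aset 14 (.const 0) (.arr 13 (.const 0))) (aset 14 (.const 1) (.arr 14 (.const 2))))
      (nset 18 (.const 0))

theorem run_countCmd {P : HingeProblem} {T M N Z : ℕ} {s : Memory} {u l : ℕ → ℝ} {θ : ℝ}
    (h : Holds P T M N Z s) (h10 : ∀ r < T + M, s.arr 10 r / (Z : ℝ) ^ 26 = u r)
    (h11 : ∀ r < T + M, s.arr 11 r / (Z : ℝ) ^ 26 = l r) (hθ : s.arr 14 2 = θ) :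
    (run ω countCmd s).arr 13 0 = P.count u l (1 / (Z : ℝ) ^ 3) θ := by
  have hcap := h.cap
  rw [countCmd, run_seq, HingeProblem.count, h.hR]
  have hf1 := run_frame (ω := ω) (p := aset 13 (.const 0) (.ofNat (.const 0))) trivial
    (by decide) s
  have e0 : (run ω (aset 13 (.const 0) (.ofNat (.const 0))) s).arr 13 0 = 0 := by
    simp [Memory.setA_arr]
  set s1 := run ω (aset 13 (.const 0) (.ofNat (.const 0))) s
  have hP1 := h.frame hf1 (by decide) (by decide)
  refine run_forTo_inv_frame (ω := ω) (fun m s' => s'.arr 13 0 = ∑ r ∈ Finset.range m,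
    if P.pu r * (u r - θ) < 1 / (Z : ℝ) ^ 3 ∧ P.pl r * (l r - θ) < 1 / (Z : ℝ) ^ 3 then P.w r
      else 0) (by decide) (by decide) (by simp [hP1.hT, hP1.hM]) (by have := hP1.cap; omega)
    (by rw [Finset.range_zero, Finset.sum_empty]; exact e0) ?_
  intro r hr s2 hr2 hf2 hI
  have hP2 := hP1.frame hf2 (by decide) (by decide)
  have hb : countB.holds s2 ↔
      (P.pu r * (u r - θ) < 1 / (Z : ℝ) ^ 3 ∧ P.pl r * (l r - θ) < 1 / (Z : ℝ) ^ 3) := by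
    simp only [countB, BExp.holds_and, BExp.holds_realLt, RExp.eval_mul, RExp.eval_sub,
      RExp.eval_div, RExp.eval_arr, RExp.eval_ofNat, NExp.eval_cell, NExp.eval_const,
      NExp.eval_pow, hr2, hP2.hZ, hP2.pu r hr, hP2.pl r hr, hf2.arr 10 (by norm_num) (by decide),
      hf2.arr 11 (by norm_num) (by decide), hf2.arr 14 (by norm_num) (by decide),
      hf1.arr 10 (by norm_num) (by decide),
      hf1.arr 11 (by norm_num) (by decide), hf1.arr 14 (by norm_num) (by decide), hθ,
      Nat.cast_pow, Nat.cast_one, h10 r hr, h11 r hr]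
  rw [Memory.setN_arr _ _ (by norm_num), run_ite, Finset.sum_range_succ, ← hI]
  by_cases hc : P.pu r * (u r - θ) < 1 / (Z : ℝ) ^ 3 ∧ P.pl r * (l r - θ) < 1 / (Z : ℝ) ^ 3
  · rw [if_pos (hb.2 hc), if_pos hc, run_aset, Memory.setA_arr _ _ _ _ (by norm_num) (by norm_num),
      if_pos ⟨rfl, rfl⟩]
    simp [hr2, hP2.w r hr]
  · rw [if_neg (fun h' => hc (hb.1 h')), if_neg hc, run_nset,
      Memory.setN_arr _ _ (by norm_num), add_zero]

/-- The running minimum starts at `3`, a stand-in for infinity: the total weight of the rows will be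
at most `2`, which later excludes the first alternative. -/
theorem run_thresholdCmd {P : HingeProblem} {T M N Z : ℕ} {s : Memory} {u l : ℕ → ℝ}
    (h : Holds P T M N Z s) (hcap : Z ^ 3 ≤ s.nat 4)
    (h10 : ∀ r < T + M, s.arr 10 r / (Z : ℝ) ^ 26 = u r)
    (h11 : ∀ r < T + M, s.arr 11 r / (Z : ℝ) ^ 26 = l r) :
    ∃ b : ℝ, (∀ g < Z ^ 3, b ≤ P.count u l (1 / (Z : ℝ) ^ 3) (2 * g / (Z : ℝ) ^ 3 - 1)) ∧
      (b = 3 ∧ (run ω thresholdCmd s).arr 14 1 = 0 ∨ ∃ g < Z ^ 3,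
        (run ω thresholdCmd s).arr 14 1 = 2 * g / (Z : ℝ) ^ 3 - 1 ∧
        b = P.count u l (1 / (Z : ℝ) ^ 3) (2 * g / (Z : ℝ) ^ 3 - 1)) := by
  rw [thresholdCmd, run_seq, run_seq]
  set p0 : Cmd := aset 14 (.const 0) (.ofNat (.const 3)) with hp0
  set p1 : Cmd := aset 14 (.const 1) (.ofNat (.const 0)) with hp1
  have hf1 : Frame [] [14] s (run ω p1 (run ω p0 s)) :=
    (run_frame (ω := ω) (p := p0) trivial (by decide) s).trans (by decide)
      (run_frame (ω := ω) (p := p1) trivial (by decide) _)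
  have e0 : (run ω p1 (run ω p0 s)).arr 14 0 = 3 := by simp [hp0, hp1, Memory.setA_arr]
  have e1 : (run ω p1 (run ω p0 s)).arr 14 1 = 0 := by simp [hp0, hp1, Memory.setA_arr]
  set s1 := run ω p1 (run ω p0 s)
  have hP1 := h.frame hf1 (by decide) (by decide)
  refine ⟨_, run_forTo_inv_frame (ω := ω) (n := Z ^ 3) (fun m s' =>
    (∀ g < m, s'.arr 14 0 ≤ P.count u l (1 / (Z : ℝ) ^ 3) (2 * g / (Z : ℝ) ^ 3 - 1)) ∧
      (s'.arr 14 0 = 3 ∧ s'.arr 14 1 = 0 ∨ ∃ g < Z ^ 3,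
        s'.arr 14 1 = 2 * g / (Z : ℝ) ^ 3 - 1 ∧
        s'.arr 14 0 = P.count u l (1 / (Z : ℝ) ^ 3) (2 * g / (Z : ℝ) ^ 3 - 1)))
    (by decide) (by decide) (by simp [hP1.hZ]) (by rw [hf1.nat 4 (by simp)]; exact hcap)
    ⟨fun g hg => by omega, .inl ⟨e0, e1⟩⟩ ?_⟩
  rintro g hg s2 hg2 hf2 ⟨hI, hI'⟩
  have hP2 := hP1.frame hf2 (by decide) (by decide)
  rw [run_seq, run_seq]
  set p2 : Cmd := (aset 14 (.const 2) (.sub (.div (.ofNat (.mul (.const 2) (.cell 20)))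
      (.ofNat (.pow (.cell 6) 3))) (.ofNat (.const 1)))) with hp2
  have hf3 : Frame [] [14] s2 (run ω p2 s2) := run_frame (ω := ω) (p := p2) trivial (by decide) s2
  have a2 : (run ω p2 s2).arr 14 2 = 2 * g / (Z : ℝ) ^ 3 - 1 := by
    simp [hp2, Memory.setA_arr, hg2, hP2.hZ]
  have a0 : (run ω p2 s2).arr 14 0 = s2.arr 14 0 := by simp [hp2, Memory.setA_arr]
  have a1 : (run ω p2 s2).arr 14 1 = s2.arr 14 1 := by simp [hp2, Memory.setA_arr]
  set s3 := run ω p2 s2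
  have hP3 := hP2.frame hf3 (by decide) (by decide)
  have hcnt := run_countCmd (ω := ω) hP3 (u := u) (l := l) (fun r hr => by
    rw [hf3.arr 10 (by norm_num) (by decide), hf2.arr 10 (by norm_num) (by decide),
      hf1.arr 10 (by norm_num) (by decide), h10 r hr]) (fun r hr => by
    rw [hf3.arr 11 (by norm_num) (by decide), hf2.arr 11 (by norm_num) (by decide),
      hf1.arr 11 (by norm_num) (by decide), h11 r hr]) a2
  have hf4 := run_frame (ω := ω) (p := countCmd) (by decide) (by decide) s3
  set s4 := run ω countCmd s3
  have b : ∀ i, s4.arr 14 i = s3.arr 14 i := hf4.arr 14 (by norm_num) (by decide)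
  set q := P.count u l (1 / (Z : ℝ) ^ 3) (2 * g / (Z : ℝ) ^ 3 - 1) with hq
  rw [Memory.setN_arr _ _ (by norm_num), Memory.setN_arr _ _ (by norm_num), run_ite]
  by_cases hlt : q < s2.arr 14 0
  · rw [if_pos (by simpa [hcnt, b, a0] using hlt)]
    have c0 : (run ω (seq (aset 14 (.const 0) (.arr 13 (.const 0)))
        (aset 14 (.const 1) (.arr 14 (.const 2)))) s4).arr 14 0 = q := by
      simp [Memory.setA_arr, hcnt]
    have c1 : (run ω (seq (aset 14 (.const 0) (.arr 13 (.const 0)))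
        (aset 14 (.const 1) (.arr 14 (.const 2)))) s4).arr 14 1 = 2 * g / (Z : ℝ) ^ 3 - 1 := by
      simp [Memory.setA_arr, b, a2]
    rw [c0, c1]
    refine ⟨fun g' hg' => ?_, .inr ⟨g, hg, rfl, rfl⟩⟩
    rcases Nat.lt_succ_iff_lt_or_eq.1 hg' with h' | h'
    · exact hlt.le.trans (hI g' h')
    · rw [h']
  · rw [if_neg (by simpa [hcnt, b, a0] using hlt), run_nset, Memory.setN_arr _ _ (by norm_num),
      Memory.setN_arr _ _ (by norm_num), b, b, a0, a1]
    refine ⟨fun g' hg' => ?_, hI'⟩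
    rcases Nat.lt_succ_iff_lt_or_eq.1 hg' with h' | h'
    · exact hI g' h'
    · rw [h']; exact not_lt.1 hlt

end Cmd

/-! ### Monomials -/

/-- The coordinates of the point `(1, x)`. -/
def homCoord (x : ℕ → ℝ) : ℕ → ℝ
  | 0 => 1
  | c + 1 => x c

/-- The monomial of degree at most `k` in `d` variables with the number `q < (d + 1) ^ k`. -/
def mono (d : ℕ) (x : ℕ → ℝ) : ℕ → ℕ → ℝ
  | 0, _ => 1
  | k + 1, q => mono d x k (q % (d + 1) ^ k) * homCoord x (q / (d + 1) ^ k)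

/-- The digits of `q` in base `d + 1` list the factors of the monomial and the digit `0` stands for
the factor `1`, so the table for degree `k` is an initial segment of the table for degree `k + 1`.
-/
theorem mono_succ_of_lt {d : ℕ} (x : ℕ → ℝ) {k q : ℕ} (hq : q < (d + 1) ^ k) :
    mono d x (k + 1) q = mono d x k q := by
  rw [mono, Nat.mod_eq_of_lt hq, Nat.div_eq_of_lt hq, homCoord, mul_one]

/-- A new leading digit `c + 1` multiplies by the coordinate `x c`; `monoCmd` fills its table by
this rule. -/
theorem mono_succ_add {d : ℕ} (x : ℕ → ℝ) {k q : ℕ} (c : ℕ) (hq : q < (d + 1) ^ k) :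
    mono d x (k + 1) ((c + 1) * (d + 1) ^ k + q) = mono d x k q * x c := by
  have h0 : 0 < (d + 1) ^ k := Nat.pos_of_ne_zero (by positivity)
  rw [mono, Nat.add_comm, Nat.add_mul_mod_self_right, Nat.mod_eq_of_lt hq,
    Nat.add_mul_div_right _ _ h0, Nat.div_eq_of_lt hq, Nat.zero_add, homCoord]

/-- `finFunctionFinEquiv` reads a function as a number in base `d + 1` with `σ 0` as the lowest
digit, which is the numbering of `mono`. The required output format is therefore the order of the
columns. -/
theorem mono_finFunctionFinEquiv {d : ℕ} (x : ℕ → ℝ) (ℓ : ℕ) (σ : Fin ℓ → Fin (d + 1)) :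
    mono d x ℓ (finFunctionFinEquiv σ) = ∏ j, homCoord x (σ j) := by
  induction ℓ with
  | zero => simp [mono]
  | succ k ih =>
    have h : (finFunctionFinEquiv σ : ℕ) = (σ (Fin.last k) : ℕ) * (d + 1) ^ k +
        finFunctionFinEquiv (fun j : Fin k => σ j.castSucc) := by
      rw [finFunctionFinEquiv_apply, finFunctionFinEquiv_apply, Fin.sum_univ_castSucc, add_comm]
      simp
    have hlt := (finFunctionFinEquiv (fun j : Fin k => σ j.castSucc)).2
    have h0 : 0 < (d + 1) ^ k := Nat.pos_of_ne_zero (by positivity)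
    rw [mono, h, Nat.add_comm, Nat.add_mul_mod_self_right, Nat.mod_eq_of_lt hlt,
      Nat.add_mul_div_right _ _ h0, Nat.div_eq_of_lt hlt, Nat.zero_add, ih, Fin.prod_univ_castSucc]

theorem Memory.storePoint_arr {d : ℕ} (s : Memory) {a : ℕ} (x : Fin d → ℝ)
    (ha : a + d ≤ s.nat 3) (k i : ℕ) : (s.storePoint a x).arr k i = s.arr k i := by
  simp only [Memory.arr, Memory.storePoint]
  rw [dif_neg (by omega)]

namespace Cmd

variable {d : ℕ} {ω : ℕ → Fin d → ℝ}

/-- Write the monomials of the point at the address in cell `14` into the row in cell `20`. -/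
def monoCmd : Cmd :=
  seq (aset 0 (.add (.mul (.cell 20) (.cell 5)) (.const 0)) (.ofNat (.const 1))) <|
  seq (nset 13 (.const 1)) <|
  forTo 22 (.cell 1) <|
    seq (forTo 24 (.cell 0) <| forTo 26 (.cell 13) <|
      aset 0 (.add (.mul (.cell 20) (.cell 5))
        (.add (.mul (.add (.cell 24) (.const 1)) (.cell 13)) (.cell 26)))
        (.mul (vE (.cell 20) (.cell 26)) (.get (.add (.cell 14) (.cell 24))))) <|
    nset 13 (.mul (.cell 13) (.add (.cell 0) (.const 1)))

/-- The row is grown in place: cell `13` holds the current length `(d + 1) ^ k`, and block `c + 1`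
is the initial block times `x c`. Since the initial block is only read, one row suffices. -/
theorem run_monoCmd {D ℓ N r a : ℕ} {s : Memory} {x : ℕ → ℝ}
    (h0 : s.nat 0 = D) (h1 : s.nat 1 = ℓ) (h5 : s.nat 5 = N) (hN : N = (D + 1) ^ ℓ)
    (h20 : s.nat 20 = r) (h14 : s.nat 14 = a) (ha : a + D ≤ s.nat 3)
    (hx : ∀ c < D, s.real (a + c) = x c) (hcap : N + ℓ + D ≤ s.nat 4) :
    (∀ q < N, (run ω monoCmd s).arr 0 (r * N + q) = mono D x ℓ q) ∧
    ∀ i, (∀ q < N, i ≠ r * N + q) → (run ω monoCmd s).arr 0 i = s.arr 0 i := by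
  have hNpos : 0 < N := hN ▸ Nat.pos_of_ne_zero (by positivity)
  rw [monoCmd, run_seq, run_seq]
  set A : Cmd := aset 0 (.add (.mul (.cell 20) (.cell 5)) (.const 0)) (.ofNat (.const 1)) with hA
  have hf1 : Frame [13] [0] s (run ω (nset 13 (.const 1)) (run ω A s)) :=
    ((run_frame (ω := ω) (p := A) trivial (by decide) s).mono (by simp [hA, natW])
      (by simp [hA, arrW])).trans (by decide)
      ((run_frame (ω := ω) (p := nset 13 (.const 1)) (by decide) (by decide) _).mono
        (by simp [natW]) (by simp [arrW]))
  have e0 : ∀ i, (run ω (nset 13 (.const 1)) (run ω A s)).arr 0 i =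
      if i = r * N then 1 else s.arr 0 i := fun i => by
    simp [hA, Memory.setN_arr, Memory.setA_arr, h20, h5]
  have e13 : (run ω (nset 13 (.const 1)) (run ω A s)).nat 13 = 1 := by simp
  set s1 := run ω (nset 13 (.const 1)) (run ω A s)
  have main := run_forTo_inv_frame (ω := ω) (v := 22) (e := .cell 1) (s := s1) (n := ℓ)
    (p := seq (forTo 24 (.cell 0) <| forTo 26 (.cell 13) <|
      aset 0 (.add (.mul (.cell 20) (.cell 5))
        (.add (.mul (.add (.cell 24) (.const 1)) (.cell 13)) (.cell 26)))
        (.mul (vE (.cell 20) (.cell 26)) (.get (.add (.cell 14) (.cell 24)))))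
      (nset 13 (.mul (.cell 13) (.add (.cell 0) (.const 1)))))
    (fun k s' => s'.nat 13 = (D + 1) ^ k ∧
      (∀ q < (D + 1) ^ k, s'.arr 0 (r * N + q) = mono D x k q) ∧
      ∀ i, (∀ q < N, i ≠ r * N + q) → s'.arr 0 i = s.arr 0 i)
    (by decide) (by decide) (by rw [NExp.eval_cell, hf1.nat 1 (by decide), h1])
    (by rw [hf1.nat 4 (by decide)]; omega) ?_ ?_
  · obtain ⟨-, m1, m2⟩ := main
    exact ⟨fun q hq => m1 q (hN ▸ hq), m2⟩
  · simp only [Memory.setN_arr _ _ (show 22 ≠ 3 by norm_num),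
      Memory.setN_arr _ _ (show 22 + 1 ≠ 3 by norm_num)]
    refine ⟨by simpa using e13, fun q hq => ?_, fun i hi => ?_⟩
    · obtain rfl : q = 0 := by simpa using hq
      rw [e0, if_pos (by rfl)]; rfl
    · rw [e0, if_neg]
      have := hi 0 hNpos
      simpa using this
  rintro k hk s2 hk2 hf2 ⟨i13, iV, iO⟩
  have hf12 : Frame [13, 22, 23, 24, 25, 26, 27] [0] s s2 :=
    (hf1.mono (by decide) (by decide)).trans (by decide) (hf2.mono (by decide) (by decide))
  have hPk : (D + 1) ^ k * (D + 1) ≤ N := by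
    rw [hN, ← pow_succ]; exact Nat.pow_le_pow_right (by omega) (by omega)
  set p := (D + 1) ^ k with hp
  have inner := run_forTo_inv_frame (ω := ω) (v := 24) (e := .cell 0) (s := s2) (n := D)
    (p := forTo 26 (.cell 13) <|
      aset 0 (.add (.mul (.cell 20) (.cell 5))
        (.add (.mul (.add (.cell 24) (.const 1)) (.cell 13)) (.cell 26)))
        (.mul (vE (.cell 20) (.cell 26)) (.get (.add (.cell 14) (.cell 24)))))
    (fun c s' => (∀ q < (c + 1) * p, s'.arr 0 (r * N + q) = mono D x (k + 1) q) ∧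
      ∀ i, (∀ q < N, i ≠ r * N + q) → s'.arr 0 i = s.arr 0 i)
    (by decide) (by decide) (by rw [NExp.eval_cell, hf12.nat 0 (by decide), h0])
    (by rw [hf12.nat 4 (by decide)]; omega)
    ⟨fun q hq => by
      have hq' : q < p := by simpa using hq
      rw [mono_succ_of_lt x hq', ← iV q hq']; rfl, fun i hi => by rw [← iO i hi]; rfl⟩ ?_
  · obtain ⟨j1, j2⟩ := inner
    simp only [run_seq, run_nset, Memory.setN_arr _ _ (show 22 ≠ 3 by norm_num),
      Memory.setN_arr _ _ (show 13 ≠ 3 by norm_num)]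
    refine ⟨?_, fun q hq => j1 q ?_, j2⟩
    · simp only [Memory.setN_nat, NExp.eval_mul, NExp.eval_cell, NExp.eval_add, NExp.eval_const]
      rw [if_neg (by norm_num), if_pos trivial, run_nat (by decide), run_nat (by decide), i13,
        hf12.nat 0 (by decide), h0, pow_succ]
    · calc q < (D + 1) ^ (k + 1) := hq
        _ = (D + 1) * p := by rw [pow_succ, mul_comm]
  rintro c hc s3 hc3 hf3 ⟨iV', iO'⟩
  have hf13 : Frame [13, 22, 23, 24, 25, 26, 27] [0] s s3 :=
    hf12.trans (by decide) (hf3.mono (by decide) (by decide))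
  have hcp : (c + 1) * p + p ≤ N := by
    calc (c + 1) * p + p = p * (c + 2) := by ring
      _ ≤ p * (D + 1) := Nat.mul_le_mul_left _ (by omega)
      _ ≤ N := hPk
  have hpc : p ≤ (c + 1) * p := Nat.le_mul_of_pos_left _ (by omega)
  obtain ⟨m1, m2, -⟩ := run_map (ω := ω) (v := 26) (k := 0) (e := .cell 13)
    (i := .add (.mul (.cell 20) (.cell 5))
        (.add (.mul (.add (.cell 24) (.const 1)) (.cell 13)) (.cell 26)))
    (E := .mul (vE (.cell 20) (.cell 26)) (.get (.add (.cell 14) (.cell 24)))) (s := s3) (n := p)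
    (fun i => r * N + ((c + 1) * p + i)) (fun i => mono D x k i * x c) (by norm_num) (by norm_num)
    (by rw [NExp.eval_cell, hf3.nat 13 (by decide), i13])
    (by rw [hf13.nat 4 (by decide)]; omega) (fun i _ i' _ h => by omega)
    (fun i hi s' hi' hf => by
      simp only [NExp.eval_add, NExp.eval_mul, NExp.eval_cell, NExp.eval_const, hi',
        hf.nat 20 (by decide), hf.nat 5 (by decide), hf.nat 24 (by decide), hf.nat 13 (by decide),
        hf13.nat 20 (by decide), hf13.nat 5 (by decide), hf3.nat 13 (by decide), hc3, h20, h5, i13])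
    (fun i hi s' hi' hf hs' => by
      simp only [vE, RExp.eval_mul, RExp.eval_arr, RExp.eval_get, NExp.eval_add, NExp.eval_mul,
        NExp.eval_cell, hi', hf.nat 20 (by decide), hf.nat 5 (by decide), hf.nat 24 (by decide),
        hf.nat 14 (by decide), hf13.nat 14 (by decide),
        hf13.nat 20 (by decide), hf13.nat 5 (by decide), hc3, h20, h5, h14]
      rw [hs' _ (fun r' hr' => by omega), iV' i (by omega), mono_succ_of_lt x hi,
        hf.low _ (by rw [hf13.nat 3 (by decide)]; omega), hf13.low _ (by omega), hx c hc])
  simp only [Memory.setN_arr _ _ (show 24 ≠ 3 by norm_num)]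
  refine ⟨fun q hq => ?_, fun i hi => ?_⟩
  · have hq' : q < (c + 1) * p + p := by
      calc q < (c + 1 + 1) * p := hq
        _ = (c + 1) * p + p := by ring
    by_cases hqc : q < (c + 1) * p
    · rw [m2 _ (fun r' hr' => by omega), iV' q hqc]
    · obtain ⟨i, rfl⟩ := Nat.exists_eq_add_of_le (not_lt.1 hqc)
      rw [m1 i (by omega), mono_succ_add x c (by omega)]
  · rw [m2 i fun r' hr' => hi _ (by omega), iO' i hi]

end Cmd

/-! ### Assembling the data matrix and the main program -/

/-- The matrix of the monomials of the rows `xs`, followed by an identity matrix. -/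
noncomputable def monoMatrix (d ℓ R : ℕ) (xs : ℕ → ℕ → ℝ) (r q : ℕ) : ℝ :=
  if r < R then mono d (xs r) ℓ q else if r = R + q then 1 else 0

open Classical in
/-- The hinge problem for `T` oracle points and `M` examples with coordinates `xs` and labels `y`. -/
noncomputable def inputProblem (d ℓ T M Z : ℕ) (xs : ℕ → ℕ → ℝ) (y : ℕ → ℝ) : HingeProblem :=
  let N := (d + 1) ^ ℓ
  let B := gramSchmidtCols T (monoMatrix d ℓ (T + M) xs) N
  { R := T + M
    N := N
    B := B
    n := fun q => colDot T B q q
    pu := fun r => if r < T then -1 else (1 + y (r - T)) / 2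
    pl := fun r => if r < T then 1 else (y (r - T) - 1) / 2
    a := fun r => if r < T then 0 else 1
    w := fun r => if r < T then 1 / T else
      if ∀ q < N, B r q ^ 2 ≤ (Z : ℝ) ^ 10 * colDot T B q q then 1 / M else 0
    α := 1 / (Z : ℝ) ^ 15 }

namespace Cmd

variable {d : ℕ} {ω : ℕ → Fin d → ℝ}

/-- Fetch the row in cell `20`: draw a point, or look up an input example. -/
def fetchCmd : Cmd :=
  ite (.natLt (.cell 20) (.cell 11))
    (seq (draw (.cell 15)) <|
     seq (nset 14 (.cell 15)) <|
     seq (aset 2 (.cell 20) (.sub (.ofNat (.const 0)) (.ofNat (.const 1)))) <|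
     seq (aset 3 (.cell 20) (.ofNat (.const 1))) <|
     seq (aset 4 (.cell 20) (.ofNat (.const 0))) <|
     aset 5 (.cell 20) (.div (.ofNat (.const 1)) (.ofNat (.cell 11))))
    (seq (nset 14 (.add (.const 4) (.mul (.sub (.cell 20) (.cell 11))
      (.add (.cell 0) (.const 1))))) <|
     seq (aset 2 (.cell 20) (.div (.add (.ofNat (.const 1)) (.get (.add (.cell 14) (.cell 0))))
      (.ofNat (.const 2)))) <|
     seq (aset 3 (.cell 20) (.div (.sub (.get (.add (.cell 14) (.cell 0))) (.ofNat (.const 1)))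
      (.ofNat (.const 2)))) <|
     seq (aset 4 (.cell 20) (.ofNat (.const 1))) <|
     aset 5 (.cell 20) (.div (.ofNat (.const 1)) (.ofNat (.cell 2))))

def rowsCmd : Cmd := forTo 20 (.add (.cell 11) (.cell 2)) (seq fetchCmd monoCmd)

/-- The natural cells and the input region are set up for the main part of the program. -/
structure Ready (d ℓ T M N Z : ℕ) (xs : ℕ → ℕ → ℝ) (y : ℕ → ℝ) (s : Memory) : Prop where
  h0 : s.nat 0 = d
  h1 : s.nat 1 = ℓ
  hM : s.nat 2 = M
  hbase : s.nat 3 = 4 + M * (d + 1) + d + N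
  cap : T + M + N + ℓ + d ≤ s.nat 4
  hN : s.nat 5 = N
  hN' : N = (d + 1) ^ ℓ
  hZ : s.nat 6 = Z
  hT : s.nat 11 = T
  h15 : s.nat 15 = 4 + M * (d + 1)
  point : ∀ r < M, ∀ c < d, s.real (4 + r * (d + 1) + c) = xs (T + r) c
  label : ∀ r < M, s.real (4 + r * (d + 1) + d) = y r

theorem Ready.congr {ℓ T M N Z : ℕ} {xs : ℕ → ℕ → ℝ} {y : ℕ → ℝ} {s s' : Memory}
    (h : Ready d ℓ T M N Z xs y s)
    (hn : ∀ v ∈ [0, 1, 2, 3, 4, 5, 6, 11, 15], s'.nat v = s.nat v)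
    (hr : ∀ a < 4 + M * (d + 1), s'.real a = s.real a) : Ready d ℓ T M N Z xs y s' where
  h0 := by rw [hn 0 (by simp), h.h0]
  h1 := by rw [hn 1 (by simp), h.h1]
  hM := by rw [hn 2 (by simp), h.hM]
  hbase := by rw [hn 3 (by simp), h.hbase]
  cap := by rw [hn 4 (by simp)]; exact h.cap
  hN := by rw [hn 5 (by simp), h.hN]
  hN' := h.hN'
  hZ := by rw [hn 6 (by simp), h.hZ]
  hT := by rw [hn 11 (by simp), h.hT]
  h15 := by rw [hn 15 (by simp), h.h15]
  point r hr' c hc := by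
    have : (r + 1) * (d + 1) ≤ M * (d + 1) := Nat.mul_le_mul_right _ (by omega)
    have : (r + 1) * (d + 1) = r * (d + 1) + (d + 1) := by ring
    rw [hr _ (by omega), h.point r hr' c hc]
  label r hr' := by
    have : (r + 1) * (d + 1) ≤ M * (d + 1) := Nat.mul_le_mul_right _ (by omega)
    have : (r + 1) * (d + 1) = r * (d + 1) + (d + 1) := by ring
    rw [hr _ (by omega), h.label r hr']

/-- The effect of `fetchCmd` at row `r`. -/
structure Fetched (r T M : ℕ) (xs : ℕ → ℕ → ℝ) (y : ℕ → ℝ) (d : ℕ) (s s' : Memory) : Prop where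
  nat : ∀ v, v ≠ 14 → s'.nat v = s.nat v
  ptr : s'.nat 14 + d ≤ s'.nat 3
  point : ∀ c < d, s'.real (s'.nat 14 + c) = xs r c
  low : ∀ a < 4 + M * (d + 1), s'.real a = s.real a
  drawn : s'.drawn = s.drawn + if r < T then 1 else 0
  other : ∀ k < 16, k ∉ [2, 3, 4, 5] → ∀ i, s'.arr k i = s.arr k i
  pu : ∀ i, s'.arr 2 i = if i = r then (if r < T then -1 else (1 + y (r - T)) / 2) else s.arr 2 i
  pl : ∀ i, s'.arr 3 i = if i = r then (if r < T then 1 else (y (r - T) - 1) / 2) else s.arr 3 i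
  a : ∀ i, s'.arr 4 i = if i = r then (if r < T then 0 else 1) else s.arr 4 i
  w : ∀ i, s'.arr 5 i = if i = r then (if r < T then 1 / (T : ℝ) else 1 / (M : ℝ)) else s.arr 5 i

/-- Every drawn point goes into the same buffer of `d` cells between the input and the arrays, and
cell `14` is left pointing at the coordinates in either case. The next command can then treat draws
and examples alike. -/
theorem run_fetchCmd {ℓ T M N Z r : ℕ} {xs : ℕ → ℕ → ℝ} {y : ℕ → ℝ} {s : Memory}
    (h : Ready d ℓ T M N Z xs y s) (hr : s.nat 20 = r) (hrR : r < T + M)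
    (hω : r < T → ∀ c : Fin d, ω s.drawn c = xs r c) :
    Fetched r T M xs y d s (run ω fetchCmd s) := by
  rw [fetchCmd, run_ite]
  by_cases hrT : r < T
  · rw [if_pos (by simpa [hr, h.hT] using hrT)]
    simp only [run_seq]
    set s1 := run ω (draw (.cell 15)) s with hs1
    have n1 : s1.nat = s.nat := rfl
    have a1 : ∀ k i, s1.arr k i = s.arr k i := fun k i =>
      Memory.storePoint_arr s _ (by rw [NExp.eval_cell, h.h15, h.hbase]; omega) k i
    have r1 : ∀ a < 4 + M * (d + 1), s1.real a = s.real a := fun a ha => by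
      change (s.storePoint _ _).real a = _
      simp only [Memory.storePoint, NExp.eval_cell, h.h15]
      rw [dif_neg (by omega)]
    have p1 : ∀ c < d, s1.real (4 + M * (d + 1) + c) = xs r c := fun c hc => by
      change (s.storePoint _ _).real _ = _
      simp only [Memory.storePoint, NExp.eval_cell, h.h15]
      rw [dif_pos (by omega), hω hrT]
      simp
    have d1 : s1.drawn = s.drawn + 1 := rfl
    clear_value s1
    simp only [run_nset, run_aset, NExp.eval_cell, RExp.eval_sub, RExp.eval_ofNat, RExp.eval_div,
      NExp.eval_const, Memory.setA_nat, Memory.setN_nat, n1, hr, h.hT]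
    norm_num only [if_false, Nat.cast_zero, Nat.cast_one, zero_sub]
    refine ⟨fun v hv => ?_, ?_, fun c hc => ?_, fun a ha => ?_, ?_, fun k hk hk' i => ?_,
      fun i => ?_, fun i => ?_, fun i => ?_, fun i => ?_⟩
    · simp [hv, n1]
    · simp [n1, h.h15, h.hbase]
    · rw [Memory.setA_low, Memory.setA_low, Memory.setA_low, Memory.setA_low, Memory.setN_real]
      · simp [h.h15, p1 c hc]
      all_goals simp [h.h15, n1, h.hbase]; omega
    · rw [Memory.setA_low, Memory.setA_low, Memory.setA_low, Memory.setA_low, Memory.setN_real,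
        r1 a ha]
      all_goals simp [n1, h.hbase]; omega
    · simp [d1, hrT]
    · simp only [List.mem_cons, not_or] at hk'
      rw [Memory.setA_arr _ _ _ _ (by norm_num) hk, if_neg (by simp [hk']),
        Memory.setA_arr _ _ _ _ (by norm_num) hk, if_neg (by simp [hk']),
        Memory.setA_arr _ _ _ _ (by norm_num) hk, if_neg (by simp [hk']),
        Memory.setA_arr _ _ _ _ (by norm_num) hk, if_neg (by simp [hk']),
        Memory.setN_arr _ _ (by norm_num), a1]
    all_goals simp [Memory.setA_arr, Memory.setN_arr, a1, hrT]
  · rw [if_neg (by simpa [hr, h.hT] using hrT)]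
    -- Rows from `T` on are input examples; row `T + r'` reads example `r'`, whose label lies `d`
    -- cells behind its first coordinate.
    obtain ⟨r', rfl⟩ := Nat.exists_eq_add_of_le (not_lt.1 hrT)
    have hr' : r' < M := by omega
    have hsub : T + r' - T = r' := by omega
    have e1 : (r' + 1) * (d + 1) ≤ M * (d + 1) := Nat.mul_le_mul_right _ (by omega)
    have e2 : (r' + 1) * (d + 1) = r' * (d + 1) + (d + 1) := by ring
    have lab : s.real (4 + r' * (d + 1) + d) = y r' := h.label r' hr'
    have hlt : 4 + r' * (d + 1) + d < s.nat 3 := by rw [h.hbase]; omega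
    simp only [run_seq, run_nset, run_aset, NExp.eval_cell, RExp.eval_sub, RExp.eval_ofNat,
      RExp.eval_div, RExp.eval_add, RExp.eval_get, NExp.eval_add, NExp.eval_sub, NExp.eval_mul,
      NExp.eval_const, Memory.setA_nat, Memory.setN_nat, hr, h.hT, h.hM, h.h0, hsub]
    norm_num only [if_false, if_true, Nat.cast_zero, Nat.cast_one, zero_sub]
    rw [Memory.setA_low _ _ (by simpa using hlt)]
    simp only [Memory.setN_real, lab]
    refine ⟨fun v hv => ?_, ?_, fun c hc => ?_, fun a ha => ?_, ?_, fun k hk hk' i => ?_,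
      fun i => ?_, fun i => ?_, fun i => ?_, fun i => ?_⟩
    · simp [hv]
    · simp [h.hbase]; omega
    · rw [Memory.setA_low, Memory.setA_low, Memory.setA_low, Memory.setA_low, Memory.setN_real]
      · simp [h.point r' hr' c hc]
      all_goals simp [h.hbase]; omega
    · rw [Memory.setA_low, Memory.setA_low, Memory.setA_low, Memory.setA_low, Memory.setN_real]
      all_goals simp [h.hbase]; omega
    · simp [hrT]
    · simp only [List.mem_cons, not_or] at hk'
      rw [Memory.setA_arr _ _ _ _ (by norm_num) hk, if_neg (by simp [hk']),
        Memory.setA_arr _ _ _ _ (by norm_num) hk, if_neg (by simp [hk']),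
        Memory.setA_arr _ _ _ _ (by norm_num) hk, if_neg (by simp [hk']),
        Memory.setA_arr _ _ _ _ (by norm_num) hk, if_neg (by simp [hk']),
        Memory.setN_arr _ _ (by norm_num)]
    all_goals simp [Memory.setA_arr, Memory.setN_arr, hrT]

/-- The rows before `m` are written. -/
structure RowsDone (m d ℓ T M N : ℕ) (xs : ℕ → ℕ → ℝ) (y : ℕ → ℝ) (s s' : Memory) : Prop where
  mono : ∀ r < m, ∀ q < N, s'.arr 0 (r * N + q) = mono d (xs r) ℓ q
  rest : ∀ i, m * N ≤ i → s'.arr 0 i = s.arr 0 i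
  other : ∀ k < 16, k ∉ [0, 2, 3, 4, 5] → ∀ i, s'.arr k i = s.arr k i
  pu : ∀ r < m, s'.arr 2 r = if r < T then -1 else (1 + y (r - T)) / 2
  pl : ∀ r < m, s'.arr 3 r = if r < T then 1 else (y (r - T) - 1) / 2
  a : ∀ r < m, s'.arr 4 r = if r < T then 0 else 1
  w : ∀ r < m, s'.arr 5 r = if r < T then 1 / (T : ℝ) else 1 / (M : ℝ)
  nat : ∀ v ∉ rowsCmd.natW, s'.nat v = s.nat v
  low : ∀ a < 4 + M * (d + 1), s'.real a = s.real a
  drawn : s'.drawn = s.drawn + min m T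

/-- `rowsCmd` draws points, so it is not local and the frame rule does not apply to it. The
invariant `RowsDone` records by hand what stays unchanged, including the number of draws. -/
theorem run_rowsCmd {ℓ T M N Z : ℕ} {xs : ℕ → ℕ → ℝ} {y : ℕ → ℝ} {s : Memory}
    (h : Ready d ℓ T M N Z xs y s) (hω : ∀ r < T, ∀ c : Fin d, ω (s.drawn + r) c = xs r c) :
    RowsDone (T + M) d ℓ T M N xs y s (run ω rowsCmd s) := by
  refine run_forTo_inv (ω := ω) (fun m s' => RowsDone m d ℓ T M N xs y s s') (by decide)
    (by simp [h.hT, h.hM]) (by have := h.cap; omega) ?_ ?_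
  · exact ⟨fun r hr => by omega, fun _ _ => rfl, fun _ _ _ _ => rfl, fun r hr => by omega,
      fun r hr => by omega, fun r hr => by omega, fun r hr => by omega, fun v hv => by
      rw [Memory.setN_nat, if_neg, Memory.setN_nat, if_neg]
      · rintro rfl; exact hv (by decide)
      · rintro rfl; exact hv (by decide), fun _ _ => rfl, by simp⟩
  intro m hm s1 hm1 hI
  have hR1 : Ready d ℓ T M N Z xs y s1 := h.congr (fun v hv => hI.nat v (by
    intro hv'; revert v; decide)) hI.low
  have hF := run_fetchCmd (ω := ω) hR1 hm1 hm (fun hmT c => by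
    rw [hI.drawn, min_eq_left hmT.le, hω m hmT c])
  rw [run_seq]
  set s2 := run ω fetchCmd s1
  have hR2 : Ready d ℓ T M N Z xs y s2 := hR1.congr (fun v hv => hF.nat v (by
    rintro rfl; revert hv; decide)) hF.low
  obtain ⟨c1, c2⟩ := run_monoCmd (ω := ω) (r := m) (x := xs m) hR2.h0 hR2.h1 hR2.hN hR2.hN'
    (by rw [hF.nat 20 (by decide), hm1]) rfl hF.ptr hF.point (by have := hR2.cap; omega)
  have hf3 := run_frame (ω := ω) (p := monoCmd) (by decide) (by decide) s2
  have hNpos : 0 < N := hR2.hN' ▸ Nat.pos_of_ne_zero (by positivity)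
  set s3 := run ω monoCmd s2
  have hbase : 4 + M * (d + 1) ≤ s2.nat 3 := by rw [hR2.hbase]; omega
  have split : ∀ {r : ℕ}, r < m + 1 → r ≠ m → r < m := by omega
  constructor
  · intro r hr q hq
    rw [Memory.setN_arr _ _ (by norm_num)]
    by_cases hrm : r = m
    · rw [hrm]; exact c1 q hq
    · rw [c2 _ (fun q' hq' h' => hrm (row_index_inj hq hq' h').1),
        hF.other 0 (by norm_num) (by decide), hI.mono r (split hr hrm) q hq]
  · intro i hi
    have : (m + 1) * N = m * N + N := by ring
    rw [Memory.setN_arr _ _ (by norm_num), c2 _ (fun q' hq' h' => by omega),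
        hF.other 0 (by norm_num) (by decide), hI.rest i (by omega)]
  · intro k hk hk' i
    simp only [List.mem_cons, not_or] at hk'
    rw [Memory.setN_arr _ _ (by norm_num), hf3.arr k hk (by
      intro h'
      have : k = 0 := by
        have h2 : ∀ x ∈ monoCmd.arrW, x = 0 := by decide
        exact h2 k h'
      exact hk'.1 this), hF.other k hk (by simp [hk']), hI.other k hk (by simp [hk'])]
  · intro r hr
    rw [Memory.setN_arr _ _ (by norm_num), hf3.arr 2 (by norm_num) (by decide), hF.pu]
    by_cases h1 : r = m
    · subst h1; rw [if_pos rfl]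
    · rw [if_neg h1, hI.pu r (split hr h1)]
  · intro r hr
    rw [Memory.setN_arr _ _ (by norm_num), hf3.arr 3 (by norm_num) (by decide), hF.pl]
    by_cases h1 : r = m
    · subst h1; rw [if_pos rfl]
    · rw [if_neg h1, hI.pl r (split hr h1)]
  · intro r hr
    rw [Memory.setN_arr _ _ (by norm_num), hf3.arr 4 (by norm_num) (by decide), hF.a]
    by_cases h1 : r = m
    · subst h1; rw [if_pos rfl]
    · rw [if_neg h1, hI.a r (split hr h1)]
  · intro r hr
    rw [Memory.setN_arr _ _ (by norm_num), hf3.arr 5 (by norm_num) (by decide), hF.w]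
    by_cases h1 : r = m
    · subst h1; rw [if_pos rfl]
    · rw [if_neg h1, hI.w r (split hr h1)]
  · intro v hv
    have hv1 : v ∉ monoCmd.natW := fun h' => hv (by simp [rowsCmd, natW, h'])
    have hv2 : v ∉ fetchCmd.natW := fun h' => hv (by simp [rowsCmd, natW, h'])
    have hv3 : v ≠ 20 := fun h' => hv (by simp [rowsCmd, natW, h'])
    rw [Memory.setN_nat, if_neg hv3, hf3.nat v hv1, run_nat hv2, hI.nat v hv]
  · intro a ha
    rw [Memory.setN_real, hf3.low a (by omega), hF.low a ha, hI.low a ha]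
  · rw [Memory.setN_drawn, hf3.drawn, hF.drawn, hI.drawn]
    split_ifs with h1 <;> omega

end Cmd

/-- The averages of the values of the upper iterates of the descent. -/
noncomputable def HingeProblem.avgU (P : HingeProblem) (K r : ℕ) : ℝ :=
  (∑ k ∈ Finset.range K, P.lin (P.descent k).1 r) / K

/-- The averages of the values of the lower iterates of the descent. -/
noncomputable def HingeProblem.avgL (P : HingeProblem) (K r : ℕ) : ℝ :=
  (∑ k ∈ Finset.range K, P.lin (P.descent k).2 r) / K

/-- `θ` is the best threshold of the grid with `G` points. -/
def HingeProblem.IsBestThreshold (P : HingeProblem) (K G : ℕ) (θ : ℝ) : Prop :=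
  ∃ b : ℝ, (∀ g < G, b ≤ P.count (P.avgU K) (P.avgL K) (1 / G) (2 * g / G - 1)) ∧
    (b = 3 ∧ θ = 0 ∨ ∃ g < G, θ = 2 * g / G - 1 ∧
      b = P.count (P.avgU K) (P.avgL K) (1 / G) (2 * g / G - 1))

namespace Cmd

variable {d : ℕ} {ω : ℕ → Fin d → ℝ}

/-- Only the diagonal is written; the zeros of the identity block are the initial contents of the
memory. -/
def identityCmd : Cmd :=
  forTo 20 (.cell 5) <| aset 0 (.add (.mul (.add (.add (.cell 11) (.cell 2)) (.cell 20)) (.cell 5))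
    (.cell 20)) (.ofNat (.const 1))

def outputCmd : Cmd :=
  seq (forTo 20 (.cell 5) <| rset (.cell 20)
    (.div (.arr 11 (.add (.add (.cell 11) (.cell 2)) (.cell 20))) (.ofNat (.pow (.cell 6) 26)))) <|
  rset (.const 0) (.sub (.get (.const 0)) (.arr 14 (.const 1)))

/-- The learning algorithm, after the computation of the parameters. -/
def learnCmd : Cmd :=
  seq rowsCmd <| seq identityCmd <| seq gramSchmidtCmd <| seq filterCmd <| seq descentCmd <|
    seq thresholdCmd outputCmd

/-- The condition `N ≤ s.nat 3` keeps the output cells below the arrays, so the writes do not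
destroy values still to be read. Subtracting the threshold from coefficient `0` shifts the
polynomial, because monomial `0` is the constant `1`. -/
theorem run_outputCmd {T M N Z : ℕ} {s : Memory} (hT : s.nat 11 = T) (hM : s.nat 2 = M)
    (hN : s.nat 5 = N) (hZ : s.nat 6 = Z) (hN0 : 0 < N) (hcap : N ≤ s.nat 4) (hb : N ≤ s.nat 3) :
    ∀ q < N, (run ω outputCmd s).real q =
      s.arr 11 (T + M + q) / (Z ^ 26 : ℕ) - if q = 0 then s.arr 14 1 else 0 := by
  rw [outputCmd, run_seq]
  set A := forTo 20 (.cell 5) <| rset (.cell 20)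
    (.div (.arr 11 (.add (.add (.cell 11) (.cell 2)) (.cell 20))) (.ofNat (.pow (.cell 6) 26)))
    with hA
  obtain ⟨h1, h2⟩ := run_forTo_inv (ω := ω) (v := 20) (e := .cell 5) (s := s) (n := N)
    (p := rset (.cell 20) (.div (.arr 11 (.add (.add (.cell 11) (.cell 2)) (.cell 20)))
      (.ofNat (.pow (.cell 6) 26))))
    (fun m s' => (∀ q < m, s'.real q = s.arr 11 (T + M + q) / (Z ^ 26 : ℕ)) ∧
      ((∀ i, N ≤ i → s'.real i = s.real i) ∧ ∀ v, v ≠ 20 → v ≠ 21 → s'.nat v = s.nat v))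
    (by decide) hN hcap
    ⟨fun q hq => by omega, fun _ _ => rfl, fun v h h' => by simp [h, h']⟩ (by
      rintro m hm s1 hm1 ⟨h1, h2, h3⟩
      have e : ((NExp.cell 11).add (NExp.cell 2)).eval s1 = T + M := by
        simp [h3 11, h3 2, hT, hM]
      have ev : (RExp.div (.arr 11 (.add (.add (.cell 11) (.cell 2)) (.cell 20)))
          (.ofNat (.pow (.cell 6) 26))).eval s1 = s.arr 11 (T + M + m) / (Z ^ 26 : ℕ) := by
        simp only [RExp.eval_div, RExp.eval_arr, RExp.eval_ofNat, NExp.eval_add, NExp.eval_cell,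
          NExp.eval_pow, h3 11 (by norm_num) (by norm_num), h3 2 (by norm_num) (by norm_num),
          h3 6 (by norm_num) (by norm_num), hm1, hT, hM, hZ, Memory.arr,
          h3 3 (by norm_num) (by norm_num)]
        rw [h2 _ (by omega)]
      have hrun : run ω (rset (.cell 20) (.div (.arr 11 (.add (.add (.cell 11) (.cell 2))
          (.cell 20))) (.ofNat (.pow (.cell 6) 26)))) s1 =
          s1.setR m (s.arr 11 (T + M + m) / (Z ^ 26 : ℕ)) := by
        rw [← ev, ← hm1]; rfl
      rw [hrun]
      refine ⟨fun q hq => ?_, fun i hi => ?_, fun v h h' => ?_⟩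
      · rw [Memory.setN_real, Memory.setR_real]
        split_ifs with h
        · rw [h]
        · exact h1 q (by omega)
      · rw [Memory.setN_real, Memory.setR_real, if_neg (by omega), h2 i hi]
      · simp [h, h3 v h h'])
  set s1 := run ω A s
  intro q hq
  have e14 : s1.arr 14 1 = s.arr 14 1 := by
    simp only [Memory.arr, h2.2 3 (by norm_num) (by norm_num)]
    rw [h2.1 _ (by omega)]
  have hrun : run ω (rset (.const 0) (.sub (.get (.const 0)) (.arr 14 (.const 1)))) s1 =
      s1.setR 0 (s1.real 0 - s1.arr 14 1) := rfl
  rw [hrun, Memory.setR_real, e14]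
  split_ifs with h
  · rw [h1 0 hN0, h]
  · rw [h1 q hq, sub_zero]

/-- The output polynomial is the averaged lower iterate, read off the identity rows. The upper
iterate enters only through the choice of the threshold. -/
theorem run_learnCmd {ℓ T M N Z : ℕ} {xs : ℕ → ℕ → ℝ} {y : ℕ → ℝ} {s : Memory}
    (h : Ready d ℓ T M N Z xs y s) (hω : ∀ r < T, ∀ c : Fin d, ω (s.drawn + r) c = xs r c)
    (h0 : ∀ k ∈ [0, 6, 7, 10, 11], ∀ i, s.arr k i = 0) (hcap : Z ^ 26 ≤ s.nat 4)
    (hcap' : Z ^ 3 ≤ s.nat 4) :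
    ∃ θ, (inputProblem d ℓ T M Z xs y).IsBestThreshold (Z ^ 26) (Z ^ 3) θ ∧
      ∀ q < N, (run ω learnCmd s).real q =
        (inputProblem d ℓ T M Z xs y).avgL (Z ^ 26) (T + M + q) - if q = 0 then θ else 0 := by
  have hNpos : 0 < N := h.hN' ▸ Nat.pos_of_ne_zero (by positivity)
  have hrows := run_rowsCmd (ω := ω) h hω
  simp only [learnCmd, run_seq]
  set s1 := run ω rowsCmd s
  have hcap4 := h.cap
  have n1 : ∀ v ∈ [2, 3, 4, 5, 6, 11], s1.nat v = s.nat v := fun v hv => hrows.nat v (by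
    intro hv'; revert v; decide)
  have a1 : ∀ k ∈ [6, 7, 10, 11], ∀ i, s1.arr k i = 0 := fun k hk i => by
    rw [hrows.other k (by revert k; decide) (by revert k; decide), h0 k (by revert k; decide)]
  have hid := run_map (ω := ω) (v := 20) (k := 0) (e := .cell 5) (s := s1) (n := N)
    (i := .add (.mul (.add (.add (.cell 11) (.cell 2)) (.cell 20)) (.cell 5)) (.cell 20))
    (E := .ofNat (.const 1)) (fun q => (T + M + q) * N + q) (fun _ => 1) (by norm_num) (by norm_num)
    (by rw [NExp.eval_cell, n1 5 (by simp), h.hN]) (by rw [n1 4 (by simp)]; omega)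
    (fun r hr r' hr' h' => (row_index_inj hr hr' h').2)
    (fun r hr s' hr' hf => by
      simp [hf.nat 11, hf.nat 2, hf.nat 5, hr', n1, h.hT, h.hM, h.hN])
    (fun r hr s' hr' hf _ => by simp)
  obtain ⟨i1, i2, hf2⟩ := hid
  change Frame _ _ s1 (run ω identityCmd s1) at hf2
  change ∀ r < N, (run ω identityCmd s1).arr 0 _ = _ at i1
  change ∀ i, _ → (run ω identityCmd s1).arr 0 _ = _ at i2
  set s2 := run ω identityCmd s1
  have hV2 : ∀ r < T + M + N, ∀ q < N,
      s2.arr 0 (r * N + q) = monoMatrix d ℓ (T + M) xs r q := by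
    intro r hr q hq
    rw [monoMatrix]
    by_cases hr' : r < T + M
    · rw [if_pos hr', i2 _ (fun q' hq' h' => by have := (row_index_inj hq hq' h').1; omega),
        hrows.mono r hr' q hq]
    · rw [if_neg hr']
      by_cases hrq : r = T + M + q
      · rw [if_pos hrq, hrq, i1 q hq]
      · rw [if_neg hrq, i2 _ (fun q' hq' h' => by
          have := row_index_inj hq hq' h'; omega), hrows.rest, h0 0 (by simp)]
        have := Nat.mul_le_mul_right N (not_lt.1 hr')
        omega
  have n2 : ∀ v ∈ [2, 3, 4, 5, 6, 11], s2.nat v = s.nat v := fun v hv => by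
    rw [hf2.nat v (by revert v; decide), n1 v hv]
  obtain ⟨g1, g2⟩ := run_gramSchmidtCmd (ω := ω) (s := s2) (T := T) (M := M) (N := N)
    (by rw [n2 11 (by simp), h.hT]) (by rw [n2 2 (by simp), h.hM]) (by rw [n2 5 (by simp), h.hN])
    (by rw [n2 4 (by simp)]; omega) hV2
  have hf3 := run_frame (ω := ω) (p := gramSchmidtCmd) (by decide) (by decide) s2
  set s3 := run ω gramSchmidtCmd s2
  have n3 : ∀ v ∈ [2, 3, 4, 5, 6, 11], s3.nat v = s.nat v := fun v hv => by
    rw [hf3.nat v (by revert v; decide), n2 v hv]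
  obtain ⟨w1, w2⟩ := run_filterCmd (ω := ω) (s := s3) (T := T) (M := M) (N := N) (Z := Z)
    (by rw [n3 11 (by simp), h.hT]) (by rw [n3 2 (by simp), h.hM]) (by rw [n3 5 (by simp), h.hN])
    (by rw [n3 6 (by simp), h.hZ]) (by rw [n3 4 (by simp)]; omega) g1 g2
  have hf4 := run_frame (ω := ω) (p := filterCmd) (by decide) (by decide) s3
  set s4 := run ω filterCmd s3
  have n4 : ∀ v ∈ [2, 3, 4, 5, 6, 11], s4.nat v = s.nat v := fun v hv => by
    rw [hf4.nat v (by revert v; decide), n3 v hv]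
  have a4 : ∀ k ∈ [2, 3, 4, 6, 7, 10, 11], ∀ i, s4.arr k i = s1.arr k i := fun k hk i => by
    rw [hf4.arr k (by revert k; decide) (by revert k; decide),
      hf3.arr k (by revert k; decide) (by revert k; decide),
      hf2.arr k (by revert k; decide) (by revert k; decide)]
  have a5 : ∀ i, s3.arr 5 i = s1.arr 5 i := fun i => by
    rw [hf3.arr 5 (by decide) (by decide), hf2.arr 5 (by decide) (by decide)]
  have hP : Holds (inputProblem d ℓ T M Z xs y) T M N Z s4 :=
    { hT := by rw [n4 11 (by simp), h.hT]
      hM := by rw [n4 2 (by simp), h.hM]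
      hN := by rw [n4 5 (by simp), h.hN]
      hZ := by rw [n4 6 (by simp), h.hZ]
      hR := rfl
      hN' := h.hN'.symm
      cap := by rw [n4 4 (by simp)]; omega
      B := fun r hr q hq => by
        rw [hf4.arr 0 (by decide) (by decide), g1 r hr q hq, h.hN']; rfl
      n := fun q hq => by
        rw [hf4.arr 1 (by decide) (by decide), g2 q hq, h.hN']; rfl
      pu := fun r hr => by rw [a4 2 (by simp), hrows.pu r hr]; rfl
      pl := fun r hr => by rw [a4 3 (by simp), hrows.pl r hr]; rfl
      a := fun r hr => by rw [a4 4 (by simp), hrows.a r hr]; rfl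
      w := fun r hr => by
        simp only [inputProblem, ← h.hN']
        by_cases hrT : r < T
        · rw [if_pos hrT, w1 r hrT, a5, hrows.w r hr, if_pos hrT]
        · obtain ⟨r', rfl⟩ := Nat.exists_eq_add_of_le (not_lt.1 hrT)
          rw [if_neg hrT, w2 r' (by omega), a5, hrows.w _ hr, if_neg hrT] }
  obtain ⟨d1, d2⟩ := run_descentCmd (ω := ω) hP rfl (by rw [n4 4 (by simp)]; exact hcap)
    (fun j _ => by rw [a4 6 (by simp), a1 6 (by simp)])
    (fun j _ => by rw [a4 7 (by simp), a1 7 (by simp)])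
    (fun j _ => by rw [a4 10 (by simp), a1 10 (by simp)])
    (fun j _ => by rw [a4 11 (by simp), a1 11 (by simp)])
  have hf5 := run_frame (ω := ω) (p := descentCmd) (by decide) (by decide) s4
  set s5 := run ω descentCmd s4
  have hP5 := hP.frame hf5 (by decide) (by decide)
  have hK : (((Z ^ 26 : ℕ)) : ℝ) = (Z : ℝ) ^ 26 := by push_cast; rfl
  obtain ⟨b, t1, t2⟩ := run_thresholdCmd (ω := ω) hP5
    (u := (inputProblem d ℓ T M Z xs y).avgU (Z ^ 26))
    (l := (inputProblem d ℓ T M Z xs y).avgL (Z ^ 26))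
    (by rw [hf5.nat 4 (by decide), n4 4 (by simp)]; exact hcap')
    (fun r hr => by rw [d1 r (by omega), ← hK]; rfl)
    (fun r hr => by rw [d2 r (by omega), ← hK]; rfl)
  have hf6 := run_frame (ω := ω) (p := thresholdCmd) (by decide) (by decide) s5
  set s6 := run ω thresholdCmd s5
  have n6 : ∀ v ∈ [2, 3, 4, 5, 6, 11], s6.nat v = s.nat v := fun v hv => by
    rw [hf6.nat v (by revert v; decide), hf5.nat v (by revert v; decide), n4 v hv]
  have hout := run_outputCmd (ω := ω) (s := s6) (T := T) (M := M) (N := N) (Z := Z)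
    (by rw [n6 11 (by simp), h.hT]) (by rw [n6 2 (by simp), h.hM]) (by rw [n6 5 (by simp), h.hN])
    (by rw [n6 6 (by simp), h.hZ]) hNpos (by rw [n6 4 (by simp)]; omega)
    (by rw [n6 3 (by simp), h.hbase]; omega)
  refine ⟨s6.arr 14 1, ⟨b, ?_, ?_⟩, fun q hq => ?_⟩
  · simpa using t1
  · simpa using t2
  · rw [hout q hq, hf6.arr 11 (by decide) (by decide), d2 _ (by omega)]; rfl

end Cmd

/-! ### The program -/

/-- Reals cannot be converted to naturals on this machine, but counting up while the counter is
below `E` stops exactly at the ceiling. -/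
theorem exec_countUp {d : ℕ} {ω : ℕ → Fin d → ℝ} (v : ℕ) (E : RExp) (s : Memory)
    (hE : ∀ x, E.eval (s.setN v x) = E.eval s) (hv : s.nat v = 0) :
    ∃ t ≤ ⌈E.eval s⌉₊ * (E.cost + 10) + (E.cost + 4),
      Exec ω (.loop (.realLt (.ofNat (NExp.cell v)) E)
        (.setNat (.const v) (.add (NExp.cell v) (.const 1)))) s t (s.setN v ⌈E.eval s⌉₊) := by
  have hit : ∀ k, (fun s' : Memory => s'.setN v (s'.nat v + 1))^[k] s = s.setN v k := by
    intro k
    induction k with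
    | zero =>
      change s = s.setN v 0
      rw [← hv]
      simp [Memory.setN]
    | succ k ih =>
      rw [Function.iterate_succ_apply', ih]
      simp [Memory.setN]
  obtain ⟨t, ht, ex⟩ := exec_loop_iterate (ω := ω) (b := .realLt (.ofNat (NExp.cell v)) E)
    (p := .setNat (.const v) (.add (NExp.cell v) (.const 1)))
    (fun s' : Memory => s'.setN v (s'.nat v + 1)) 6 ⌈E.eval s⌉₊ s
    (fun k hk => by
      rw [hit]
      exact ⟨by simpa [hE] using Nat.lt_ceil.1 hk, 6, le_rfl, .setNat _ _ _⟩)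
    (by rw [hit]; simpa [hE] using Nat.le_ceil _)
  refine ⟨t, ?_, hit _ ▸ ex⟩
  simp only [BExp.cost, RExp.cost, NExp.cost, NExp.cell] at ht
  calc t ≤ _ := ht
    _ = _ := by ring

/-- The loop that computes the logarithm of `2 / δ`. -/
def logLoop : Program :=
  .loop (.realLt (.ofNat (NExp.cell 10)) (.div (.ofNat (.const 2)) (.get (.const 2))))
    (.seq (.setNat (.const 10) (.mul (NExp.cell 10) (.const 2)))
      (.setNat (.const 9) (.add (NExp.cell 9) (.const 1))))

/-- Doubling until `2 / δ` is reached: `2 ^ k < 2 / δ` holds exactly for `k` below the ceiling of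
the binary logarithm, so the time is logarithmic in `1 / δ`. -/
theorem exec_logLoop {d : ℕ} {ω : ℕ → Fin d → ℝ} (s : Memory) (h9 : s.nat 9 = 0)
    (h10 : s.nat 10 = 1) :
    ∃ t ≤ Nat.clog 2 ⌈2 / s.real 2⌉₊ * 21 + 9,
      Exec ω logLoop s t ((s.setN 10 (2 ^ Nat.clog 2 ⌈2 / s.real 2⌉₊)).setN 9
        (Nat.clog 2 ⌈2 / s.real 2⌉₊)) := by
  have hit : ∀ k, (fun s' : Memory => (s'.setN 10 (s'.nat 10 * 2)).setN 9 (s'.nat 9 + 1))^[k] s =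
      (s.setN 10 (2 ^ k)).setN 9 k := by
    intro k
    induction k with
    | zero =>
      have e1 : Function.update s.nat 10 1 = s.nat := by rw [← h10, Function.update_eq_self]
      have e2 : Function.update s.nat 9 0 = s.nat := by rw [← h9, Function.update_eq_self]
      simp [Memory.setN, e1, e2]
    | succ k ih =>
      rw [Function.iterate_succ_apply', ih]
      simp [Memory.setN, pow_succ]
      rw [Function.update_comm (by norm_num), Function.update_idem,
        Function.update_comm (by norm_num), Function.update_idem]
  have hlt : ∀ k, ((2 ^ k : ℕ) : ℝ) < 2 / s.real 2 ↔ k < Nat.clog 2 ⌈2 / s.real 2⌉₊ := fun k => by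
    rw [← Nat.lt_ceil, Nat.lt_clog_iff_pow_lt (by norm_num)]
  obtain ⟨t, ht, ex⟩ := exec_loop_iterate (ω := ω)
    (b := .realLt (.ofNat (NExp.cell 10)) (.div (.ofNat (.const 2)) (.get (.const 2))))
    (p := (.seq (.setNat (.const 10) (.mul (NExp.cell 10) (.const 2)))
      (.setNat (.const 9) (.add (NExp.cell 9) (.const 1)))))
    (fun s' : Memory => (s'.setN 10 (s'.nat 10 * 2)).setN 9 (s'.nat 9 + 1)) 12
    (Nat.clog 2 ⌈2 / s.real 2⌉₊) s
    (fun k hk => by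
      refine ⟨?_, 12, le_rfl, Exec.seq (t₁ := 6) (t₂ := 6) (.setNat _ _ _) (.setNat _ _ _)⟩
      rw [hit]
      simpa using (hlt k).2 hk)
    (by
      rw [hit]
      have := mt (hlt (Nat.clog 2 ⌈2 / s.real 2⌉₊)).1 (lt_irrefl _)
      simpa using this)
  refine ⟨t, ?_, hit _ ▸ ex⟩
  simp only [BExp.cost, RExp.cost, NExp.cost, NExp.cell] at ht
  omega

/-- The number `⌈log₂ (2 / δ)⌉`. -/
noncomputable def logParam (δ : ℝ) : ℕ := Nat.clog 2 ⌈2 / δ⌉₊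

/-- The scale parameter: all other parameters of the algorithm are powers of it. -/
noncomputable def scaleParam (d ℓ : ℕ) (A ε δ Q : ℝ) : ℕ :=
  (16 * ⌈A⌉₊ * logParam δ * (d + 1)) ^ ℓ * ⌈Q / ε⌉₊

namespace Cmd

/-- Compute the number of monomials, the scale parameter, the number of draws, and the address of
the drawn points. -/
def paramCmd : Cmd :=
  seq (nset 5 (.const 1)) <| seq (nset 6 (.const 1)) <|
  seq (forTo 20 (.cell 1) (seq (nset 5 (.mul (.cell 5) (.add (.cell 0) (.const 1))))
    (nset 6 (.mul (.cell 6) (.mul (.mul (.mul (.const 16) (.cell 7)) (.cell 9))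
      (.add (.cell 0) (.const 1))))))) <|
  seq (nset 6 (.mul (.cell 6) (.cell 8))) <|
  seq (nset 11 (.pow (.cell 6) 30)) <|
  nset 15 (.add (.const 4) (.mul (.cell 2) (.add (.cell 0) (.const 1))))

variable {d : ℕ} {ω : ℕ → Fin d → ℝ}

theorem run_paramCmd {D ℓ M a e t : ℕ} {s : Memory} (h0 : s.nat 0 = D) (h1 : s.nat 1 = ℓ)
    (h2 : s.nat 2 = M) (h7 : s.nat 7 = a) (h8 : s.nat 8 = e) (h9 : s.nat 9 = t)
    (hcap : ℓ ≤ s.nat 4) :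
    (run ω paramCmd s).nat 5 = (D + 1) ^ ℓ ∧
    (run ω paramCmd s).nat 6 = (16 * a * t * (D + 1)) ^ ℓ * e ∧
    (run ω paramCmd s).nat 11 = ((16 * a * t * (D + 1)) ^ ℓ * e) ^ 30 ∧
    (run ω paramCmd s).nat 15 = 4 + M * (D + 1) ∧
    (∀ v ∈ [0, 1, 2, 3, 4], (run ω paramCmd s).nat v = s.nat v) ∧
    (run ω paramCmd s).real = s.real ∧ (run ω paramCmd s).drawn = s.drawn := by
  have hloop := run_forTo_inv (ω := ω) (v := 20) (e := .cell 1)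
    (p := seq (nset 5 (.mul (.cell 5) (.add (.cell 0) (.const 1))))
      (nset 6 (.mul (.cell 6) (.mul (.mul (.mul (.const 16) (.cell 7)) (.cell 9))
      (.add (.cell 0) (.const 1)))))) (s := (s.setN 5 1).setN 6 1) (n := ℓ)
    (fun m s' => s'.nat 5 = (D + 1) ^ m ∧ s'.nat 6 = (16 * a * t * (D + 1)) ^ m ∧
      (∀ v ∈ [0, 1, 2, 3, 4, 7, 8, 9], s'.nat v = s.nat v) ∧ s'.real = s.real ∧
      s'.drawn = s.drawn)
    (by decide) (by simp [h1]) (by simpa using hcap)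
    ⟨by simp, by simp, by simp, rfl, rfl⟩ (by
      rintro m hm s' hm' ⟨i5, i6, i, ir, id⟩
      refine ⟨?_, ?_, ?_, ir, id⟩
      · simp [i5, i, h0, pow_succ]
      · simp [i6, i, h0, h7, h9, pow_succ]
      · intro v hv
        have e5 : v ≠ 5 := by rintro rfl; revert hv; decide
        have e6 : v ≠ 6 := by rintro rfl; revert hv; decide
        have e20 : v ≠ 20 := by rintro rfl; revert hv; decide
        simp [e5, e6, e20, i v hv])
  obtain ⟨j5, j6, j, jr, jd⟩ := hloop
  simp only [paramCmd, run_seq]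
  have e : run ω (nset 6 (.const 1)) (run ω (nset 5 (.const 1)) s) = (s.setN 5 1).setN 6 1 := rfl
  rw [e]
  set s1 := run ω (forTo 20 (.cell 1) (seq (nset 5 (.mul (.cell 5) (.add (.cell 0) (.const 1))))
      (nset 6 (.mul (.cell 6) (.mul (.mul (.mul (.const 16) (.cell 7)) (.cell 9))
      (.add (.cell 0) (.const 1))))))) ((s.setN 5 1).setN 6 1)
  refine ⟨?_, ?_, ?_, ?_, ?_, jr, jd⟩
  · simp [j5]
  · simp [j6, j, h8]
  · simp [j6, j, h8]
  · simp [j, h2, h0]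
  · intro v hv
    have e6 : v ≠ 6 := by rintro rfl; revert hv; decide
    have e11 : v ≠ 11 := by rintro rfl; revert hv; decide
    have e15 : v ≠ 15 := by rintro rfl; revert hv; decide
    simp only [run_nset, Memory.setN_nat, if_neg e6, if_neg e11, if_neg e15]
    exact j v (by revert v; decide)

/-- The running time is polynomial in the dimension and the cap on the loop counts. -/
theorem time_le (p : Cmd) : ∃ c k : ℕ, ∀ D β, p.time D β ≤ c * (D + β + 1) ^ k := by
  have mono : ∀ {c c' k k' : ℕ} (D β : ℕ), c ≤ c' → k ≤ k' →
      c * (D + β + 1) ^ k ≤ c' * (D + β + 1) ^ k' := fun D β hc hk =>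
    Nat.mul_le_mul hc (Nat.pow_le_pow_right (by omega) hk)
  have add : ∀ {p q : ℕ → ℕ → ℕ}, (∃ c k : ℕ, ∀ D β, p D β ≤ c * (D + β + 1) ^ k) →
      (∃ c k : ℕ, ∀ D β, q D β ≤ c * (D + β + 1) ^ k) →
      ∃ c k : ℕ, ∀ D β, p D β + q D β ≤ c * (D + β + 1) ^ k := by
    rintro p q ⟨c, k, h⟩ ⟨c', k', h'⟩
    refine ⟨c + c', k + k', fun D β => ?_⟩
    rw [Nat.add_mul]
    exact Nat.add_le_add ((h D β).trans (mono D β le_rfl (by omega)))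
      ((h' D β).trans (mono D β le_rfl (by omega)))
  have cst : ∀ n : ℕ, ∃ c k : ℕ, ∀ D β : ℕ, n ≤ c * (D + β + 1) ^ k := fun n =>
    ⟨n, 0, fun D β => by simp⟩
  induction p with
  | nset v e => exact cst _
  | aset k i e => exact cst _
  | rset a e => exact cst _
  | draw a =>
    refine ⟨a.cost + 1, 1, fun D β => ?_⟩
    simp only [time, pow_one]
    nlinarith [Nat.zero_le (a.cost * (D + β))]
  | seq p q ihp ihq => exact add ihp ihq
  | ite b p q ihp ihq => exact add (cst _) (add ihp ihq)
  | forTo v e p ih =>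
    obtain ⟨c, k, h⟩ := add ih (cst 11)
    refine add (cst (e.cost + e.cost + 17)) ⟨c, k + 1, fun D β => ?_⟩
    calc β * (p.time D β + 11) ≤ (D + β + 1) * (c * (D + β + 1) ^ k) :=
          Nat.mul_le_mul (by omega) (h D β)
      _ = _ := by ring

end Cmd

/-- The learning algorithm. -/
def learner : Program :=
  .seq (.loop (.realLt (.ofNat (NExp.cell 7)) (.get (.const 0)))
    (.setNat (.const 7) (.add (NExp.cell 7) (.const 1)))) <|
  .seq (.loop (.realLt (.ofNat (NExp.cell 8)) (.div (.get (.const 3)) (.get (.const 1))))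
    (.setNat (.const 8) (.add (NExp.cell 8) (.const 1)))) <|
  .seq (.setNat (.const 10) (.const 1)) <|
  .seq logLoop <|
  .seq (.setNat (.const 4) (NExp.cell 1)) <|
  .seq Cmd.paramCmd.toProgram <|
  .seq (.setNat (.const 3) (.add (.add (NExp.cell 15) (NExp.cell 0)) (NExp.cell 5))) <|
  .seq (.setNat (.const 4) (.add (.add (NExp.cell 11) (NExp.cell 2)) (NExp.cell 6)))
  Cmd.learnCmd.toProgram

/-- The coordinates of the oracle points and the input examples. -/
noncomputable def inputRows {d : ℕ} {X : Set (Fin d → ℝ)} {M : ℕ} (T : ℕ) (S : Fin M → X × ℤˣ)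
    (ω : ℕ → X) (r c : ℕ) : ℝ :=
  if hc : c < d then
    if r < T then (ω r).1 ⟨c, hc⟩ else if h : r - T < M then (S ⟨r - T, h⟩).1.1 ⟨c, hc⟩ else 0
  else 0

noncomputable def inputLabels {d : ℕ} {X : Set (Fin d → ℝ)} {M : ℕ} (S : Fin M → X × ℤˣ)
    (r : ℕ) : ℝ :=
  if h : r < M then (((S ⟨r, h⟩).2 : ℤ) : ℝ) else 0

/-- The hinge problem for the data `S` and the oracle points `ω`. -/
noncomputable def dataProblem {d : ℕ} {X : Set (Fin d → ℝ)} {M : ℕ} (ℓ Z : ℕ) (S : Fin M → X × ℤˣ)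
    (ω : ℕ → X) : HingeProblem :=
  inputProblem d ℓ (Z ^ 30) M Z (inputRows (Z ^ 30) S ω) (inputLabels S)

/-- All quantities that are looped over or enter the running time before `Z` is known are bounded by
`Z`. The first bound also gives `N + ℓ + d ≤ Z`, so that the cap `Z ^ 30 + M + Z` exceeds every loop
count of the main part. -/
theorem le_scaleParam {d ℓ : ℕ} {A ε δ Q : ℝ} (hd : 1 ≤ d) (hℓ : 1 ≤ ℓ) (hA : 1 ≤ A) (hε : 0 < ε)
    (hδ : 0 < δ) (hδ1 : δ < 1) (hQ : 1 ≤ Q) :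
    16 * ((d + 1) ^ ℓ + ℓ + d) ≤ 3 * scaleParam d ℓ A ε δ Q ∧ ⌈A⌉₊ ≤ scaleParam d ℓ A ε δ Q ∧
      logParam δ ≤ scaleParam d ℓ A ε δ Q ∧ ⌈Q / ε⌉₊ ≤ scaleParam d ℓ A ε δ Q := by
  have ha : 1 ≤ ⌈A⌉₊ := Nat.one_le_ceil_iff.2 (by linarith)
  have he : 1 ≤ ⌈Q / ε⌉₊ := Nat.one_le_ceil_iff.2 (by positivity)
  have h2 : 1 < ⌈2 / δ⌉₊ := by
    rw [Nat.lt_ceil, Nat.cast_one, lt_div_iff₀ hδ]; linarith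
  have ht : 1 ≤ logParam δ := by
    rw [logParam, Nat.succ_le_iff]; exact Nat.clog_pos (by norm_num) h2
  unfold scaleParam
  set a := ⌈A⌉₊
  set e := ⌈Q / ε⌉₊
  set t := logParam δ
  have hb : 16 * (d + 1) ≤ 16 * a * t * (d + 1) := by
    have : 1 ≤ a * t := Nat.mul_pos ha ht
    calc 16 * (d + 1) = 16 * 1 * (d + 1) := by ring
      _ ≤ 16 * (a * t) * (d + 1) := by gcongr
      _ = _ := by ring
  have hpow : 16 * a * t * (d + 1) ≤ (16 * a * t * (d + 1)) ^ ℓ :=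
    Nat.le_self_pow (by omega) _
  have hZ : (16 * a * t * (d + 1)) ^ ℓ ≤ (16 * a * t * (d + 1)) ^ ℓ * e :=
    Nat.le_mul_of_pos_right _ he
  have hN : 16 * (d + 1) ^ ℓ ≤ (16 * a * t * (d + 1)) ^ ℓ := by
    calc 16 * (d + 1) ^ ℓ ≤ 16 ^ ℓ * (d + 1) ^ ℓ := by
          gcongr; exact Nat.le_self_pow (by omega) _
      _ = (16 * (d + 1)) ^ ℓ := by rw [mul_pow]
      _ ≤ _ := Nat.pow_le_pow_left hb _
  have hℓN : ℓ ≤ (d + 1) ^ ℓ := (Nat.lt_pow_self (by omega)).le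
  have hdN : d ≤ (d + 1) ^ ℓ := (Nat.le_succ d).trans (Nat.le_self_pow (by omega) _)
  refine ⟨by omega, ?_, ?_, ?_⟩
  · have : a ≤ 16 * a * t * (d + 1) := by
      calc a = a * 1 := by ring
        _ ≤ a * (16 * t * (d + 1)) := Nat.mul_le_mul_left _ (by
          have : 0 < 16 * t * (d + 1) := by positivity
          omega)
        _ = _ := by ring
    omega
  · have : t ≤ 16 * a * t * (d + 1) := by
      calc t = t * 1 := by ring
        _ ≤ t * (16 * a * (d + 1)) := Nat.mul_le_mul_left _ (by
          have : 0 < 16 * a * (d + 1) := by positivity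
          omega)
        _ = _ := by ring
    omega
  · exact Nat.le_mul_of_pos_left _ (by positivity)

/-- The learning algorithm halts in polynomial time with the average of the descent, shifted by the
best threshold. -/
theorem exec_learner : ∃ c k : ℕ, ∀ {d ℓ : ℕ} {A ε δ Q : ℝ} (_ : 1 ≤ d) (_ : 1 ≤ ℓ) (_ : 1 ≤ A)
    (_ : 0 < ε) (_ : 0 < δ) (_ : δ < 1) (_ : 1 ≤ Q) {X : Set (Fin d → ℝ)} {M : ℕ}
    (S : Fin M → X × ℤˣ) (ω : ℕ → X), ∃ (t : ℕ) (s : Memory),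
      Exec (fun k => (ω k).1) learner (initialMemory ℓ A ε δ Q S) t s ∧
      t ≤ c * (scaleParam d ℓ A ε δ Q + M + 1) ^ k ∧
      ∃ θ, (dataProblem ℓ (scaleParam d ℓ A ε δ Q) S ω).IsBestThreshold
          (scaleParam d ℓ A ε δ Q ^ 26) (scaleParam d ℓ A ε δ Q ^ 3) θ ∧
        ∀ q < (d + 1) ^ ℓ, s.real q = (dataProblem ℓ (scaleParam d ℓ A ε δ Q) S ω).avgL
          (scaleParam d ℓ A ε δ Q ^ 26) (scaleParam d ℓ A ε δ Q ^ 30 + M + q) -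
            if q = 0 then θ else 0 := by
  obtain ⟨c1, k1, hc1⟩ := Cmd.time_le Cmd.paramCmd
  obtain ⟨c2, k2, hc2⟩ := Cmd.time_le Cmd.learnCmd
  refine ⟨100 + c1 * 2 ^ k1 + c2 * 3 ^ k2, 1 + k1 + 30 * k2, ?_⟩
  intro d ℓ A ε δ Q hd hℓ hA hε hδ hδ1 hQ X M S ω
  obtain ⟨z1, z2, z3, z4⟩ := le_scaleParam hd hℓ hA hε hδ hδ1 hQ
  set Z := scaleParam d ℓ A ε δ Q with hZ
  set s0 := initialMemory ℓ A ε δ Q S with hs0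
  have hlow : ∀ r (hr : r < M), ∀ c (hc : c < d),
      s0.real (4 + r * (d + 1) + c) = (S ⟨r, hr⟩).1.1 ⟨c, hc⟩ := by
    intro r hr c hc
    have e1 : 4 + r * (d + 1) + c = (c + r * (d + 1)) + 4 := by ring
    have e2 : (c + r * (d + 1)) / (d + 1) = r := by
      rw [Nat.add_mul_div_right _ _ (by omega), Nat.div_eq_of_lt (by omega), Nat.zero_add]
    have e3 : (c + r * (d + 1)) % (d + 1) = c := by
      rw [Nat.add_mul_mod_self_right, Nat.mod_eq_of_lt (by omega)]
    rw [e1]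
    simp only [hs0, initialMemory, e2, e3, hr, hc, dif_pos]
  have hlab : ∀ r (hr : r < M), s0.real (4 + r * (d + 1) + d) = (((S ⟨r, hr⟩).2 : ℤ) : ℝ) := by
    intro r hr
    have e1 : 4 + r * (d + 1) + d = (d + r * (d + 1)) + 4 := by ring
    have e2 : (d + r * (d + 1)) / (d + 1) = r := by
      rw [Nat.add_mul_div_right _ _ (by omega), Nat.div_eq_of_lt (by omega), Nat.zero_add]
    have e3 : (d + r * (d + 1)) % (d + 1) = d := by
      rw [Nat.add_mul_mod_self_right, Nat.mod_eq_of_lt (by omega)]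
    rw [e1]
    simp only [hs0, initialMemory, e2, e3, hr, dif_pos]
    rw [dif_neg (lt_irrefl d)]
  have hzero : ∀ i, 4 + M * (d + 1) ≤ i → s0.real i = 0 := by
    intro i hi
    obtain ⟨j, rfl⟩ := Nat.exists_eq_add_of_le' (show 4 ≤ i by omega)
    have : ¬ j / (d + 1) < M := by
      rw [Nat.div_lt_iff_lt_mul (by omega)]; omega
    simp only [hs0, initialMemory, this, dif_neg, not_false_eq_true]
  obtain ⟨ta, hta, exa⟩ := exec_countUp (ω := fun k => (ω k).1) 7 (.get (.const 0)) s0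
    (fun x => rfl) rfl
  set s1 := s0.setN 7 ⌈(RExp.get (.const 0)).eval s0⌉₊ with hs1
  obtain ⟨te, hte, exe⟩ := exec_countUp (ω := fun k => (ω k).1) 8
    (.div (.get (.const 3)) (.get (.const 1))) s1 (fun x => rfl) rfl
  set s2 := s1.setN 8 ⌈(RExp.div (.get (.const 3)) (.get (.const 1))).eval s1⌉₊ with hs2
  obtain ⟨tl, htl, exl⟩ := exec_logLoop (ω := fun k => (ω k).1) (s2.setN 10 1) rfl rfl
  set s3 := ((s2.setN 10 1).setN 10 (2 ^ Nat.clog 2 ⌈2 / (s2.setN 10 1).real 2⌉₊)).setN 9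
        (Nat.clog 2 ⌈2 / (s2.setN 10 1).real 2⌉₊) with hs3
  set s4 := s3.setN 4 ℓ with hs4
  have r4 : s4.real = s0.real := rfl
  have d4 : s4.drawn = 0 := rfl
  have n4 : s4.nat 0 = d ∧ s4.nat 1 = ℓ ∧ s4.nat 2 = M ∧ s4.nat 4 = ℓ ∧ s4.nat 7 = ⌈A⌉₊ ∧
      s4.nat 8 = ⌈Q / ε⌉₊ ∧ s4.nat 9 = logParam δ := by
    refine ⟨rfl, rfl, rfl, rfl, rfl, rfl, rfl⟩
  obtain ⟨n40, n41, n42, n44, n47, n48, n49⟩ := n4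
  -- During the computation of the parameters the cap is `ℓ`, the only loop count there.
  obtain ⟨tp, htp, exp'⟩ := Cmd.exec_toProgram (ω := fun k => (ω k).1) (p := Cmd.paramCmd)
    (by decide) (β := ℓ) s4 n44.le
  obtain ⟨p5, p6, p11, p15, pn, pr, pd⟩ := Cmd.run_paramCmd (ω := fun k => (ω k).1) n40 n41 n42
    n47 n48 n49 n44.ge
  set s5 := Cmd.run (fun k => (ω k).1) Cmd.paramCmd s4
  change s5.nat 6 = Z at p6
  change s5.nat 11 = Z ^ 30 at p11
  set s6 := s5.setN 3 (s5.nat 15 + s5.nat 0 + s5.nat 5) with hs6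
  set s7 := s6.setN 4 (s6.nat 11 + s6.nat 2 + s6.nat 6) with hs7
  have hZ1 : 1 ≤ Z := by omega
  have h26 : Z ^ 26 ≤ Z ^ 30 := Nat.pow_le_pow_right hZ1 (by norm_num)
  have h3 : Z ^ 3 ≤ Z ^ 30 := Nat.pow_le_pow_right hZ1 (by norm_num)
  have cap7 : s7.nat 4 = Z ^ 30 + M + Z := by
    simp [hs7, hs6, p11, p6, pn 2, n42]
  have base7 : s7.nat 3 = 4 + M * (d + 1) + d + (d + 1) ^ ℓ := by
    simp [hs7, hs6, p15, p5, pn 0, n40]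
  -- From here the cap is `Z ^ 30 + M + Z`, and `time_le` turns it into a polynomial step bound.
  obtain ⟨tm, htm, exm⟩ := Cmd.exec_toProgram (ω := fun k => (ω k).1) (p := Cmd.learnCmd)
    (by decide) (β := Z ^ 30 + M + Z) s7 cap7.le
  have r7 : s7.real = s0.real := pr.trans r4
  have hready : Cmd.Ready d ℓ (Z ^ 30) M ((d + 1) ^ ℓ) Z (inputRows (Z ^ 30) S ω) (inputLabels S) s7 :=
    { h0 := by simp [hs7, hs6, pn 0, n40]
      h1 := by simp [hs7, hs6, pn 1, n41]
      hM := by simp [hs7, hs6, pn 2, n42]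
      hbase := base7
      cap := by rw [cap7]; omega
      hN := by simp [hs7, hs6, p5]
      hN' := rfl
      hZ := by simp [hs7, hs6, p6]
      hT := by simp [hs7, hs6, p11]
      h15 := by simp [hs7, hs6, p15]
      point := fun r hr c hc => by
        have e : Z ^ 30 + r - Z ^ 30 = r := by omega
        rw [r7, hlow r hr c hc, inputRows, dif_pos hc, if_neg (by omega)]
        simp only [e, hr, dif_pos]
      label := fun r hr => by rw [r7, hlab r hr, inputLabels, dif_pos hr] }
  obtain ⟨θ, hθ, hout⟩ := Cmd.run_learnCmd (ω := fun k => (ω k).1) hready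
    (fun r hr c => by
      change (ω (s5.drawn + r)).1 c = _
      rw [pd, d4, Nat.zero_add, inputRows, dif_pos c.2, if_pos hr])
    (fun k _ i => by
      rw [Memory.arr, r7, hzero _ (by rw [base7]; omega)])
    (by rw [cap7]; omega) (by rw [cap7]; omega)
  refine ⟨_, _, .seq exa <| .seq exe <| .seq (.setNat _ _ _) <| .seq exl <| .seq (.setNat _ _ _) <|
    .seq exp' <| .seq (.setNat _ _ _) <| .seq (.setNat _ _ _) exm, ?_, θ, hθ, hout⟩
  have hta' : ta ≤ ⌈A⌉₊ * 12 + 6 := hta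
  have hte' : te ≤ ⌈Q / ε⌉₊ * 15 + 9 := hte
  have htl' : tl ≤ logParam δ * 21 + 9 := htl
  have htp' : tp ≤ c1 * 2 ^ k1 * (Z + M + 1) ^ k1 := by
    calc tp ≤ c1 * (d + ℓ + 1) ^ k1 := htp.trans (hc1 _ _)
      _ ≤ c1 * (2 * (Z + M + 1)) ^ k1 := by gcongr; omega
      _ = _ := by rw [mul_pow, mul_assoc]
  have htm' : tm ≤ c2 * 3 ^ k2 * (Z + M + 1) ^ (30 * k2) := by
    calc tm ≤ c2 * (d + (Z ^ 30 + M + Z) + 1) ^ k2 := htm.trans (hc2 _ _)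
      _ ≤ c2 * (3 * (Z + M + 1) ^ 30) ^ k2 := by
        gcongr
        have e1 : Z ^ 30 ≤ (Z + M + 1) ^ 30 := Nat.pow_le_pow_left (by omega) _
        have e2 : Z + M + 1 ≤ (Z + M + 1) ^ 30 := Nat.le_self_pow (by norm_num) _
        omega
      _ = _ := by rw [mul_pow, mul_assoc, pow_mul]
  have hone : 1 ≤ Z + M + 1 := by omega
  have b0 : Z + M + 1 ≤ (Z + M + 1) ^ (1 + k1 + 30 * k2) := Nat.le_self_pow (by omega) _
  have b1 : c1 * 2 ^ k1 * (Z + M + 1) ^ k1 ≤ c1 * 2 ^ k1 * (Z + M + 1) ^ (1 + k1 + 30 * k2) :=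
    Nat.mul_le_mul_left _ (Nat.pow_le_pow_right hone (by omega))
  have b2 : c2 * 3 ^ k2 * (Z + M + 1) ^ (30 * k2) ≤
      c2 * 3 ^ k2 * (Z + M + 1) ^ (1 + k1 + 30 * k2) :=
    Nat.mul_le_mul_left _ (Nat.pow_le_pow_right hone (by omega))
  simp only [NExp.cost, NExp.cell]
  rw [Nat.add_mul, Nat.add_mul]
  omega

/-! ### Convergence of the subgradient descent -/

namespace HingeProblem

variable (P : HingeProblem)

/-- The objective function, in terms of the values of the two linear functions at the rows. -/
noncomputable def obj (u l : ℕ → ℝ) : ℝ :=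
  ∑ r ∈ Finset.range P.R, P.w r * max 0 (P.a r - P.pu r * u r - P.pl r * l r)

/-- Sign and size conditions for a hinge problem. -/
structure Bounded (G : ℝ) : Prop where
  n_nonneg : ∀ j < P.N, 0 ≤ P.n j
  w_nonneg : ∀ r < P.R, 0 ≤ P.w r
  pu_le : ∀ r < P.R, |P.pu r| ≤ 1
  pl_le : ∀ r < P.R, |P.pl r| ≤ 1
  col : ∀ j < P.N, (∑ r ∈ Finset.range P.R, P.w r * |P.B r j|) ^ 2 ≤ G * P.n j
  α_pos : 0 < P.α
  G_nonneg : 0 ≤ G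

variable {P} {G : ℝ}

theorem active_nonneg (h : P.Bounded G) (c : (ℕ → ℝ) × (ℕ → ℝ)) {r : ℕ} (hr : r < P.R) :
    0 ≤ P.active c r := by
  unfold active; split_ifs
  · exact h.w_nonneg r hr
  · exact le_rfl

theorem active_le (h : P.Bounded G) (c : (ℕ → ℝ) × (ℕ → ℝ)) {r : ℕ} (hr : r < P.R) :
    P.active c r ≤ P.w r := by
  unfold active; split_ifs
  · exact le_rfl
  · exact h.w_nonneg r hr

/-- Active weights are at most the weights and `|p r| ≤ 1`, so the triangle inequality reduces this
to the column bound in `Bounded`. -/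
theorem sq_gradient_le (h : P.Bounded G) (c : (ℕ → ℝ) × (ℕ → ℝ)) {p : ℕ → ℝ}
    (hp : ∀ r < P.R, |p r| ≤ 1) {j : ℕ} (hj : j < P.N) :
    (∑ r ∈ Finset.range P.R, P.active c r * (p r * P.B r j)) ^ 2 ≤ G * P.n j := by
  refine le_trans (sq_le_sq.2 ?_) (h.col j hj)
  rw [abs_of_nonneg (Finset.sum_nonneg fun r hr => mul_nonneg
    (h.w_nonneg r (Finset.mem_range.1 hr)) (abs_nonneg _))]
  refine (Finset.abs_sum_le_sum_abs _ _).trans (Finset.sum_le_sum fun r hr => ?_)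
  have hr := Finset.mem_range.1 hr
  rw [abs_mul, abs_mul, abs_of_nonneg (active_nonneg h c hr)]
  refine mul_le_mul (active_le h c hr) ?_ (by positivity) (h.w_nonneg r hr)
  calc |p r| * |P.B r j| ≤ 1 * |P.B r j| := by gcongr; exact hp r hr
    _ = _ := one_mul _

/-- The scaled squared distance of two coefficient vectors. -/
noncomputable def dist (P : HingeProblem) (c a : ℕ → ℝ) : ℝ :=
  ∑ j ∈ Finset.range P.N, P.n j * (c j - a j) ^ 2

/-- Expanding the square in the metric with weights `n j`: dividing the gradient by `n j` makes the
cross term the plain pairing of `g` with `c - a`, and the quadratic term is at most `α ^ 2 * G` per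
column. -/
theorem dist_step (h : P.Bounded G) {c a g : ℕ → ℝ} (hg : ∀ j < P.N, g j ^ 2 ≤ G * P.n j) :
    P.dist (fun j => c j + P.α * (g j / P.n j)) a ≤
      P.dist c a + 2 * P.α * (∑ j ∈ Finset.range P.N, g j * (c j - a j)) + P.N * (P.α ^ 2 * G) := by
  unfold dist
  rw [Finset.mul_sum, ← Finset.sum_add_distrib, ← nsmul_eq_mul, ← Finset.card_range P.N,
    ← Finset.sum_const, Finset.card_range, ← Finset.sum_add_distrib]
  refine Finset.sum_le_sum fun j hj => ?_
  have hj := Finset.mem_range.1 hj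
  have hn := h.n_nonneg j hj
  have hgj := hg j hj
  rcases hn.eq_or_lt with h0 | h0
  -- A column that vanishes on the draws has scale `0`. The bound on `g j` then forces a zero
  -- gradient, and division by zero leaves the coefficient unchanged.
  · have g0 : g j = 0 := by
      rw [← h0, mul_zero] at hgj
      exact pow_eq_zero_iff (two_ne_zero) |>.1 (le_antisymm hgj (sq_nonneg _))
    rw [← h0, g0]
    have := h.G_nonneg
    simp only [zero_mul, mul_zero, add_zero, zero_add]
    positivity
  · have h1 : g j ^ 2 / P.n j ≤ G := by rwa [div_le_iff₀ h0]
    have h2 : P.n j * (c j + P.α * (g j / P.n j) - a j) ^ 2 = P.n j * (c j - a j) ^ 2 +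
        2 * P.α * (g j * (c j - a j)) + P.α ^ 2 * (g j ^ 2 / P.n j) := by
      field_simp; ring
    rw [h2]
    gcongr

/-- The subgradient inequality, row by row: an active hinge is affine at `c` and bounded below by
its affine part at `a`; an inactive one is `0` at `c` and nonnegative at `a`. -/
theorem gradient_le (h : P.Bounded G) (c a : (ℕ → ℝ) × (ℕ → ℝ)) :
    (∑ j ∈ Finset.range P.N, (∑ r ∈ Finset.range P.R, P.active c r * (P.pu r * P.B r j)) *
        (c.1 j - a.1 j)) +
      (∑ j ∈ Finset.range P.N, (∑ r ∈ Finset.range P.R, P.active c r * (P.pl r * P.B r j)) *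
        (c.2 j - a.2 j)) ≤
      P.obj (P.lin a.1) (P.lin a.2) - P.obj (P.lin c.1) (P.lin c.2) := by
  have key : ∀ (p : ℕ → ℝ) (x y : ℕ → ℝ),
      (∑ j ∈ Finset.range P.N, (∑ r ∈ Finset.range P.R, P.active c r * (p r * P.B r j)) *
        (x j - y j)) = ∑ r ∈ Finset.range P.R, P.active c r * (p r * (P.lin x r - P.lin y r)) := by
    intro p x y
    simp only [Finset.sum_mul]
    rw [Finset.sum_comm]
    refine Finset.sum_congr rfl fun r _ => ?_
    rw [lin, lin, ← Finset.sum_sub_distrib, Finset.mul_sum, Finset.mul_sum]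
    exact Finset.sum_congr rfl fun j _ => by ring
  rw [key, key, obj, obj, ← Finset.sum_add_distrib, ← Finset.sum_sub_distrib]
  refine Finset.sum_le_sum fun r hr => ?_
  have hw := h.w_nonneg r (Finset.mem_range.1 hr)
  unfold active
  split_ifs with hc
  · rw [max_eq_right hc.le]
    have := le_max_right 0 (P.a r - P.pu r * P.lin a.1 r - P.pl r * P.lin a.2 r)
    nlinarith [mul_le_mul_of_nonneg_left this hw]
  · rw [max_eq_left (not_lt.1 hc)]
    have := le_max_left 0 (P.a r - P.pu r * P.lin a.1 r - P.pl r * P.lin a.2 r)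
    simp only [zero_mul, add_zero, mul_zero, sub_zero]
    positivity

theorem descent_step (h : P.Bounded G) (a : (ℕ → ℝ) × (ℕ → ℝ)) (k : ℕ) :
    P.dist (P.descent (k + 1)).1 a.1 + P.dist (P.descent (k + 1)).2 a.2 ≤
      P.dist (P.descent k).1 a.1 + P.dist (P.descent k).2 a.2 +
      2 * P.α * (P.obj (P.lin a.1) (P.lin a.2) -
        P.obj (P.lin (P.descent k).1) (P.lin (P.descent k).2)) + 2 * (P.N * (P.α ^ 2 * G)) := by
  have h1 := dist_step h (c := (P.descent k).1) (a := a.1)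
    (fun j hj => sq_gradient_le h (P.descent k) h.pu_le hj)
  have h2 := dist_step h (c := (P.descent k).2) (a := a.2)
    (fun j hj => sq_gradient_le h (P.descent k) h.pl_le hj)
  have h3 := mul_le_mul_of_nonneg_left (gradient_le h (P.descent k) a)
    (show 0 ≤ 2 * P.α by have := h.α_pos; positivity)
  rw [mul_add] at h3
  change P.dist (P.next (P.descent k)).1 a.1 + P.dist (P.next (P.descent k)).2 a.2 ≤ _
  unfold next
  linarith

theorem dist_nonneg (h : P.Bounded G) (c a : ℕ → ℝ) : 0 ≤ P.dist c a :=
  Finset.sum_nonneg fun j hj =>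
    mul_nonneg (h.n_nonneg j (Finset.mem_range.1 hj)) (sq_nonneg _)

/-- The steps telescope and the final distance is nonnegative. -/
theorem sum_obj_le (h : P.Bounded G) (a : (ℕ → ℝ) × (ℕ → ℝ)) (K : ℕ) :
    2 * P.α * ∑ k ∈ Finset.range K, P.obj (P.lin (P.descent k).1) (P.lin (P.descent k).2) ≤
      P.dist 0 a.1 + P.dist 0 a.2 + K * (2 * P.α * P.obj (P.lin a.1) (P.lin a.2) +
        2 * (P.N * (P.α ^ 2 * G))) := by
  suffices H : P.dist (P.descent K).1 a.1 + P.dist (P.descent K).2 a.2 + 2 * P.α *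
      ∑ k ∈ Finset.range K, P.obj (P.lin (P.descent k).1) (P.lin (P.descent k).2) ≤
      P.dist 0 a.1 + P.dist 0 a.2 + K * (2 * P.α * P.obj (P.lin a.1) (P.lin a.2) +
        2 * (P.N * (P.α ^ 2 * G))) by
    have h1 := dist_nonneg h (P.descent K).1 a.1
    have h2 := dist_nonneg h (P.descent K).2 a.2
    linarith
  induction K with
  | zero => simp [descent]; exact le_rfl
  | succ K ih =>
    have := descent_step h a K
    rw [Finset.sum_range_succ]
    push_cast
    linarith

/-- Jensen's inequality, since every hinge function is convex in the two values. -/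
theorem obj_avg_le (h : P.Bounded G) {K : ℕ} (hK : 0 < K) :
    K * P.obj (P.avgU K) (P.avgL K) ≤
      ∑ k ∈ Finset.range K, P.obj (P.lin (P.descent k).1) (P.lin (P.descent k).2) := by
  have hK' : (0 : ℝ) < K := by exact_mod_cast hK
  unfold obj
  rw [Finset.sum_comm, Finset.mul_sum]
  refine Finset.sum_le_sum fun r hr => ?_
  rw [← Finset.mul_sum, mul_left_comm]
  refine mul_le_mul_of_nonneg_left ?_ (h.w_nonneg r (Finset.mem_range.1 hr))
  rw [mul_max_of_nonneg _ _ hK'.le, mul_zero]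
  refine max_le (Finset.sum_nonneg fun k _ => le_max_left _ _) ?_
  have e : (K : ℝ) * (P.a r - P.pu r * P.avgU K r - P.pl r * P.avgL K r) =
      ∑ k ∈ Finset.range K, (P.a r - P.pu r * P.lin (P.descent k).1 r -
        P.pl r * P.lin (P.descent k).2 r) := by
    rw [Finset.sum_sub_distrib, Finset.sum_sub_distrib, ← Finset.mul_sum, ← Finset.mul_sum, avgU,
      avgL]
    simp only [Finset.sum_const, Finset.card_range, nsmul_eq_mul]
    field_simp
  rw [e]
  exact Finset.sum_le_sum fun k _ => le_max_right _ _

/-- The average of the descent is nearly optimal. -/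
theorem obj_avg_le_obj (h : P.Bounded G) (a : (ℕ → ℝ) × (ℕ → ℝ)) {K : ℕ} (hK : 0 < K) :
    P.obj (P.avgU K) (P.avgL K) ≤ P.obj (P.lin a.1) (P.lin a.2) +
      (P.dist 0 a.1 + P.dist 0 a.2) / (2 * P.α * K) + P.N * (P.α * G) := by
  have hK' : (0 : ℝ) < K := by exact_mod_cast hK
  have hα := h.α_pos
  have h1 := sum_obj_le h a K
  have h2 := obj_avg_le h hK
  have h3 : 2 * P.α * (K * P.obj (P.avgU K) (P.avgL K)) ≤
      P.dist 0 a.1 + P.dist 0 a.2 + K * (2 * P.α * P.obj (P.lin a.1) (P.lin a.2) +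
        2 * (P.N * (P.α ^ 2 * G))) := le_trans (by gcongr) h1
  rw [← mul_le_mul_iff_right₀ (show 0 < 2 * P.α * K by positivity)]
  calc 2 * P.α * K * P.obj (P.avgU K) (P.avgL K) = 2 * P.α * (K * P.obj (P.avgU K) (P.avgL K)) := by
        ring
    _ ≤ _ := h3
    _ = _ := by field_simp; ring

/-- In the scaled coordinate `√n * c` a single step has length at most `α * √G`. This is an a priori
bound on the iterates, needed because uniform convergence holds only for polynomials of bounded
norm. -/
theorem n_mul_descent_le (h : P.Bounded G) (k : ℕ) {j : ℕ} (hj : j < P.N) :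
    √(P.n j) * |(P.descent k).1 j| ≤ k * (P.α * √G) ∧
      √(P.n j) * |(P.descent k).2 j| ≤ k * (P.α * √G) := by
  have hα := h.α_pos
  have key : ∀ (k : ℕ) (x g : ℝ), √(P.n j) * |x| ≤ k * (P.α * √G) → g ^ 2 ≤ G * P.n j →
      √(P.n j) * |x + P.α * (g / P.n j)| ≤ (k + 1 : ℕ) * (P.α * √G) := by
    intro k x g hx hg
    have hn := h.n_nonneg j hj
    have h1 : √(P.n j) * |g / P.n j| ≤ √G := by
      rcases hn.eq_or_lt with h0 | h0
      · rw [← h0]; simp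
      · rw [abs_div, abs_of_pos h0]
        have : |g| ≤ √G * √(P.n j) := by
          rw [← Real.sqrt_mul h.G_nonneg, ← Real.sqrt_sq_eq_abs]
          exact Real.sqrt_le_sqrt hg
        calc √(P.n j) * (|g| / P.n j) ≤ √(P.n j) * ((√G * √(P.n j)) / P.n j) := by gcongr
          _ = √G * ((√(P.n j) * √(P.n j)) / P.n j) := by ring
          _ = √G := by rw [Real.mul_self_sqrt hn, div_self h0.ne', mul_one]
    calc √(P.n j) * |x + P.α * (g / P.n j)| ≤ √(P.n j) * (|x| + |P.α * (g / P.n j)|) := by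
          gcongr; exact abs_add_le _ _
      _ = √(P.n j) * |x| + P.α * (√(P.n j) * |g / P.n j|) := by
          rw [abs_mul, abs_of_pos hα]; ring
      _ ≤ k * (P.α * √G) + P.α * √G := by gcongr
      _ = _ := by push_cast; ring
  induction k with
  | zero => simp [descent]
  | succ k ih =>
    exact ⟨key k _ _ ih.1 (sq_gradient_le h (P.descent k) h.pu_le hj),
      key k _ _ ih.2 (sq_gradient_le h (P.descent k) h.pl_le hj)⟩

/-- The average of the coefficient vectors of the descent. -/
noncomputable def avgCoeff (P : HingeProblem) (K : ℕ) : (ℕ → ℝ) × (ℕ → ℝ) :=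
  (fun j => (∑ k ∈ Finset.range K, (P.descent k).1 j) / K,
   fun j => (∑ k ∈ Finset.range K, (P.descent k).2 j) / K)

theorem lin_avg (P : HingeProblem) (K r : ℕ) (c : ℕ → ℕ → ℝ) :
    P.lin (fun j => (∑ k ∈ Finset.range K, c k j) / K) r =
      (∑ k ∈ Finset.range K, P.lin (c k) r) / K := by
  unfold lin
  rw [Finset.sum_comm, Finset.sum_div]
  refine Finset.sum_congr rfl fun j _ => ?_
  rw [← Finset.sum_mul, div_mul_eq_mul_div]

theorem avgU_eq (P : HingeProblem) (K r : ℕ) : P.avgU K r = P.lin (P.avgCoeff K).1 r :=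
  (lin_avg P K r fun k => (P.descent k).1).symm

theorem avgL_eq (P : HingeProblem) (K r : ℕ) : P.avgL K r = P.lin (P.avgCoeff K).2 r :=
  (lin_avg P K r fun k => (P.descent k).2).symm

theorem n_mul_avgCoeff_sq_le (h : P.Bounded G) {K : ℕ} (hK : 0 < K) {j : ℕ} (hj : j < P.N) :
    P.n j * (P.avgCoeff K).1 j ^ 2 ≤ (K * P.α) ^ 2 * G ∧
      P.n j * (P.avgCoeff K).2 j ^ 2 ≤ (K * P.α) ^ 2 * G := by
  have hα := h.α_pos
  have hK' : (0 : ℝ) < K := by exact_mod_cast hK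
  have key : ∀ c : ℕ → ℝ, (∀ k, √(P.n j) * |c k| ≤ k * (P.α * √G)) →
      P.n j * ((∑ k ∈ Finset.range K, c k) / K) ^ 2 ≤ (K * P.α) ^ 2 * G := by
    intro c hc
    have h1 : √(P.n j) * |(∑ k ∈ Finset.range K, c k) / K| ≤ K * P.α * √G := by
      rw [abs_div, abs_of_pos hK', ← mul_div_assoc, div_le_iff₀ hK']
      calc √(P.n j) * |∑ k ∈ Finset.range K, c k|
          ≤ √(P.n j) * ∑ k ∈ Finset.range K, |c k| := by
            gcongr; exact Finset.abs_sum_le_sum_abs _ _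
        _ = ∑ k ∈ Finset.range K, √(P.n j) * |c k| := Finset.mul_sum _ _ _
        _ ≤ ∑ k ∈ Finset.range K, K * (P.α * √G) := by
            refine Finset.sum_le_sum fun k hk => (hc k).trans ?_
            have : (k : ℝ) ≤ K := by exact_mod_cast (Finset.mem_range.1 hk).le
            gcongr
        _ = _ := by simp; ring
    have h2 := pow_le_pow_left₀ (by positivity) h1 2
    rwa [mul_pow, sq_abs, Real.sq_sqrt (h.n_nonneg j hj), mul_pow, Real.sq_sqrt h.G_nonneg] at h2
  exact ⟨key _ fun k => (n_mul_descent_le h k hj).1, key _ fun k => (n_mul_descent_le h k hj).2⟩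

/-! ### The threshold -/

end HingeProblem

/-- An open interval of length `y - x` contains at most `y - x + 1` integers. -/
theorem card_filter_range_le (G : ℕ) (x y : ℝ) :
    (((Finset.range G).filter fun g : ℕ => x < g ∧ (g : ℝ) < y).card : ℝ) ≤
      max 0 (y - x) + 1 := by
  have h1 : ((Finset.range G).filter fun g : ℕ => x < g ∧ (g : ℝ) < y).card ≤
      (Finset.Ioo ⌊x⌋ ⌈y⌉).card := by
    refine Finset.card_le_card_of_injOn (fun g : ℕ => (g : ℤ)) (fun g hg => ?_)
      (fun a _ b _ h => Int.ofNat_inj.1 h)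
    rw [Finset.mem_coe, Finset.mem_filter] at hg
    simp only [Finset.coe_Ioo, Set.mem_Ioo]
    exact ⟨Int.floor_lt.2 (by exact_mod_cast hg.2.1), Int.lt_ceil.2 (by exact_mod_cast hg.2.2)⟩
  rw [Int.card_Ioo] at h1
  have h2 : (((⌈y⌉ - ⌊x⌋ - 1).toNat : ℕ) : ℝ) ≤ max 0 (y - x) + 1 := by
    rcases le_total 0 (⌈y⌉ - ⌊x⌋ - 1) with h | h
    · have e : (((⌈y⌉ - ⌊x⌋ - 1).toNat : ℕ) : ℝ) = ((⌈y⌉ - ⌊x⌋ - 1 : ℤ) : ℝ) := by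
        exact_mod_cast Int.toNat_of_nonneg h
      rw [e]
      push_cast
      have := Int.ceil_lt_add_one y
      have := Int.lt_floor_add_one x
      have := le_max_right 0 (y - x)
      linarith
    · rw [Int.toNat_of_nonpos h]
      have := le_max_left 0 (y - x)
      push_cast; linarith
  exact le_trans (by exact_mod_cast h1) h2

namespace HingeProblem

variable {P : HingeProblem}

/-- Each row is of one of the three types: a positive example, a negative example, or an oracle
point. -/
def RowTypes (P : HingeProblem) : Prop :=
  ∀ r < P.R, P.pu r = 1 ∧ P.pl r = 0 ∧ P.a r = 1 ∨ P.pu r = 0 ∧ P.pl r = -1 ∧ P.a r = 1 ∨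
    P.pu r = -1 ∧ P.pl r = 1 ∧ P.a r = 0

open Classical in
-- The violating grid indices lie in an interval: to the right of `u` for a positive example, to the
-- left of `l` for a negative one, between `l` and `u` for a draw. Thresholds have spacing `2 / G`,
-- so a hinge of size `h` gives length `G * h / 2`. The margin `1 / G` and the ends of the grid add
-- at most `2`, and counting integers adds `1`.
theorem sum_count_row_le (hP : P.RowTypes) {r : ℕ} (hr : r < P.R) {G : ℕ} (hG : 0 < G) (u l : ℝ) :
    (∑ g ∈ Finset.range G, if P.pu r * (u - (2 * g / G - 1)) < 1 / G ∧
      P.pl r * (l - (2 * g / G - 1)) < 1 / G then (1 : ℝ) else 0) ≤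
      G * (max 0 (P.a r - P.pu r * u - P.pl r * l) / 2) + 3 := by
  have hG' : (0 : ℝ) < G := by exact_mod_cast hG
  rw [Finset.sum_boole]
  have main : ∀ x y : ℝ, (∀ g ∈ Finset.range G, (P.pu r * (u - (2 * g / G - 1)) < 1 / G ∧
      P.pl r * (l - (2 * g / G - 1)) < 1 / G) → x < g ∧ (g : ℝ) < y) →
      y - x ≤ G * ((P.a r - P.pu r * u - P.pl r * l) / 2) + 2 →
      (((Finset.range G).filter fun g : ℕ => P.pu r * (u - (2 * g / G - 1)) < 1 / G ∧
      P.pl r * (l - (2 * g / G - 1)) < 1 / G).card : ℝ) ≤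
      G * (max 0 (P.a r - P.pu r * u - P.pl r * l) / 2) + 3 := by
    intro x y h1 h2
    have h3 : ((Finset.range G).filter fun g : ℕ => P.pu r * (u - (2 * g / G - 1)) < 1 / G ∧
      P.pl r * (l - (2 * g / G - 1)) < 1 / G).card ≤
      ((Finset.range G).filter fun g : ℕ => x < g ∧ (g : ℝ) < y).card := by
      refine Finset.card_le_card fun g hg => ?_
      rw [Finset.mem_filter] at hg ⊢
      exact ⟨hg.1, h1 g hg.1 hg.2⟩
    have h4 := card_filter_range_le G x y
    have h5 : max 0 (y - x) ≤ G * (max 0 (P.a r - P.pu r * u - P.pl r * l) / 2) + 2 := by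
      refine max_le (by positivity) (h2.trans ?_)
      have := le_max_right 0 (P.a r - P.pu r * u - P.pl r * l)
      gcongr
    calc _ ≤ _ := (by exact_mod_cast h3 : _ ≤ (((Finset.range G).filter
          fun g : ℕ => x < g ∧ (g : ℝ) < y).card : ℝ))
      _ ≤ _ := h4
      _ ≤ _ := by linarith
  rcases hP r hr with ⟨e1, e2, e3⟩ | ⟨e1, e2, e3⟩ | ⟨e1, e2, e3⟩
  · refine main ((G * (1 + u) - 1) / 2) G (fun g hg ⟨h1, h2⟩ => ⟨?_, ?_⟩) ?_
    · rw [e1] at h1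
      have : (1 * (u - (2 * g / G - 1))) * G < 1 / G * G := by gcongr
      field_simp at this
      linarith
    · exact_mod_cast Finset.mem_range.1 hg
    · rw [e1, e2, e3]; linarith
  · refine main (-1) ((G * (1 + l) + 1) / 2) (fun g hg ⟨h1, h2⟩ => ⟨?_, ?_⟩) ?_
    · have : (0 : ℝ) ≤ g := by positivity
      linarith
    · rw [e2] at h2
      have : (-1 * (l - (2 * g / G - 1))) * G < 1 / G * G := by gcongr
      field_simp at this
      linarith
    · rw [e1, e2, e3]; linarith
  · refine main ((G * (1 + l) - 1) / 2) ((G * (1 + u) + 1) / 2) (fun g hg ⟨h1, h2⟩ => ⟨?_, ?_⟩) ?_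
    · rw [e2] at h2
      have : (1 * (l - (2 * g / G - 1))) * G < 1 / G * G := by gcongr
      field_simp at this
      linarith
    · rw [e1] at h1
      have : (-1 * (u - (2 * g / G - 1))) * G < 1 / G * G := by gcongr
      field_simp at this
      linarith
    · rw [e1, e2, e3]; linarith

theorem sum_count_le (hP : P.RowTypes) (hw : ∀ r < P.R, 0 ≤ P.w r) {G : ℕ} (hG : 0 < G)
    (u l : ℕ → ℝ) :
    ∑ g ∈ Finset.range G, P.count u l (1 / G) (2 * g / G - 1) ≤
      G * (P.obj u l / 2) + 3 * ∑ r ∈ Finset.range P.R, P.w r := by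
  unfold count obj
  rw [Finset.sum_comm, Finset.sum_div, Finset.mul_sum, Finset.mul_sum, ← Finset.sum_add_distrib]
  refine Finset.sum_le_sum fun r hr => ?_
  have hr := Finset.mem_range.1 hr
  have := mul_le_mul_of_nonneg_left (sum_count_row_le hP hr hG (u r) (l r)) (hw r hr)
  rw [Finset.mul_sum] at this
  simp only [mul_ite, mul_one, mul_zero] at this
  refine this.trans (le_of_eq ?_)
  ring

/-- The minimum over the grid is at most the average; `6` is `3` per row times the total weight `2`.
-/
theorem count_le_of_isBestThreshold (hP : P.RowTypes) (hw : ∀ r < P.R, 0 ≤ P.w r)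
    (hw2 : ∑ r ∈ Finset.range P.R, P.w r ≤ 2) {G K : ℕ} (hG : 0 < G) {θ : ℝ}
    (hθ : P.IsBestThreshold K G θ) :
    |θ| ≤ 1 ∧ P.count (P.avgU K) (P.avgL K) (1 / G) θ ≤
      P.obj (P.avgU K) (P.avgL K) / 2 + 6 / G := by
  obtain ⟨b, hb, hθ⟩ := hθ
  have hG' : (0 : ℝ) < G := by exact_mod_cast hG
  have h1 : b ≤ P.obj (P.avgU K) (P.avgL K) / 2 + 6 / G := by
    have h2 : ∑ g ∈ Finset.range G, b ≤ _ := (Finset.sum_le_sum fun g hg =>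
      hb g (Finset.mem_range.1 hg)).trans (sum_count_le hP hw hG (P.avgU K) (P.avgL K))
    rw [Finset.sum_const, Finset.card_range, nsmul_eq_mul] at h2
    rw [← mul_le_mul_iff_right₀ hG']
    calc G * b ≤ _ := h2
      _ ≤ G * (P.obj (P.avgU K) (P.avgL K) / 2) + 3 * 2 := by gcongr
      _ = _ := by field_simp; ring
  rcases hθ with ⟨h3, -⟩ | ⟨g, hg, rfl, h4⟩
  -- The initial value `3` cannot have survived: every count is at most the total weight `2`.
  · exfalso
    have h5 := hb 0 hG
    have h6 : P.count (P.avgU K) (P.avgL K) (1 / G) (2 * (0 : ℕ) / G - 1) ≤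
        ∑ r ∈ Finset.range P.R, P.w r := by
      refine Finset.sum_le_sum fun r hr => ?_
      split_ifs
      · exact le_rfl
      · exact hw r (Finset.mem_range.1 hr)
    linarith
  · refine ⟨?_, h4 ▸ h1⟩
    have : (g : ℝ) ≤ G := by exact_mod_cast hg.le
    have h7 : (2 : ℝ) * g / G ≤ 2 := by rw [div_le_iff₀ hG']; linarith
    have h8 : (0 : ℝ) ≤ 2 * g / G := by positivity
    rw [abs_le]; constructor <;> linarith

end HingeProblem

/-! ### Gram–Schmidt orthogonalization -/

theorem colDot_comm (T : ℕ) (V : ℕ → ℕ → ℝ) (i j : ℕ) : colDot T V i j = colDot T V j i := by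
  simp only [colDot, mul_comm]

theorem colDot_self_nonneg (T : ℕ) (V : ℕ → ℕ → ℝ) (i : ℕ) : 0 ≤ colDot T V i i :=
  div_nonneg (Finset.sum_nonneg fun _ _ => mul_self_nonneg _) (Nat.cast_nonneg _)

/-- A column of norm zero vanishes on the first `T` rows, so dividing by its norm in `colElim` is
harmless. -/
theorem colDot_eq_zero_of_self {T : ℕ} {V : ℕ → ℕ → ℝ} {i : ℕ} (h : colDot T V i i = 0) (j : ℕ) :
    colDot T V i j = 0 := by
  unfold colDot at *
  rcases div_eq_zero_iff.1 h with h | h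
  · have := (Finset.sum_eq_zero_iff_of_nonneg fun r _ => mul_self_nonneg (V r i)).1 h
    rw [Finset.sum_eq_zero fun r hr => by rw [mul_self_eq_zero.1 (this r hr), zero_mul], zero_div]
  · rw [h, div_zero]

theorem colDot_colElim_left {T : ℕ} {V : ℕ → ℕ → ℝ} {i j q : ℕ} (hq : q ≠ j) :
    colDot T (colElim T V j i) q j =
      colDot T V q j - colDot T V i j / colDot T V i i * colDot T V q i := by
  unfold colElim
  generalize colDot T V i j / colDot T V i i = k
  simp only [colDot, if_neg hq, if_true]
  rw [← mul_div_assoc, ← sub_div, Finset.mul_sum, ← Finset.sum_sub_distrib]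
  congr 1
  exact Finset.sum_congr rfl fun r _ => by ring

/-- Eliminating column `i` subtracts a multiple of a column that is orthogonal to all earlier `q`,
so the orthogonality already achieved is kept. -/
theorem colDot_colReduce {T : ℕ} {V : ℕ → ℕ → ℝ} {j : ℕ}
    (h : ∀ a < j, ∀ b < j, a ≠ b → colDot T V a b = 0) {i : ℕ} (hi : i ≤ j) :
    ∀ q < i, colDot T (colReduce T V j i) q j = 0 := by
  have other : ∀ i, ∀ a ≠ j, ∀ b ≠ j, colDot T (colReduce T V j i) a b = colDot T V a b := by
    intro i a ha b hb
    exact colDot_congr (fun r _ => colReduce_of_ne T V j i r a ha)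
      (fun r _ => colReduce_of_ne T V j i r b hb)
  induction i with
  | zero => intro q hq; omega
  | succ i ih =>
    intro q hq
    rw [colReduce, colDot_colElim_left (by omega)]
    rcases Nat.lt_succ_iff_lt_or_eq.1 hq with hq | rfl
    · rw [ih (by omega) q hq, other i q (by omega) i (by omega),
        h q (by omega) i (by omega) (by omega)]
      ring
    · by_cases h0 : colDot T (colReduce T V j q) q q = 0
      · rw [colDot_eq_zero_of_self h0, h0]; ring
      · rw [div_mul_cancel₀ _ h0, sub_self]

theorem colDot_gramSchmidtCols (T : ℕ) (V : ℕ → ℕ → ℝ) (N : ℕ) :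
    ∀ a < N, ∀ b < N, a ≠ b → colDot T (gramSchmidtCols T V N) a b = 0 := by
  induction N with
  | zero => intro a ha; omega
  | succ j ih =>
    have key := colDot_colReduce ih le_rfl
    intro a ha b hb hab
    rw [gramSchmidtCols]
    rcases Nat.lt_succ_iff_lt_or_eq.1 ha with ha | rfl
    · rcases Nat.lt_succ_iff_lt_or_eq.1 hb with hb | rfl
      · rw [← ih a ha b hb hab]
        exact colDot_congr (fun r _ => colReduce_of_ne _ _ _ _ r a (by omega))
          (fun r _ => colReduce_of_ne _ _ _ _ r b (by omega))
      · exact key a ha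
    · rw [colDot_comm]
      exact key b (by omega)

/-- A property of matrices that is preserved by the column operations holds after
orthogonalization. -/
theorem gramSchmidtCols_induction {T : ℕ} {V : ℕ → ℕ → ℝ} {N : ℕ} {p : (ℕ → ℕ → ℝ) → Prop}
    (h0 : p V) (hs : ∀ W, p W → ∀ j < N, ∀ i < j, p (colElim T W j i)) :
    p (gramSchmidtCols T V N) := by
  have main : ∀ n ≤ N, p (gramSchmidtCols T V n) := by
    intro n
    induction n with
    | zero => exact fun _ => h0
    | succ j ih =>
      intro hj
      have : ∀ i ≤ j, p (colReduce T (gramSchmidtCols T V j) j i) := by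
        intro i
        induction i with
        | zero => exact fun _ => ih (by omega)
        | succ i ih => exact fun hi => hs _ (ih (by omega)) j (by omega) i (by omega)
      exact this j le_rfl
  exact main N le_rfl

/-- Linear relations between the rows are preserved. -/
theorem gramSchmidtCols_row {T N R r : ℕ} {V : ℕ → ℕ → ℝ} {φ : ℕ → ℝ}
    (h : ∀ q < N, V r q = ∑ s ∈ Finset.range N, φ s * V (R + s) q) {q : ℕ} (hq : q < N) :
    gramSchmidtCols T V N r q = ∑ s ∈ Finset.range N, φ s * gramSchmidtCols T V N (R + s) q := by
  refine gramSchmidtCols_induction (T := T) (V := V) (N := N)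
    (p := fun W => ∀ q < N, W r q = ∑ s ∈ Finset.range N, φ s * W (R + s) q) h ?_ q hq
  intro W hW j hj i hi q hq
  unfold colElim
  split_ifs
  · rw [hW j hj, hW i (by omega), Finset.mul_sum, ← Finset.sum_sub_distrib]
    exact Finset.sum_congr rfl fun s _ => by ring
  · exact hW q hq

/-- The column space is preserved. -/
theorem gramSchmidtCols_span (T : ℕ) (V : ℕ → ℕ → ℝ) (N : ℕ) (c : ℕ → ℝ) :
    ∃ a : ℕ → ℝ, ∀ r, ∑ q ∈ Finset.range N, c q * V r q =
      ∑ q ∈ Finset.range N, a q * gramSchmidtCols T V N r q := by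
  refine gramSchmidtCols_induction (T := T) (V := V) (N := N)
    (p := fun W => ∃ a : ℕ → ℝ, ∀ r, ∑ q ∈ Finset.range N, c q * V r q =
      ∑ q ∈ Finset.range N, a q * W r q) ⟨c, fun r => rfl⟩ ?_
  rintro W ⟨a, ha⟩ j hj i hi
  unfold colElim
  generalize colDot T W i j / colDot T W i i = k
  -- Column `j` has become `W_j - k W_i`, so the coefficient of column `i` must absorb `k * a j`.
  refine ⟨fun q => a q + if q = i then k * a j else 0, fun r => ?_⟩
  rw [ha r]
  have e : ∀ q, (a q + if q = i then k * a j else 0) * (if q = j then W r j - k * W r i else W r q)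
      = a q * W r q + ((if q = i then k * a j * W r i else 0) -
        if q = j then a j * k * W r i else 0) := by
    intro q
    by_cases h1 : q = j
    · subst h1
      rw [if_pos rfl, if_neg (by omega), if_neg (by omega), if_pos rfl]; ring
    · rw [if_neg h1, if_neg h1]
      split_ifs with h2
      · subst h2; ring
      · ring
  simp only [e]
  rw [Finset.sum_add_distrib, Finset.sum_sub_distrib, Finset.sum_ite_eq', Finset.sum_ite_eq',
    if_pos (Finset.mem_range.2 (by omega)), if_pos (Finset.mem_range.2 hj)]
  ring

/-- Pythagoras for the empirical inner product. -/
theorem mean_sq_of_orthogonal {T N : ℕ} {W : ℕ → ℕ → ℝ}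
    (h : ∀ a < N, ∀ b < N, a ≠ b → colDot T W a b = 0) (a : ℕ → ℝ) :
    (∑ r ∈ Finset.range T, (∑ q ∈ Finset.range N, a q * W r q) ^ 2) / T =
      ∑ q ∈ Finset.range N, colDot T W q q * a q ^ 2 := by
  have e : ∀ r, (∑ q ∈ Finset.range N, a q * W r q) ^ 2 =
      ∑ q ∈ Finset.range N, ∑ s ∈ Finset.range N, a q * a s * (W r q * W r s) := fun r => by
    rw [sq, Finset.sum_mul_sum]
    exact Finset.sum_congr rfl fun q _ => Finset.sum_congr rfl fun s _ => by ring
  simp only [e]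
  rw [Finset.sum_comm, Finset.sum_div]
  refine Finset.sum_congr rfl fun q hq => ?_
  rw [Finset.sum_comm, Finset.sum_div, Finset.sum_eq_single q]
  · rw [← Finset.mul_sum, mul_div_assoc]; unfold colDot; ring
  · intro s hs hsq
    rw [← Finset.mul_sum, mul_div_assoc]
    have := h q (Finset.mem_range.1 hq) s (Finset.mem_range.1 hs) hsq.symm
    unfold colDot at this
    rw [this, mul_zero]
  · exact fun h => absurd hq h

/-- The polynomial with coefficient vector `c` at the point `x`. -/
noncomputable def polyVal (d ℓ : ℕ) (c : ℕ → ℝ) (x : ℕ → ℝ) : ℝ :=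
  ∑ s ∈ Finset.range ((d + 1) ^ ℓ), c s * mono d x ℓ s

/-! ### The data satisfy the conditions for descent and threshold choice -/

section InputProblem

variable {d ℓ T M Z : ℕ} {xs : ℕ → ℕ → ℝ} {y : ℕ → ℝ}

/-- Before orthogonalization each data row is the combination of the identity rows with its own
monomials as coefficients. Column operations preserve linear relations between rows. -/
theorem inputProblem_row {r q : ℕ} (hr : r < T + M) (hq : q < (d + 1) ^ ℓ) :
    (inputProblem d ℓ T M Z xs y).B r q =
      polyVal d ℓ (fun s => (inputProblem d ℓ T M Z xs y).B (T + M + s) q) (xs r) := by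
  refine (gramSchmidtCols_row (φ := mono d (xs r) ℓ) (R := T + M) (fun q hq => ?_) hq).trans ?_
  · unfold monoMatrix
    rw [if_pos hr, Finset.sum_eq_single q]
    · rw [if_neg (by omega), if_pos rfl, mul_one]
    · intro s _ hs
      rw [if_neg (by omega), if_neg (by omega), mul_zero]
    · exact fun h => absurd (Finset.mem_range.2 hq) h
  · exact Finset.sum_congr rfl fun s _ => mul_comm _ _

/-- Every polynomial is a combination of the columns. -/
theorem exists_lin_eq_polyVal (c : ℕ → ℝ) :
    ∃ a : ℕ → ℝ, ∀ r < T + M, (inputProblem d ℓ T M Z xs y).lin a r = polyVal d ℓ c (xs r) := by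
  obtain ⟨a, ha⟩ := gramSchmidtCols_span T (monoMatrix d ℓ (T + M) xs) ((d + 1) ^ ℓ) c
  refine ⟨a, fun r hr => ((ha r).symm.trans ?_)⟩
  exact Finset.sum_congr rfl fun s _ => by rw [monoMatrix, if_pos hr]

/-- Every combination of the columns is a polynomial, and its coefficients can be read off the
identity rows. -/
theorem lin_eq_polyVal (a : ℕ → ℝ) {r : ℕ} (hr : r < T + M) :
    (inputProblem d ℓ T M Z xs y).lin a r =
      polyVal d ℓ (fun s => (inputProblem d ℓ T M Z xs y).lin a (T + M + s)) (xs r) := by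
  unfold HingeProblem.lin polyVal
  simp only [Finset.sum_mul]
  rw [Finset.sum_comm]
  refine Finset.sum_congr rfl fun q hq => ?_
  rw [inputProblem_row hr (Finset.mem_range.1 hq), polyVal, Finset.mul_sum]
  exact Finset.sum_congr rfl fun s _ => by ring

/-- The metric of the descent is thus the empirical `L²` norm of polynomials on the draws. -/
theorem mean_sq_lin (a : ℕ → ℝ) :
    (∑ r ∈ Finset.range T, (inputProblem d ℓ T M Z xs y).lin a r ^ 2) / T =
      ∑ q ∈ Finset.range ((d + 1) ^ ℓ), (inputProblem d ℓ T M Z xs y).n q * a q ^ 2 :=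
  mean_sq_of_orthogonal (colDot_gramSchmidtCols T _ _) a

/-- A data row is kept if every column is of the order of its scale there. -/
def IsKept (P : HingeProblem) (Z r : ℕ) : Prop :=
  ∀ q < P.N, P.B r q ^ 2 ≤ (Z : ℝ) ^ 10 * P.n q

theorem inputProblem_w_lt {r : ℕ} (hr : r < T) :
    (inputProblem d ℓ T M Z xs y).w r = 1 / T := if_pos hr

theorem inputProblem_w_add_of_isKept {i : ℕ} (h : IsKept (inputProblem d ℓ T M Z xs y) Z (T + i)) :
    (inputProblem d ℓ T M Z xs y).w (T + i) = 1 / M :=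
  (if_neg (by omega)).trans (if_pos h)

theorem inputProblem_w_add_of_not_isKept {i : ℕ}
    (h : ¬ IsKept (inputProblem d ℓ T M Z xs y) Z (T + i)) :
    (inputProblem d ℓ T M Z xs y).w (T + i) = 0 :=
  (if_neg (by omega)).trans (if_neg h)

theorem inputProblem_w_nonneg (r : ℕ) : 0 ≤ (inputProblem d ℓ T M Z xs y).w r := by
  rcases lt_or_ge r T with h | h
  · rw [inputProblem_w_lt h]; positivity
  · obtain ⟨i, rfl⟩ := Nat.exists_eq_add_of_le h
    by_cases h : IsKept (inputProblem d ℓ T M Z xs y) Z (T + i)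
    · rw [inputProblem_w_add_of_isKept h]; positivity
    · rw [inputProblem_w_add_of_not_isKept h]

theorem inputProblem_w_add_le (i : ℕ) : (inputProblem d ℓ T M Z xs y).w (T + i) ≤ 1 / M := by
  by_cases h : IsKept (inputProblem d ℓ T M Z xs y) Z (T + i)
  · rw [inputProblem_w_add_of_isKept h]
  · rw [inputProblem_w_add_of_not_isKept h]; positivity

theorem inputProblem_sum_w_le :
    ∑ r ∈ Finset.range (T + M), (inputProblem d ℓ T M Z xs y).w r ≤ 2 := by
  rw [Finset.sum_range_add]
  have h1 : ∑ r ∈ Finset.range T, (inputProblem d ℓ T M Z xs y).w r ≤ 1 := by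
    rw [Finset.sum_congr rfl fun r hr => inputProblem_w_lt (Finset.mem_range.1 hr)]
    simp only [Finset.sum_const, Finset.card_range, nsmul_eq_mul]
    rw [mul_one_div]; exact div_self_le_one _
  have h2 : ∑ i ∈ Finset.range M, (inputProblem d ℓ T M Z xs y).w (T + i) ≤ 1 := by
    refine (Finset.sum_le_sum fun i _ => inputProblem_w_add_le i).trans ?_
    simp only [Finset.sum_const, Finset.card_range, nsmul_eq_mul]
    rw [mul_one_div]; exact div_self_le_one _
  linarith

theorem inputProblem_rowTypes (hy : ∀ i < M, y i = 1 ∨ y i = -1) :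
    (inputProblem d ℓ T M Z xs y).RowTypes := by
  intro r hr
  by_cases h : r < T
  · right; right
    exact ⟨if_pos h, if_pos h, if_pos h⟩
  · have hr' : r < T + M := hr
    have e1 : (inputProblem d ℓ T M Z xs y).pu r = (1 + y (r - T)) / 2 := if_neg h
    have e2 : (inputProblem d ℓ T M Z xs y).pl r = (y (r - T) - 1) / 2 := if_neg h
    have e3 : (inputProblem d ℓ T M Z xs y).a r = 1 := if_neg h
    rcases hy (r - T) (by omega) with e | e
    · left; rw [e1, e2, e3, e]; norm_num
    · right; left; rw [e1, e2, e3, e]; norm_num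

/-- The draws contribute at most `√n` to the column sum by Cauchy–Schwarz, since `n` is their mean
square. The kept examples contribute at most `Z ^ 5 * √n`, which is exactly what the filter
guarantees. Squaring `2 * Z ^ 5 * √n` gives `4 * Z ^ 10`. -/
theorem inputProblem_bounded (hZ : 1 ≤ Z) (hy : ∀ i < M, y i = 1 ∨ y i = -1) :
    (inputProblem d ℓ T M Z xs y).Bounded (4 * (Z : ℝ) ^ 10) := by
  have hZ' : (1 : ℝ) ≤ Z := by exact_mod_cast hZ
  have types := inputProblem_rowTypes (d := d) (ℓ := ℓ) (T := T) (Z := Z) (xs := xs) hy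
  refine ⟨fun j _ => colDot_self_nonneg _ _ _, fun r _ => inputProblem_w_nonneg r, ?_, ?_, ?_, ?_,
    by positivity⟩
  · intro r hr
    rcases types r hr with h | h | h <;> rw [h.1] <;> norm_num
  · intro r hr
    rcases types r hr with h | h | h <;> rw [h.2.1] <;> norm_num
  · intro j hj
    set P := inputProblem d ℓ T M Z xs y with hP
    have hn : 0 ≤ P.n j := colDot_self_nonneg _ _ _
    have h1 : ∑ r ∈ Finset.range T, P.w r * |P.B r j| ≤ Real.sqrt (P.n j) := by
      refine Real.le_sqrt_of_sq_le ?_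
      have e : ∑ r ∈ Finset.range T, P.w r * |P.B r j| =
          (∑ r ∈ Finset.range T, |P.B r j|) / T := by
        rw [Finset.sum_div]
        refine Finset.sum_congr rfl fun r hr => ?_
        rw [inputProblem_w_lt (Finset.mem_range.1 hr)]; ring
      rw [e, div_pow]
      have h := sq_sum_le_card_mul_sum_sq (s := Finset.range T) (f := fun r => |P.B r j|)
      rw [Finset.card_range] at h
      rcases Nat.eq_zero_or_pos T with h0 | h0
      · rw [h0] at *; simpa using hn
      · have h0' : (0 : ℝ) < T := by exact_mod_cast h0
        have e2 : P.n j = (∑ r ∈ Finset.range T, |P.B r j| ^ 2) / T := by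
          simp only [sq_abs]
          change colDot _ _ _ _ = _
          simp only [colDot, sq]; rfl
        rw [e2, div_le_div_iff₀ (by positivity) h0']
        calc _ ≤ (T * ∑ r ∈ Finset.range T, |P.B r j| ^ 2) * T := by gcongr
          _ = _ := by ring
    have h2 : ∑ i ∈ Finset.range M, P.w (T + i) * |P.B (T + i) j| ≤
        Z ^ 5 * Real.sqrt (P.n j) := by
      have : ∀ i ∈ Finset.range M, P.w (T + i) * |P.B (T + i) j| ≤
          1 / M * (Z ^ 5 * Real.sqrt (P.n j)) := by
        intro i _
        by_cases h : IsKept P Z (T + i)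
        · rw [inputProblem_w_add_of_isKept h]
          gcongr
          rw [← Real.sqrt_sq_eq_abs]
          refine (Real.sqrt_le_sqrt (h j hj)).trans (le_of_eq ?_)
          rw [Real.sqrt_mul (by positivity), show (Z : ℝ) ^ 10 = (Z ^ 5) ^ 2 by ring,
            Real.sqrt_sq (by positivity)]
        · rw [inputProblem_w_add_of_not_isKept h, zero_mul]; positivity
      refine (Finset.sum_le_sum this).trans ?_
      simp only [Finset.sum_const, Finset.card_range, nsmul_eq_mul]
      rw [← mul_assoc, mul_one_div]
      exact mul_le_of_le_one_left (by positivity) (div_self_le_one _)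
    change (∑ r ∈ Finset.range (T + M), P.w r * |P.B r j|) ^ 2 ≤ _
    rw [Finset.sum_range_add]
    have h3 : (1 : ℝ) ≤ Z ^ 5 := one_le_pow₀ hZ'
    have h4 : ∑ r ∈ Finset.range T, P.w r * |P.B r j| +
        ∑ i ∈ Finset.range M, P.w (T + i) * |P.B (T + i) j| ≤ 2 * Z ^ 5 * Real.sqrt (P.n j) := by
      nlinarith [Real.sqrt_nonneg (P.n j)]
    have h5 : 0 ≤ ∑ r ∈ Finset.range T, P.w r * |P.B r j| +
        ∑ i ∈ Finset.range M, P.w (T + i) * |P.B (T + i) j| :=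
      add_nonneg (Finset.sum_nonneg fun r _ => mul_nonneg (inputProblem_w_nonneg r) (abs_nonneg _))
        (Finset.sum_nonneg fun r _ => mul_nonneg (inputProblem_w_nonneg _) (abs_nonneg _))
    calc _ ≤ (2 * Z ^ 5 * Real.sqrt (P.n j)) ^ 2 := by gcongr
      _ = 4 * (Z ^ 10 * Real.sqrt (P.n j) ^ 2) := by ring
      _ = _ := by rw [Real.sq_sqrt hn]; ring
  · change (0 : ℝ) < 1 / (Z : ℝ) ^ 15
    positivity

end InputProblem

/-! ### What the learner guarantees -/

/-- The coordinates of a point as a sequence. -/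
def coords {d : ℕ} (x : Fin d → ℝ) (c : ℕ) : ℝ := if h : c < d then x ⟨c, h⟩ else 0

/-- The polynomial of degree at most `ℓ` with coefficient vector `c`. -/
noncomputable def polyFn {d : ℕ} (ℓ : ℕ) (c : Fin ((d + 1) ^ ℓ) → ℝ) (x : Fin d → ℝ) : ℝ :=
  ∑ s, c s * mono d (coords x) ℓ s

theorem polyVal_coords {d ℓ : ℕ} (c : ℕ → ℝ) (x : Fin d → ℝ) :
    polyVal d ℓ c (coords x) = polyFn ℓ (fun s => c s) x := Finset.sum_range _

theorem mono_zero {d : ℕ} (x : ℕ → ℝ) (k : ℕ) : mono d x k 0 = 1 := by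
  induction k with
  | zero => rfl
  | succ k ih => rw [mono_succ_of_lt x (by positivity), ih]

theorem homCoord_coords {d : ℕ} (x : Fin d → ℝ) (i : Fin (d + 1)) :
    homCoord (coords x) i = (Fin.cons 1 x : Fin (d + 1) → ℝ) i := by
  refine Fin.cases rfl (fun j => ?_) i
  rw [Fin.cons_succ, Fin.val_succ, homCoord, coords, dif_pos j.2]

theorem outputHypothesis_eq {d : ℕ} {X : Set (Fin d → ℝ)} {ℓ : ℕ} {s : Memory} {l : ℕ → ℝ} {θ : ℝ}
    (h : ∀ q < (d + 1) ^ ℓ, s.real q = l q - if q = 0 then θ else 0) (x : X) :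
    outputHypothesis X ℓ s x = if θ ≤ polyFn ℓ (fun q => l q) x.1 then 1 else -1 := by
  have e : ∑ σ : Fin ℓ → Fin (d + 1),
      s.real (finFunctionFinEquiv σ) * ∏ j, (Fin.cons 1 x.1 : Fin (d + 1) → ℝ) (σ j) =
      polyFn ℓ (fun q => l q) x.1 - θ := by
    have h1 : ∀ σ : Fin ℓ → Fin (d + 1),
        s.real (finFunctionFinEquiv σ) * ∏ j, (Fin.cons 1 x.1 : Fin (d + 1) → ℝ) (σ j) =
        s.real (finFunctionFinEquiv σ) * mono d (coords x.1) ℓ (finFunctionFinEquiv σ) := by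
      intro σ
      rw [mono_finFunctionFinEquiv]
      simp only [homCoord_coords]
    simp only [h1]
    rw [finFunctionFinEquiv.sum_comp (fun q => s.real q * mono d (coords x.1) ℓ q)]
    have h0 : 0 < (d + 1) ^ ℓ := by positivity
    have h2 : ∀ q : Fin ((d + 1) ^ ℓ), s.real q * mono d (coords x.1) ℓ q =
        l q * mono d (coords x.1) ℓ q - if q = ⟨0, h0⟩ then θ else 0 := by
      intro q
      rw [h q q.2]
      by_cases hq : (q : ℕ) = 0
      · rw [if_pos hq, if_pos (Fin.ext hq), hq, mono_zero]; ring
      · rw [if_neg hq, if_neg (fun h => hq (congrArg Fin.val h))]; ring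
    simp only [h2, Finset.sum_sub_distrib, Finset.sum_ite_eq', Finset.mem_univ, if_true]
    rfl
  unfold outputHypothesis
  rw [e]
  simp only [sub_nonneg]

/-- The pair of values `u`, `l` violates the label `y` at the threshold `θ`, up to `γ`. -/
def LabelViolated (γ θ u l : ℝ) (y : ℤˣ) : Prop := if y = 1 then u < θ + γ else θ - γ < l

/-- The hinge loss of the pair of values `u`, `l` for the label `y`. -/
noncomputable def labelHinge (u l : ℝ) (y : ℤˣ) : ℝ :=
  if y = 1 then max 0 (1 - u) else max 0 (1 + l)

/-- The mean of a function over the first `T` points of a sequence. -/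
noncomputable def refMean {α : Type*} (T : ℕ) (ω : ℕ → α) (f : α → ℝ) : ℝ :=
  (∑ r ∈ Finset.range T, f (ω r)) / T

/-! ### From hinge problems to polynomials on the data -/

section

variable {d : ℕ} {X : Set (Fin d → ℝ)} {M T : ℕ}

theorem inputRows_of_lt (S : Fin M → X × ℤˣ) (ω : ℕ → X) {r : ℕ} (hr : r < T) :
    inputRows T S ω r = coords (ω r).1 := by
  funext c
  unfold inputRows coords
  simp only [if_pos hr]

theorem inputRows_add (S : Fin M → X × ℤˣ) (ω : ℕ → X) (i : Fin M) :
    inputRows T S ω (T + i) = coords (S i).1.1 := by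
  funext c
  unfold inputRows coords
  have h1 : ¬ (T + (i : ℕ) < T) := by omega
  simp only [if_neg h1, Nat.add_sub_cancel_left, dif_pos i.2]

theorem inputLabels_coe (S : Fin M → X × ℤˣ) (i : Fin M) :
    inputLabels S i = (((S i).2 : ℤ) : ℝ) := by
  unfold inputLabels
  rw [dif_pos i.2]

theorem inputLabels_cases (S : Fin M → X × ℤˣ) (i : ℕ) (hi : i < M) :
    inputLabels S i = 1 ∨ inputLabels S i = -1 := by
  unfold inputLabels
  rw [dif_pos hi]
  rcases Int.units_eq_one_or (S ⟨i, hi⟩).2 with h | h <;> rw [h] <;> norm_num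

variable {ℓ Z : ℕ}

/-- Every column is itself a polynomial evaluated at the rows, so a point at which all polynomials
are moderate compared with their empirical norm passes the filter. -/
theorem dataProblem_sq_le (S : Fin M → X × ℤˣ) (ω : ℕ → X) (i : Fin M)
    (h : ∀ c, polyFn ℓ c (S i).1.1 ^ 2 ≤
      (Z : ℝ) ^ 10 * refMean (Z ^ 30) ω fun x => polyFn ℓ c x.1 ^ 2) :
    IsKept (dataProblem ℓ Z S ω) Z (Z ^ 30 + i) := by
  intro q hq
  have hi := i.2
  have e : ∀ r < Z ^ 30 + M, (dataProblem ℓ Z S ω).B r q = polyVal d ℓ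
      (fun s => (dataProblem ℓ Z S ω).B (Z ^ 30 + M + s) q) (inputRows (Z ^ 30) S ω r) :=
    fun r hr => inputProblem_row hr hq
  have h1 := h fun s => (dataProblem ℓ Z S ω).B (Z ^ 30 + M + s) q
  rw [← polyVal_coords (fun s => (dataProblem ℓ Z S ω).B (Z ^ 30 + M + s) q),
    ← inputRows_add (T := Z ^ 30) S ω, ← e _ (by omega)] at h1
  refine h1.trans (le_of_eq ?_)
  congr 1
  change _ = colDot _ _ _ _
  unfold refMean colDot
  congr 1
  refine Finset.sum_congr rfl fun r hr => ?_
  rw [Finset.mem_range] at hr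
  beta_reduce
  rw [← polyVal_coords (fun s => (dataProblem ℓ Z S ω).B (Z ^ 30 + M + s) q),
    ← inputRows_of_lt S ω hr, ← e _ (by omega), sq]
  rfl

/-- The hinge loss of the examples is counted in full on the right: filtered examples have weight
`0`, which only lowers the objective. -/
theorem obj_le_of_eq (S : Fin M → X × ℤˣ) (ω : ℕ → X) {u l : ℕ → ℝ} {cu cl : Fin ((d + 1) ^ ℓ) → ℝ}
    (hu : ∀ r < Z ^ 30 + M, u r = polyVal d ℓ (fun q => if h : q < _ then cu ⟨q, h⟩ else 0)
      (inputRows (Z ^ 30) S ω r))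
    (hl : ∀ r < Z ^ 30 + M, l r = polyVal d ℓ (fun q => if h : q < _ then cl ⟨q, h⟩ else 0)
      (inputRows (Z ^ 30) S ω r)) :
    (dataProblem ℓ Z S ω).obj u l ≤
      (∑ i, labelHinge (polyFn ℓ cu (S i).1.1) (polyFn ℓ cl (S i).1.1) (S i).2) / M +
      refMean (Z ^ 30) ω fun x => max 0 (polyFn ℓ cu x.1 - polyFn ℓ cl x.1) := by
  have ev : ∀ (c : Fin ((d + 1) ^ ℓ) → ℝ) (x : Fin d → ℝ),
      polyVal d ℓ (fun q => if h : q < _ then c ⟨q, h⟩ else 0) (coords x) = polyFn ℓ c x := by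
    intro c x
    rw [polyVal_coords]
    congr 1
    funext s
    rw [dif_pos s.2]
  unfold HingeProblem.obj
  change ∑ r ∈ Finset.range (Z ^ 30 + M), _ ≤ _
  rw [Finset.sum_range_add, add_comm]
  refine add_le_add ?_ (le_of_eq ?_)
  · rw [Finset.sum_range, Finset.sum_div]
    refine Finset.sum_le_sum fun i _ => ?_
    have hi := i.2
    have e1 : (dataProblem ℓ Z S ω).pu (Z ^ 30 + i) = (1 + inputLabels S i) / 2 :=
      (if_neg (by omega)).trans (by rw [Nat.add_sub_cancel_left])
    have e2 : (dataProblem ℓ Z S ω).pl (Z ^ 30 + i) = (inputLabels S i - 1) / 2 :=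
      (if_neg (by omega)).trans (by rw [Nat.add_sub_cancel_left])
    have e3 : (dataProblem ℓ Z S ω).a (Z ^ 30 + i) = 1 := if_neg (by omega)
    have e4 : max 0 ((dataProblem ℓ Z S ω).a (Z ^ 30 + i) - (dataProblem ℓ Z S ω).pu (Z ^ 30 + i) *
        u (Z ^ 30 + i) - (dataProblem ℓ Z S ω).pl (Z ^ 30 + i) * l (Z ^ 30 + i)) =
        labelHinge (polyFn ℓ cu (S i).1.1) (polyFn ℓ cl (S i).1.1) (S i).2 := by
      rw [hu _ (by omega), hl _ (by omega), e1, e2, e3, inputRows_add, ev, ev, inputLabels_coe]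
      unfold labelHinge
      rcases Int.units_eq_one_or (S i).2 with h | h <;> rw [h]
      · norm_num
      · norm_num
    rw [e4]
    have h0 : 0 ≤ labelHinge (polyFn ℓ cu (S i).1.1) (polyFn ℓ cl (S i).1.1) (S i).2 := by
      rw [← e4]; exact le_max_left _ _
    refine (mul_le_mul_of_nonneg_right (inputProblem_w_add_le _) h0).trans (le_of_eq ?_)
    ring
  · unfold refMean
    rw [Finset.sum_div]
    refine Finset.sum_congr rfl fun r hr => ?_
    rw [Finset.mem_range] at hr
    have e1 : (dataProblem ℓ Z S ω).pu r = -1 := if_pos hr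
    have e2 : (dataProblem ℓ Z S ω).pl r = 1 := if_pos hr
    have e3 : (dataProblem ℓ Z S ω).a r = 0 := if_pos hr
    have e4 : (dataProblem ℓ Z S ω).w r = 1 / ((Z ^ 30 : ℕ) : ℝ) := inputProblem_w_lt hr
    rw [hu _ (by omega), hl _ (by omega), e1, e2, e3, e4, inputRows_of_lt S ω hr, ev, ev]
    rw [one_div, div_eq_inv_mul]
    congr 2
    ring

open Classical in
-- Here the filter has to be kept: only kept examples are counted by the program. For either label,
-- the condition on the polynomial with factor `0` reads `0 < γ`, which is why `γ` must be positive.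
theorem le_count_of_eq (S : Fin M → X × ℤˣ) (ω : ℕ → X) {u l : ℕ → ℝ} {cu cl : ℕ → ℝ} (γ θ : ℝ)
    (hγ : 0 < γ)
    (hu : ∀ r < Z ^ 30 + M, u r = polyVal d ℓ cu (inputRows (Z ^ 30) S ω r))
    (hl : ∀ r < Z ^ 30 + M, l r = polyVal d ℓ cl (inputRows (Z ^ 30) S ω r)) :
    (∑ i : Fin M, if IsKept (dataProblem ℓ Z S ω) Z (Z ^ 30 + i) ∧
      LabelViolated γ θ (polyFn ℓ (fun q => cu q) (S i).1.1) (polyFn ℓ (fun q => cl q) (S i).1.1)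
        (S i).2 then (1 : ℝ) else 0) / M +
      refMean (Z ^ 30) ω (fun x => if polyFn ℓ (fun q => cl q) x.1 < θ + γ ∧
        θ - γ < polyFn ℓ (fun q => cu q) x.1 then 1 else 0) ≤
    (dataProblem ℓ Z S ω).count u l γ θ := by
  unfold HingeProblem.count
  change _ ≤ ∑ r ∈ Finset.range (Z ^ 30 + M), _
  rw [Finset.sum_range_add, add_comm]
  refine add_le_add (le_of_eq ?_) (le_of_eq ?_)
  · unfold refMean
    rw [Finset.sum_div]
    refine Finset.sum_congr rfl fun r hr => ?_
    rw [Finset.mem_range] at hr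
    have e1 : (dataProblem ℓ Z S ω).pu r = -1 := if_pos hr
    have e2 : (dataProblem ℓ Z S ω).pl r = 1 := if_pos hr
    have e4 : (dataProblem ℓ Z S ω).w r = 1 / ((Z ^ 30 : ℕ) : ℝ) := inputProblem_w_lt hr
    rw [hu _ (by omega), hl _ (by omega), e1, e2, e4, inputRows_of_lt S ω hr, polyVal_coords,
      polyVal_coords]
    have : (polyFn ℓ (fun q => cl q) (ω r).1 < θ + γ ∧ θ - γ < polyFn ℓ (fun q => cu q) (ω r).1) ↔
        (-1 * (polyFn ℓ (fun q => cu q) (ω r).1 - θ) < γ ∧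
          1 * (polyFn ℓ (fun q => cl q) (ω r).1 - θ) < γ) := by
      constructor <;> rintro ⟨h1, h2⟩ <;> constructor <;> linarith
    simp only [this]
    split_ifs <;> simp
  · rw [Finset.sum_range, Finset.sum_div]
    refine Finset.sum_congr rfl fun i _ => ?_
    have hi := i.2
    have e1 : (dataProblem ℓ Z S ω).pu (Z ^ 30 + i) = (1 + inputLabels S i) / 2 :=
      (if_neg (by omega)).trans (by rw [Nat.add_sub_cancel_left])
    have e2 : (dataProblem ℓ Z S ω).pl (Z ^ 30 + i) = (inputLabels S i - 1) / 2 :=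
      (if_neg (by omega)).trans (by rw [Nat.add_sub_cancel_left])
    rw [hu _ (by omega), hl _ (by omega), e1, e2, inputRows_add, polyVal_coords, polyVal_coords,
      inputLabels_coe]
    have : LabelViolated γ θ (polyFn ℓ (fun q => cu q) (S i).1.1)
        (polyFn ℓ (fun q => cl q) (S i).1.1) (S i).2 ↔
        ((1 + (((S i).2 : ℤ) : ℝ)) / 2 * (polyFn ℓ (fun q => cu q) (S i).1.1 - θ) < γ ∧
        ((((S i).2 : ℤ) : ℝ) - 1) / 2 * (polyFn ℓ (fun q => cl q) (S i).1.1 - θ) < γ) := by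
      unfold LabelViolated
      rcases Int.units_eq_one_or (S i).2 with h | h <;> rw [h]
      · norm_num
        constructor
        · intro h; exact ⟨by linarith, hγ⟩
        · intro h; linarith [h.1]
      · rw [if_neg (by decide)]
        norm_num
        constructor
        · intro h; exact ⟨hγ, by linarith⟩
        · intro h; linarith [h.2]
    rw [this]
    by_cases hk : IsKept (dataProblem ℓ Z S ω) Z (Z ^ 30 + i)
    · have e4 : (dataProblem ℓ Z S ω).w (Z ^ 30 + i) = 1 / M := inputProblem_w_add_of_isKept hk
      rw [e4]
      simp only [hk, true_and]
      split_ifs <;> simp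
    · have e4 : (dataProblem ℓ Z S ω).w (Z ^ 30 + i) = 0 := inputProblem_w_add_of_not_isKept hk
      rw [e4]
      simp only [hk, false_and, if_false]
      split_ifs <;> simp

open Classical in
/-- What is known about the polynomials `u`, `l` and the threshold `θ` that the learner finds. -/
structure Guarantee (ℓ Z : ℕ) (S : Fin M → X × ℤˣ) (ω : ℕ → X) (u l : Fin ((d + 1) ^ ℓ) → ℝ)
    (θ : ℝ) (κ : Fin M → Prop) : Prop where
  θ_le : |θ| ≤ 1
  u_le : (refMean (Z ^ 30) ω fun x => polyFn ℓ u x.1 ^ 2) ≤ (Z : ℝ) ^ 34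
  l_le : (refMean (Z ^ 30) ω fun x => polyFn ℓ l x.1 ^ 2) ≤ (Z : ℝ) ^ 34
  kept : ∀ i, (∀ c, polyFn ℓ c (S i).1.1 ^ 2 ≤
    (Z : ℝ) ^ 10 * refMean (Z ^ 30) ω fun x => polyFn ℓ c x.1 ^ 2) → κ i
  count : ∀ cu cl : Fin ((d + 1) ^ ℓ) → ℝ,
    (∑ i : Fin M, if κ i ∧ LabelViolated (1 / (Z : ℝ) ^ 3) θ (polyFn ℓ u (S i).1.1)
        (polyFn ℓ l (S i).1.1) (S i).2 then (1 : ℝ) else 0) / M +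
      refMean (Z ^ 30) ω (fun x => if polyFn ℓ l x.1 < θ + 1 / (Z : ℝ) ^ 3 ∧
        θ - 1 / (Z : ℝ) ^ 3 < polyFn ℓ u x.1 then 1 else 0) ≤
    ((∑ i, labelHinge (polyFn ℓ cu (S i).1.1) (polyFn ℓ cl (S i).1.1) (S i).2) / M +
      (refMean (Z ^ 30) ω fun x => max 0 (polyFn ℓ cu x.1 - polyFn ℓ cl x.1)) +
      ((refMean (Z ^ 30) ω fun x => polyFn ℓ cu x.1 ^ 2) +
        refMean (Z ^ 30) ω fun x => polyFn ℓ cl x.1 ^ 2) / (2 * (Z : ℝ) ^ 11) +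
      4 / (Z : ℝ) ^ 4) / 2 + 6 / (Z : ℝ) ^ 3

/-- With `K = Z ^ 26`, `α = Z ^ (-15)` and `G = 4 * Z ^ 10`, the error terms of the descent are the
squared norms over `2 * α * K = 2 * Z ^ 11` and `N * α * G ≤ 4 / Z ^ 4`. Each scaled coefficient of
the average has square at most `(K * α) ^ 2 * G = 4 * Z ^ 32`, whence the norm bound `Z ^ 34`. -/
theorem guarantee_of_isBestThreshold (S : Fin M → X × ℤˣ) (ω : ℕ → X) {θ : ℝ}
    (hZ : 4 ≤ Z) (hN : (d + 1) ^ ℓ ≤ Z)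
    (hθ : (dataProblem ℓ Z S ω).IsBestThreshold (Z ^ 26) (Z ^ 3) θ) :
    ∃ κ, Guarantee ℓ Z S ω
      (fun q => (dataProblem ℓ Z S ω).avgU (Z ^ 26) (Z ^ 30 + M + q))
      (fun q => (dataProblem ℓ Z S ω).avgL (Z ^ 26) (Z ^ 30 + M + q)) θ κ := by
  set P := dataProblem ℓ Z S ω with hP
  have hZ' : (4 : ℝ) ≤ Z := by exact_mod_cast hZ
  have hN' : (((d + 1) ^ ℓ : ℕ) : ℝ) ≤ Z := by exact_mod_cast hN
  have hb : P.Bounded (4 * (Z : ℝ) ^ 10) := inputProblem_bounded (by omega) (inputLabels_cases S)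
  have ht : P.RowTypes := inputProblem_rowTypes (inputLabels_cases S)
  have hK : 0 < Z ^ 26 := by positivity
  have hα : P.α = 1 / (Z : ℝ) ^ 15 := rfl
  have hmean : ∀ (a : ℕ → ℝ) (c : ℕ → ℝ), (∀ r < Z ^ 30 + M,
      P.lin a r = polyVal d ℓ c (inputRows (Z ^ 30) S ω r)) →
      (refMean (Z ^ 30) ω fun x => polyFn ℓ (fun q => c q) x.1 ^ 2) = P.dist 0 a := by
    intro a c h
    have := mean_sq_lin (d := d) (ℓ := ℓ) (T := Z ^ 30) (M := M) (Z := Z)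
      (xs := inputRows (Z ^ 30) S ω) (y := inputLabels S) a
    have e : P.dist 0 a = ∑ q ∈ Finset.range ((d + 1) ^ ℓ), P.n q * a q ^ 2 := by
      refine Finset.sum_congr rfl fun q _ => ?_
      simp only [Pi.zero_apply]; ring
    rw [e]
    refine Eq.trans ?_ this
    unfold refMean
    congr 1
    refine Finset.sum_congr rfl fun r hr => ?_
    rw [Finset.mem_range] at hr
    have h1 := h r (by omega)
    rw [inputRows_of_lt S ω hr, polyVal_coords] at h1
    beta_reduce
    rw [← h1]; rfl
  have bound : ∀ a : ℕ → ℝ, (∀ j < P.N, P.n j * a j ^ 2 ≤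
      (((Z ^ 26 : ℕ) : ℝ) * P.α) ^ 2 * (4 * (Z : ℝ) ^ 10)) → P.dist 0 a ≤ (Z : ℝ) ^ 34 := by
    intro a ha
    have e : P.dist 0 a = ∑ q ∈ Finset.range P.N, P.n q * a q ^ 2 := by
      refine Finset.sum_congr rfl fun q _ => ?_
      simp only [Pi.zero_apply]; ring
    have e2 : (((Z ^ 26 : ℕ) : ℝ) * P.α) ^ 2 * (4 * (Z : ℝ) ^ 10) = 4 * (Z : ℝ) ^ 32 := by
      rw [hα]; push_cast; field_simp
    rw [e2] at ha
    rw [e]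
    refine (Finset.sum_le_sum fun q hq => ha q (Finset.mem_range.1 hq)).trans ?_
    rw [Finset.sum_const, Finset.card_range, nsmul_eq_mul]
    calc (P.N : ℝ) * (4 * (Z : ℝ) ^ 32) ≤ Z * (Z * (Z : ℝ) ^ 32) := by gcongr; exact hN
      _ = _ := by ring
  have hu : ∀ r < Z ^ 30 + M, P.avgU (Z ^ 26) r = polyVal d ℓ
      (fun q => P.avgU (Z ^ 26) (Z ^ 30 + M + q)) (inputRows (Z ^ 30) S ω r) := by
    intro r hr
    simp only [HingeProblem.avgU_eq]
    exact lin_eq_polyVal _ hr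
  have hl : ∀ r < Z ^ 30 + M, P.avgL (Z ^ 26) r = polyVal d ℓ
      (fun q => P.avgL (Z ^ 26) (Z ^ 30 + M + q)) (inputRows (Z ^ 30) S ω r) := by
    intro r hr
    simp only [HingeProblem.avgL_eq]
    exact lin_eq_polyVal _ hr
  obtain ⟨h1, h2⟩ := HingeProblem.count_le_of_isBestThreshold ht
    (fun r _ => inputProblem_w_nonneg r) inputProblem_sum_w_le (by positivity) hθ
  refine ⟨fun i => IsKept P Z (Z ^ 30 + i), h1, ?_, ?_,
    fun i => dataProblem_sq_le S ω i, fun cu cl => ?_⟩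
  · rw [hmean (P.avgCoeff (Z ^ 26)).1 (fun q => P.avgU (Z ^ 26) (Z ^ 30 + M + q))
      (fun r hr => by rw [← HingeProblem.avgU_eq, hu r hr])]
    exact bound _ fun j hj => (HingeProblem.n_mul_avgCoeff_sq_le hb hK hj).1
  · rw [hmean (P.avgCoeff (Z ^ 26)).2 (fun q => P.avgL (Z ^ 26) (Z ^ 30 + M + q))
      (fun r hr => by rw [← HingeProblem.avgL_eq, hl r hr])]
    exact bound _ fun j hj => (HingeProblem.n_mul_avgCoeff_sq_le hb hK hj).2
  · have h3 := le_count_of_eq S ω (1 / (Z : ℝ) ^ 3) θ (by positivity) hu hl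
    rw [show 1 / ((Z ^ 3 : ℕ) : ℝ) = 1 / (Z : ℝ) ^ 3 by push_cast; rfl,
      show 6 / ((Z ^ 3 : ℕ) : ℝ) = 6 / (Z : ℝ) ^ 3 by push_cast; rfl] at h2
    refine (h3.trans h2).trans ?_
    obtain ⟨au, hau⟩ := exists_lin_eq_polyVal (d := d) (ℓ := ℓ) (T := Z ^ 30) (M := M) (Z := Z)
      (xs := inputRows (Z ^ 30) S ω) (y := inputLabels S)
      (fun q => if h : q < _ then cu ⟨q, h⟩ else 0)
    obtain ⟨al, hal⟩ := exists_lin_eq_polyVal (d := d) (ℓ := ℓ) (T := Z ^ 30) (M := M) (Z := Z)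
      (xs := inputRows (Z ^ 30) S ω) (y := inputLabels S)
      (fun q => if h : q < _ then cl ⟨q, h⟩ else 0)
    have h4 := HingeProblem.obj_avg_le_obj hb (au, al) hK
    have h5 := obj_le_of_eq S ω hau hal
    rw [← hmean au _ hau, ← hmean al _ hal] at h4
    have ec : ∀ c : Fin ((d + 1) ^ ℓ) → ℝ, (fun q : Fin ((d + 1) ^ ℓ) =>
        if h : (q : ℕ) < (d + 1) ^ ℓ then c ⟨q, h⟩ else 0) = c := fun c => by
      funext q; rw [dif_pos q.2]
    simp only [ec] at h4
    have e6 : 2 * P.α * ((Z ^ 26 : ℕ) : ℝ) = 2 * (Z : ℝ) ^ 11 := by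
      rw [hα]; push_cast; field_simp
    have e7 : (P.N : ℝ) * (P.α * (4 * (Z : ℝ) ^ 10)) ≤ 4 / (Z : ℝ) ^ 4 := by
      calc (P.N : ℝ) * (P.α * (4 * (Z : ℝ) ^ 10)) ≤ Z * (P.α * (4 * (Z : ℝ) ^ 10)) := by
            rw [hα]; gcongr; exact hN
        _ = _ := by rw [hα]; field_simp
    rw [e6] at h4
    have h8 : P.obj (P.avgU (Z ^ 26)) (P.avgL (Z ^ 26)) ≤ _ :=
      h4.trans (add_le_add (add_le_add h5 le_rfl) e7)
    linarith

end

/-- The learner halts in polynomial time with a hypothesis for which the guarantee holds. -/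
theorem exec_learner_guarantee : ∃ c k : ℕ, ∀ {d ℓ : ℕ} {A ε δ Q : ℝ} (_ : 1 ≤ d) (_ : 1 ≤ ℓ)
    (_ : 1 ≤ A) (_ : 0 < ε) (_ : 0 < δ) (_ : δ < 1) (_ : 1 ≤ Q) {X : Set (Fin d → ℝ)} {M : ℕ}
    (S : Fin M → X × ℤˣ) (ω : ℕ → X), ∃ (t : ℕ) (s : Memory),
      Exec (fun k => (ω k).1) learner (initialMemory ℓ A ε δ Q S) t s ∧
      t ≤ c * (scaleParam d ℓ A ε δ Q + M + 1) ^ k ∧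
      ∃ u l θ κ, Guarantee ℓ (scaleParam d ℓ A ε δ Q) S ω u l θ κ ∧
        ∀ x, outputHypothesis X ℓ s x = if θ ≤ polyFn ℓ l x.1 then 1 else -1 := by
  obtain ⟨c, k, h⟩ := exec_learner
  refine ⟨c, k, fun {d ℓ A ε δ Q} hd hℓ hA hε hδ hδ1 hQ X M S ω => ?_⟩
  obtain ⟨t, s, h1, h2, θ, h3, h4⟩ := h hd hℓ hA hε hδ hδ1 hQ S ω
  obtain ⟨z1, z2, z3, z4⟩ := le_scaleParam hd hℓ hA hε hδ hδ1 hQ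
  have hN : 1 ≤ (d + 1) ^ ℓ := Nat.one_le_pow _ _ (by omega)
  obtain ⟨κ, h5⟩ := guarantee_of_isBestThreshold S ω (by omega) (by omega) h3
  exact ⟨t, s, h1, h2, _, _, θ, κ, h5, fun x => outputHypothesis_eq
    (l := fun q => (dataProblem ℓ (scaleParam d ℓ A ε δ Q) S ω).avgL
      (scaleParam d ℓ A ε δ Q ^ 26) (scaleParam d ℓ A ε δ Q ^ 30 + M + q)) h4 x⟩

/-! ### Uniform deviation bounds -/

section Deviation

open ProbabilityTheory

variable {Ω W ι : Type*} [MeasurableSpace Ω] [MeasurableSpace W]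

/-- The random variables `Y i` are independent with law `μ`. -/
structure IsIID (P : Measure Ω) (Y : ι → Ω → W) (μ : Measure W) : Prop where
  indep : iIndepFun Y P
  law : ∀ i, MeasurePreserving (Y i) P μ

theorem isIID_pi [Fintype ι] (μ : Measure W) [IsProbabilityMeasure μ] :
    IsIID (Measure.pi fun _ : ι => μ) (fun i z => z i) μ where
  indep := iIndepFun_pi (X := fun _ w => w) fun _ => aemeasurable_id
  law i := measurePreserving_eval (fun _ : ι => μ) i

theorem isIID_infinitePi (μ : Measure W) [IsProbabilityMeasure μ] :
    IsIID (Measure.infinitePi fun _ : ι => μ) (fun i z => z i) μ where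
  indep := iIndepFun_infinitePi (X := fun _ w => w) fun _ => measurable_id
  law i := measurePreserving_eval_infinitePi (fun _ : ι => μ) i

variable {P : Measure Ω} [IsProbabilityMeasure P] {μ : Measure W} [IsProbabilityMeasure μ]
  {Y : ι → Ω → W}

/-- Hoeffding's inequality. -/
theorem IsIID.measure_sum_le (h : IsIID P Y μ) {f : W → ℝ} (hf : Measurable f)
    (hf0 : ∀ w, 0 ≤ f w) (hf1 : ∀ w, f w ≤ 1) (s : Finset ι) {τ : ℝ} (hτ : 0 ≤ τ) :
    P {ω | ∑ i ∈ s, f (Y i ω) + s.card * τ ≤ s.card * ∫ w, f w ∂μ} ≤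
      ENNReal.ofReal (Real.exp (-(2 * s.card * τ ^ 2))) := by
  set I := ∫ w, f w ∂μ with hI
  have hg : Measurable fun w => I - f w := measurable_const.sub hf
  have hind : iIndepFun (fun i ω => I - f (Y i ω)) P := h.indep.comp (fun _ w => I - f w)
    fun _ => hg
  have hsub : ∀ i ∈ s, HasSubgaussianMGF (fun ω => I - f (Y i ω))
      ((‖(I - 0) - (I - 1)‖₊ / 2) ^ 2) P := by
    intro i _
    refine hasSubgaussianMGF_of_mem_Icc_of_integral_eq_zero
      (hg.comp (h.law i).measurable).aemeasurable (Filter.Eventually.of_forall fun ω => ?_) ?_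
    · constructor
      · have := hf1 (Y i ω); linarith
      · have := hf0 (Y i ω); linarith
    · have hint : Integrable f μ := Integrable.of_bound hf.aestronglyMeasurable 1
        (Filter.Eventually.of_forall fun w => by
          rw [Real.norm_eq_abs, abs_of_nonneg (hf0 w)]; exact hf1 w)
      have h1 : ∫ ω, f (Y i ω) ∂P = I := by
        rw [hI, ← (h.law i).map_eq, integral_map (h.law i).measurable.aemeasurable
          hf.aestronglyMeasurable]
      have h2 : Integrable (fun ω => f (Y i ω)) P := (h.law i).integrable_comp_of_integrable hint
      rw [integral_sub (integrable_const _) h2, h1]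
      simp
  have key := HasSubgaussianMGF.measure_sum_ge_le_of_iIndepFun hind hsub
    (ε := s.card * τ) (by positivity)
  rw [← ENNReal.ofReal_toReal (measure_ne_top P _)]
  refine ENNReal.ofReal_le_ofReal ?_
  have e : {ω | ∑ i ∈ s, f (Y i ω) + s.card * τ ≤ s.card * I} =
      {ω | s.card * τ ≤ ∑ i ∈ s, (I - f (Y i ω))} := by
    ext ω
    simp only [Set.mem_ofPred_eq, Finset.sum_sub_distrib, Finset.sum_const, nsmul_eq_mul]
    constructor <;> intro h <;> linarith
  rw [e]
  refine key.trans (Real.exp_le_exp.2 (le_of_eq ?_))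
  -- Each summand lies in an interval of length `1`, hence has sub-Gaussian parameter `1 / 4`.
  have e2 : ((∑ i ∈ s, (‖(I - 0) - (I - 1)‖₊ / 2) ^ 2 : NNReal) : ℝ) = s.card / 4 := by
    rw [Finset.sum_const, nsmul_eq_mul]
    push_cast
    rw [show (I - 0) - (I - 1) = 1 by ring]
    norm_num
    ring
  rw [e2]
  rcases Nat.eq_zero_or_pos s.card with h0 | h0
  · rw [h0]; simp
  · have : (0 : ℝ) < s.card := by exact_mod_cast h0
    field_simp
    ring

/-- A uniform law of large numbers for a family of functions that depend in a Lipschitz way on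
parameters in a cube. -/
theorem IsIID.measure_exists_le {κ : Type*} [Fintype κ] (h : IsIID P Y μ)
    {f : (κ → ℝ) → W → ℝ} (hf : ∀ p, Measurable (f p)) {ρ L τ : ℝ}
    (hf0 : ∀ p, (∀ i, |p i| ≤ ρ) → ∀ w, 0 ≤ f p w) (hf1 : ∀ p, (∀ i, |p i| ≤ ρ) → ∀ w, f p w ≤ 1)
    (hρ : 0 ≤ ρ) (hτ : 0 ≤ τ)
    {k : ℕ} (hk : 0 < k) (hL : L * ρ / k ≤ τ)
    (hlip : ∀ p p' : κ → ℝ, ∀ η, 0 ≤ η → (∀ i, |p i| ≤ ρ) → (∀ i, |p' i| ≤ ρ) → (∀ i, |p i - p' i| ≤ η) →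
      ∀ w, |f p w - f p' w| ≤ L * η) (s : Finset ι) :
    P {ω | ∃ p : κ → ℝ, (∀ i, |p i| ≤ ρ) ∧
      ∑ i ∈ s, f p (Y i ω) + s.card * (3 * τ) ≤ s.card * ∫ w, f p w ∂μ} ≤
      ENNReal.ofReal ((2 * k + 1) ^ Fintype.card κ * Real.exp (-(2 * s.card * τ ^ 2))) := by
  classical
  have hk' : (0 : ℝ) < k := by exact_mod_cast hk
  -- The net is a grid with spacing `ρ / k`; rounding a parameter down to it changes the function by
  -- at most `L * ρ / k ≤ τ`. This is paid once in the integral and once in the sum, and with the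
  -- deviation at the grid point this gives `3 * τ`.
  let pt : (κ → Fin (2 * k + 1)) → κ → ℝ := fun g i => ρ * ((g i : ℕ) - k) / k
  have hin : ∀ g : ℕ, g ≤ 2 * k → |ρ * ((g : ℝ) - k) / k| ≤ ρ := by
    intro g hg
    have hg' : (g : ℝ) ≤ 2 * k := by exact_mod_cast hg
    rw [abs_div, abs_mul, abs_of_nonneg hρ, abs_of_pos hk', div_le_iff₀ hk']
    refine mul_le_mul_of_nonneg_left ?_ hρ
    rw [abs_le]
    constructor
    · have : (0 : ℝ) ≤ g := by positivity
      linarith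
    · linarith
  have hpt : ∀ g i, |pt g i| ≤ ρ := fun g i => hin _ (by omega)
  have hsub : {ω | ∃ p : κ → ℝ, (∀ i, |p i| ≤ ρ) ∧
      ∑ i ∈ s, f p (Y i ω) + s.card * (3 * τ) ≤ s.card * ∫ w, f p w ∂μ} ⊆
      ⋃ g ∈ (Finset.univ : Finset (κ → Fin (2 * k + 1))),
        {ω | ∑ i ∈ s, f (pt g) (Y i ω) + s.card * τ ≤ s.card * ∫ w, f (pt g) w ∂μ} := by
    rintro ω ⟨p, hp, hω⟩
    have hgrid : ∀ i, ∃ g : Fin (2 * k + 1), |p i - ρ * ((g : ℕ) - k) / k| ≤ ρ / k ∧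
        |ρ * ((g : ℕ) - k) / k| ≤ ρ := by
      intro i
      rcases hρ.eq_or_lt with h0 | h0
      · refine ⟨⟨0, by omega⟩, ?_, hin 0 (by omega)⟩
        have := hp i
        rw [← h0] at this ⊢
        simpa using this
      · have hx0 : 0 ≤ (p i / ρ + 1) * k := by
          have : -1 ≤ p i / ρ := by rw [le_div_iff₀ h0]; linarith [(abs_le.1 (hp i)).1]
          exact mul_nonneg (by linarith) hk'.le
        have hx1 : (p i / ρ + 1) * k ≤ (2 * k : ℕ) := by
          have : p i / ρ ≤ 1 := by rw [div_le_iff₀ h0]; linarith [(abs_le.1 (hp i)).2]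
          push_cast
          nlinarith
        have hfl := Nat.floor_le_of_le hx1
        refine ⟨⟨⌊(p i / ρ + 1) * k⌋₊, by omega⟩, ?_, hin _ hfl⟩
        have h1 := Nat.floor_le hx0
        have h2 := Nat.lt_floor_add_one ((p i / ρ + 1) * k)
        simp only
        have e : p i - ρ * ((⌊(p i / ρ + 1) * k⌋₊ : ℝ) - k) / k =
            ρ / k * ((p i / ρ + 1) * k - ⌊(p i / ρ + 1) * k⌋₊) := by
          field_simp
          ring
        rw [e, abs_mul, abs_of_nonneg (by positivity)]
        refine mul_le_of_le_one_right (by positivity) ?_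
        rw [abs_le]; constructor <;> linarith
    choose g hg1 hg2 using hgrid
    simp only [Set.mem_iUnion, Finset.mem_univ, exists_true_left]
    refine ⟨g, ?_⟩
    have hd : ∀ w, |f p w - f (pt g) w| ≤ τ := fun w =>
      (hlip p (pt g) (ρ / k) (by positivity) hp hg2 hg1 w).trans (by rw [← mul_div_assoc]; exact hL)
    have hint : ∀ p, (∀ i, |p i| ≤ ρ) → Integrable (f p) μ := fun p hp =>
      Integrable.of_bound (hf p).aestronglyMeasurable 1 (Filter.Eventually.of_forall fun w => by
        rw [Real.norm_eq_abs, abs_of_nonneg (hf0 p hp w)]; exact hf1 p hp w)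
    have hint' := hint _ (hpt g)
    have hI : ∫ w, f p w ∂μ ≤ ∫ w, f (pt g) w ∂μ + τ := by
      have : ∫ w, f p w ∂μ ≤ ∫ w, (f (pt g) w + τ) ∂μ :=
        integral_mono (hint p hp) (hint'.add (integrable_const _)) fun w => by
          have := (abs_le.1 (hd w)).2
          simp only; linarith
      rwa [integral_add hint' (integrable_const _), integral_const, probReal_univ,
        one_smul] at this
    have hS : ∑ i ∈ s, f (pt g) (Y i ω) ≤ ∑ i ∈ s, f p (Y i ω) + s.card * τ := by
      rw [← nsmul_eq_mul, ← Finset.sum_const, ← Finset.sum_add_distrib]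
      exact Finset.sum_le_sum fun i _ => by
        have := (abs_le.1 (hd (Y i ω))).1
        linarith
    have hI' : s.card * ∫ w, f p w ∂μ ≤ s.card * (∫ w, f (pt g) w ∂μ + τ) :=
      mul_le_mul_of_nonneg_left hI (Nat.cast_nonneg _)
    simp only [Set.mem_ofPred_eq]
    linarith
  refine (measure_mono hsub).trans ((measure_biUnion_finset_le _ _).trans ?_)
  refine (Finset.sum_le_sum fun g _ => h.measure_sum_le (hf (pt g)) (hf0 _ (hpt g))
    (hf1 _ (hpt g)) s hτ).trans ?_
  rw [Finset.sum_const, Finset.card_univ, Fintype.card_fun, Fintype.card_fin,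
    ENNReal.ofReal_mul (by positivity), nsmul_eq_mul]
  refine mul_le_mul_left (le_of_eq ?_) _
  rw [ENNReal.ofReal_pow (by positivity)]
  push_cast
  congr 1
  rw [ENNReal.ofReal_add (by positivity) (by positivity), ENNReal.ofReal_mul (by positivity)]
  simp

end Deviation

/-! ### Polynomials and hypercontractivity -/

section Polynomials

variable {d : ℕ}

theorem exists_mvPolynomial_mono (d k q : ℕ) : ∃ p : MvPolynomial (Fin d) ℝ,
    p.totalDegree ≤ k ∧ ∀ x : Fin d → ℝ, MvPolynomial.eval x p = mono d (coords x) k q := by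
  induction k generalizing q with
  | zero => exact ⟨1, by simp, fun x => by simp [mono]⟩
  | succ k ih =>
    obtain ⟨p, hp, he⟩ := ih (q % (d + 1) ^ k)
    have : ∃ h : MvPolynomial (Fin d) ℝ, h.totalDegree ≤ 1 ∧
        ∀ x : Fin d → ℝ, MvPolynomial.eval x h = homCoord (coords x) (q / (d + 1) ^ k) := by
      generalize q / (d + 1) ^ k = c
      cases c with
      | zero => exact ⟨1, by simp, fun x => by simp [homCoord]⟩
      | succ c =>
        by_cases hc : c < d
        · exact ⟨MvPolynomial.X ⟨c, hc⟩, by simp, fun x => by simp [homCoord, coords, hc]⟩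
        · exact ⟨0, by simp, fun x => by simp [homCoord, coords, hc]⟩
    obtain ⟨h, hh, he'⟩ := this
    refine ⟨p * h, (MvPolynomial.totalDegree_mul p h).trans (by omega), fun x => ?_⟩
    rw [map_mul, he, he', mono]

theorem exists_mvPolynomial_polyFn {ℓ : ℕ} (c : Fin ((d + 1) ^ ℓ) → ℝ) :
    ∃ p : MvPolynomial (Fin d) ℝ, p.totalDegree ≤ ℓ ∧
      ∀ x : Fin d → ℝ, MvPolynomial.eval x p = polyFn ℓ c x := by
  choose p hp he using fun q : Fin ((d + 1) ^ ℓ) => exists_mvPolynomial_mono d ℓ q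
  refine ⟨∑ q, c q • p q, MvPolynomial.totalDegree_finsetSum_le fun q _ =>
    (MvPolynomial.totalDegree_smul_le _ _).trans (hp q), fun x => ?_⟩
  simp [polyFn, MvPolynomial.smul_eval, he]

/-- Remove one variable from the exponent and make it the new leading digit. -/
theorem exists_mono_eq_prod (m : Fin d →₀ ℕ) (k : ℕ) (hm : m.degree ≤ k) :
    ∃ q < (d + 1) ^ k, ∀ x : Fin d → ℝ, mono d (coords x) k q = ∏ i, x i ^ m i := by
  induction k generalizing m with
  | zero =>
    have : m = 0 := (Finsupp.degree_eq_zero_iff m).1 (by omega)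
    exact ⟨0, by simp, fun x => by simp [this, mono]⟩
  | succ k ih =>
    by_cases h0 : m = 0
    · exact ⟨0, by positivity, fun x => by simp [h0, mono_zero]⟩
    · obtain ⟨i, hi⟩ := Finsupp.ne_iff.1 h0
      have hle : Finsupp.single i 1 ≤ m := by
        rw [Finsupp.single_le_iff]
        simp only [Finsupp.coe_zero, Pi.zero_apply] at hi
        omega
      set m' := m - Finsupp.single i 1 with hm'
      have hmm : m = m' + Finsupp.single i 1 := (tsub_add_cancel_of_le hle).symm
      have hdeg : m'.degree ≤ k := by
        have := congrArg Finsupp.degree hmm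
        rw [map_add, Finsupp.degree_single] at this
        omega
      obtain ⟨q, hq, he⟩ := ih m' hdeg
      refine ⟨(i + 1) * (d + 1) ^ k + q, ?_, fun x => ?_⟩
      · have hi2 := i.2
        calc (i + 1) * (d + 1) ^ k + q < (i + 1) * (d + 1) ^ k + (d + 1) ^ k := by omega
          _ = (i + 2) * (d + 1) ^ k := by ring
          _ ≤ (d + 1) * (d + 1) ^ k := Nat.mul_le_mul_right _ (by omega)
          _ = _ := by ring
      · have e := mono_succ_add (coords x) (i : ℕ) hq
        have h2 : coords x i = x i := by simp [coords]
        rw [e, he, hmm, h2]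
        simp only [Finsupp.add_apply, pow_add, Finset.prod_mul_distrib]
        congr 1
        rw [Finset.prod_eq_single i]
        · simp
        · intro j _ hj
          rw [Finsupp.single_eq_of_ne hj, pow_zero]
        · simp

/-- Monomials with a fixed exponent have several numbers when factors are ordered differently or
padded by `1`; one number is chosen for each. -/
theorem exists_polyFn_eq_eval {ℓ : ℕ} (p : MvPolynomial (Fin d) ℝ) (hp : p.totalDegree ≤ ℓ) :
    ∃ c : Fin ((d + 1) ^ ℓ) → ℝ, ∀ x : Fin d → ℝ, polyFn ℓ c x = MvPolynomial.eval x p := by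
  have : ∀ m : Fin d →₀ ℕ, m ∈ p.support → ∃ q < (d + 1) ^ ℓ,
      ∀ x : Fin d → ℝ, mono d (coords x) ℓ q = ∏ i, x i ^ m i := fun m hm =>
    exists_mono_eq_prod m ℓ ((MvPolynomial.le_totalDegree hm).trans hp)
  choose! q hq he using this
  refine ⟨fun s => ∑ m ∈ p.support, if q m = s then p.coeff m else 0, fun x => ?_⟩
  unfold polyFn
  simp only [Finset.sum_mul]
  rw [Finset.sum_comm, MvPolynomial.eval_eq']
  refine Finset.sum_congr rfl fun m hm => ?_
  rw [Finset.sum_eq_single ⟨q m, hq m hm⟩]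
  · simp [he m hm]
  · intro s _ hs
    rw [if_neg fun h => hs (Fin.ext h.symm), zero_mul]
  · simp

theorem abs_mono_le (x : ℕ → ℝ) (k q : ℕ) (hq : q < (d + 1) ^ k) :
    |mono d x k q| ≤ (1 + ∑ i ∈ Finset.range d, |x i|) ^ k := by
  induction k generalizing q with
  | zero => simp [mono]
  | succ k ih =>
    rw [mono, abs_mul, pow_succ]
    have h0 : ∀ i ∈ Finset.range d, 0 ≤ |x i| := fun i _ => abs_nonneg _
    have h1 : |homCoord x (q / (d + 1) ^ k)| ≤ 1 + ∑ i ∈ Finset.range d, |x i| := by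
      have hlt : q / (d + 1) ^ k < d + 1 := Nat.div_lt_of_lt_mul (by rwa [pow_succ] at hq)
      revert hlt
      generalize q / (d + 1) ^ k = c
      intro hc
      cases c with
      | zero =>
        have := Finset.sum_nonneg h0
        simp only [homCoord, abs_one]; linarith
      | succ c =>
        have := Finset.single_le_sum h0 (Finset.mem_range.2 (by omega : c < d))
        simp only [homCoord]; linarith
    exact mul_le_mul (ih _ (Nat.mod_lt _ (by positivity))) h1 (abs_nonneg _)
      (pow_nonneg (add_nonneg zero_le_one (Finset.sum_nonneg h0)) _)

theorem continuous_coords (c : ℕ) : Continuous fun x : Fin d → ℝ => coords x c := by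
  unfold coords
  by_cases h : c < d
  · simp only [h, dif_pos]; exact continuous_apply _
  · simp only [h, dif_neg, not_false_iff]; exact continuous_const

theorem measurable_mono (k q : ℕ) : Measurable fun x : Fin d → ℝ => mono d (coords x) k q := by
  induction k generalizing q with
  | zero => exact measurable_const
  | succ k ih =>
    refine (ih _).mul ?_
    generalize q / (d + 1) ^ k = c
    cases c with
    | zero => exact measurable_const
    | succ c => exact (continuous_coords c).measurable

theorem measurable_polyFn {ℓ : ℕ} (c : Fin ((d + 1) ^ ℓ) → ℝ) :
    Measurable (polyFn ℓ c : (Fin d → ℝ) → ℝ) := by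
  unfold polyFn
  exact Finset.measurable_sum _ fun s _ => (measurable_mono ℓ s).const_mul _

end Polynomials

/-! ### Moments of polynomials under hypercontractivity -/

section Hypercontractive

variable {d : ℕ} {X : Set (Fin d → ℝ)} {D : Measure X} [IsProbabilityMeasure D] {A : ℝ}

/-- The moment inequality is informative only if the first moment is finite, which is assumed for
coordinates. The exponent `n + 2` puts it in the range `t ≥ 2`, and smaller exponents follow on a
probability space. -/
theorem IsHypercontractive.memLp_coord (h : IsHypercontractive D A) (i : Fin d) (n : ℕ) :
    MemLp (fun x : X => x.1 i) n D := by
  have hm : AEStronglyMeasurable (fun x : X => x.1 i) D := (h.2.2 i).aestronglyMeasurable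
  have h2 : MemLp (fun x : X => x.1 i) (n + 2 : ℕ) D := by
    refine ⟨hm, ?_⟩
    rw [eLpNorm_lt_top_iff_lintegral_rpow_enorm_lt_top (by simp) (by simp)]
    have hb := h.2.1 (MvPolynomial.X i) ((n + 2 : ℕ) : ℝ) (by push_cast; linarith [n.cast_nonneg (α := ℝ)])
    simp only [MvPolynomial.eval_X] at hb
    have e : ∀ x : X, ‖x.1 i‖ₑ ^ ((n + 2 : ℕ) : ENNReal).toReal =
        ENNReal.ofReal (|x.1 i| ^ ((n + 2 : ℕ) : ℝ)) := fun x => by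
      rw [ENNReal.toReal_natCast, Real.enorm_eq_ofReal_abs,
        ENNReal.ofReal_rpow_of_nonneg (abs_nonneg _) (by positivity)]
    simp only [e]
    refine hb.trans_lt (ENNReal.mul_lt_top ENNReal.ofReal_lt_top
      (ENNReal.rpow_lt_top_of_nonneg (by positivity) ?_))
    have := (h.2.2 i).2
    rw [hasFiniteIntegral_iff_norm] at this
    exact this.ne
  exact h2.mono_exponent (by exact_mod_cast (by omega : n ≤ n + 2))

theorem IsHypercontractive.integrable_polyFn (h : IsHypercontractive D A) {ℓ : ℕ}
    (c : Fin ((d + 1) ^ ℓ) → ℝ) : Integrable (fun x : X => polyFn ℓ c x.1) D := by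
  have h1 : MemLp (fun x : X => 1 + ∑ i ∈ Finset.range d, |coords x.1 i|) ℓ D := by
    have h0 : ∀ i ∈ Finset.range d, MemLp (fun x : X => |coords x.1 i|) ℓ D := by
      intro i hi
      have hi := Finset.mem_range.1 hi
      have e : (fun x : X => |coords x.1 i|) = fun x : X => |x.1 ⟨i, hi⟩| := by
        funext x; simp [coords, hi]
      rw [e]
      exact (h.memLp_coord ⟨i, hi⟩ ℓ).norm
    have hs : MemLp (fun x : X => ∑ i ∈ Finset.range d, |coords x.1 i|) ℓ D :=
      memLp_finsetSum _ h0
    exact MemLp.add (memLp_const (1 : ℝ)) hs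
  have h2 := h1.integrable_norm_pow'
  unfold polyFn
  refine integrable_finsetSum _ fun s _ => Integrable.const_mul ?_ _
  refine h2.mono' ((measurable_mono ℓ s).comp measurable_subtype_coe).aestronglyMeasurable
    (Filter.Eventually.of_forall fun x => ?_)
  have h3 : 0 ≤ 1 + ∑ i ∈ Finset.range d, |coords x.1 i| :=
    add_nonneg zero_le_one (Finset.sum_nonneg fun i _ => abs_nonneg _)
  rw [Real.norm_eq_abs, Real.norm_of_nonneg h3]
  exact abs_mono_le _ ℓ s s.2

/-- Moment bounds for polynomials of degree at most `ℓ`. -/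
theorem IsHypercontractive.moment_le (h : IsHypercontractive D A) {ℓ n : ℕ} (hn : 2 ≤ n)
    (c : Fin ((d + 1) ^ ℓ) → ℝ) :
    Integrable (fun x : X => |polyFn ℓ c x.1| ^ n) D ∧
    ∫ x : X, |polyFn ℓ c x.1| ^ n ∂D ≤
      (A * n) ^ (ℓ * n) * (∫ x : X, |polyFn ℓ c x.1| ∂D) ^ n := by
  obtain ⟨p, hp, he⟩ := exists_mvPolynomial_polyFn c
  have hA := h.1
  have hn' : (2 : ℝ) ≤ n := by exact_mod_cast hn
  have hint := h.integrable_polyFn c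
  have hm : Measurable fun x : X => polyFn ℓ c x.1 :=
    (measurable_polyFn c).comp measurable_subtype_coe
  have hb := h.2.1 p n hn'
  simp only [he, Real.rpow_natCast] at hb
  have e1 : ∫⁻ x : X, ENNReal.ofReal |polyFn ℓ c x.1| ∂D =
      ENNReal.ofReal (∫ x : X, |polyFn ℓ c x.1| ∂D) :=
    (ofReal_integral_eq_lintegral_ofReal hint.abs
      (Filter.Eventually.of_forall fun x => abs_nonneg _)).symm
  have hI : 0 ≤ ∫ x : X, |polyFn ℓ c x.1| ∂D := integral_nonneg fun x => abs_nonneg _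
  have hAn : (1 : ℝ) ≤ A * n := by nlinarith
  have e2 : (A * n) ^ ((p.totalDegree : ℝ) * n) ≤ (A * n) ^ (ℓ * n) := by
    rw [← Nat.cast_mul, Real.rpow_natCast]
    exact pow_le_pow_right₀ hAn (Nat.mul_le_mul_right _ hp)
  have hb2 : ∫⁻ x : X, ENNReal.ofReal (|polyFn ℓ c x.1| ^ n) ∂D ≤
      ENNReal.ofReal ((A * n) ^ (ℓ * n) * (∫ x : X, |polyFn ℓ c x.1| ∂D) ^ n) := by
    refine hb.trans ?_
    rw [e1, ENNReal.ofReal_mul (by positivity), ENNReal.rpow_natCast, ← ENNReal.ofReal_pow hI]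
    gcongr
  have hmn : Measurable fun x : X => |polyFn ℓ c x.1| ^ n :=
    (measurable_norm.comp hm).pow_const n
  have hint2 : Integrable (fun x : X => |polyFn ℓ c x.1| ^ n) D := by
    refine ⟨hmn.aestronglyMeasurable, ?_⟩
    rw [hasFiniteIntegral_iff_ofReal (Filter.Eventually.of_forall fun x => by positivity)]
    exact hb2.trans_lt ENNReal.ofReal_lt_top
  refine ⟨hint2, ?_⟩
  rw [integral_eq_lintegral_of_nonneg_ae (Filter.Eventually.of_forall fun x => by positivity)
    hmn.aestronglyMeasurable]
  exact ENNReal.toReal_le_of_le_ofReal (by positivity) hb2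

theorem IsHypercontractive.memLp_two (h : IsHypercontractive D A) {ℓ : ℕ}
    (c : Fin ((d + 1) ^ ℓ) → ℝ) : MemLp (fun x : X => polyFn ℓ c x.1) 2 D := by
  have hm : Measurable fun x : X => polyFn ℓ c x.1 :=
    (measurable_polyFn c).comp measurable_subtype_coe
  rw [memLp_two_iff_integrable_sq hm.aestronglyMeasurable]
  have := (h.moment_le (le_refl 2) c).1
  simpa only [sq_abs] using this

/-- The squared `L²` norm of a polynomial. -/
noncomputable def polySq (D : Measure X) (ℓ : ℕ) (c : Fin ((d + 1) ^ ℓ) → ℝ) : ℝ :=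
  ∫ x : X, polyFn ℓ c x.1 ^ 2 ∂D

/-- The case `t = 2`: the `L²` norm is at most `(2 * A) ^ ℓ` times the `L¹` norm. -/
theorem IsHypercontractive.polySq_le (h : IsHypercontractive D A) {ℓ : ℕ}
    (c : Fin ((d + 1) ^ ℓ) → ℝ) :
    polySq D ℓ c ≤ ((2 * A) ^ ℓ * ∫ x : X, |polyFn ℓ c x.1| ∂D) ^ 2 := by
  have := (h.moment_le (le_refl 2) c).2
  simp only [sq_abs] at this
  refine this.trans (le_of_eq ?_)
  push_cast
  ring

/-- The variance of `|p|` is nonnegative. -/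
theorem IsHypercontractive.sq_integral_abs_le (h : IsHypercontractive D A) {ℓ : ℕ}
    (c : Fin ((d + 1) ^ ℓ) → ℝ) :
    (∫ x : X, |polyFn ℓ c x.1| ∂D) ^ 2 ≤ polySq D ℓ c := by
  have h1 := h.integrable_polyFn c
  have h2 : Integrable (fun x : X => polyFn ℓ c x.1 ^ 2) D := (h.memLp_two c).integrable_sq
  set I := ∫ x : X, |polyFn ℓ c x.1| ∂D with hI
  have h3 : 0 ≤ ∫ x : X, (|polyFn ℓ c x.1| - I) ^ 2 ∂D := integral_nonneg fun x => sq_nonneg _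
  have e : ∀ x : X, (|polyFn ℓ c x.1| - I) ^ 2 =
      polyFn ℓ c x.1 ^ 2 - (2 * I) * |polyFn ℓ c x.1| + I ^ 2 := fun x => by
    rw [sub_sq, sq_abs]; ring
  simp only [e] at h3
  have h4 : Integrable (fun x : X => polyFn ℓ c x.1 ^ 2 - (2 * I) * |polyFn ℓ c x.1|) D :=
    h2.sub (h1.abs.const_mul _)
  rw [integral_add h4 (integrable_const _), integral_sub h2 (h1.abs.const_mul _), integral_const_mul, integral_const, probReal_univ,
    one_smul, ← hI] at h3
  unfold polySq
  nlinarith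

end Hypercontractive

/-! ### Orthonormal systems of polynomials -/

section Orthonormal

variable {d : ℕ} {X : Set (Fin d → ℝ)}

/-- A finite family of polynomials `polyFn ℓ (b j)` that is orthonormal in `L²(D)` and spans the
polynomials of degree at most `ℓ` up to null sets. -/
structure OrthonormalSystem (D : Measure X) (ℓ r : ℕ) where
  b : Fin r → Fin ((d + 1) ^ ℓ) → ℝ
  a : Fin ((d + 1) ^ ℓ) → Fin r → ℝ
  orth : ∀ α : Fin r → ℝ, ∫ x : X, (∑ j, α j * polyFn ℓ (b j) x.1) ^ 2 ∂D = ∑ j, α j ^ 2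
  repr : ∀ s : Fin ((d + 1) ^ ℓ), ∀ᵐ x : X ∂D,
    mono d (coords x.1) ℓ s = ∑ j, a s j * polyFn ℓ (b j) x.1
  card_le : r ≤ (d + 1) ^ ℓ

theorem sum_smul_toLp {α ι : Type*} [MeasurableSpace α] {μ : Measure α} {f : ι → α → ℝ}
    (hf : ∀ i, MemLp (f i) 2 μ) (s : Finset ι) (c : ι → ℝ) :
    ∃ h : MemLp (fun x => ∑ i ∈ s, c i * f i x) 2 μ,
      ∑ i ∈ s, c i • (hf i).toLp = h.toLp := by
  classical
  induction s using Finset.induction_on with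
  | empty =>
    refine ⟨by simp, ?_⟩
    simp only [Finset.sum_empty]
    exact (MemLp.toLp_zero _).symm
  | insert i s hi ih =>
    obtain ⟨h, e⟩ := ih
    have e2 : (fun x => ∑ i ∈ insert i s, c i * f i x) =
        (c i • f i) + fun x => ∑ i ∈ s, c i * f i x := by
      funext x; simp [Finset.sum_insert hi]
    have h2 : MemLp (fun x => ∑ i ∈ insert i s, c i * f i x) 2 μ := by
      rw [e2]; exact ((hf i).const_smul (c i)).add h
    refine ⟨h2, ?_⟩
    rw [Finset.sum_insert hi, e, ← MemLp.toLp_const_smul, ← MemLp.toLp_add]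
    exact MemLp.toLp_congr _ _ (Filter.Eventually.of_forall fun x => (congrFun e2 x).symm)

/-- An orthonormal basis of the span of the monomials in `L²(D)`. Monomials may be linearly
dependent there, so `r` can be smaller than their number. Identities in `L²` hold only almost
everywhere, which is why the core below is needed for the individual sample points. -/
theorem exists_orthonormalSystem {D : Measure X} {ℓ : ℕ}
    (h : ∀ c : Fin ((d + 1) ^ ℓ) → ℝ, MemLp (fun x : X => polyFn ℓ c x.1) 2 D) :
    ∃ r, Nonempty (OrthonormalSystem D ℓ r) := by
  have hφ : ∀ s : Fin ((d + 1) ^ ℓ), MemLp (fun x : X => mono d (coords x.1) ℓ s) 2 D := by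
    intro s
    have := h (Pi.single s 1)
    refine this.ae_eq (Filter.Eventually.of_forall fun x => ?_)
    simp [polyFn, Pi.single_apply]
  set v : Fin ((d + 1) ^ ℓ) → Lp ℝ 2 D := fun s => (hφ s).toLp with hv
  let V := Submodule.span ℝ (Set.range v)
  have : FiniteDimensional ℝ V := FiniteDimensional.span_of_finite ℝ (Set.finite_range v)
  let e := stdOrthonormalBasis ℝ V
  have hb : ∀ j, ∃ b : Fin ((d + 1) ^ ℓ) → ℝ, ∑ s, b s • v s = (e j : Lp ℝ 2 D) := fun j =>
    (Submodule.mem_span_range_iff_exists_fun ℝ).1 (e j).2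
  choose b hb using hb
  have hpoly : ∀ c : Fin ((d + 1) ^ ℓ) → ℝ, ∑ s, c s • v s = (h c).toLp := fun c => by
    obtain ⟨h1, h2⟩ := sum_smul_toLp hφ Finset.univ c
    exact h2
  have hψ : ∀ j, (e j : Lp ℝ 2 D) = (h (b j)).toLp := fun j => by rw [← hb, hpoly]
  have hcomb : ∀ α : Fin (Module.finrank ℝ V) → ℝ,
      ∃ hm : MemLp (fun x : X => ∑ j, α j * polyFn ℓ (b j) x.1) 2 D,
        ∑ j, α j • (e j : Lp ℝ 2 D) = hm.toLp := fun α => by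
    obtain ⟨h1, h2⟩ := sum_smul_toLp (fun j => h (b j)) Finset.univ α
    exact ⟨h1, by simpa only [hψ] using h2⟩
  refine ⟨Module.finrank ℝ V, ⟨⟨b, fun s j => e.repr ⟨v s, Submodule.subset_span ⟨s, rfl⟩⟩ j,
    fun α => ?_, fun s => ?_, ?_⟩⟩⟩
  · obtain ⟨hm, he⟩ := hcomb α
    have h1 : inner ℝ (∑ j, α j • e j) (∑ j, α j • e j) = ∑ j, α j ^ 2 := by
      rw [e.orthonormal.inner_sum]
      simp [sq]
    rw [← h1, Submodule.coe_inner]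
    have h2 : ((∑ j, α j • e j : V) : Lp ℝ 2 D) = hm.toLp := by
      rw [← he]; simp
    rw [h2, L2.inner_def]
    refine integral_congr_ae ?_
    filter_upwards [hm.coeFn_toLp] with x hx
    rw [hx]
    simp [sq]
  · obtain ⟨hm, he⟩ := hcomb fun j => e.repr ⟨v s, Submodule.subset_span ⟨s, rfl⟩⟩ j
    have h1 := e.sum_repr ⟨v s, Submodule.subset_span ⟨s, rfl⟩⟩
    have h2 := congrArg (Subtype.val) h1
    have h3 : (hφ s).toLp = hm.toLp := by
      rw [← he]
      refine Eq.trans ?_ (h2.symm.trans ?_)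
      · rfl
      · simp
    exact (MemLp.toLp_eq_toLp_iff _ _).1 h3
  · have := finrank_range_le_card (R := ℝ) v
    simpa [Set.finrank] using this

namespace OrthonormalSystem

variable {D : Measure X} {ℓ r : ℕ} (E : OrthonormalSystem D ℓ r)

/-- The linear combination of the system with coefficients `α`. -/
noncomputable def comb (α : Fin r → ℝ) (x : X) : ℝ := ∑ j, α j * polyFn ℓ (E.b j) x.1

/-- The coefficients of a polynomial with respect to the system. -/
noncomputable def coeff (c : Fin ((d + 1) ^ ℓ) → ℝ) (j : Fin r) : ℝ := ∑ s, c s * E.a s j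

/-- The points at which the relations that hold almost everywhere do hold. -/
def core : Set X := {x | ∀ s : Fin ((d + 1) ^ ℓ), mono d (coords x.1) ℓ s =
  ∑ j, E.a s j * polyFn ℓ (E.b j) x.1}

/-- The points of the core where all elements of the system are bounded. -/
def region (R : ℝ) : Set X := E.core ∩ {x | ∀ j, polyFn ℓ (E.b j) x.1 ^ 2 ≤ R}

theorem measurable_poly (c : Fin ((d + 1) ^ ℓ) → ℝ) : Measurable fun x : X => polyFn ℓ c x.1 :=
  (measurable_polyFn c).comp measurable_subtype_coe

theorem measurable_comb (α : Fin r → ℝ) : Measurable (E.comb α) :=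
  Finset.measurable_sum _ fun _ _ => (measurable_poly _).const_mul _

theorem measurableSet_core : MeasurableSet E.core := by
  unfold core
  rw [Set.ofPred_forall]
  exact MeasurableSet.iInter fun s => measurableSet_eq_fun
    ((measurable_mono ℓ s).comp measurable_subtype_coe) (E.measurable_comb _)

theorem measurableSet_region (R : ℝ) : MeasurableSet (E.region R) := by
  refine E.measurableSet_core.inter ?_
  rw [Set.ofPred_forall]
  exact MeasurableSet.iInter fun j => measurableSet_le ((measurable_poly _).pow_const 2)
    measurable_const

theorem ae_mem_core : ∀ᵐ x ∂D, x ∈ E.core := ae_all_iff.2 E.repr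

theorem polyFn_eq_comb (c : Fin ((d + 1) ^ ℓ) → ℝ) {x : X} (hx : x ∈ E.core) :
    polyFn ℓ c x.1 = E.comb (E.coeff c) x := by
  have h1 : polyFn ℓ c x.1 =
      ∑ s, c s * ∑ j, E.a s j * polyFn ℓ (E.b j) x.1 := Finset.sum_congr rfl fun s _ => by rw [hx s]
  rw [h1]
  simp only [comb, coeff, Finset.mul_sum, Finset.sum_mul]
  rw [Finset.sum_comm]
  exact Finset.sum_congr rfl fun j _ => Finset.sum_congr rfl fun s _ => by ring

theorem comb_eq_polyFn (α : Fin r → ℝ) (x : X) :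
    E.comb α x = polyFn ℓ (fun s => ∑ j, α j * E.b j s) x.1 := by
  unfold polyFn comb polyFn
  simp only [Finset.mul_sum, Finset.sum_mul]
  rw [Finset.sum_comm]
  exact Finset.sum_congr rfl fun j _ => Finset.sum_congr rfl fun s _ => by ring

theorem integral_comb_sq (α : Fin r → ℝ) : ∫ x, E.comb α x ^ 2 ∂D = ∑ j, α j ^ 2 := E.orth α

theorem sum_coeff_sq (c : Fin ((d + 1) ^ ℓ) → ℝ) : ∑ j, E.coeff c j ^ 2 = polySq D ℓ c := by
  rw [← E.integral_comb_sq]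
  refine integral_congr_ae ?_
  filter_upwards [E.ae_mem_core] with x hx
  rw [E.polyFn_eq_comb c hx]

theorem abs_coeff_le (c : Fin ((d + 1) ^ ℓ) → ℝ) (j : Fin r) : |E.coeff c j| ≤ √(polySq D ℓ c) := by
  refine Real.abs_le_sqrt ?_
  rw [← E.sum_coeff_sq]
  exact Finset.single_le_sum (f := fun j => E.coeff c j ^ 2) (fun j _ => sq_nonneg _)
    (Finset.mem_univ j)

theorem integral_basis_sq (j : Fin r) : ∫ x : X, polyFn ℓ (E.b j) x.1 ^ 2 ∂D = 1 := by
  have := E.orth (Pi.single j 1)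
  simpa [Pi.single_apply] using this

variable {R : ℝ}

theorem abs_comb_le {x : X} (hx : x ∈ E.region R) {α : Fin r → ℝ} {η : ℝ}
    (hα : ∀ j, |α j| ≤ η) : |E.comb α x| ≤ r * √R * η := by
  unfold comb
  refine (Finset.abs_sum_le_sum_abs _ _).trans ?_
  calc ∑ j, |α j * polyFn ℓ (E.b j) x.1| ≤ ∑ _j : Fin r, η * √R := by
        refine Finset.sum_le_sum fun j _ => ?_
        rw [abs_mul]
        exact mul_le_mul (hα j) (Real.abs_le_sqrt (hx.2 j)) (abs_nonneg _)
          ((abs_nonneg _).trans (hα j))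
    _ = _ := by simp; ring

theorem comb_sub (α β : Fin r → ℝ) (x : X) :
    E.comb α x - E.comb β x = E.comb (fun j => α j - β j) x := by
  unfold comb
  rw [← Finset.sum_sub_distrib]
  exact Finset.sum_congr rfl fun j _ => by ring

theorem comb_smul (k : ℝ) (α : Fin r → ℝ) (x : X) :
    E.comb (fun j => k * α j) x = k * E.comb α x := by
  unfold comb
  rw [Finset.mul_sum]
  exact Finset.sum_congr rfl fun j _ => by ring

theorem abs_comb_sub_le {x : X} (hx : x ∈ E.region R) {α β : Fin r → ℝ} {η : ℝ}
    (hα : ∀ j, |α j - β j| ≤ η) : |E.comb α x - E.comb β x| ≤ r * √R * η := by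
  rw [E.comb_sub]
  exact E.abs_comb_le hx hα

/-- Cauchy–Schwarz for the expansion in the orthonormal system. -/
theorem polyFn_sq_le {x : X} (hx : x ∈ E.region R) (c : Fin ((d + 1) ^ ℓ) → ℝ) :
    polyFn ℓ c x.1 ^ 2 ≤ r * R * polySq D ℓ c := by
  rw [E.polyFn_eq_comb c hx.1, ← E.sum_coeff_sq]
  unfold comb
  refine (Finset.sum_mul_sq_le_sq_mul_sq _ _ _).trans ?_
  rw [mul_comm]
  refine mul_le_mul_of_nonneg_right ?_ (Finset.sum_nonneg fun _ _ => sq_nonneg _)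
  refine (Finset.sum_le_sum fun j _ => hx.2 j).trans ?_
  simp

/-- Markov's inequality for each squared basis element, which has mean `1`, and a union bound; the
core has full measure. -/
theorem measure_region_compl_le (hR : 0 < R) (hint : ∀ c : Fin ((d + 1) ^ ℓ) → ℝ,
    MemLp (fun x : X => polyFn ℓ c x.1) 2 D) [IsProbabilityMeasure D] :
    D.real (E.region R)ᶜ ≤ r / R := by
  have hsub : (E.region R)ᶜ ⊆ E.coreᶜ ∪ ⋃ j ∈ (Finset.univ : Finset (Fin r)),
      {x : X | R ≤ polyFn ℓ (E.b j) x.1 ^ 2} := by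
    intro x hx
    by_cases h : x ∈ E.core
    · right
      have : ¬ ∀ j, polyFn ℓ (E.b j) x.1 ^ 2 ≤ R := fun h' => hx ⟨h, h'⟩
      push Not at this
      obtain ⟨j, hj⟩ := this
      simp only [Set.mem_iUnion, Finset.mem_univ, exists_true_left]
      exact ⟨j, hj.le⟩
    · exact Or.inl h
  have h0 : D.real E.coreᶜ = 0 := by
    rw [measureReal_def, mem_ae_iff.1 (show E.core ∈ ae D from E.ae_mem_core), ENNReal.toReal_zero]
  have h1 : ∀ j, D.real {x : X | R ≤ polyFn ℓ (E.b j) x.1 ^ 2} ≤ 1 / R := fun j => by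
    have := mul_meas_ge_le_integral_of_nonneg (μ := D)
      (Filter.Eventually.of_forall fun x : X => sq_nonneg (polyFn ℓ (E.b j) x.1))
      (hint (E.b j)).integrable_sq R
    rw [E.integral_basis_sq] at this
    rw [le_div_iff₀ hR, mul_comm]
    exact this
  calc D.real (E.region R)ᶜ ≤ _ := measureReal_mono hsub
    _ ≤ D.real E.coreᶜ + _ := measureReal_union_le _ _
    _ ≤ 0 + ∑ j : Fin r, D.real {x : X | R ≤ polyFn ℓ (E.b j) x.1 ^ 2} := by
        rw [h0]; gcongr; exact measureReal_biUnion_finset_le _ _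
    _ ≤ 0 + ∑ _j : Fin r, 1 / R := by gcongr with j; exact h1 j
    _ = _ := by simp; ring

end OrthonormalSystem

end Orthonormal

/-! ### Deviation bounds for polynomials on the region -/

namespace OrthonormalSystem

variable {d : ℕ} {X : Set (Fin d → ℝ)} {D : Measure X} {ℓ r : ℕ} (E : OrthonormalSystem D ℓ r)
  {R B : ℝ} {Ω W ι : Type*} [MeasurableSpace Ω] [MeasurableSpace W]
  {P : Measure Ω} [IsProbabilityMeasure P] {Y : ι → Ω → X}

theorem integrable_indicator_comb_pow [IsProbabilityMeasure D] (n : ℕ) (α : Fin r → ℝ) :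
    Integrable ((E.region R).indicator fun x => |E.comb α x| ^ n) D := by
  have hm : Measurable ((E.region R).indicator fun x => |E.comb α x| ^ n) :=
    ((measurable_norm.comp (E.measurable_comb α)).pow_const n).indicator (E.measurableSet_region R)
  refine Integrable.of_bound hm.aestronglyMeasurable ((r * √R * ∑ j, |α j|) ^ n)
    (Filter.Eventually.of_forall fun x => ?_)
  have h0 : 0 ≤ r * √R * ∑ j, |α j| := by positivity
  by_cases hx : x ∈ E.region R
  · rw [Set.indicator_of_mem hx, Real.norm_of_nonneg (by positivity)]
    refine pow_le_pow_left₀ (abs_nonneg _) (E.abs_comb_le hx fun j => ?_) n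
    exact Finset.single_le_sum (f := fun j => |α j|) (fun j _ => abs_nonneg _) (Finset.mem_univ j)
  · rw [Set.indicator_of_notMem hx, norm_zero]
    exact pow_nonneg h0 n

/-- On the region a combination with coefficients in `[-1, 1]` is bounded by `B` and `B`-Lipschitz
in them, so its square divided by `B ^ 2` is a `2`-Lipschitz family in `[0, 1]`. -/
theorem measure_exists_sq_le [IsProbabilityMeasure D] (hY : IsIID P Y D) (hB : 0 < B)
    (hRB : r * √R ≤ B) {τ : ℝ} (hτ : 0 ≤ τ) {k : ℕ} (hk : 0 < k) (hkτ : 2 / k ≤ τ) (s : Finset ι) :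
    P {ω | ∃ α : Fin r → ℝ, (∀ j, |α j| ≤ 1) ∧
      ∑ i ∈ s, (E.region R).indicator (fun x => |E.comb α x| ^ 2) (Y i ω) +
        s.card * (3 * τ) * B ^ 2 ≤
      s.card * ∫ x, (E.region R).indicator (fun x => |E.comb α x| ^ 2) x ∂D} ≤
      ENNReal.ofReal ((2 * k + 1) ^ r * Real.exp (-(2 * s.card * τ ^ 2))) := by
  have h := hY.measure_exists_le (κ := Fin r) (ρ := 1) (L := 2) (τ := τ) (k := k)
    (f := fun α x => (E.region R).indicator (fun x => |E.comb α x| ^ 2) x / B ^ 2)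
    (fun α => (((measurable_norm.comp (E.measurable_comb α)).pow_const 2).indicator
      (E.measurableSet_region R)).div_const _)
    (fun α _ x => div_nonneg (Set.indicator_nonneg (fun _ _ => by positivity) _) (by positivity))
    (fun α hα x => by
      rw [div_le_one (by positivity)]
      by_cases hx : x ∈ E.region R
      · rw [Set.indicator_of_mem hx]
        refine pow_le_pow_left₀ (abs_nonneg _) ((E.abs_comb_le hx hα).trans (by linarith)) 2
      · rw [Set.indicator_of_notMem hx]; positivity)
    zero_le_one hτ hk (by simpa using hkτ)
    (fun α β η hη0 hα hβ hη x => by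
      by_cases hx : x ∈ E.region R
      · rw [Set.indicator_of_mem hx, Set.indicator_of_mem hx, ← sub_div, abs_div, sq_abs, sq_abs,
          abs_of_pos (pow_pos hB 2), div_le_iff₀ (pow_pos hB 2), sq_sub_sq, abs_mul]
        have h1 := (E.abs_comb_sub_le hx hη).trans (mul_le_mul_of_nonneg_right hRB hη0)
        have h2 : |E.comb α x + E.comb β x| ≤ 2 * B := by
          have ha := (E.abs_comb_le hx hα).trans (by linarith : r * √R * 1 ≤ B)
          have hb := (E.abs_comb_le hx hβ).trans (by linarith : r * √R * 1 ≤ B)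
          linarith [abs_add_le (E.comb α x) (E.comb β x)]
        calc _ ≤ (2 * B) * (B * η) := mul_le_mul h2 h1 (abs_nonneg _) (by positivity)
          _ = _ := by ring
      · rw [Set.indicator_of_notMem hx, Set.indicator_of_notMem hx]
        simpa using hη0) s
  rw [Fintype.card_fin] at h
  refine (measure_mono ?_).trans h
  rintro ω ⟨α, hα, hω⟩
  refine ⟨α, hα, ?_⟩
  rw [← Finset.sum_div, integral_div, ← mul_div_assoc, div_add' _ _ _ (by positivity)]
  exact div_le_div_of_nonneg_right hω (by positivity)

/-- The deviation bound is one-sided, so the opposite side is obtained by applying it to `1 - |p| /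
B`. -/
theorem measure_exists_abs_le [IsProbabilityMeasure D] (hY : IsIID P Y D) (hB : 0 < B)
    (hRB : r * √R ≤ B) {τ : ℝ} (hτ : 0 ≤ τ) {k : ℕ} (hk : 0 < k) (hkτ : 1 / k ≤ τ) (s : Finset ι) :
    P {ω | ∃ α : Fin r → ℝ, (∀ j, |α j| ≤ 1) ∧
      s.card * ∫ x, (E.region R).indicator (fun x => |E.comb α x| ^ 1) x ∂D +
        s.card * (3 * τ) * B ≤
      ∑ i ∈ s, (E.region R).indicator (fun x => |E.comb α x| ^ 1) (Y i ω)} ≤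
      ENNReal.ofReal ((2 * k + 1) ^ r * Real.exp (-(2 * s.card * τ ^ 2))) := by
  have hle : ∀ α : Fin r → ℝ, (∀ j, |α j| ≤ 1) → ∀ x,
      (E.region R).indicator (fun x => |E.comb α x| ^ 1) x / B ≤ 1 := fun α hα x => by
    rw [div_le_one (by positivity)]
    by_cases hx : x ∈ E.region R
    · rw [Set.indicator_of_mem hx, pow_one]
      exact (E.abs_comb_le hx hα).trans (by linarith)
    · rw [Set.indicator_of_notMem hx]; positivity
  have hge : ∀ (α : Fin r → ℝ) (x),
      0 ≤ (E.region R).indicator (fun x => |E.comb α x| ^ 1) x / B := fun α x =>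
    div_nonneg (Set.indicator_nonneg (fun _ _ => by positivity) _) hB.le
  have h := hY.measure_exists_le (κ := Fin r) (ρ := 1) (L := 1) (τ := τ) (k := k)
    (f := fun α x => 1 - (E.region R).indicator (fun x => |E.comb α x| ^ 1) x / B)
    (fun α => measurable_const.sub ((((measurable_norm.comp (E.measurable_comb α)).pow_const
      1).indicator (E.measurableSet_region R)).div_const _))
    (fun α hα x => sub_nonneg.2 (hle α hα x))
    (fun α _ x => sub_le_self _ (hge α x))
    zero_le_one hτ hk (by simpa using hkτ)
    (fun α β η hη0 hα hβ hη x => by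
      by_cases hx : x ∈ E.region R
      · rw [Set.indicator_of_mem hx, Set.indicator_of_mem hx, sub_sub_sub_cancel_left, ← sub_div,
          abs_div, abs_of_pos hB, div_le_iff₀ hB, pow_one, pow_one, abs_sub_comm]
        refine (abs_abs_sub_abs_le _ _).trans ?_
        calc _ ≤ B * η := (E.abs_comb_sub_le hx hη).trans (mul_le_mul_of_nonneg_right hRB hη0)
          _ = _ := by ring
      · rw [Set.indicator_of_notMem hx, Set.indicator_of_notMem hx]
        simpa using hη0) s
  rw [Fintype.card_fin] at h
  refine (measure_mono ?_).trans h
  rintro ω ⟨α, hα, hω⟩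
  refine ⟨α, hα, ?_⟩
  rw [integral_sub (integrable_const _) ((E.integrable_indicator_comb_pow 1 α).div_const B),
    Finset.sum_sub_distrib, ← Finset.sum_div, integral_div, integral_const, probReal_univ, one_smul,
    Finset.sum_const, nsmul_eq_mul, mul_one, mul_sub, mul_one]
  have h1 := div_le_div_of_nonneg_right hω hB.le
  rw [add_div, mul_div_cancel_right₀ _ hB.ne', mul_div_assoc] at h1
  linarith

theorem measure_region_freq_le [IsProbabilityMeasure D] (hY : IsIID P Y D) {τ : ℝ} (hτ : 0 ≤ τ)
    (s : Finset ι) :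
    P {ω | ∑ i ∈ s, (E.region R).indicator (fun _ => (1 : ℝ)) (Y i ω) + s.card * τ ≤
      s.card * D.real (E.region R)} ≤ ENNReal.ofReal (Real.exp (-(2 * s.card * τ ^ 2))) := by
  have h := hY.measure_sum_le (f := (E.region R).indicator fun _ => (1 : ℝ))
    (measurable_const.indicator (E.measurableSet_region R))
    (Set.indicator_nonneg fun _ _ => zero_le_one)
    (fun x => Set.indicator_le_self' (fun _ _ => zero_le_one) x) s hτ
  rwa [integral_indicator (E.measurableSet_region R), setIntegral_const, smul_eq_mul, mul_one] at h

/-- Uniform one-sided approximation of the probability of a margin condition for two polynomials and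
a threshold by the frequency of the relaxed condition. -/
theorem measure_exists_margin_le {μ : Measure W} [IsProbabilityMeasure μ] {Y : ι → Ω → W}
    (hY : IsIID P Y μ) {π : W → X} (hπ : Measurable π) {g : W → ℝ → ℝ → ℝ → ℝ}
    (hg : ∀ u l : W → ℝ, Measurable u → Measurable l → ∀ θ : ℝ,
      Measurable fun w => g w (u w) (l w) θ)
    (hlip : ∀ w u l θ u' l' θ' η, |u - u'| ≤ η → |l - l'| ≤ η → |θ - θ'| ≤ η →
      |g w u l θ - g w u' l' θ'| ≤ 2 * η)
    {γ ρ τ : ℝ} (hγ : 0 < γ) (hB : 1 ≤ B) (hRB : r * √R ≤ B) (hρ : 0 ≤ ρ) (hτ : 0 ≤ τ)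
    {k : ℕ} (hk : 0 < k) (hkτ : 2 * B / γ * ρ / k ≤ τ) (s : Finset ι) :
    P {ω | ∃ (α β : Fin r → ℝ) (θ : ℝ), (∀ j, |α j| ≤ ρ) ∧ (∀ j, |β j| ≤ ρ) ∧ |θ| ≤ ρ ∧
      ∑ i ∈ s, {w | π w ∈ E.region R ∧ -γ < g w (E.comb α (π w)) (E.comb β (π w)) θ}.indicator
        (fun _ => (1 : ℝ)) (Y i ω) + s.card * (3 * τ) ≤
      s.card * μ.real {w | π w ∈ E.region R ∧ 0 ≤ g w (E.comb α (π w)) (E.comb β (π w)) θ}} ≤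
      ENNReal.ofReal ((2 * k + 1) ^ (2 * r + 1) * Real.exp (-(2 * s.card * τ ^ 2))) := by
  let G : ((Fin r ⊕ Fin r) ⊕ Unit → ℝ) → W → ℝ := fun p w =>
    g w (E.comb (fun j => p (.inl (.inl j))) (π w)) (E.comb (fun j => p (.inl (.inr j))) (π w))
      (p (.inr ()))
  have hG : ∀ p, Measurable (G p) := fun p =>
    hg _ _ ((E.measurable_comb _).comp hπ) ((E.measurable_comb _).comp hπ) _
  have hreg : MeasurableSet (π ⁻¹' E.region R) := hπ (E.measurableSet_region R)
  -- A ramp that is `1` for `g ≥ 0` and `0` for `g ≤ -γ`. It lies between the two indicators and,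
  -- unlike them, is Lipschitz in the parameters.
  let F : ((Fin r ⊕ Fin r) ⊕ Unit → ℝ) → W → ℝ := fun p =>
    (π ⁻¹' E.region R).indicator fun w => max 0 (min 1 (1 + G p w / γ))
  have hF : ∀ p, Measurable (F p) := fun p =>
    (measurable_const.max (measurable_const.min (measurable_const.add
      ((hG p).div_const γ)))).indicator hreg
  have hF0 : ∀ p w, 0 ≤ F p w := fun p w => Set.indicator_nonneg (fun _ _ => le_max_left _ _) _
  have hF1 : ∀ p w, F p w ≤ 1 := fun p w =>
    Set.indicator_le' (fun _ _ => max_le zero_le_one (min_le_left _ _)) (fun _ _ => zero_le_one) w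
  have h := hY.measure_exists_le (ρ := ρ) (L := 2 * B / γ) (τ := τ) (k := k) (f := F) hF
    (fun p _ => hF0 p) (fun p _ => hF1 p) hρ hτ hk hkτ
    (fun p p' η hη0 _ _ hη w => by
      by_cases hw : w ∈ π ⁻¹' E.region R
      · simp only [F]
        rw [Set.indicator_of_mem hw, Set.indicator_of_mem hw]
        rw [max_comm 0, max_comm 0]
        refine (abs_max_sub_max_le_abs (min 1 (1 + G p w / γ)) (min 1 (1 + G p' w / γ)) 0).trans ?_
        refine (abs_min_sub_min_le_max _ _ _ _).trans (max_le (by simp; positivity) ?_)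
        rw [add_sub_add_left_eq_sub, ← sub_div, abs_div, abs_of_pos hγ]
        have h1 : |G p w - G p' w| ≤ 2 * (B * η) := by
          have hb : ∀ {x : ℝ}, x ≤ r * √R * η → x ≤ B * η := fun hx =>
            hx.trans (mul_le_mul_of_nonneg_right hRB hη0)
          refine hlip _ _ _ _ _ _ _ _ (hb (E.abs_comb_sub_le hw fun j => hη _))
            (hb (E.abs_comb_sub_le hw fun j => hη _)) ((hη _).trans ?_)
          nlinarith
        calc _ ≤ 2 * (B * η) / γ := by gcongr
          _ = _ := by ring
      · simp only [F]
        rw [Set.indicator_of_notMem hw, Set.indicator_of_notMem hw, sub_zero, abs_zero]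
        positivity) s
  have hcard : Fintype.card ((Fin r ⊕ Fin r) ⊕ Unit) = 2 * r + 1 := by
    simp; ring
  rw [hcard] at h
  refine (measure_mono ?_).trans h
  rintro ω ⟨α, β, θ, hα, hβ, hθ, hω⟩
  let p : (Fin r ⊕ Fin r) ⊕ Unit → ℝ := Sum.elim (Sum.elim α β) fun _ => θ
  refine ⟨p, ?_, ?_⟩
  · rintro ((j | j) | j)
    · exact hα j
    · exact hβ j
    · exact hθ
  have hGp : ∀ w, G p w = g w (E.comb α (π w)) (E.comb β (π w)) θ := fun w => rfl
  have h1 : ∑ i ∈ s, F p (Y i ω) ≤ ∑ i ∈ s, {w | π w ∈ E.region R ∧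
      -γ < g w (E.comb α (π w)) (E.comb β (π w)) θ}.indicator (fun _ => (1 : ℝ)) (Y i ω) := by
    refine Finset.sum_le_sum fun i _ => ?_
    by_cases hw : Y i ω ∈ {w | π w ∈ E.region R ∧
      -γ < g w (E.comb α (π w)) (E.comb β (π w)) θ}
    · rw [Set.indicator_of_mem hw]; exact hF1 _ _
    · rw [Set.indicator_of_notMem hw]
      by_cases hw1 : Y i ω ∈ π ⁻¹' E.region R
      · simp only [F]
        rw [Set.indicator_of_mem hw1, hGp]
        have h2 : ¬ -γ < g (Y i ω) (E.comb α (π (Y i ω))) (E.comb β (π (Y i ω))) θ :=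
          fun h => hw ⟨hw1, h⟩
        refine max_le le_rfl ((min_le_right _ _).trans ?_)
        have : g (Y i ω) (E.comb α (π (Y i ω))) (E.comb β (π (Y i ω))) θ / γ ≤ -1 := by
          rw [div_le_iff₀ hγ]; linarith
        linarith
      · simp only [F]
        rw [Set.indicator_of_notMem hw1]
  have h2 : μ.real {w | π w ∈ E.region R ∧ 0 ≤ g w (E.comb α (π w)) (E.comb β (π w)) θ} ≤
      ∫ w, F p w ∂μ := by
    have hms : MeasurableSet {w | π w ∈ E.region R ∧
        0 ≤ g w (E.comb α (π w)) (E.comb β (π w)) θ} :=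
      hreg.inter (measurableSet_le measurable_const (hG p))
    have e : μ.real {w | π w ∈ E.region R ∧ 0 ≤ g w (E.comb α (π w)) (E.comb β (π w)) θ} =
        ∫ w, {w | π w ∈ E.region R ∧ 0 ≤ g w (E.comb α (π w)) (E.comb β (π w)) θ}.indicator
          (fun _ => (1 : ℝ)) w ∂μ := by
      rw [integral_indicator hms, setIntegral_const, smul_eq_mul, mul_one]
    rw [e]
    refine integral_mono ((integrable_const _).indicator hms)
      (Integrable.of_bound (hF p).aestronglyMeasurable 1 (Filter.Eventually.of_forall fun w => by
        rw [Real.norm_of_nonneg (hF0 p w)]; exact hF1 p w)) fun w => ?_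
    by_cases hw : w ∈ {w | π w ∈ E.region R ∧ 0 ≤ g w (E.comb α (π w)) (E.comb β (π w)) θ}
    · simp only [F]
      rw [Set.indicator_of_mem hw, Set.indicator_of_mem (show w ∈ π ⁻¹' E.region R from hw.1), hGp]
      have := div_nonneg hw.2 hγ.le
      rw [min_eq_left (by linarith)]
      exact le_max_right _ _
    · rw [Set.indicator_of_notMem hw]; exact hF0 _ _
  have h3 : s.card * μ.real {w | π w ∈ E.region R ∧
      0 ≤ g w (E.comb α (π w)) (E.comb β (π w)) θ} ≤ s.card * ∫ w, F p w ∂μ := by gcongr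
  linarith

end OrthonormalSystem

/-! ### Typical draws -/

section RefMean

variable {α : Type*} {T : ℕ} {ω : ℕ → α} {f g : α → ℝ}

theorem refMean_mono (h : ∀ r < T, f (ω r) ≤ g (ω r)) : refMean T ω f ≤ refMean T ω g :=
  div_le_div_of_nonneg_right (Finset.sum_le_sum fun r hr => h r (Finset.mem_range.1 hr))
    (Nat.cast_nonneg _)

theorem refMean_congr (h : ∀ r < T, f (ω r) = g (ω r)) : refMean T ω f = refMean T ω g :=
  le_antisymm (refMean_mono fun r hr => (h r hr).le) (refMean_mono fun r hr => (h r hr).ge)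

theorem refMean_add : (refMean T ω fun x => f x + g x) = refMean T ω f + refMean T ω g := by
  unfold refMean
  rw [Finset.sum_add_distrib, add_div]

theorem refMean_const_mul (k : ℝ) : (refMean T ω fun x => k * f x) = k * refMean T ω f := by
  unfold refMean
  rw [← Finset.mul_sum, mul_div_assoc]

theorem refMean_nonneg (h : ∀ x, 0 ≤ f x) : 0 ≤ refMean T ω f :=
  div_nonneg (Finset.sum_nonneg fun _ _ => h _) (Nat.cast_nonneg _)

theorem refMean_sum {ι : Type*} (s : Finset ι) (F : ι → α → ℝ) :
    (refMean T ω fun x => ∑ i ∈ s, F i x) = ∑ i ∈ s, refMean T ω (F i) := by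
  unfold refMean
  rw [Finset.sum_comm, Finset.sum_div]

theorem mul_refMean (hT : 0 < T) : T * refMean T ω f = ∑ r ∈ Finset.range T, f (ω r) := by
  unfold refMean
  rw [mul_div_cancel₀]
  exact_mod_cast hT.ne'

/-- A Markov inequality for means over independent draws. -/
theorem measure_le_refMean_le [MeasurableSpace α] {D : Measure α} [IsProbabilityMeasure D]
    (hf : ∀ x, 0 ≤ f x) {t : ℕ} (hint : Integrable (fun x => f x ^ t) D) {w : ℝ}
    (hw : 0 < w) (hT : 0 < T) :
    (Measure.infinitePi fun _ : ℕ => D).real {ω | w ≤ refMean T ω f} ≤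
      (∫ x, f x ^ t ∂D) / w ^ t := by
  have hT' : (0 : ℝ) < T := by exact_mod_cast hT
  have hpres := fun i : ℕ => measurePreserving_eval_infinitePi (fun _ : ℕ => D) i
  have hint2 : ∀ i : ℕ, Integrable (fun ω : ℕ → α => f (ω i) ^ t)
      (Measure.infinitePi fun _ : ℕ => D) := fun i => (hpres i).integrable_comp_of_integrable hint
  have hI : ∀ i : ℕ, ∫ ω, f (ω i) ^ t ∂(Measure.infinitePi fun _ : ℕ => D) = ∫ x, f x ^ t ∂D := by
    intro i
    conv_rhs => rw [← (hpres i).map_eq]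
    rw [integral_map (hpres i).measurable.aemeasurable]
    rw [(hpres i).map_eq]
    exact hint.aestronglyMeasurable
  have hsum : Integrable (fun ω : ℕ → α => refMean T ω fun x => f x ^ t)
      (Measure.infinitePi fun _ : ℕ => D) :=
    (integrable_finsetSum _ fun i _ => hint2 i).div_const _
  have key := mul_meas_ge_le_integral_of_nonneg (Filter.Eventually.of_forall fun ω : ℕ → α =>
    refMean_nonneg (ω := ω) (T := T) fun x => pow_nonneg (hf x) t) hsum (w ^ t)
  have hE : ∫ ω, (refMean T ω fun x => f x ^ t) ∂(Measure.infinitePi fun _ : ℕ => D) =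
      ∫ x, f x ^ t ∂D := by
    unfold refMean
    rw [integral_div, integral_finsetSum _ fun i _ => hint2 i]
    simp only [hI, Finset.sum_const, Finset.card_range, nsmul_eq_mul]
    field_simp
  rw [hE] at key
  rw [le_div_iff₀ (by positivity), mul_comm]
  refine le_trans (mul_le_mul_of_nonneg_left (measureReal_mono fun ω hω => ?_) (by positivity)) key
  simp only [Set.mem_ofPred_eq] at hω ⊢
  refine (pow_le_pow_left₀ hw.le hω t).trans ?_
  -- Convexity of the power reduces a large mean to a large mean of `t`-th powers.
  have := Real.pow_arith_mean_le_arith_mean_pow (Finset.range T) (fun _ => 1 / (T : ℝ))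
    (fun i => f (ω i)) (fun _ _ => by positivity) (by simp; field_simp) (fun _ _ => hf _) t
  unfold refMean
  simp only [← Finset.mul_sum] at this
  rw [div_eq_inv_mul, div_eq_inv_mul, ← one_div]
  exact this

end RefMean

/-! ### Typical draws -/

/-- The properties of the scale parameter `Z` on which the analysis rests. -/
structure ScaleFacts (d ℓ : ℕ) (A ε δ Q : ℝ) (Z t : ℕ) : Prop where
  t_pos : 1 ≤ t
  t_le : 32 * t ≤ Z
  delta_le : 2 / δ ≤ 2 ^ t
  card_le : 4 * (d + 1) ^ ℓ ≤ Z
  four_le : (4 * A) ^ ℓ ≤ Z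
  moment_le : 16 * (((d + 1) ^ ℓ : ℕ) : ℝ) ^ 2 * (A * (2 * t : ℕ)) ^ (2 * ℓ) ≤ (Z : ℝ) ^ 2
  eps_le : 32 * (Q / ε) ≤ Z

/-- The net contributes at most `exp (31 * Z ^ 2)`, while `Z ^ 30` draws with accuracy at least `1 /
Z ^ 12` give an exponent of at least `2 * Z ^ 6`. -/
theorem pow_mul_exp_le {Z n : ℕ} (hZ : 32 ≤ Z) (hn : n ≤ Z) {τ : ℝ} (hτ : 1 / (Z : ℝ) ^ 12 ≤ τ) :
    (2 * ((Z ^ 30 : ℕ) : ℝ) + 1) ^ n * Real.exp (-(2 * ((Z ^ 30 : ℕ) : ℝ) * τ ^ 2)) ≤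
      Real.exp (-Z) := by
  have hZ' : (32 : ℝ) ≤ Z := by exact_mod_cast hZ
  have h1 : (2 * ((Z ^ 30 : ℕ) : ℝ) + 1) ≤ Real.exp (31 * Z) := by
    have h2 : (Z : ℝ) ≤ Real.exp Z := by linarith [Real.add_one_le_exp (Z : ℝ)]
    calc (2 * ((Z ^ 30 : ℕ) : ℝ) + 1) = 2 * (Z : ℝ) ^ 30 + 1 := by push_cast; ring
      _ ≤ Z * (Z : ℝ) ^ 30 := by
          have : (1 : ℝ) ≤ (Z : ℝ) ^ 30 := one_le_pow₀ (by linarith)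
          nlinarith
      _ = (Z : ℝ) ^ 31 := by ring
      _ ≤ Real.exp Z ^ 31 := by gcongr
      _ = _ := by rw [← Real.exp_nat_mul]; norm_num
  have h3 : (Z : ℝ) ^ 6 ≤ ((Z ^ 30 : ℕ) : ℝ) * τ ^ 2 := by
    calc (Z : ℝ) ^ 6 = (Z : ℝ) ^ 30 * (1 / (Z : ℝ) ^ 12) ^ 2 := by field_simp
      _ ≤ (Z : ℝ) ^ 30 * τ ^ 2 := by gcongr
      _ = _ := by push_cast; ring
  calc _ ≤ Real.exp (31 * Z) ^ n * Real.exp (-(2 * ((Z ^ 30 : ℕ) : ℝ) * τ ^ 2)) := by gcongr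
    _ ≤ Real.exp (31 * Z) ^ Z * Real.exp (-(2 * ((Z ^ 30 : ℕ) : ℝ) * τ ^ 2)) := by
        gcongr
        exact Real.one_le_exp (by positivity)
    _ = Real.exp (Z * (31 * Z) + -(2 * ((Z ^ 30 : ℕ) : ℝ) * τ ^ 2)) := by
        rw [← Real.exp_nat_mul, ← Real.exp_add]
    _ ≤ _ := by
        refine Real.exp_le_exp.2 ?_
        have : (32 : ℝ) * (Z * Z) ≤ (Z : ℝ) ^ 6 := by
          calc (32 : ℝ) * (Z * Z) ≤ (Z : ℝ) ^ 4 * (Z * Z) := by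
                gcongr
                calc (32 : ℝ) ≤ (Z : ℝ) ^ 1 := by simpa using hZ'
                  _ ≤ _ := pow_le_pow_right₀ (by linarith) (by norm_num)
            _ = _ := by ring
        nlinarith

theorem ScaleFacts.failure_le {d ℓ : ℕ} {A ε δ Q : ℝ} {Z t : ℕ} (h : ScaleFacts d ℓ A ε δ Q Z t)
    (hδ : 0 < δ) (hδ1 : δ < 1) : (1 / 16 : ℝ) ^ t + 4 * Real.exp (-Z) ≤ δ / 2 := by
  have h2t : (1 / 2 : ℝ) ^ t ≤ δ / 2 := by
    rw [one_div, inv_pow, inv_le_comm₀ (by positivity) (by positivity)]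
    calc (δ / 2)⁻¹ = 2 / δ := by rw [inv_div]
      _ ≤ _ := h.delta_le
  have h1 : (1 / 16 : ℝ) ^ t ≤ (δ / 2) ^ 4 := by
    calc (1 / 16 : ℝ) ^ t = ((1 / 2 : ℝ) ^ t) ^ 4 := by
          rw [← pow_mul, mul_comm, pow_mul]; norm_num
      _ ≤ _ := by gcongr
  have h2 : Real.exp (-Z) ≤ (δ / 2) ^ 4 := by
    have : (32 * t : ℝ) ≤ Z := by exact_mod_cast h.t_le
    have h3 : Real.exp (-1) ≤ 1 / 2 := by
      rw [Real.exp_neg, inv_eq_one_div]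
      refine one_div_le_one_div_of_le (by norm_num) ?_
      linarith [Real.add_one_le_exp (1 : ℝ)]
    calc Real.exp (-Z) ≤ Real.exp ((t * 4 : ℕ) * (-1)) := by
          refine Real.exp_le_exp.2 ?_
          push_cast
          have : (0 : ℝ) ≤ t := Nat.cast_nonneg _
          linarith
      _ = (Real.exp (-1) ^ t) ^ 4 := by rw [Real.exp_nat_mul, pow_mul]
      _ ≤ ((1 / 2) ^ t) ^ 4 := by gcongr
      _ ≤ _ := by gcongr
  have h4 : (δ / 2) ^ 4 ≤ δ / 16 := by
    have h5 : δ ^ 4 ≤ δ := pow_le_of_le_one hδ.le hδ1.le (by norm_num)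
    calc (δ / 2) ^ 4 = δ ^ 4 / 16 := by ring
      _ ≤ _ := by linarith
  linarith

namespace OrthonormalSystem

variable {d : ℕ} {X : Set (Fin d → ℝ)} {D : Measure X} {ℓ r : ℕ}
  (E : OrthonormalSystem D ℓ r) {A ε δ Q : ℝ} {Z t : ℕ}

/-- The events that hold for typical draws. -/
structure TypicalEvents (Z : ℕ) (ε : ℝ) (w : ℝ) (ω : ℕ → X) : Prop where
  core : ∀ i, ω i ∈ E.core
  sq : ∀ α : Fin r → ℝ, (∀ j, |α j| ≤ 1) →
    ∫ x, (E.region ((Z : ℝ) ^ 8)).indicator (fun x => |E.comb α x| ^ 2) x ∂D ≤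
      refMean (Z ^ 30) ω ((E.region ((Z : ℝ) ^ 8)).indicator fun x => |E.comb α x| ^ 2) + 1 / 4
  abs : ∀ α : Fin r → ℝ, (∀ j, |α j| ≤ 1) →
    refMean (Z ^ 30) ω ((E.region ((Z : ℝ) ^ 8)).indicator fun x => |E.comb α x| ^ 1) ≤
      ∫ x, (E.region ((Z : ℝ) ^ 8)).indicator (fun x => |E.comb α x| ^ 1) x ∂D + 1 / (Z : ℝ) ^ 3
  freq : D.real (E.region ((Z : ℝ) ^ 8)) ≤
    refMean (Z ^ 30) ω ((E.region ((Z : ℝ) ^ 8)).indicator fun _ => (1 : ℝ)) + 1 / (Z : ℝ) ^ 8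
  basis : ∀ j, refMean (Z ^ 30) ω (fun x => polyFn ℓ (E.b j) x.1 ^ 2) ≤ w
  margin : ∀ (α β : Fin r → ℝ) (θ : ℝ), (∀ j, |α j| ≤ (Z : ℝ) ^ 18) →
    (∀ j, |β j| ≤ (Z : ℝ) ^ 18) → |θ| ≤ (Z : ℝ) ^ 18 →
    D.real {x | x ∈ E.region ((Z : ℝ) ^ 8) ∧ 0 ≤ min (θ - E.comb β x) (E.comb α x - θ)} ≤
    refMean (Z ^ 30) ω ({x | x ∈ E.region ((Z : ℝ) ^ 8) ∧
      -(1 / (Z : ℝ) ^ 3) < min (θ - E.comb β x) (E.comb α x - θ)}.indicator fun _ => (1 : ℝ)) +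
      ε / 8

theorem card_mul_sqrt_le (E : OrthonormalSystem D ℓ r) (h : ScaleFacts d ℓ A ε δ Q Z t) :
    r * √((Z : ℝ) ^ 8) ≤ (Z : ℝ) ^ 5 := by
  have h1 : (r : ℝ) ≤ Z := by
    have := E.card_le.trans (by have := h.card_le; omega : (d + 1) ^ ℓ ≤ Z)
    exact_mod_cast this
  rw [show (Z : ℝ) ^ 8 = (Z ^ 4) ^ 2 by ring, Real.sqrt_sq (by positivity)]
  calc r * (Z : ℝ) ^ 4 ≤ Z * (Z : ℝ) ^ 4 := by gcongr
    _ = _ := by ring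

/-- Four events come from net arguments and fail with probability at most `exp (-Z)` each. The basis
elements are not bounded outside the region, so their empirical squares are controlled by moments:
the `t`-th moment of the square is at most `(w / (16 * N)) ^ t`, and a union bound over at most `N`
elements leaves `16 ^ (-t)`. -/
theorem measure_not_typicalEvents_le [IsProbabilityMeasure D]
    (E : OrthonormalSystem D ℓ r) (hD : IsHypercontractive D A)
    (h : ScaleFacts d ℓ A ε δ Q Z t) (hε : 0 < ε) (hδ : 0 < δ) (hδ1 : δ < 1) (hQ : 1 ≤ Q) :
    (Measure.infinitePi fun _ : ℕ => D) {ω | ¬ E.TypicalEvents Z ε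
      (16 * (((d + 1) ^ ℓ : ℕ) : ℝ) * (A * (2 * t : ℕ)) ^ (2 * ℓ)) ω} ≤ ENNReal.ofReal (δ / 2) := by
  set N := (d + 1) ^ ℓ with hN
  set w : ℝ := 16 * (N : ℝ) * (A * (2 * t : ℕ)) ^ (2 * ℓ) with hw
  set P := Measure.infinitePi fun _ : ℕ => D with hP
  have hZ : 32 ≤ Z := by have := h.t_le; have := h.t_pos; omega
  have hZ' : (32 : ℝ) ≤ Z := by exact_mod_cast hZ
  have hZ0 : (0 : ℝ) < Z := by linarith
  have hT : 0 < Z ^ 30 := by positivity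
  have hT' : (0 : ℝ) < ((Z ^ 30 : ℕ) : ℝ) := by exact_mod_cast hT
  have hA := hD.1
  have hN1 : 1 ≤ N := Nat.one_le_pow _ _ (by omega)
  have hN1' : (1 : ℝ) ≤ N := by exact_mod_cast hN1
  have hr : 2 * r + 1 ≤ Z := by have := E.card_le; have := h.card_le; omega
  have hY := isIID_infinitePi (ι := ℕ) D
  have hB := E.card_mul_sqrt_le h
  have hε32 : 32 / Z ≤ ε := by
    have := h.eps_le
    rw [div_le_iff₀ hZ0]
    have h2 : 1 / ε ≤ Q / ε := by gcongr
    have h3 : 32 * (1 / ε) ≤ Z := by linarith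
    rw [mul_one_div, div_le_iff₀ hε] at h3
    linarith
  have small : ∀ k : ℕ, 1 ≤ k → 1 / (Z : ℝ) ^ k ≤ 1 / 32 := fun k hk => by
    refine one_div_le_one_div_of_le (by norm_num) ?_
    calc (32 : ℝ) ≤ (Z : ℝ) ^ 1 := by simpa using hZ'
      _ ≤ _ := pow_le_pow_right₀ (by linarith) hk
  have hsm : ∀ a : ℝ, a ≤ 2 → 1 / 32 * (a / Z) ≤ 1 / 24 * (32 / Z) := fun a ha => by
    rw [mul_div_assoc', mul_div_assoc']
    exact div_le_div_of_nonneg_right (by linarith) hZ0.le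
  have hk : ((Z ^ 30 : ℕ) : ℝ) = (Z : ℝ) ^ 30 := by push_cast; rfl
  -- The accuracies are chosen so that `3 * τ * B ^ 2 = 1 / 4` here and `3 * τ * B = 1 / Z ^ 3` in
  -- the next bound, where `B = Z ^ 5`.
  have e1 := E.measure_exists_sq_le (R := (Z : ℝ) ^ 8) (B := (Z : ℝ) ^ 5) hY (by positivity) hB
    (τ := 1 / (12 * (Z : ℝ) ^ 10)) (by positivity) (k := Z ^ 30) hT
    (by
      rw [hk, div_le_div_iff₀ (by positivity) (by positivity)]
      calc 2 * (12 * (Z : ℝ) ^ 10) = 24 * 1 * (Z : ℝ) ^ 10 := by ring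
        _ ≤ Z * (Z : ℝ) ^ 19 * (Z : ℝ) ^ 10 := by
            gcongr
            · linarith
            · exact one_le_pow₀ (by linarith)
        _ = _ := by ring) (Finset.range (Z ^ 30))
  have e2 := E.measure_exists_abs_le (R := (Z : ℝ) ^ 8) (B := (Z : ℝ) ^ 5) hY (by positivity) hB
    (τ := 1 / (3 * (Z : ℝ) ^ 8)) (by positivity) (k := Z ^ 30) hT
    (by
      rw [hk]
      refine one_div_le_one_div_of_le (by positivity) ?_
      calc 3 * (Z : ℝ) ^ 8 = 3 * 1 * (Z : ℝ) ^ 8 := by ring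
        _ ≤ Z * (Z : ℝ) ^ 21 * (Z : ℝ) ^ 8 := by
            gcongr
            · linarith
            · exact one_le_pow₀ (by linarith)
        _ = _ := by ring) (Finset.range (Z ^ 30))
  have e3 := E.measure_region_freq_le (R := (Z : ℝ) ^ 8) hY
    (τ := 1 / (Z : ℝ) ^ 8) (by positivity) (Finset.range (Z ^ 30))
  have e4 := E.measure_exists_margin_le (R := (Z : ℝ) ^ 8) (B := (Z : ℝ) ^ 5) hY measurable_id
    (g := fun _ u l θ => min (θ - l) (u - θ))
    (fun u l hu hl θ => (measurable_const.sub hl).min (hu.sub_const θ))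
    (fun _ u l θ u' l' θ' η h1 h2 h3 => by
      refine (abs_min_sub_min_le_max _ _ _ _).trans (max_le ?_ ?_)
      · rw [show θ - l - (θ' - l') = (θ - θ') - (l - l') by ring]
        exact (abs_sub _ _).trans (by linarith)
      · rw [show u - θ - (u' - θ') = (u - u') - (θ - θ') by ring]
        exact (abs_sub _ _).trans (by linarith))
    (γ := 1 / (Z : ℝ) ^ 3) (ρ := (Z : ℝ) ^ 18) (τ := ε / 24) (by positivity)
    (one_le_pow₀ (by linarith)) hB (by positivity) (by positivity) (k := Z ^ 30) hT
    (by
      rw [hk]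
      have : 2 * (Z : ℝ) ^ 5 / (1 / (Z : ℝ) ^ 3) * (Z : ℝ) ^ 18 / (Z : ℝ) ^ 30 =
          1 / (Z : ℝ) ^ 3 * (2 / Z) := by field_simp
      rw [this]
      exact ((mul_le_mul_of_nonneg_right (small 3 (by norm_num)) (by positivity)).trans
        (hsm 2 (by norm_num))).trans (by linarith)) (Finset.range (Z ^ 30))
  have e5 : ∀ j, P {ω | w ≤ refMean (Z ^ 30) ω fun x => polyFn ℓ (E.b j) x.1 ^ 2} ≤
      ENNReal.ofReal ((1 / (16 * N)) ^ t) := by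
    intro j
    have ht2 : 2 ≤ 2 * t := by have := h.t_pos; omega
    obtain ⟨m1, m2⟩ := hD.moment_le ht2 (E.b j)
    have eq : ∀ x : X, |polyFn ℓ (E.b j) x.1| ^ (2 * t) = (polyFn ℓ (E.b j) x.1 ^ 2) ^ t :=
      fun x => by rw [pow_mul, sq_abs]
    simp only [eq] at m1 m2
    have ht0 : (0 : ℝ) < (2 * t : ℕ) := by exact_mod_cast (by omega : 0 < 2 * t)
    have hw0 : 0 < w := by positivity
    have key := measure_le_refMean_le (D := D) (T := Z ^ 30)
      (f := fun x : X => polyFn ℓ (E.b j) x.1 ^ 2) (fun x => sq_nonneg _) m1 hw0 hT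
    rw [← ENNReal.ofReal_toReal (measure_ne_top P _)]
    refine ENNReal.ofReal_le_ofReal (key.trans ?_)
    have hE1 : (∫ x : X, |polyFn ℓ (E.b j) x.1| ∂D) ^ (2 * t) ≤ 1 := by
      rw [pow_mul]
      refine pow_le_one₀ (sq_nonneg _) ?_
      exact (hD.sq_integral_abs_le (E.b j)).trans (E.integral_basis_sq j).le
    rw [div_le_iff₀ (by positivity)]
    refine m2.trans ?_
    calc (A * (2 * t : ℕ)) ^ (ℓ * (2 * t)) * (∫ x : X, |polyFn ℓ (E.b j) x.1| ∂D) ^ (2 * t)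
        ≤ (A * (2 * t : ℕ)) ^ (ℓ * (2 * t)) * 1 := by gcongr
      _ = _ := by
        have e : 1 / (16 * (N : ℝ)) * w = (A * (2 * t : ℕ)) ^ (2 * ℓ) := by
          rw [hw]; field_simp
        rw [← mul_pow, e, mul_one, ← pow_mul]
        congr 1; ring
  have e0 : P {ω | ¬ ∀ i, ω i ∈ E.core} = 0 := by
    have : ∀ᵐ ω ∂P, ∀ i, ω i ∈ E.core := by
      rw [ae_all_iff]
      intro i
      exact (measurePreserving_eval_infinitePi (fun _ : ℕ => D) i).quasiMeasurePreserving.ae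
        E.ae_mem_core
    exact ae_iff.1 this
  rw [Finset.card_range] at e1 e2 e3 e4
  have f1 := e1.trans (ENNReal.ofReal_le_ofReal (pow_mul_exp_le hZ (by omega) (by
    refine one_div_le_one_div_of_le (by positivity) ?_
    calc 12 * (Z : ℝ) ^ 10 ≤ (Z * Z) * (Z : ℝ) ^ 10 := by gcongr; nlinarith
      _ = _ := by ring)))
  have f2 := e2.trans (ENNReal.ofReal_le_ofReal (pow_mul_exp_le hZ (by omega) (by
    refine one_div_le_one_div_of_le (by positivity) ?_
    calc 3 * (Z : ℝ) ^ 8 = 3 * 1 * (Z : ℝ) ^ 8 := by ring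
      _ ≤ Z * (Z : ℝ) ^ 3 * (Z : ℝ) ^ 8 := by
            gcongr
            · linarith
            · exact one_le_pow₀ (by linarith)
      _ = _ := by ring)))
  have f3 := (e3.trans : ENNReal.ofReal _ ≤ ENNReal.ofReal (Real.exp (-Z)) → _) (ENNReal.ofReal_le_ofReal (by
    have := pow_mul_exp_le hZ (Nat.zero_le Z) (τ := 1 / (Z : ℝ) ^ 8) (by
      refine one_div_le_one_div_of_le (by positivity) ?_
      exact pow_le_pow_right₀ (by linarith) (by norm_num))
    rwa [pow_zero, one_mul] at this))
  have f4 := e4.trans (ENNReal.ofReal_le_ofReal (pow_mul_exp_le hZ hr (by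
    rw [show 1 / (Z : ℝ) ^ 12 = 1 / (Z : ℝ) ^ 11 * (1 / Z) by field_simp]
    exact ((mul_le_mul_of_nonneg_right (small 11 (by norm_num)) (by positivity)).trans
      (hsm 1 (by norm_num))).trans (by linarith))))
  have f5 : P (⋃ j ∈ (Finset.univ : Finset (Fin r)),
      {ω | w ≤ refMean (Z ^ 30) ω fun x => polyFn ℓ (E.b j) x.1 ^ 2}) ≤
      ENNReal.ofReal ((1 / 16) ^ t) := by
    refine (measure_biUnion_finset_le _ _).trans ((Finset.sum_le_sum fun j _ => e5 j).trans ?_)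
    rw [Finset.sum_const, Finset.card_univ, Fintype.card_fin, nsmul_eq_mul,
      ← ENNReal.ofReal_natCast, ← ENNReal.ofReal_mul (by positivity)]
    refine ENNReal.ofReal_le_ofReal ?_
    have hrN : (r : ℝ) ≤ N := by exact_mod_cast E.card_le
    have hNt : (N : ℝ) ≤ (N : ℝ) ^ t := le_self_pow₀ hN1' (by have := h.t_pos; omega)
    rw [one_div, one_div, mul_inv, mul_pow, inv_pow (N : ℝ)]
    calc (r : ℝ) * (16⁻¹ ^ t * ((N : ℝ) ^ t)⁻¹) ≤ (N : ℝ) ^ t * (16⁻¹ ^ t * ((N : ℝ) ^ t)⁻¹) := by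
          gcongr; exact hrN.trans hNt
      _ = _ := by field_simp
  have g1 : P {ω | ¬ ∀ α : Fin r → ℝ, (∀ j, |α j| ≤ 1) →
      ∫ x, (E.region ((Z : ℝ) ^ 8)).indicator (fun x => |E.comb α x| ^ 2) x ∂D ≤
      refMean (Z ^ 30) ω ((E.region ((Z : ℝ) ^ 8)).indicator fun x => |E.comb α x| ^ 2) + 1 / 4} ≤
      ENNReal.ofReal (Real.exp (-Z)) := (measure_mono fun ω hω => by
    simp only [Set.mem_ofPred_eq] at hω
    push Not at hω
    obtain ⟨α, hα, hlt⟩ := hω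
    refine ⟨α, hα, ?_⟩
    rw [← mul_refMean hT, mul_assoc, ← mul_add]
    refine mul_le_mul_of_nonneg_left (le_trans (le_of_eq ?_) hlt.le) hT'.le
    congr 1
    field_simp
    norm_num).trans f1
  have g2 : P {ω | ¬ ∀ α : Fin r → ℝ, (∀ j, |α j| ≤ 1) →
      refMean (Z ^ 30) ω ((E.region ((Z : ℝ) ^ 8)).indicator fun x => |E.comb α x| ^ 1) ≤
      ∫ x, (E.region ((Z : ℝ) ^ 8)).indicator (fun x => |E.comb α x| ^ 1) x ∂D +
        1 / (Z : ℝ) ^ 3} ≤ ENNReal.ofReal (Real.exp (-Z)) := (measure_mono fun ω hω => by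
    simp only [Set.mem_ofPred_eq] at hω
    push Not at hω
    obtain ⟨α, hα, hlt⟩ := hω
    refine ⟨α, hα, ?_⟩
    rw [← mul_refMean hT, mul_assoc, ← mul_add]
    refine mul_le_mul_of_nonneg_left (le_trans (le_of_eq ?_) hlt.le) hT'.le
    congr 1
    field_simp).trans f2
  have g3 : P {ω | ¬ (D.real (E.region ((Z : ℝ) ^ 8)) ≤
      refMean (Z ^ 30) ω ((E.region ((Z : ℝ) ^ 8)).indicator fun _ => (1 : ℝ)) +
        1 / (Z : ℝ) ^ 8)} ≤ ENNReal.ofReal (Real.exp (-Z)) := by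
    refine (measure_mono fun ω hω => ?_).trans f3
    simp only [Set.mem_ofPred_eq] at hω ⊢
    push Not at hω
    rw [← mul_refMean hT, ← mul_add]
    exact mul_le_mul_of_nonneg_left hω.le hT'.le
  have g4 : P {ω | ¬ ∀ (α β : Fin r → ℝ) (θ : ℝ), (∀ j, |α j| ≤ (Z : ℝ) ^ 18) →
      (∀ j, |β j| ≤ (Z : ℝ) ^ 18) → |θ| ≤ (Z : ℝ) ^ 18 →
      D.real {x | x ∈ E.region ((Z : ℝ) ^ 8) ∧ 0 ≤ min (θ - E.comb β x) (E.comb α x - θ)} ≤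
      refMean (Z ^ 30) ω ({x | x ∈ E.region ((Z : ℝ) ^ 8) ∧
        -(1 / (Z : ℝ) ^ 3) < min (θ - E.comb β x) (E.comb α x - θ)}.indicator fun _ => (1 : ℝ)) +
        ε / 8} ≤ ENNReal.ofReal (Real.exp (-Z)) := (measure_mono fun ω hω => by
    simp only [Set.mem_ofPred_eq] at hω
    push Not at hω
    obtain ⟨α, β, θ, hα, hβ, hθ, hlt⟩ := hω
    refine ⟨α, β, θ, hα, hβ, hθ, ?_⟩
    simp only [id]
    rw [← mul_refMean hT, ← mul_add]
    refine mul_le_mul_of_nonneg_left (le_trans (le_of_eq ?_) hlt.le) hT'.le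
    ring).trans f4
  have g5 : P {ω | ¬ ∀ j, refMean (Z ^ 30) ω (fun x => polyFn ℓ (E.b j) x.1 ^ 2) ≤ w} ≤
      ENNReal.ofReal ((1 / 16) ^ t) := (measure_mono fun ω hω => by
    simp only [Set.mem_ofPred_eq] at hω
    push Not at hω
    obtain ⟨j, hj⟩ := hω
    simp only [Set.mem_iUnion, Finset.mem_univ, exists_true_left]
    exact ⟨j, hj.le⟩).trans f5
  have union : ∀ {u v : Set (ℕ → X)} {a b : ENNReal}, P u ≤ a → P v ≤ b → P (u ∪ v) ≤ a + b :=
    fun hu hv => (measure_union_le _ _).trans (add_le_add hu hv)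
  have all := union e0.le (union g1 (union g2 (union g3 (union g4 g5))))
  refine (measure_mono fun ω hω => ?_).trans (all.trans ?_)
  · by_contra hc
    simp only [Set.mem_union, Set.mem_ofPred_eq, not_or, not_not] at hc
    exact hω ⟨hc.1, hc.2.1, hc.2.2.1, hc.2.2.2.1, hc.2.2.2.2.2, hc.2.2.2.2.1⟩
  · have hexp := (Real.exp_pos (-(Z : ℝ))).le
    rw [zero_add, ← ENNReal.ofReal_add (by positivity) (by positivity),
      ← ENNReal.ofReal_add (by positivity) (by positivity),
      ← ENNReal.ofReal_add (by positivity) (by positivity),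
      ← ENNReal.ofReal_add (by positivity) (by positivity)]
    refine ENNReal.ofReal_le_ofReal ?_
    have := h.failure_le hδ hδ1
    linarith

end OrthonormalSystem

/-! ### Consequences for polynomials -/

namespace OrthonormalSystem

variable {d : ℕ} {X : Set (Fin d → ℝ)} {D : Measure X} {ℓ r : ℕ}
  {E : OrthonormalSystem D ℓ r} {A ε δ Q w : ℝ} {Z t : ℕ} {ω : ℕ → X}

/-- Off `s`, the inequality of arithmetic and geometric means trades `|f|` for its square and the
mass of the complement. It is used both for `D` and for the empirical measure. -/
theorem le_indicator_add (s : Set X) (f : X → ℝ) (x : X) {k : ℝ} (hk : 0 < k) :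
    |f x| ≤ s.indicator (fun x => |f x|) x +
      (1 / (2 * k) * f x ^ 2 + k / 2 * sᶜ.indicator (fun _ => (1 : ℝ)) x) := by
  by_cases hx : x ∈ s
  · rw [Set.indicator_of_mem hx, Set.indicator_of_notMem (by simpa using hx)]
    have : 0 ≤ 1 / (2 * k) * f x ^ 2 := by positivity
    linarith
  · rw [Set.indicator_of_notMem hx, Set.indicator_of_mem (by simpa using hx)]
    have h := sq_nonneg (|f x| - k)
    rw [sub_sq, sq_abs] at h
    have : |f x| * (2 * k) ≤ f x ^ 2 + k ^ 2 := by nlinarith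
    calc |f x| ≤ (f x ^ 2 + k ^ 2) / (2 * k) := by rwa [le_div_iff₀ (by positivity)]
      _ = _ := by field_simp; ring

theorem TypicalEvents.refMean_comb_sq_le [IsProbabilityMeasure D] (hω : E.TypicalEvents Z ε w ω)
    (hw : r * w ≤ (Z : ℝ) ^ 2) (α : Fin r → ℝ) :
    (refMean (Z ^ 30) ω fun x => E.comb α x ^ 2) ≤ (Z : ℝ) ^ 2 * ∑ j, α j ^ 2 := by
  have h0 : 0 ≤ ∑ j, α j ^ 2 := Finset.sum_nonneg fun _ _ => sq_nonneg _
  calc (refMean (Z ^ 30) ω fun x => E.comb α x ^ 2)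
      ≤ refMean (Z ^ 30) ω fun x => (∑ j, α j ^ 2) * ∑ j, polyFn ℓ (E.b j) x.1 ^ 2 :=
        refMean_mono fun i _ => Finset.sum_mul_sq_le_sq_mul_sq _ _ _
    _ = (∑ j, α j ^ 2) * ∑ j, refMean (Z ^ 30) ω fun x => polyFn ℓ (E.b j) x.1 ^ 2 := by
        rw [refMean_const_mul, refMean_sum]
    _ ≤ (∑ j, α j ^ 2) * ∑ _j : Fin r, w := by gcongr with j; exact hω.basis j
    _ = (∑ j, α j ^ 2) * (r * w) := by simp
    _ ≤ (∑ j, α j ^ 2) * (Z : ℝ) ^ 2 := by gcongr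
    _ = _ := by ring

theorem compl_region_le [IsProbabilityMeasure D]
    (hD : IsHypercontractive D A) (h : ScaleFacts d ℓ A ε δ Q Z t)
    (E : OrthonormalSystem D ℓ r) : D.real (E.region ((Z : ℝ) ^ 8))ᶜ + 1 / (Z : ℝ) ^ 8 ≤
      1 / (Z : ℝ) ^ 7 := by
  have hZ : 32 ≤ Z := by have := h.t_le; have := h.t_pos; omega
  have hZ' : (32 : ℝ) ≤ Z := by exact_mod_cast hZ
  have h1 := E.measure_region_compl_le (R := (Z : ℝ) ^ 8) (by positivity) fun c => hD.memLp_two c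
  have h2 : ((r + 1 : ℕ) : ℝ) ≤ Z := by
    have := E.card_le; have := h.card_le
    exact_mod_cast (by omega : r + 1 ≤ Z)
  push_cast at h2
  calc _ ≤ r / (Z : ℝ) ^ 8 + 1 / (Z : ℝ) ^ 8 := by gcongr
    _ = (r + 1) / (Z : ℝ) ^ 8 := by rw [add_div]
    _ ≤ Z / (Z : ℝ) ^ 8 := by gcongr
    _ = _ := by field_simp

theorem integral_abs_comb_pow_le [IsProbabilityMeasure D]
    (hD : IsHypercontractive D A) (h : ScaleFacts d ℓ A ε δ Q Z t)
    (E : OrthonormalSystem D ℓ r) {α : Fin r → ℝ} (hα : ∑ j, α j ^ 2 = 1) :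
    Integrable (fun x => |E.comb α x|) D ∧ Integrable (fun x => E.comb α x ^ 2) D ∧
    Integrable (fun x => (E.comb α x ^ 2) ^ 2) D ∧
    ∫ x, (E.comb α x ^ 2) ^ 2 ∂D ≤ (Z : ℝ) ^ 4 ∧ 1 / (Z : ℝ) ≤ ∫ x, |E.comb α x| ∂D := by
  have hZ : 32 ≤ Z := by have := h.t_le; have := h.t_pos; omega
  have hZ' : (32 : ℝ) ≤ Z := by exact_mod_cast hZ
  have hA := hD.1
  set c : Fin ((d + 1) ^ ℓ) → ℝ := fun s => ∑ j, α j * E.b j s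
  have hc : ∀ x : X, E.comb α x = polyFn ℓ c x.1 := E.comb_eq_polyFn α
  have hsq : polySq D ℓ c = 1 := by
    rw [← hα, ← E.integral_comb_sq]
    exact integral_congr_ae (Filter.Eventually.of_forall fun x => by simp only [hc])
  have hI : 0 ≤ ∫ x : X, |polyFn ℓ c x.1| ∂D := integral_nonneg fun x => abs_nonneg _
  simp only [hc]
  obtain ⟨m1, m2⟩ := hD.moment_le (by norm_num : 2 ≤ 4) c
  have e : ∀ x : X, |polyFn ℓ c x.1| ^ 4 = (polyFn ℓ c x.1 ^ 2) ^ 2 := fun x => by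
    rw [show (4 : ℕ) = 2 * 2 by norm_num, pow_mul, sq_abs]
  simp only [e] at m1 m2
  refine ⟨(hD.integrable_polyFn c).abs, (hD.memLp_two c).integrable_sq, m1, m2.trans ?_, ?_⟩
  · have h1 := hD.sq_integral_abs_le c
    rw [hsq] at h1
    calc _ = ((4 * A) ^ ℓ) ^ 4 * ((∫ x : X, |polyFn ℓ c x.1| ∂D) ^ 2) ^ 2 := by
          push_cast; ring
      _ ≤ (Z : ℝ) ^ 4 * 1 ^ 2 := by gcongr; exact h.four_le
      _ = _ := by ring
  · have h1 := hD.polySq_le c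
    rw [hsq] at h1
    have h2 : (2 * A) ^ ℓ * ∫ x : X, |polyFn ℓ c x.1| ∂D ≤ Z * ∫ x : X, |polyFn ℓ c x.1| ∂D := by
      refine mul_le_mul_of_nonneg_right (le_trans ?_ h.four_le) hI
      gcongr; norm_num
    have h3 : 1 ≤ (2 * A) ^ ℓ * ∫ x : X, |polyFn ℓ c x.1| ∂D := by
      have : 0 ≤ (2 * A) ^ ℓ * ∫ x : X, |polyFn ℓ c x.1| ∂D := by positivity
      nlinarith
    rw [div_le_iff₀ (by linarith), mul_comm]
    exact h3.trans h2

/-- The true mean square is `1`. The fourth moment and the small complement of the region show that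
truncation loses at most `1 / 4`, and sampling on the region loses another `1 / 4`. -/
theorem TypicalEvents.half_le [IsProbabilityMeasure D]
    (hD : IsHypercontractive D A) (h : ScaleFacts d ℓ A ε δ Q Z t)
    (hω : E.TypicalEvents Z ε w ω) {α : Fin r → ℝ} (hα : ∑ j, α j ^ 2 = 1) :
    1 / 2 ≤ refMean (Z ^ 30) ω fun x => E.comb α x ^ 2 := by
  have hZ : 32 ≤ Z := by have := h.t_le; have := h.t_pos; omega
  have hZ' : (32 : ℝ) ≤ Z := by exact_mod_cast hZ
  obtain ⟨i1, i2, i3, b3, -⟩ := E.integral_abs_comb_pow_le hD h hα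
  have hα1 : ∀ j, |α j| ≤ 1 := fun j => by
    rw [← sq_le_one_iff_abs_le_one, ← hα]
    exact Finset.single_le_sum (f := fun j => α j ^ 2) (fun j _ => sq_nonneg _) (Finset.mem_univ j)
  set s := E.region ((Z : ℝ) ^ 8)
  have hs : MeasurableSet s := E.measurableSet_region _
  have j1 : Integrable (s.indicator fun x => |E.comb α x| ^ 2) D :=
    E.integrable_indicator_comb_pow 2 α
  have j2 : Integrable (fun x => 1 / (2 * (Z : ℝ) ^ 5) * (E.comb α x ^ 2) ^ 2) D := i3.const_mul _
  have j3 : Integrable (fun x => (Z : ℝ) ^ 5 / 2 * sᶜ.indicator (fun _ => (1 : ℝ)) x) D :=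
    ((integrable_const _).indicator hs.compl).const_mul _
  have key : 1 ≤ ∫ x, s.indicator (fun x => |E.comb α x| ^ 2) x ∂D +
      (1 / (2 * (Z : ℝ) ^ 5) * (Z : ℝ) ^ 4 + (Z : ℝ) ^ 5 / 2 * (1 / (Z : ℝ) ^ 7)) := by
    calc (1 : ℝ) = ∫ x, E.comb α x ^ 2 ∂D := by rw [E.integral_comb_sq, hα]
      _ ≤ ∫ x, (s.indicator (fun x => |E.comb α x| ^ 2) x +
          (1 / (2 * (Z : ℝ) ^ 5) * (E.comb α x ^ 2) ^ 2 +
            (Z : ℝ) ^ 5 / 2 * sᶜ.indicator (fun _ => (1 : ℝ)) x)) ∂D := by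
          refine integral_mono i2 (j1.add (j2.add j3)) fun x => ?_
          have := le_indicator_add s (fun x => E.comb α x ^ 2) x (k := (Z : ℝ) ^ 5) (by positivity)
          simp only [abs_pow] at this
          simpa only [sq_abs] using this
      _ = ∫ x, s.indicator (fun x => |E.comb α x| ^ 2) x ∂D +
          (1 / (2 * (Z : ℝ) ^ 5) * ∫ x, (E.comb α x ^ 2) ^ 2 ∂D +
            (Z : ℝ) ^ 5 / 2 * D.real sᶜ) := by
          have j23 : Integrable (fun x => 1 / (2 * (Z : ℝ) ^ 5) * (E.comb α x ^ 2) ^ 2 +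
            (Z : ℝ) ^ 5 / 2 * sᶜ.indicator (fun _ => (1 : ℝ)) x) D := j2.add j3
          rw [integral_add j1 j23, integral_add j2 j3, integral_const_mul, integral_const_mul,
            integral_indicator hs.compl, setIntegral_const, smul_eq_mul, mul_one]
      _ ≤ _ := by
          have h7 := E.compl_region_le hD h
          have h8 : 0 ≤ 1 / (Z : ℝ) ^ 8 := by positivity
          gcongr
          linarith
  have hsmall : 1 / (2 * (Z : ℝ) ^ 5) * (Z : ℝ) ^ 4 + (Z : ℝ) ^ 5 / 2 * (1 / (Z : ℝ) ^ 7) ≤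
      1 / 4 := by
    have e : 1 / (2 * (Z : ℝ) ^ 5) * (Z : ℝ) ^ 4 + (Z : ℝ) ^ 5 / 2 * (1 / (Z : ℝ) ^ 7) =
        1 / 2 * (1 / Z) + 1 / 2 * (1 / Z * (1 / Z)) := by field_simp
    have h1 : 1 / (Z : ℝ) ≤ 1 / 32 := one_div_le_one_div_of_le (by norm_num) hZ'
    have h2 : 0 ≤ 1 / (Z : ℝ) := by positivity
    rw [e]; nlinarith
  have hs2 := hω.sq α hα1
  have hmono : refMean (Z ^ 30) ω (s.indicator fun x => |E.comb α x| ^ 2) ≤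
      refMean (Z ^ 30) ω fun x => E.comb α x ^ 2 := refMean_mono fun i _ => by
    simp only [sq_abs]
    exact Set.indicator_le_self' (fun _ _ => sq_nonneg _) _
  linarith

/-- The additive errors of truncation and sampling add up to at most `1 / Z`. They become a
multiplicative factor because a polynomial of `L²` norm `1` has `L¹` norm at least `1 / Z`. -/
theorem TypicalEvents.refMean_abs_le [IsProbabilityMeasure D]
    (hD : IsHypercontractive D A)
    (h : ScaleFacts d ℓ A ε δ Q Z t) (hω : E.TypicalEvents Z ε w ω) (hw : r * w ≤ (Z : ℝ) ^ 2)
    {α : Fin r → ℝ} (hα : ∑ j, α j ^ 2 = 1) :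
    (refMean (Z ^ 30) ω fun x => |E.comb α x|) ≤ 3 * ∫ x, |E.comb α x| ∂D := by
  have hZ : 32 ≤ Z := by have := h.t_le; have := h.t_pos; omega
  have hZ' : (32 : ℝ) ≤ Z := by exact_mod_cast hZ
  obtain ⟨i1, i2, i3, b3, b1⟩ := E.integral_abs_comb_pow_le hD h hα
  have hα1 : ∀ j, |α j| ≤ 1 := fun j => by
    rw [← sq_le_one_iff_abs_le_one, ← hα]
    exact Finset.single_le_sum (f := fun j => α j ^ 2) (fun j _ => sq_nonneg _) (Finset.mem_univ j)
  set s := E.region ((Z : ℝ) ^ 8)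
  have hs : MeasurableSet s := E.measurableSet_region _
  have hfreq : (refMean (Z ^ 30) ω fun x => sᶜ.indicator (fun _ => (1 : ℝ)) x) ≤
      1 / (Z : ℝ) ^ 7 := by
    have e : (refMean (Z ^ 30) ω fun x => s.indicator (fun _ => (1 : ℝ)) x) +
        (refMean (Z ^ 30) ω fun x => sᶜ.indicator (fun _ => (1 : ℝ)) x) = 1 := by
      rw [← refMean_add]
      have : ∀ x, s.indicator (fun _ => (1 : ℝ)) x + sᶜ.indicator (fun _ => (1 : ℝ)) x = 1 :=
        fun x => congrFun (Set.indicator_self_add_compl s fun _ => (1 : ℝ)) x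
      simp only [this, refMean, Finset.sum_const, Finset.card_range, nsmul_eq_mul, mul_one]
      exact div_self (by positivity)
    have h1 := hω.freq
    have h2 := E.compl_region_le hD h
    rw [probReal_compl_eq_one_sub hs] at h2
    change D.real s ≤ (refMean (Z ^ 30) ω fun x => s.indicator (fun _ => (1 : ℝ)) x) + _ at h1
    linarith
  have h2 := hω.refMean_comb_sq_le hw α
  rw [hα, mul_one] at h2
  have key : (refMean (Z ^ 30) ω fun x => |E.comb α x|) ≤
      refMean (Z ^ 30) ω (s.indicator fun x => |E.comb α x| ^ 1) +
      (1 / (2 * (Z : ℝ) ^ 4) * (Z : ℝ) ^ 2 + (Z : ℝ) ^ 4 / 2 * (1 / (Z : ℝ) ^ 7)) := by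
    calc (refMean (Z ^ 30) ω fun x => |E.comb α x|) ≤
        refMean (Z ^ 30) ω fun x => s.indicator (fun x => |E.comb α x| ^ 1) x +
          (1 / (2 * (Z : ℝ) ^ 4) * E.comb α x ^ 2 +
            (Z : ℝ) ^ 4 / 2 * sᶜ.indicator (fun _ => (1 : ℝ)) x) := refMean_mono fun i _ => by
          simp only [pow_one]
          exact le_indicator_add s (E.comb α) _ (by positivity)
      _ = refMean (Z ^ 30) ω (s.indicator fun x => |E.comb α x| ^ 1) +
          (1 / (2 * (Z : ℝ) ^ 4) * (refMean (Z ^ 30) ω fun x => E.comb α x ^ 2) +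
            (Z : ℝ) ^ 4 / 2 * (refMean (Z ^ 30) ω fun x => sᶜ.indicator (fun _ => (1 : ℝ)) x)) := by
          rw [refMean_add, refMean_add, refMean_const_mul, refMean_const_mul]
      _ ≤ _ := by gcongr
  have h3 := hω.abs α hα1
  have h4 : ∫ x, s.indicator (fun x => |E.comb α x| ^ 1) x ∂D ≤ ∫ x, |E.comb α x| ∂D := by
    refine integral_mono (E.integrable_indicator_comb_pow 1 α) i1 fun x => ?_
    simp only [pow_one]
    exact Set.indicator_le_self' (fun _ _ => abs_nonneg _) _
  have hsmall : 1 / (2 * (Z : ℝ) ^ 4) * (Z : ℝ) ^ 2 + (Z : ℝ) ^ 4 / 2 * (1 / (Z : ℝ) ^ 7) +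
      1 / (Z : ℝ) ^ 3 ≤ 1 / Z := by
    have e : 1 / (2 * (Z : ℝ) ^ 4) * (Z : ℝ) ^ 2 + (Z : ℝ) ^ 4 / 2 * (1 / (Z : ℝ) ^ 7) +
        1 / (Z : ℝ) ^ 3 = 1 / Z * (1 / 2 * (1 / Z) + 3 / 2 * (1 / Z * (1 / Z))) := by
      field_simp; ring
    have h1 : 1 / (Z : ℝ) ≤ 1 / 32 := one_div_le_one_div_of_le (by norm_num) hZ'
    have h2 : 0 ≤ 1 / (Z : ℝ) := by positivity
    rw [e]
    refine mul_le_of_le_one_right h2 ?_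
    nlinarith
  have h5 : 0 ≤ 1 / (Z : ℝ) := by positivity
  linarith

theorem comb_eq_sqrt_mul (E : OrthonormalSystem D ℓ r) {α : Fin r → ℝ} (hα : 0 < ∑ j, α j ^ 2) :
    ∃ β : Fin r → ℝ, ∑ j, β j ^ 2 = 1 ∧ ∀ x, E.comb α x = √(∑ j, α j ^ 2) * E.comb β x := by
  have h0 : 0 < √(∑ j, α j ^ 2) := Real.sqrt_pos.2 hα
  refine ⟨fun j => α j / √(∑ j, α j ^ 2), ?_, fun x => ?_⟩
  · simp only [div_pow, Real.sq_sqrt hα.le]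
    rw [← Finset.sum_div, div_self hα.ne']
  · rw [← E.comb_smul]
    congr 1
    funext j
    field_simp

open Classical in
/-- The properties of typical draws on which the analysis of the learner rests. -/
structure GoodDraws (E : OrthonormalSystem D ℓ r) (Z : ℕ) (ε : ℝ) (ω : ℕ → X) : Prop where
  lower : ∀ c, polySq D ℓ c ≤ 2 * refMean (Z ^ 30) ω fun x => polyFn ℓ c x.1 ^ 2
  upper : ∀ c, (refMean (Z ^ 30) ω fun x => polyFn ℓ c x.1 ^ 2) ≤ (Z : ℝ) ^ 2 * polySq D ℓ c
  abs : ∀ c, (refMean (Z ^ 30) ω fun x => |polyFn ℓ c x.1|) ≤ 3 * ∫ x : X, |polyFn ℓ c x.1| ∂D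
  margin : ∀ u l θ, polySq D ℓ u ≤ (Z : ℝ) ^ 35 → polySq D ℓ l ≤ (Z : ℝ) ^ 35 → |θ| ≤ 1 →
    D.real {x | x ∈ E.region ((Z : ℝ) ^ 8) ∧ polyFn ℓ l x.1 < θ ∧ θ ≤ polyFn ℓ u x.1} ≤
    refMean (Z ^ 30) ω (fun x => if polyFn ℓ l x.1 < θ + 1 / (Z : ℝ) ^ 3 ∧
        θ - 1 / (Z : ℝ) ^ 3 < polyFn ℓ u x.1 then 1 else 0) + ε / 8

theorem abs_coeff_le_pow (E : OrthonormalSystem D ℓ r) (hZ : 1 ≤ Z) {c : Fin ((d + 1) ^ ℓ) → ℝ}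
    (hc : polySq D ℓ c ≤ (Z : ℝ) ^ 35) (j : Fin r) : |E.coeff c j| ≤ (Z : ℝ) ^ 18 := by
  have hZ' : (1 : ℝ) ≤ Z := by exact_mod_cast hZ
  refine (E.abs_coeff_le c j).trans (Real.sqrt_le_iff.2 ⟨by positivity, hc.trans ?_⟩)
  rw [← pow_mul]
  exact pow_le_pow_right₀ hZ' (by norm_num)

/-- All draws lie in the core, so polynomials may be replaced by combinations of the system. The
first three bounds are homogeneous and reduce to unit norm; the margin bound needs the coefficient
bound `Z ^ 18`. -/
theorem TypicalEvents.goodDraws [IsProbabilityMeasure D]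
    (hD : IsHypercontractive D A)
    (h : ScaleFacts d ℓ A ε δ Q Z t) (hω : E.TypicalEvents Z ε w ω) (hw : r * w ≤ (Z : ℝ) ^ 2) :
    E.GoodDraws Z ε ω := by
  have hZ : 32 ≤ Z := by have := h.t_le; have := h.t_pos; omega
  have hZ' : (32 : ℝ) ≤ Z := by exact_mod_cast hZ
  have ev : ∀ c i, polyFn ℓ c (ω i).1 = E.comb (E.coeff c) (ω i) := fun c i =>
    E.polyFn_eq_comb c (hω.core i)
  have eint : ∀ c, ∫ x : X, |polyFn ℓ c x.1| ∂D = ∫ x, |E.comb (E.coeff c) x| ∂D := fun c => by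
    refine integral_congr_ae ?_
    filter_upwards [E.ae_mem_core] with x hx
    rw [E.polyFn_eq_comb c hx]
  refine ⟨fun c => ?_, fun c => ?_, fun c => ?_, fun u l θ hu hl hθ => ?_⟩
  · rw [refMean_congr (g := fun x => E.comb (E.coeff c) x ^ 2) fun i _ => by simp only [ev]]
    rw [← E.sum_coeff_sq]
    rcases (Finset.sum_nonneg fun j _ => sq_nonneg (E.coeff c j) :
      0 ≤ ∑ j, E.coeff c j ^ 2).eq_or_lt with h0 | h0
    · rw [← h0]
      exact mul_nonneg (by norm_num) (refMean_nonneg fun _ => sq_nonneg _)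
    · obtain ⟨β, h1, h2⟩ := E.comb_eq_sqrt_mul h0
      simp only [h2, mul_pow, Real.sq_sqrt h0.le]
      rw [refMean_const_mul]
      nlinarith [hω.half_le hD h h1]
  · rw [refMean_congr (g := fun x => E.comb (E.coeff c) x ^ 2) fun i _ => by simp only [ev]]
    rw [← E.sum_coeff_sq]
    exact hω.refMean_comb_sq_le hw _
  · rw [refMean_congr (g := fun x => |E.comb (E.coeff c) x|) fun i _ => by simp only [ev], eint]
    rcases (Finset.sum_nonneg fun j _ => sq_nonneg (E.coeff c j) :
      0 ≤ ∑ j, E.coeff c j ^ 2).eq_or_lt with h0 | h0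
    · have h1 : ∀ j, E.coeff c j = 0 := fun j => by
        have := (Finset.sum_eq_zero_iff_of_nonneg fun j _ => sq_nonneg (E.coeff c j)).1 h0.symm j
          (Finset.mem_univ j)
        exact pow_eq_zero_iff (two_ne_zero) |>.1 this
      have h2 : ∀ x, E.comb (E.coeff c) x = 0 := fun x => by simp [comb, h1]
      simp [h2, refMean]
    · obtain ⟨β, h1, h2⟩ := E.comb_eq_sqrt_mul h0
      simp only [h2, abs_mul]
      rw [refMean_const_mul, integral_const_mul]
      have := mul_le_mul_of_nonneg_left (hω.refMean_abs_le hD h hw h1)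
        (abs_nonneg √(∑ j, E.coeff c j ^ 2))
      linarith
  · have h1 := hω.margin (E.coeff u) (E.coeff l) θ (E.abs_coeff_le_pow (by omega) hu)
      (E.abs_coeff_le_pow (by omega) hl) (hθ.trans (one_le_pow₀ (by linarith)))
    refine le_trans (measureReal_mono fun x hx => ?_) (h1.trans ?_)
    · refine ⟨hx.1, ?_⟩
      rw [← E.polyFn_eq_comb l hx.1.1, ← E.polyFn_eq_comb u hx.1.1]
      exact le_min (by linarith [hx.2.1]) (by linarith [hx.2.2])
    · gcongr
      refine refMean_mono fun i _ => ?_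
      refine Set.indicator_apply_le' (fun hx => ?_) (fun _ => by positivity)
      rw [Set.mem_ofPred_eq, ← ev, ← ev, lt_min_iff] at hx
      rw [if_pos ⟨by linarith [hx.2.1], by linarith [hx.2.2]⟩]

theorem measure_not_goodDraws_le [IsProbabilityMeasure D]
    (E : OrthonormalSystem D ℓ r) (hD : IsHypercontractive D A)
    (h : ScaleFacts d ℓ A ε δ Q Z t) (hε : 0 < ε) (hδ : 0 < δ) (hδ1 : δ < 1) (hQ : 1 ≤ Q) :
    (Measure.infinitePi fun _ : ℕ => D) {ω | ¬ E.GoodDraws Z ε ω} ≤ ENNReal.ofReal (δ / 2) := by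
  refine (measure_mono fun ω hω => ?_).trans
    (E.measure_not_typicalEvents_le hD h hε hδ hδ1 hQ)
  refine fun h' => hω (h'.goodDraws hD h (le_trans ?_ h.moment_le))
  have hA := hD.1
  have hr : (r : ℝ) ≤ ((d + 1) ^ ℓ : ℕ) := by exact_mod_cast E.card_le
  calc _ ≤ (((d + 1) ^ ℓ : ℕ) : ℝ) * (16 * (((d + 1) ^ ℓ : ℕ) : ℝ) *
        (A * (2 * t : ℕ)) ^ (2 * ℓ)) := by gcongr
    _ = _ := by ring

end OrthonormalSystem

/-! ### The error of the output hypothesis -/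

namespace OrthonormalSystem

variable {d : ℕ} {X : Set (Fin d → ℝ)} {D : Measure X} {ℓ r : ℕ}
  {E : OrthonormalSystem D ℓ r} {A ε δ Q : ℝ} {Z t m M : ℕ} {Dbar : Measure (X × ℤˣ)}

open Classical in
/-- The clean sample is representative of the clean distribution on the region. -/
def GoodSample (E : OrthonormalSystem D ℓ r) (Dbar : Measure (X × ℤˣ)) (Z : ℕ) (ε : ℝ)
    (S : Fin m → X × ℤˣ) : Prop :=
  ∀ u l θ, polySq D ℓ u ≤ (Z : ℝ) ^ 35 → polySq D ℓ l ≤ (Z : ℝ) ^ 35 → |θ| ≤ 1 →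
    Dbar.real {w | w.1 ∈ E.region ((Z : ℝ) ^ 8) ∧
      if w.2 = 1 then polyFn ℓ u w.1.1 < θ else θ ≤ polyFn ℓ l w.1.1} ≤
    (∑ i, if (S i).1 ∈ E.region ((Z : ℝ) ^ 8) ∧ LabelViolated (1 / (Z : ℝ) ^ 3) θ
      (polyFn ℓ u (S i).1.1) (polyFn ℓ l (S i).1.1) (S i).2 then (1 : ℝ) else 0) / m + ε / 8

/-- Measurability of the label as an integer is used, since the `σ`-algebra of `ℤˣ` is pulled back
from `ℤ`. -/
theorem measurableSet_label_eq_one {α : Type*} [MeasurableSpace α] :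
    MeasurableSet {w : α × ℤˣ | w.2 = 1} := by
  have h : Measurable fun w : α × ℤˣ => (w.2 : ℤ) := (comap_measurable Units.val).comp measurable_snd
  have e : {w : α × ℤˣ | w.2 = 1} = (fun w : α × ℤˣ => (w.2 : ℤ)) ⁻¹' {1} := by
    ext w; simp
  rw [e]
  exact h (measurableSet_singleton 1)

/-- Both labels are handled by one margin function, `θ - u` for positive and `l - θ` for negative
examples. The event quantifies over all bounded `u`, `l`, `θ` and does not mention the adversary. -/
theorem measure_not_goodSample_le [IsProbabilityMeasure Dbar] (E : OrthonormalSystem D ℓ r)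
    (h : ScaleFacts d ℓ A ε δ Q Z t) (hε : 0 < ε) (hQ : 1 ≤ Q) (hm : 0 < m)
    (hδ : (2 * ((Z ^ 30 : ℕ) : ℝ) + 1) ^ (2 * (d + 1) ^ ℓ + 1) *
      Real.exp (-(2 * m * (ε / 24) ^ 2)) ≤ δ / 2) :
    (Measure.pi fun _ : Fin m => Dbar) {S | ¬ E.GoodSample Dbar Z ε S} ≤ ENNReal.ofReal (δ / 2) := by
  have hZ : 32 ≤ Z := by have := h.t_le; have := h.t_pos; omega
  have hZ' : (32 : ℝ) ≤ Z := by exact_mod_cast hZ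
  have hZ0 : (0 : ℝ) < Z := by linarith
  have hm' : (0 : ℝ) < m := by exact_mod_cast hm
  have hT : 0 < Z ^ 30 := by positivity
  have hε32 : 32 / Z ≤ ε := by
    have := h.eps_le
    rw [div_le_iff₀ hZ0]
    have h2 : 1 / ε ≤ Q / ε := by gcongr
    have h3 : 32 * (1 / ε) ≤ Z := by linarith
    rw [mul_one_div, div_le_iff₀ hε] at h3
    linarith
  have e4 := E.measure_exists_margin_le (R := (Z : ℝ) ^ 8) (B := (Z : ℝ) ^ 5)
    (isIID_pi (ι := Fin m) Dbar) measurable_fst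
    (g := fun w u l θ => if w.2 = 1 then θ - u else l - θ)
    (fun u l hu hl θ => Measurable.ite measurableSet_label_eq_one (measurable_const.sub hu)
      (hl.sub_const θ))
    (fun w u l θ u' l' θ' η h1 h2 h3 => by
      split_ifs
      · rw [show θ - u - (θ' - u') = (θ - θ') - (u - u') by ring]
        exact (abs_sub _ _).trans (by linarith)
      · rw [show l - θ - (l' - θ') = (l - l') - (θ - θ') by ring]
        exact (abs_sub _ _).trans (by linarith))
    (γ := 1 / (Z : ℝ) ^ 3) (ρ := (Z : ℝ) ^ 18) (τ := ε / 24) (by positivity)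
    (one_le_pow₀ (by linarith)) (E.card_mul_sqrt_le h) (by positivity) (by positivity)
    (k := Z ^ 30) hT
    (by
      have : 2 * (Z : ℝ) ^ 5 / (1 / (Z : ℝ) ^ 3) * (Z : ℝ) ^ 18 / ((Z ^ 30 : ℕ) : ℝ) =
          1 / (Z : ℝ) ^ 3 * (2 / Z) := by push_cast; field_simp
      rw [this]
      have h1 : 1 / (Z : ℝ) ^ 3 ≤ 1 / 32 := one_div_le_one_div_of_le (by norm_num)
        (hZ'.trans (le_self_pow₀ (by linarith) (by norm_num)))
      calc 1 / (Z : ℝ) ^ 3 * (2 / Z) ≤ 1 / 32 * (2 / Z) := by gcongr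
        _ = 1 / 512 * (32 / Z) := by ring
        _ ≤ _ := by linarith) Finset.univ
  rw [Finset.card_univ, Fintype.card_fin] at e4
  refine (measure_mono fun S hS => ?_).trans (e4.trans (ENNReal.ofReal_le_ofReal (le_trans ?_ hδ)))
  · simp only [GoodSample, Set.mem_ofPred_eq] at hS
    push Not at hS
    obtain ⟨u, l, θ, hu, hl, hθ, hlt⟩ := hS
    refine ⟨E.coeff u, E.coeff l, θ, E.abs_coeff_le_pow (by omega) hu,
      E.abs_coeff_le_pow (by omega) hl, hθ.trans (one_le_pow₀ (by linarith)), ?_⟩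
    have h1 : {w : X × ℤˣ | w.1 ∈ E.region ((Z : ℝ) ^ 8) ∧
        if w.2 = 1 then polyFn ℓ u w.1.1 < θ else θ ≤ polyFn ℓ l w.1.1} ⊆
        {w | w.1 ∈ E.region ((Z : ℝ) ^ 8) ∧
          0 ≤ if w.2 = 1 then θ - E.comb (E.coeff u) w.1 else E.comb (E.coeff l) w.1 - θ} := by
      rintro w ⟨hw, hw2⟩
      refine ⟨hw, ?_⟩
      rw [← E.polyFn_eq_comb l hw.1, ← E.polyFn_eq_comb u hw.1]
      split_ifs at hw2 ⊢ <;> linarith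
    have h2 := hlt.le.trans (measureReal_mono h1)
    refine le_trans ?_ (mul_le_mul_of_nonneg_left h2 hm'.le)
    rw [mul_add, mul_div_cancel₀ _ hm'.ne', show 3 * (ε / 24) = ε / 8 by ring]
    refine add_le_add (Finset.sum_le_sum fun i _ => ?_) le_rfl
    refine Set.indicator_apply_le' (fun hx => ?_) (fun _ => by positivity)
    obtain ⟨hx1, hx2⟩ := hx
    rw [← E.polyFn_eq_comb l hx1.1, ← E.polyFn_eq_comb u hx1.1] at hx2
    rw [if_pos]
    refine ⟨hx1, ?_⟩
    unfold LabelViolated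
    split_ifs at hx2 ⊢ <;> linarith
  · gcongr
    · have : (0 : ℝ) ≤ ((Z ^ 30 : ℕ) : ℝ) := Nat.cast_nonneg _
      linarith
    · exact E.card_le

end OrthonormalSystem

/-- A sandwiching pair satisfies `u ≥ 1` where `f = 1` and `l ≤ -1` where `f = -1`; in all cases `u
≥ -1` and `l ≤ 1`. -/
theorem labelHinge_le {u l : ℝ} {y f : ℤˣ} (hu : ((f : ℤ) : ℝ) ≤ u) (hl : l ≤ ((f : ℤ) : ℝ)) :
    labelHinge u l y ≤ 2 * if y ≠ f then 1 else 0 := by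
  unfold labelHinge
  rcases Int.units_eq_one_or y with rfl | rfl <;> rcases Int.units_eq_one_or f with rfl | rfl
  · norm_num at hu ⊢; linarith
  · norm_num at hu ⊢; linarith
  · norm_num at hl ⊢; linarith
  · norm_num at hl ⊢; linarith

/-! ### The error bound -/

section Error

variable {d : ℕ} {X : Set (Fin d → ℝ)} {D : Measure X} [IsProbabilityMeasure D] {ℓ r : ℕ}
  {E : OrthonormalSystem D ℓ r} {A ε δ Q : ℝ} {Z t m M : ℕ} {ω : ℕ → X}

theorem polySq_le_of_abs_le (hD : IsHypercontractive D A) (h : ScaleFacts d ℓ A ε δ Q Z t)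
    {c : Fin ((d + 1) ^ ℓ) → ℝ} {g : X → ℝ} (hg : Integrable g D) (hg1 : ∫ x, g x ∂D ≤ 1)
    (hc : ∀ x : X, |polyFn ℓ c x.1| ≤ 1 + g x) : polySq D ℓ c ≤ 4 * (Z : ℝ) ^ 2 := by
  have h1 : ∫ x : X, |polyFn ℓ c x.1| ∂D ≤ 2 := by
    calc _ ≤ ∫ x, (1 + g x) ∂D := integral_mono (hD.integrable_polyFn c).abs
          ((integrable_const _).add hg) hc
      _ = 1 + ∫ x, g x ∂D := by
          rw [integral_add (integrable_const _) hg]; simp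
      _ ≤ _ := by linarith
  have h0 : 0 ≤ ∫ x : X, |polyFn ℓ c x.1| ∂D := integral_nonneg fun x => abs_nonneg _
  have hA := hD.1
  refine (hD.polySq_le c).trans ?_
  have h2 : (2 * A) ^ ℓ ≤ Z := le_trans (by gcongr; norm_num) h.four_le
  calc _ ≤ ((Z : ℝ) * 2) ^ 2 := by gcongr
    _ = _ := by ring

/-- The best objective value is at most about `opt_total`. -/
theorem exists_comparator (hD : IsHypercontractive D A) (h : ScaleFacts d ℓ A ε δ Q Z t)
    (hω : E.GoodDraws Z ε ω) {𝒞 : Set (X → ℤˣ)} (hne : 𝒞.Nonempty) {η ζ : ℝ} (hη : η ≤ 1)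
    (hζ : 0 < ζ) (hS : HasSandwichingDegree 𝒞 D η ℓ) (S : Fin M → X × ℤˣ) :
    ∃ cu cl : Fin ((d + 1) ^ ℓ) → ℝ,
      (∑ i, labelHinge (polyFn ℓ cu (S i).1.1) (polyFn ℓ cl (S i).1.1) (S i).2) / M ≤
        2 * (optTotal 𝒞 S + ζ) ∧
      (refMean (Z ^ 30) ω fun x => max 0 (polyFn ℓ cu x.1 - polyFn ℓ cl x.1)) ≤ 3 * η ∧
      (refMean (Z ^ 30) ω fun x => polyFn ℓ cu x.1 ^ 2) ≤ 4 * (Z : ℝ) ^ 4 ∧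
      (refMean (Z ^ 30) ω fun x => polyFn ℓ cl x.1 ^ 2) ≤ 4 * (Z : ℝ) ^ 4 := by
  have : Nonempty 𝒞 := hne.to_subtype
  -- The slack `ζ` avoids having to find a minimizing concept.
  obtain ⟨⟨f, hf⟩, hopt⟩ := exists_lt_of_ciInf_lt (show optTotal 𝒞 S < optTotal 𝒞 S + ζ by linarith)
  obtain ⟨pu, pl, du, dl, hs, hint, hle⟩ := hS f hf
  obtain ⟨cu, hcu⟩ := exists_polyFn_eq_eval pu du
  obtain ⟨cl, hcl⟩ := exists_polyFn_eq_eval pl dl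
  simp only [← hcu, ← hcl] at hs hint hle
  have hsub : ∀ x : Fin d → ℝ, polyFn ℓ cu x - polyFn ℓ cl x = polyFn ℓ (cu - cl) x := fun x => by
    unfold polyFn
    rw [← Finset.sum_sub_distrib]
    exact Finset.sum_congr rfl fun s _ => by simp only [Pi.sub_apply]; ring
  have hf1 : ∀ x, |((f x : ℤ) : ℝ)| = 1 := fun x => by
    rcases Int.units_eq_one_or (f x) with h | h <;> rw [h] <;> norm_num
  have hsq : ∀ c, polySq D ℓ c ≤ 4 * (Z : ℝ) ^ 2 →
      (refMean (Z ^ 30) ω fun x => polyFn ℓ c x.1 ^ 2) ≤ 4 * (Z : ℝ) ^ 4 := fun c hc => by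
    refine (hω.upper c).trans ?_
    calc (Z : ℝ) ^ 2 * polySq D ℓ c ≤ (Z : ℝ) ^ 2 * (4 * (Z : ℝ) ^ 2) := by gcongr
      _ = _ := by ring
  refine ⟨cu, cl, ?_, ?_, hsq cu (polySq_le_of_abs_le hD h hint (hle.trans hη) fun x => ?_),
    hsq cl (polySq_le_of_abs_le hD h hint (hle.trans hη) fun x => ?_)⟩
  · have h1 : ∑ i, labelHinge (polyFn ℓ cu (S i).1.1) (polyFn ℓ cl (S i).1.1) (S i).2 ≤
        2 * ∑ i, if (S i).2 ≠ f (S i).1 then (1 : ℝ) else 0 := by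
      rw [Finset.mul_sum]
      exact Finset.sum_le_sum fun i _ => labelHinge_le (hs _).2 (hs _).1
    calc _ ≤ (2 * ∑ i, if (S i).2 ≠ f (S i).1 then (1 : ℝ) else 0) / M := by gcongr
      _ = 2 * (1 / (M : ℝ) * ∑ i, if (S i).2 ≠ f (S i).1 then (1 : ℝ) else 0) := by ring
      _ ≤ _ := by gcongr
  · calc (refMean (Z ^ 30) ω fun x => max 0 (polyFn ℓ cu x.1 - polyFn ℓ cl x.1))
        ≤ refMean (Z ^ 30) ω fun x => |polyFn ℓ (cu - cl) x.1| := refMean_mono fun i _ => by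
          rw [hsub]; exact max_le (abs_nonneg _) (le_abs_self _)
      _ ≤ 3 * ∫ x : X, |polyFn ℓ (cu - cl) x.1| ∂D := hω.abs _
      _ = 3 * ∫ x : X, (polyFn ℓ cu x.1 - polyFn ℓ cl x.1) ∂D := by
          congr 1
          refine integral_congr_ae (Filter.Eventually.of_forall fun x => ?_)
          simp only [← hsub]
          exact abs_of_nonneg (by linarith [(hs x).1, (hs x).2])
      _ ≤ _ := by linarith
  · have := abs_le.1 (hf1 x).le
    rw [abs_le]
    constructor <;> linarith [(hs x).1, (hs x).2]
  · have := abs_le.1 (hf1 x).le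
    rw [abs_le]
    constructor <;> linarith [(hs x).1, (hs x).2]

/-- After halving and multiplying by `Q`, the slack `ζ` costs `ε / 16`, the sandwiching error `ε ^ 2
/ 8`, and descent and grid together at most `ε / 16`, because `Q / Z ≤ ε / 32`. -/
theorem mul_le_of_objective_le {Z ε Q opt H R P₁ P₂ y : ℝ} (hZ' : 32 ≤ Z) (hε : 0 ≤ ε)
    (hε1 : ε ≤ 1) (hQ : 1 ≤ Q) (hz : Q / Z ≤ ε / 32) (hH : H ≤ 2 * (opt + ε / (16 * Q)))
    (hR : R ≤ 3 * (ε ^ 2 / (12 * Q))) (h₁ : P₁ ≤ 4 * Z ^ 4) (h₂ : P₂ ≤ 4 * Z ^ 4)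
    (hy : y ≤ (H + R + (P₁ + P₂) / (2 * Z ^ 11) + 4 / Z ^ 4) / 2 + 6 / Z ^ 3) :
    Q * y ≤ Q * opt + ε / 2 := by
  have hZ0 : 0 < Z := by linarith
  have hinv : 1 / Z ≤ 1 / 32 := one_div_le_one_div_of_le (by norm_num) hZ'
  have hinv0 : 0 < 1 / Z := by positivity
  have h9 : (P₁ + P₂) / (2 * Z ^ 11) ≤ 4 / Z ^ 7 := by
    calc _ ≤ (4 * Z ^ 4 + 4 * Z ^ 4) / (2 * Z ^ 11) := by gcongr
      _ = _ := by field_simp; ring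
  have h10 : 4 / Z ^ 7 + 4 / Z ^ 4 ≤ 4 / Z ^ 3 := by
    have e1 : 4 / Z ^ 7 = 4 / Z ^ 3 * (1 / Z ^ 4) := by field_simp
    have e2 : 4 / Z ^ 4 = 4 / Z ^ 3 * (1 / Z) := by field_simp
    have e3 : 1 / Z ^ 4 ≤ 1 / Z := by
      refine one_div_le_one_div_of_le hZ0 ?_
      exact le_self_pow₀ (by linarith) (by norm_num)
    have e4 : 0 ≤ 4 / Z ^ 3 := by positivity
    rw [e1, e2]
    nlinarith
  have h8 : y ≤ opt + ε / (16 * Q) + 3 / 2 * (ε ^ 2 / (12 * Q)) + 8 / Z ^ 3 := by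
    have e5 : 8 / Z ^ 3 = 4 / Z ^ 3 / 2 + 6 / Z ^ 3 := by ring
    linarith
  have h13 : Q * (8 / Z ^ 3) ≤ ε / 16 := by
    have e : Q * (8 / Z ^ 3) = Q / Z * (8 * (1 / Z * (1 / Z))) := by field_simp
    rw [e]
    have h14 : 8 * (1 / Z * (1 / Z)) ≤ 1 := by nlinarith
    calc Q / Z * (8 * (1 / Z * (1 / Z))) ≤ ε / 32 * 1 :=
          mul_le_mul hz h14 (by positivity) (by positivity)
      _ ≤ _ := by linarith
  calc Q * y ≤ Q * (opt + ε / (16 * Q) + 3 / 2 * (ε ^ 2 / (12 * Q)) + 8 / Z ^ 3) := by gcongr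
    _ = Q * opt + ε / 16 + ε ^ 2 / 8 + Q * (8 / Z ^ 3) := by
        have e1 : Q * (ε / (16 * Q)) = ε / 16 := by field_simp
        have e2 : Q * (3 / 2 * (ε ^ 2 / (12 * Q))) = ε ^ 2 / 8 := by field_simp; ring
        rw [mul_add, mul_add, mul_add, e1, e2]
    _ ≤ _ := by
        have : ε ^ 2 ≤ ε := by nlinarith
        linarith

theorem error_le (hD : IsHypercontractive D A) (h : ScaleFacts d ℓ A ε δ Q Z t)
    (hε : 0 < ε) (hε1 : ε < 1) (hQ : 1 ≤ Q)
    (hω : E.GoodDraws Z ε ω) {𝒞 : Set (X → ℤˣ)} (hne : 𝒞.Nonempty)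
    (hS : HasSandwichingDegree 𝒞 D (ε ^ 2 / (12 * Q)) ℓ)
    {Dbar : Measure (X × ℤˣ)} [IsProbabilityMeasure Dbar] (hmap : Dbar.map Prod.fst = D)
    {Scln : Fin m → X × ℤˣ} (hcln : E.GoodSample Dbar Z ε Scln) (hm : 0 < m)
    (hmM : m ≤ M) (hMQ : (M : ℝ) ≤ Q * m) {S : Fin M → X × ℤˣ}
    (hadd : IsAdditiveContamination Scln S) {u l : Fin ((d + 1) ^ ℓ) → ℝ} {θ : ℝ} {κ : Fin M → Prop}
    (hG : Guarantee ℓ Z S ω u l θ κ) {f : X → ℤˣ}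
    (hf : ∀ x, f x = if θ ≤ polyFn ℓ l x.1 then 1 else -1) :
    Dbar.real {w | w.2 ≠ f w.1} ≤ Q * optTotal 𝒞 S + ε := by
  classical
  have hZ : 32 ≤ Z := by have := h.t_le; have := h.t_pos; omega
  have hZ' : (32 : ℝ) ≤ Z := by exact_mod_cast hZ
  have hZ0 : (0 : ℝ) < Z := by linarith
  have hm' : (0 : ℝ) < m := by exact_mod_cast hm
  have hM' : (0 : ℝ) < M := by exact_mod_cast (by omega : 0 < M)
  have hsq : ∀ c, (refMean (Z ^ 30) ω fun x => polyFn ℓ c x.1 ^ 2) ≤ (Z : ℝ) ^ 34 →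
      polySq D ℓ c ≤ (Z : ℝ) ^ 35 := fun c hc => by
    calc polySq D ℓ c ≤ 2 * refMean (Z ^ 30) ω fun x => polyFn ℓ c x.1 ^ 2 := hω.lower c
      _ ≤ Z * (Z : ℝ) ^ 34 :=
        mul_le_mul (by linarith) hc (refMean_nonneg fun x => sq_nonneg _) hZ0.le
      _ = _ := by ring
  have hu := hsq u hG.u_le
  have hl := hsq l hG.l_le
  -- In the region `p x ^ 2 ≤ r * Z ^ 8 * ‖p‖²`, and the true norm is at most twice the empirical
  -- one; with `2 * r ≤ Z` this fits below the factor `Z ^ 10` of the filter.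
  have hkept : ∀ i, (S i).1 ∈ E.region ((Z : ℝ) ^ 8) → κ i := fun i hi => hG.kept i fun c => by
    have hr : (2 * r : ℝ) ≤ (Z : ℝ) := by
      have := E.card_le; have := h.card_le
      exact_mod_cast (by omega : 2 * r ≤ Z)
    have h0 : 0 ≤ refMean (Z ^ 30) ω fun x => polyFn ℓ c x.1 ^ 2 :=
      refMean_nonneg fun x => sq_nonneg _
    calc polyFn ℓ c (S i).1.1 ^ 2 ≤ r * (Z : ℝ) ^ 8 * polySq D ℓ c := E.polyFn_sq_le hi c
      _ ≤ r * (Z : ℝ) ^ 8 * (2 * refMean (Z ^ 30) ω fun x => polyFn ℓ c x.1 ^ 2) := by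
          gcongr; exact hω.lower c
      _ = (2 * r) * (Z : ℝ) ^ 8 * refMean (Z ^ 30) ω fun x => polyFn ℓ c x.1 ^ 2 := by ring
      _ ≤ (Z * Z) * (Z : ℝ) ^ 8 * refMean (Z ^ 30) ω fun x => polyFn ℓ c x.1 ^ 2 := by
          have hr2 : (2 * r : ℝ) ≤ Z * Z := by nlinarith
          gcongr ?_ * _ * _
      _ = _ := by ring
  set reg := E.region ((Z : ℝ) ^ 8) with hreg
  have hregm : MeasurableSet reg := E.measurableSet_region _
  set γ : ℝ := 1 / (Z : ℝ) ^ 3 with hγ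
  set cnt : ℝ := (∑ i : Fin M, if κ i ∧ LabelViolated γ θ (polyFn ℓ u (S i).1.1)
    (polyFn ℓ l (S i).1.1) (S i).2 then (1 : ℝ) else 0) with hcnt
  set ref : ℝ := refMean (Z ^ 30) ω (fun x => if polyFn ℓ l x.1 < θ + γ ∧
    θ - γ < polyFn ℓ u x.1 then (1 : ℝ) else 0) with href
  have hcnt0 : 0 ≤ cnt := Finset.sum_nonneg fun i _ => by split_ifs <;> norm_num
  have href0 : 0 ≤ ref := refMean_nonneg fun x => by split_ifs <;> norm_num
  have hfst : ∀ s : Set X, MeasurableSet s → Dbar.real (Prod.fst ⁻¹' s) = D.real s := fun s hs => by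
    rw [← hmap, map_measureReal_apply measurable_fst hs]
  -- A point in the region with a wrong prediction either violates its label or, if it is positive
  -- with `θ ≤ u`, satisfies `l < θ ≤ u`. The latter event is measured under `D`.
  have h1 : Dbar.real {w | w.2 ≠ f w.1} ≤ D.real regᶜ +
      (Dbar.real {w | w.1 ∈ reg ∧ if w.2 = 1 then polyFn ℓ u w.1.1 < θ else θ ≤ polyFn ℓ l w.1.1} +
      D.real {x | x ∈ reg ∧ polyFn ℓ l x.1 < θ ∧ θ ≤ polyFn ℓ u x.1}) := by
    rw [← hfst _ hregm.compl, ← hfst {x | x ∈ reg ∧ polyFn ℓ l x.1 < θ ∧ θ ≤ polyFn ℓ u x.1}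
      (hregm.inter ((measurableSet_lt (OrthonormalSystem.measurable_poly l) measurable_const).inter
        (measurableSet_le measurable_const (OrthonormalSystem.measurable_poly u))))]
    refine (measureReal_mono fun w hw => ?_).trans ((measureReal_union_le _ _).trans
      (add_le_add le_rfl (measureReal_union_le _ _)))
    by_cases hwr : w.1 ∈ reg
    · right
      simp only [Set.mem_ofPred_eq, hf] at hw
      rcases Int.units_eq_one_or w.2 with hy | hy
      · rw [hy] at hw
        have hlt : polyFn ℓ l w.1.1 < θ := by
          by_contra hc
          exact hw (if_pos (not_lt.1 hc)).symm
        by_cases huθ : polyFn ℓ u w.1.1 < θ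
        · left; exact ⟨hwr, by rw [if_pos hy]; exact huθ⟩
        · right; exact ⟨hwr, hlt, not_lt.1 huθ⟩
      · rw [hy] at hw
        left
        refine ⟨hwr, ?_⟩
        rw [if_neg (by rw [hy]; decide)]
        by_contra hc
        exact hw (if_neg hc).symm
    · left; exact hwr
  have h2 := hcln u l θ hu hl hG.θ_le
  have h3 := hω.margin u l θ hu hl hG.θ_le
  have h4 : (∑ i, if (Scln i).1 ∈ reg ∧ LabelViolated γ θ
      (polyFn ℓ u (Scln i).1.1) (polyFn ℓ l (Scln i).1.1) (Scln i).2 then (1 : ℝ) else 0) ≤ cnt := by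
    obtain ⟨e, he⟩ := hadd
    calc _ ≤ ∑ i : Fin m, (fun j : Fin M => if κ j ∧ LabelViolated γ θ (polyFn ℓ u (S j).1.1)
          (polyFn ℓ l (S j).1.1) (S j).2 then (1 : ℝ) else 0) (e i) := by
          refine Finset.sum_le_sum fun i _ => ?_
          rw [← he i]
          beta_reduce
          split_ifs with ha hb hb
          · exact le_rfl
          · exact absurd ⟨hkept _ ha.1, ha.2⟩ hb
          · exact zero_le_one
          · exact le_rfl
      _ = ∑ j ∈ Finset.univ.map e, if κ j ∧ LabelViolated γ θ (polyFn ℓ u (S j).1.1)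
          (polyFn ℓ l (S j).1.1) (S j).2 then (1 : ℝ) else 0 := by rw [Finset.sum_map]
      _ ≤ cnt := Finset.sum_le_sum_of_subset_of_nonneg (Finset.subset_univ _) fun i _ _ => by
          split_ifs <;> norm_num
  -- The only place where the contamination rate costs a factor: `1 / m ≤ Q / M`.
  have h5 : cnt / m ≤ Q * (cnt / M) := by
    rw [← mul_div_assoc, div_le_div_iff₀ hm' hM']
    nlinarith
  have h6 : ref ≤ Q * ref := le_mul_of_one_le_left href0 hQ
  have hη1 : ε ^ 2 / (12 * Q) ≤ 1 := by
    rw [div_le_one (by positivity)]; nlinarith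
  obtain ⟨cu, cl, k1, k2, k3, k4⟩ := exists_comparator hD h hω hne hη1
    (ζ := ε / (16 * Q)) (by positivity) hS S
  have h7 := hG.count cu cl
  change cnt / M + ref ≤ _ at h7
  have hz2 : Q / Z ≤ ε / 32 := by
    have := h.eps_le
    rw [div_le_div_iff₀ hZ0 (by norm_num)]
    have h8 : 32 * (Q / ε) * ε ≤ Z * ε := by gcongr
    have : 32 * (Q / ε) * ε = 32 * Q := by field_simp
    linarith
  have h14 := mul_le_of_objective_le hZ' hε.le hε1.le hQ hz2 k1 k2 k3 k4 h7
  have h11 := E.compl_region_le hD h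
  have h12 : 1 / (Z : ℝ) ^ 7 ≤ ε / 32 := by
    calc 1 / (Z : ℝ) ^ 7 ≤ 1 / (Z : ℝ) := by
          refine one_div_le_one_div_of_le hZ0 ?_
          exact le_self_pow₀ (by linarith) (by norm_num)
      _ ≤ Q / Z := by gcongr
      _ ≤ _ := hz2
  have h15 : (∑ i, if (Scln i).1 ∈ reg ∧ LabelViolated γ θ
      (polyFn ℓ u (Scln i).1.1) (polyFn ℓ l (Scln i).1.1) (Scln i).2 then (1 : ℝ) else 0) / m ≤
      cnt / m := by gcongr
  have h16 : 0 ≤ 1 / (Z : ℝ) ^ 8 := by positivity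
  change Dbar.real {w | w.1 ∈ reg ∧ _} ≤ _ at h2
  linarith

end Error

/-! ### Parameters -/

section Parameters

variable {d ℓ : ℕ} {A ε δ Q : ℝ}

theorem scaleFacts (hd : 1 ≤ d) (hℓ : 1 ≤ ℓ) (hA : 1 ≤ A) (hε : 0 < ε) (hδ : 0 < δ) (hδ1 : δ < 1)
    (hQ : 1 ≤ Q) : ScaleFacts d ℓ A ε δ Q (scaleParam d ℓ A ε δ Q) (logParam δ) := by
  have ha : 1 ≤ ⌈A⌉₊ := Nat.one_le_ceil_iff.2 (by linarith)
  have he : 1 ≤ ⌈Q / ε⌉₊ := Nat.one_le_ceil_iff.2 (by positivity)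
  have h2 : 1 < ⌈2 / δ⌉₊ := by
    rw [Nat.lt_ceil, Nat.cast_one, lt_div_iff₀ hδ]; linarith
  have ht : 1 ≤ logParam δ := by
    rw [logParam, Nat.succ_le_iff]; exact Nat.clog_pos (by norm_num) h2
  have hlog : 2 / δ ≤ (2 : ℝ) ^ logParam δ := by
    refine (Nat.le_ceil _).trans ?_
    exact_mod_cast Nat.le_pow_clog (by norm_num) _
  have hAa : A ≤ ⌈A⌉₊ := Nat.le_ceil A
  have hQe : Q / ε ≤ ⌈Q / ε⌉₊ := Nat.le_ceil _
  unfold scaleParam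
  set a := ⌈A⌉₊
  set e := ⌈Q / ε⌉₊
  set t := logParam δ
  set b := 16 * a * t * (d + 1) with hb
  have hat : 1 ≤ a * t := Nat.mul_pos ha ht
  have hb1 : 1 ≤ b := Nat.mul_pos (Nat.mul_pos (Nat.mul_pos (by norm_num) ha) ht) d.succ_pos
  have hbℓ : b ≤ b ^ ℓ := Nat.le_self_pow (by omega) _
  have hZ : b ^ ℓ ≤ b ^ ℓ * e := Nat.le_mul_of_pos_right _ he
  have hbR : (b : ℝ) = 16 * a * t * (d + 1) := by rw [hb]; push_cast; ring
  have ha' : (1 : ℝ) ≤ a := by exact_mod_cast ha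
  have ht' : (1 : ℝ) ≤ t := by exact_mod_cast ht
  have hd' : (1 : ℝ) ≤ d := by exact_mod_cast hd
  have hZR : (b : ℝ) ^ ℓ ≤ ((b ^ ℓ * e : ℕ) : ℝ) := by exact_mod_cast hZ
  have hb32 : 32 * t ≤ b := by
    calc 32 * t = 16 * 1 * t * (1 + 1) := by ring
      _ ≤ b := by rw [hb]; gcongr
  refine ⟨ht, hb32.trans (hbℓ.trans hZ), hlog, ?_, ?_, ?_, ?_⟩
  · refine le_trans ?_ hZ
    calc 4 * (d + 1) ^ ℓ ≤ 4 ^ ℓ * (d + 1) ^ ℓ := by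
          gcongr; exact Nat.le_self_pow (by omega) _
      _ = (4 * (d + 1)) ^ ℓ := by rw [mul_pow]
      _ ≤ _ := by
        refine Nat.pow_le_pow_left ?_ _
        calc 4 * (d + 1) ≤ 16 * 1 * (d + 1) := by gcongr; norm_num
          _ ≤ 16 * (a * t) * (d + 1) := by gcongr
          _ = _ := by rw [hb]; ring
  · refine le_trans ?_ hZR
    gcongr
    rw [hbR]
    calc 4 * A ≤ 16 * a * 1 * (0 + 1) := by linarith
      _ ≤ _ := by gcongr; linarith
  · have h4 : (4 : ℝ) ≤ 4 ^ ℓ := le_self_pow₀ (by norm_num) (by omega)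
    have key : 4 * ((((d + 1) ^ ℓ : ℕ) : ℝ) * (A * (2 * t : ℕ)) ^ ℓ) ≤ ((b ^ ℓ * e : ℕ) : ℝ) := by
      refine le_trans ?_ hZR
      push_cast
      calc 4 * (((d : ℝ) + 1) ^ ℓ * (A * (2 * t)) ^ ℓ)
          ≤ 4 ^ ℓ * (((d : ℝ) + 1) ^ ℓ * (A * (2 * t)) ^ ℓ) := by gcongr
        _ = (4 * ((d + 1) * (A * (2 * t)))) ^ ℓ := by rw [← mul_pow, ← mul_pow]
        _ ≤ (b : ℝ) ^ ℓ := by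
          gcongr
          rw [hbR]
          calc 4 * (((d : ℝ) + 1) * (A * (2 * t))) = 8 * A * t * (d + 1) := by ring
            _ ≤ 16 * a * t * (d + 1) := by gcongr; norm_num
    calc _ = (4 * ((((d + 1) ^ ℓ : ℕ) : ℝ) * (A * (2 * t : ℕ)) ^ ℓ)) ^ 2 := by ring
      _ ≤ _ := by gcongr
  · push_cast
    have : (32 : ℝ) ≤ (b : ℝ) ^ ℓ := by exact_mod_cast (by omega : 32 ≤ b ^ ℓ)
    gcongr

theorem log_two_div_ge (hδ : 0 < δ) (hδ1 : δ < 1) : 2 / 3 ≤ Real.log (2 / δ) := by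
  have h1 : Real.log 2 ≤ Real.log (2 / δ) := by
    refine Real.log_le_log (by norm_num) ?_
    rw [le_div_iff₀ hδ]; linarith
  linarith [Real.log_two_gt_d9]

theorem logParam_le (hδ : 0 < δ) (hδ1 : δ < 1) : (logParam δ : ℝ) ≤ 5 * Real.log (2 / δ) := by
  have h0 := log_two_div_ge hδ hδ1
  have h2 : 1 < ⌈2 / δ⌉₊ := by
    rw [Nat.lt_ceil, Nat.cast_one, lt_div_iff₀ hδ]; linarith
  have ht : 1 ≤ logParam δ := by
    rw [logParam, Nat.succ_le_iff]; exact Nat.clog_pos (by norm_num) h2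
  have h3 : 2 ^ (logParam δ - 1) < ⌈2 / δ⌉₊ := Nat.pow_pred_clog_lt_self (by norm_num) h2
  have h1δ : (2 : ℝ) ≤ 2 / δ := by rw [le_div_iff₀ hδ]; linarith
  have h4 : (2 : ℝ) ^ (logParam δ - 1) ≤ 2 * (2 / δ) := by
    have h5 : ((2 ^ (logParam δ - 1) : ℕ) : ℝ) ≤ (⌈2 / δ⌉₊ : ℝ) := by exact_mod_cast h3.le
    push_cast at h5
    have h6 := Nat.ceil_lt_add_one (show (0 : ℝ) ≤ 2 / δ by positivity)
    linarith
  have h7 := Real.log_le_log (by positivity) h4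
  rw [Real.log_pow, Real.log_mul (by norm_num) (by positivity), Nat.cast_sub ht, Nat.cast_one] at h7
  have h8 := Real.log_two_gt_d9
  have h9 := Real.log_two_lt_d9
  have ht' : (1 : ℝ) ≤ logParam δ := by exact_mod_cast ht
  nlinarith

/-- The constant is `320 = 16 * 2 * 5 * 2`, from rounding `A`, from `logParam_le` and from `d + 1 ≤
2 * d`. -/
theorem scaleParam_le (hd : 1 ≤ d) (hA : 1 ≤ A) (hε : 0 < ε) (hε1 : ε < 1) (hδ : 0 < δ)
    (hδ1 : δ < 1) (hQ : 1 ≤ Q) : (scaleParam d ℓ A ε δ Q : ℝ) ≤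
      (320 * A * d) ^ ℓ * Real.log (2 / δ) ^ ℓ * (2 * (Q / ε)) := by
  have hL := log_two_div_ge hδ hδ1
  have ht := logParam_le hδ hδ1
  have hq : 1 ≤ Q / ε := by rw [le_div_iff₀ hε]; linarith
  have ha : (⌈A⌉₊ : ℝ) ≤ 2 * A := by
    have := Nat.ceil_lt_add_one (show 0 ≤ A by linarith); linarith
  have he : (⌈Q / ε⌉₊ : ℝ) ≤ 2 * (Q / ε) := by
    have := Nat.ceil_lt_add_one (show 0 ≤ Q / ε by linarith); linarith
  have hd' : (1 : ℝ) ≤ d := by exact_mod_cast hd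
  unfold scaleParam
  push_cast
  have hbase : 16 * (⌈A⌉₊ : ℝ) * logParam δ * (d + 1) ≤ 320 * A * d * Real.log (2 / δ) := by
    calc _ ≤ 16 * (2 * A) * (5 * Real.log (2 / δ)) * (2 * d) := by gcongr; linarith
      _ = _ := by ring
  rw [← mul_pow]
  exact mul_le_mul (pow_le_pow_left₀ (by positivity) hbase ℓ) he (by positivity) (by positivity)

/-- The net has about `Z ^ (30 * (2 * N + 1))` points, so `m * ε ^ 2` must dominate `N * log Z`. As
`log Z` is at most `6 * (320 * A * d) ^ ℓ * log (2 / δ) * (Q / ε)`, a constant to the power `ℓ`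
times `A ^ ℓ * d ^ (2 * ℓ)` is enough. -/
theorem sample_failure_le (hd : 1 ≤ d) (hℓ : 1 ≤ ℓ) (hA : 1 ≤ A) (hε : 0 < ε) (hε1 : ε < 1)
    (hδ : 0 < δ) (hδ1 : δ < 1) (hQ : 1 ≤ Q) {m : ℕ}
    (hm : cleanSampleBound 12000 d ℓ A ε δ Q ≤ m) :
    (2 * ((scaleParam d ℓ A ε δ Q ^ 30 : ℕ) : ℝ) + 1) ^ (2 * (d + 1) ^ ℓ + 1) *
      Real.exp (-(2 * m * (ε / 24) ^ 2)) ≤ δ / 2 := by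
  have hfacts := scaleFacts hd hℓ hA hε hδ hδ1 hQ
  have hZle := scaleParam_le (ℓ := ℓ) hd hA hε hε1 hδ hδ1 hQ
  have hL := log_two_div_ge hδ hδ1
  set Z := scaleParam d ℓ A ε δ Q
  set L := Real.log (2 / δ) with hLdef
  set q := Q / ε with hqdef
  have hZ32 : 32 ≤ Z := by have := hfacts.t_le; have := hfacts.t_pos; omega
  have hZ' : (32 : ℝ) ≤ Z := by exact_mod_cast hZ32
  have hd' : (1 : ℝ) ≤ d := by exact_mod_cast hd
  have hq : 1 ≤ q := by rw [hqdef, le_div_iff₀ hε]; linarith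
  set Y : ℝ := (320 * A * d) ^ ℓ with hY
  have hAd : 1 ≤ A * d := by nlinarith
  have hY1 : 2 ^ ℓ ≤ Y := by rw [hY]; gcongr; nlinarith
  have h2ℓ : (1 : ℝ) ≤ 2 ^ ℓ := one_le_pow₀ (by norm_num)
  have hlogZ : Real.log Z ≤ 6 * (Y * L * q) := by
    have h1 : Real.log Z ≤ Real.log (Y * L ^ ℓ * (2 * q)) :=
      Real.log_le_log (by linarith) hZle
    have h2 : Real.log (Y * L ^ ℓ * (2 * q)) = Real.log Y + ℓ * Real.log L + Real.log (2 * q) := by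
      rw [Real.log_mul (by positivity) (by positivity), Real.log_mul (by positivity) (by positivity),
        Real.log_pow L ℓ]
    have h3 : Real.log Y ≤ Y := Real.log_le_self (by positivity)
    have h4 : ℓ * Real.log L ≤ Y * L := by
      have h5 : (ℓ : ℝ) ≤ 2 ^ ℓ := by exact_mod_cast (Nat.lt_two_pow_self).le
      calc ℓ * Real.log L ≤ ℓ * L := by gcongr; exact Real.log_le_self (by linarith)
        _ ≤ Y * L := by gcongr; linarith
    have h6 : Real.log (2 * q) ≤ 2 * q := Real.log_le_self (by positivity)
    have hYL : Y * 1 ≤ Y * (3 / 2 * L) := by gcongr; linarith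
    have hYL1 : 1 ≤ Y * (3 / 2 * L) := by nlinarith
    have e1 : Y ≤ 3 / 2 * (Y * L * q) := by
      calc Y ≤ Y * (3 / 2 * L) * 1 := by linarith
        _ ≤ Y * (3 / 2 * L) * q := by gcongr
        _ = _ := by ring
    have e2 : Y * L ≤ Y * L * q := le_mul_of_one_le_right (by positivity) hq
    have e3 : 2 * q ≤ 3 * (Y * L * q) := by
      calc 2 * q = 2 * (1 * q) := by ring
        _ ≤ 2 * (Y * (3 / 2 * L) * q) := by gcongr
        _ = _ := by ring
    linarith
  have hbase : Real.log (2 * ((Z ^ 30 : ℕ) : ℝ) + 1) ≤ 31 * Real.log Z := by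
    rw [show (31 : ℝ) = (31 : ℕ) by norm_num, ← Real.log_pow]
    refine Real.log_le_log (by positivity) ?_
    push_cast
    have h1 : (1 : ℝ) ≤ (Z : ℝ) ^ 30 := one_le_pow₀ (by linarith)
    calc 2 * (Z : ℝ) ^ 30 + 1 ≤ Z * (Z : ℝ) ^ 30 := by nlinarith
      _ = _ := by ring
  have hN : ((2 * (d + 1) ^ ℓ + 1 : ℕ) : ℝ) ≤ 3 * (2 * d) ^ ℓ := by
    push_cast
    have h1 : ((d : ℝ) + 1) ^ ℓ ≤ (2 * d) ^ ℓ := by gcongr; linarith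
    have h2 : (1 : ℝ) ≤ (2 * (d : ℝ)) ^ ℓ := one_le_pow₀ (by linarith)
    linarith
  have hlog0 : 0 ≤ Real.log (2 * ((Z ^ 30 : ℕ) : ℝ) + 1) := Real.log_nonneg (by
    have : (0 : ℝ) ≤ ((Z ^ 30 : ℕ) : ℝ) := Nat.cast_nonneg _
    linarith)
  have hbound : ((2 * (d + 1) ^ ℓ + 1 : ℕ) : ℝ) * Real.log (2 * ((Z ^ 30 : ℕ) : ℝ) + 1) + L ≤
      559 * ((2 * d) ^ ℓ * Y * (L * q)) := by
    have h1 : 1 ≤ (2 * (d : ℝ)) ^ ℓ * Y * q := by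
      have : (1 : ℝ) ≤ (2 * (d : ℝ)) ^ ℓ := one_le_pow₀ (by linarith)
      have h2 : 1 ≤ Y := h2ℓ.trans hY1
      calc (1 : ℝ) = 1 * 1 * 1 := by norm_num
        _ ≤ _ := by gcongr
    have h3 : L ≤ (2 * d) ^ ℓ * Y * (L * q) := by
      calc L = L * 1 := by ring
        _ ≤ L * ((2 * (d : ℝ)) ^ ℓ * Y * q) := by gcongr
        _ = _ := by ring
    have h4 : ((2 * (d + 1) ^ ℓ + 1 : ℕ) : ℝ) * Real.log (2 * ((Z ^ 30 : ℕ) : ℝ) + 1) ≤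
        558 * ((2 * d) ^ ℓ * Y * (L * q)) := by
      calc _ ≤ 3 * (2 * (d : ℝ)) ^ ℓ * (31 * (6 * (Y * L * q))) := by
            gcongr
            exact hbase.trans (by gcongr)
        _ = _ := by ring
    linarith
  -- The factor `288 = 24 ^ 2 / 2` comes from `ε / 24`, and `559 = 3 * 31 * 6 + 1` from net size,
  -- net resolution and failure probability. Since `288 * 559 * 640` is below `12000 ^ 2`, the
  -- constant `12000` works.
  have hK : 288 * 559 * ((2 * (d : ℝ)) ^ ℓ * Y) ≤ (12000 * A * d) ^ (2 * ℓ) := by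
    have h1 : (160992 : ℝ) ≤ 160992 ^ ℓ := le_self_pow₀ (by norm_num) (by omega)
    calc 288 * 559 * ((2 * (d : ℝ)) ^ ℓ * Y) = 160992 * ((2 * (d : ℝ)) ^ ℓ * Y) := by norm_num
      _ ≤ 160992 ^ ℓ * ((2 * (d : ℝ)) ^ ℓ * Y) := by gcongr
      _ = (160992 * (2 * d * (320 * A * d))) ^ ℓ := by rw [hY, ← mul_pow, ← mul_pow]
      _ ≤ ((12000 * A * d) ^ 2) ^ ℓ := by
          gcongr
          have h2 : A ≤ A ^ 2 := by nlinarith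
          have h3 : (0 : ℝ) ≤ d ^ 2 := by positivity
          have h4 : A * d ^ 2 ≤ A ^ 2 * d ^ 2 := by gcongr
          have h5 : (12000 * A * d) ^ 2 = 144000000 * (A ^ 2 * d ^ 2) := by ring
          have h6 : 160992 * (2 * d * (320 * A * d)) = 103034880 * (A * d ^ 2) := by ring
          have h7 : 0 ≤ A ^ 2 * (d : ℝ) ^ 2 := by positivity
          linarith
      _ = _ := by rw [← pow_mul]
  have hfin : ((2 * (d + 1) ^ ℓ + 1 : ℕ) : ℝ) * Real.log (2 * ((Z ^ 30 : ℕ) : ℝ) + 1) + L ≤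
      2 * m * (ε / 24) ^ 2 := by
    have h1 : 288 * 559 * ((2 * (d : ℝ)) ^ ℓ * Y) * (L * q) ≤ m * ε ^ 2 := by
      calc _ ≤ (12000 * A * d) ^ (2 * ℓ) * (L * q) := by gcongr
        _ ≤ cleanSampleBound 12000 d ℓ A ε δ Q * ε ^ 2 := by
            unfold cleanSampleBound
            rw [← hLdef]
            have h2 : q ≤ Q ^ 2 / ε ^ 5 * ε ^ 2 := by
              have h3 : Q ^ 2 / ε ^ 5 * ε ^ 2 = q * (Q / ε ^ 2) := by rw [hqdef]; field_simp
              rw [h3]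
              refine le_mul_of_one_le_right (by linarith) ?_
              rw [le_div_iff₀ (by positivity)]
              nlinarith
            push_cast
            calc (12000 * A * d) ^ (2 * ℓ) * (L * q)
                ≤ (12000 * A * d) ^ (2 * ℓ) * (L * (Q ^ 2 / ε ^ 5 * ε ^ 2)) := by gcongr
              _ = _ := by ring
        _ ≤ _ := by gcongr
    calc _ ≤ 559 * ((2 * d) ^ ℓ * Y * (L * q)) := hbound
      _ ≤ m * ε ^ 2 / 288 := by rw [le_div_iff₀ (by norm_num)]; linarith
      _ = _ := by ring
  have hpos : (0 : ℝ) < 2 * ((Z ^ 30 : ℕ) : ℝ) + 1 := by positivity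
  rw [← Real.exp_log hpos, ← Real.exp_nat_mul, ← Real.exp_add]
  calc _ ≤ Real.exp (-L) := Real.exp_le_exp.2 (by linarith)
    _ = δ / 2 := by rw [hLdef, Real.exp_neg, Real.exp_log (by positivity), inv_div]

theorem timeBase_facts (hd : 1 ≤ d) (hℓ : 1 ≤ ℓ) (hA : 1 ≤ A) (hε : 0 < ε) (hε1 : ε < 1)
    (hδ : 0 < δ) (hδ1 : δ < 1) (hQ : 1 ≤ Q) :
    2 ≤ timeBase d ℓ A ε δ Q ∧ A ^ ℓ ≤ timeBase d ℓ A ε δ Q ∧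
    Real.log (2 / δ) ^ ℓ ≤ timeBase d ℓ A ε δ Q ∧ Real.log (2 / δ) ≤ timeBase d ℓ A ε δ Q ∧
    (d : ℝ) ^ ℓ ≤ timeBase d ℓ A ε δ Q ∧ (2 : ℝ) ^ ℓ ≤ timeBase d ℓ A ε δ Q ∧
    Q / ε ≤ timeBase d ℓ A ε δ Q := by
  have hL := log_two_div_ge hδ hδ1
  have hd' : (1 : ℝ) ≤ d := by exact_mod_cast hd
  have hq : 1 ≤ Q / ε := by rw [le_div_iff₀ hε]; linarith
  have h1 : 1 ≤ A ^ ℓ := one_le_pow₀ hA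
  have h2 : 0 ≤ Real.log (2 / δ) ^ ℓ := by positivity
  have h3 : (2 : ℝ) ^ ℓ ≤ ((d : ℝ) + 1) ^ ℓ := by gcongr; linarith
  have h4 : (d : ℝ) ^ ℓ ≤ ((d : ℝ) + 1) ^ ℓ := by gcongr; linarith
  have h5 : (1 : ℝ) ≤ (2 : ℝ) ^ ℓ := one_le_pow₀ (by norm_num)
  unfold timeBase
  refine ⟨by linarith, by linarith, by linarith, ?_, by linarith, by linarith, by linarith⟩
  rcases le_total (Real.log (2 / δ)) 1 with h | h
  · linarith
  · have : Real.log (2 / δ) ≤ Real.log (2 / δ) ^ ℓ := le_self_pow₀ h (by omega)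
    linarith

/-- Constants to the power `ℓ` are absorbed because `2 ^ ℓ ≤ (d + 1) ^ ℓ`: here `320 ≤ 2 ^ 9` uses
nine factors, the three powers one each, and `2 * (Q / ε)` two. -/
theorem scaleParam_le_pow (hd : 1 ≤ d) (hℓ : 1 ≤ ℓ) (hA : 1 ≤ A) (hε : 0 < ε) (hε1 : ε < 1)
    (hδ : 0 < δ) (hδ1 : δ < 1) (hQ : 1 ≤ Q) :
    (scaleParam d ℓ A ε δ Q : ℝ) ≤ timeBase d ℓ A ε δ Q ^ 14 := by
  obtain ⟨b2, bA, bLℓ, bL, bd, b2ℓ, bq⟩ := timeBase_facts hd hℓ hA hε hε1 hδ hδ1 hQ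
  have hL := log_two_div_ge hδ hδ1
  set B := timeBase d ℓ A ε δ Q
  have h320 : (320 : ℝ) ^ ℓ ≤ B ^ 9 := by
    calc (320 : ℝ) ^ ℓ ≤ (2 ^ 9) ^ ℓ := by gcongr; norm_num
      _ = (2 ^ ℓ) ^ 9 := by rw [← pow_mul, ← pow_mul, mul_comm]
      _ ≤ _ := by gcongr
  calc (scaleParam d ℓ A ε δ Q : ℝ) ≤ _ := scaleParam_le hd hA hε hε1 hδ hδ1 hQ
    _ = 320 ^ ℓ * A ^ ℓ * (d : ℝ) ^ ℓ * Real.log (2 / δ) ^ ℓ * (2 * (Q / ε)) := by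
        rw [mul_pow, mul_pow]
    _ ≤ B ^ 9 * B * B * B * (B * B) := by gcongr
    _ = _ := by ring

theorem mul_ceil_le_pow (hd : 1 ≤ d) (hℓ : 1 ≤ ℓ) (hA : 1 ≤ A) (hε : 0 < ε) (hε1 : ε < 1)
    (hδ : 0 < δ) (hδ1 : δ < 1) (hQ : 1 ≤ Q) :
    Q * ⌈cleanSampleBound 12000 d ℓ A ε δ Q⌉₊ ≤ timeBase d ℓ A ε δ Q ^ 40 := by
  obtain ⟨b2, bA, bLℓ, bL, bd, b2ℓ, bq⟩ := timeBase_facts hd hℓ hA hε hε1 hδ hδ1 hQ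
  have hL := log_two_div_ge hδ hδ1
  set B := timeBase d ℓ A ε δ Q
  have hQq : Q ≤ Q / ε := by rw [le_div_iff₀ hε]; nlinarith
  have hq5 : Q ^ 2 / ε ^ 5 ≤ B ^ 5 := by
    calc Q ^ 2 / ε ^ 5 ≤ Q ^ 5 / ε ^ 5 := by
          exact div_le_div_of_nonneg_right (pow_le_pow_right₀ hQ (by norm_num)) (by positivity)
      _ = (Q / ε) ^ 5 := by rw [div_pow]
      _ ≤ _ := by gcongr
  have hK : (12000 : ℝ) ^ ℓ ≤ B ^ 14 := by
    calc (12000 : ℝ) ^ ℓ ≤ (2 ^ 14) ^ ℓ := by gcongr; norm_num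
      _ = (2 ^ ℓ) ^ 14 := by rw [← pow_mul, ← pow_mul, mul_comm]
      _ ≤ _ := by gcongr
  have h1 : cleanSampleBound 12000 d ℓ A ε δ Q ≤ B ^ 38 := by
    unfold cleanSampleBound
    calc _ = Q ^ 2 / ε ^ 5 * (12000 ^ ℓ * A ^ ℓ * (d : ℝ) ^ ℓ) ^ 2 * Real.log (2 / δ) := by
          push_cast
          rw [mul_comm 2 ℓ, pow_mul]
          simp only [mul_pow]
      _ ≤ B ^ 5 * (B ^ 14 * B * B) ^ 2 * B := by gcongr
      _ = _ := by ring
  have h0 : 0 ≤ cleanSampleBound 12000 d ℓ A ε δ Q := by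
    unfold cleanSampleBound; positivity
  have h2 := (Nat.ceil_lt_add_one h0).le
  have h3 : (1 : ℝ) ≤ B ^ 38 := one_le_pow₀ (by linarith)
  calc Q * ⌈cleanSampleBound 12000 d ℓ A ε δ Q⌉₊ ≤ B * (B * B ^ 38) := by
        gcongr
        · exact hQq.trans bq
        · nlinarith
    _ = _ := by ring

end Parameters

/-! ### Conclusion -/

/-- A running time that is polynomial in the scale parameter and the size of the dataset is
polynomial in the terms of `timeBase`. -/
theorem time_le_of_le {B Z M : ℝ} {c k : ℕ} (hB : 2 ≤ B) (hZ0 : 0 ≤ Z) (hZ : Z ≤ B ^ 14)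
    (hM : 0 ≤ M) : c * (Z + M + 1) ^ k ≤ ((c + 16 * k : ℕ) : ℝ) * (B + M) ^ (c + 16 * k) := by
  have hW : 2 ≤ B + M := by linarith
  have h1 : Z + M + 1 ≤ (B + M) ^ 16 := by
    have h2 : (1 : ℝ) ≤ (B + M) ^ 13 := one_le_pow₀ (by linarith)
    have h3 : B + M ≤ (B + M) ^ 14 := le_self_pow₀ (by linarith) (by norm_num)
    have h4 : B ^ 14 ≤ (B + M) ^ 14 := by gcongr; linarith
    have h5 : (4 : ℝ) ≤ (B + M) ^ 2 := by nlinarith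
    calc Z + M + 1 ≤ 4 * (B + M) ^ 14 := by linarith
      _ ≤ (B + M) ^ 2 * (B + M) ^ 14 := by gcongr
      _ = _ := by ring
  calc c * (Z + M + 1) ^ k ≤ c * ((B + M) ^ 16) ^ k := by gcongr
    _ = c * (B + M) ^ (16 * k) := by rw [← pow_mul]
    _ ≤ _ := by
      gcongr
      · exact_mod_cast Nat.le_add_right c (16 * k)
      · linarith
      · omega

/-- The learner succeeds with probability at least `1 - δ`. -/
theorem isHCLearner_learner {d ℓ : ℕ} (hd : 1 ≤ d) (hℓ : 1 ≤ ℓ) {A ε δ Q : ℝ} (hA : 1 ≤ A)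
    (hε : 0 < ε) (hε1 : ε < 1) (hδ : 0 < δ) (hδ1 : δ < 1) (hQ : 1 ≤ Q) {X : Set (Fin d → ℝ)}
    {D : Measure X} [IsProbabilityMeasure D] (hD : IsHypercontractive D A) {𝒞 : Set (X → ℤˣ)}
    (hne : 𝒞.Nonempty) (hS : HasSandwichingDegree 𝒞 D (ε ^ 2 / (12 * Q)) ℓ) {m : ℕ}
    (hm : cleanSampleBound 12000 d ℓ A ε δ Q ≤ m) : IsHCLearner learner 𝒞 D ℓ A ε δ Q m := by
  intro Dbar _ hmap M hmM hMQ adv hadv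
  have hfacts := scaleFacts hd hℓ hA hε hδ hδ1 hQ
  obtain ⟨c, k, hexec⟩ := exec_learner_guarantee
  obtain ⟨r, ⟨E⟩⟩ := exists_orthonormalSystem (D := D) (ℓ := ℓ) fun c => hD.memLp_two c
  set Z := scaleParam d ℓ A ε δ Q
  have hm0 : 0 < m := by
    have hL := log_two_div_ge hδ hδ1
    have hd' : (1 : ℝ) ≤ d := by exact_mod_cast hd
    have : 0 < cleanSampleBound 12000 d ℓ A ε δ Q := by
      unfold cleanSampleBound; positivity
    exact_mod_cast this.trans_le hm
  have h1 := E.measure_not_goodSample_le (Dbar := Dbar) (m := m) hfacts hε hQ hm0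
    (sample_failure_le hd hℓ hA hε hε1 hδ hδ1 hQ hm)
  have h2 := E.measure_not_goodDraws_le hD hfacts hε hδ hδ1 hQ
  -- The adversary need not be measurable. The failure event is covered by two cylinders that do not
  -- involve it, one for the clean sample and one for the draws, each of outer measure at most `δ /
  -- 2`.
  have hsub : {z : (Fin m → X × ℤˣ) × (ℕ → X) | ¬ ∃ (t : ℕ) (s : Memory),
      Exec (fun k => (z.2 k).1) learner (initialMemory ℓ A ε δ Q (adv z.1)) t s ∧
      Dbar.real {w | w.2 ≠ outputHypothesis X ℓ s w.1} ≤ Q * optTotal 𝒞 (adv z.1) + ε} ⊆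
      {S | ¬ E.GoodSample Dbar Z ε S} ×ˢ Set.univ ∪ Set.univ ×ˢ {ω | ¬ E.GoodDraws Z ε ω} := by
    rintro ⟨S, ω⟩ hz
    by_contra hc
    simp only [Set.mem_union, Set.mem_prod, Set.mem_ofPred_eq, Set.mem_univ, and_true, true_and,
      not_or, not_not] at hc
    obtain ⟨t, s, e1, -, u, l, θ, κ, e2, e3⟩ := hexec hd hℓ hA hε hδ hδ1 hQ (adv S) ω
    exact hz ⟨t, s, e1, error_le hD hfacts hε hε1 hQ hc.2 hne hS hmap hc.1 hm0 hmM hMQ (hadv S) e2 e3⟩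
  refine (measure_mono hsub).trans ((measure_union_le _ _).trans ?_)
  rw [Measure.prod_prod, Measure.prod_prod, measure_univ, measure_univ, mul_one, one_mul]
  calc _ ≤ ENNReal.ofReal (δ / 2) + ENNReal.ofReal (δ / 2) := add_le_add h1 h2
    _ = ENNReal.ofReal δ := by
      rw [← ENNReal.ofReal_add (by positivity) (by positivity), add_halves]

/-- The learner runs in polynomial time. -/
theorem exists_runsInTime_learner : ∃ k : ℕ, ∀ {d ℓ : ℕ} (_ : 1 ≤ d) (_ : 1 ≤ ℓ) {A ε δ Q : ℝ}
    (_ : 1 ≤ A) (_ : 0 < ε) (_ : ε < 1) (_ : 0 < δ) (_ : δ < 1) (_ : 1 ≤ Q) (X : Set (Fin d → ℝ)),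
    (∀ M : ℕ, (M : ℝ) ≤ Q * ⌈cleanSampleBound 12000 d ℓ A ε δ Q⌉₊ →
      RunsInTime X learner ℓ A ε δ Q M (k * timeBase d ℓ A ε δ Q ^ k)) ∧
    ∀ M : ℕ, RunsInTime X learner ℓ A ε δ Q M (k * (timeBase d ℓ A ε δ Q + M) ^ k) := by
  obtain ⟨c, k, hexec⟩ := exec_learner_guarantee
  refine ⟨41 * (c + 16 * k), fun {d ℓ} hd hℓ {A ε δ Q} hA hε hε1 hδ hδ1 hQ X => ?_⟩
  obtain ⟨b2, -⟩ := timeBase_facts (ℓ := ℓ) hd hℓ hA hε hε1 hδ hδ1 hQ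
  have hZ := scaleParam_le_pow (ℓ := ℓ) hd hℓ hA hε hε1 hδ hδ1 hQ
  have hn := mul_ceil_le_pow (ℓ := ℓ) hd hℓ hA hε hε1 hδ hδ1 hQ
  set B := timeBase d ℓ A ε δ Q
  set n := c + 16 * k
  have main : ∀ (M : ℕ) (S : Fin M → X × ℤˣ) (ω : ℕ → X), ∃ (t : ℕ) (s : Memory),
      Exec (fun k => (ω k).1) learner (initialMemory ℓ A ε δ Q S) t s ∧
        (t : ℝ) ≤ n * (B + M) ^ n := by
    intro M S ω
    obtain ⟨t, s, h1, h2, -⟩ := hexec hd hℓ hA hε hδ hδ1 hQ S ω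
    refine ⟨t, s, h1, le_trans ?_ (time_le_of_le b2 (Nat.cast_nonneg _) hZ (Nat.cast_nonneg M))⟩
    exact_mod_cast h2
  have hn41 : (n : ℝ) ≤ ((41 * n : ℕ) : ℝ) := by exact_mod_cast (by omega : n ≤ 41 * n)
  refine ⟨fun M hM S ω => ?_, fun M S ω => ?_⟩
  · obtain ⟨t, s, h1, h2⟩ := main M S ω
    refine ⟨t, s, h1, h2.trans ?_⟩
    -- By `mul_ceil_le_pow`, a dataset with `M ≤ Q * ⌈n₀⌉` has size at most `B ^ 40`.
    have h3 : B + M ≤ B ^ 41 := by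
      have h4 : B ≤ B ^ 40 := le_self_pow₀ (by linarith) (by norm_num)
      calc B + M ≤ 2 * B ^ 40 := by linarith
        _ ≤ B * B ^ 40 := by gcongr
        _ = _ := by ring
    calc n * (B + M) ^ n ≤ ((41 * n : ℕ) : ℝ) * (B ^ 41) ^ n := by gcongr
      _ = _ := by rw [← pow_mul]
  · obtain ⟨t, s, h1, h2⟩ := main M S ω
    refine ⟨t, s, h1, h2.trans ?_⟩
    have hM : (0 : ℝ) ≤ M := Nat.cast_nonneg M
    gcongr
    · linarith
    · omega

theorem mainTheorem2 :
    ∃ (C : ℝ) (K k : ℕ) (P : Program), 1 ≤ C ∧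
      ∀ (d ℓ : ℕ), 1 ≤ d → 1 ≤ ℓ →
      ∀ (A ε δ Q : ℝ), 1 ≤ A → 0 < ε → ε < 1 → 0 < δ → δ < 1 → 1 ≤ Q →
      ∀ (X : Set (Fin d → ℝ)),
        (∀ (D : Measure X) [IsProbabilityMeasure D], IsHypercontractive D A →
          ∀ 𝒞 : Set (X → ℤˣ), 𝒞.Nonempty → HasSandwichingDegree 𝒞 D (ε ^ 2 / (C * Q)) ℓ →
          ∀ m : ℕ, cleanSampleBound K d ℓ A ε δ Q ≤ m → IsHCLearner P 𝒞 D ℓ A ε δ Q m) ∧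
        (∀ M : ℕ, (M : ℝ) ≤ Q * ⌈cleanSampleBound K d ℓ A ε δ Q⌉₊ →
          RunsInTime X P ℓ A ε δ Q M (k * timeBase d ℓ A ε δ Q ^ k)) ∧
        (∀ M : ℕ, RunsInTime X P ℓ A ε δ Q M (k * (timeBase d ℓ A ε δ Q + M) ^ k)) := by
  obtain ⟨k, hk⟩ := exists_runsInTime_learner
  refine ⟨12, 12000, k, learner, by norm_num, ?_⟩
  intro d ℓ hd hℓ A ε δ Q hA hε hε1 hδ hδ1 hQ X
  exact ⟨fun D _ hD 𝒞 hne hS m hm => isHCLearner_learner hd hℓ hA hε hε1 hδ hδ1 hQ hD hne hS hm,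
    hk hd hℓ hA hε hε1 hδ hδ1 hQ X⟩
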